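/- **Setting.** Let $\lambda,\theta>0$. The rhombus tilings of the $k\times n\times p$ hexagon are encoded by families of $k$ non-intersecting lattice paths, the $i$-th one ($0\le i<k$) going from $(i,-i)$ to $(p+i,\,n-i)$ by unit steps $(1,0)$ and $(0,1)$. Put the uniform distribution on these families and let $m_1<\dots<m_k$ be the first coordinates of the points of the paths after $m$ steps, i.e. on the cut parallel to the edge of length $k$ at distance $m$ from it. An integrable function $\rho$ on $\mathbb R$ is the *limit density* at $x$ if, whenever $k\to\infty$, $n/k\to\lambda$, $p/k\to\theta$, $m/k\to x$ (with $0\le m\le n+p$), one has $\frac1k\#\{i: m_i\le tk\}\to\int_{-\infty}^t\rho(u)\,du$ in probability for every real $t$. For $0\le x\le\lambda+\theta$ put $I=[\ell,h]$ with $\ell=\max(0,x-\lambda)$, $h=1+\min(x,\theta)$, and $$a,b=\left(\frac{\sqrt{\lambda(\lambda+\theta-x)}\mp\sqrt{x\theta(1+\lambda+\theta)}}{\lambda+\theta}\right)^2,$$ $$x_2=\tfrac{\theta}{1+\lambda},\quad x_3=\tfrac{\lambda}{1+\theta},\quad x_4=\tfrac{\theta(1+\lambda+\theta)}{1+\theta},\quad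 x_5=\tfrac{\lambda(1+\lambda+\theta)}{1+\lambda}.$$ Let $\tau=1$ if $x<x_2$ or $x>x_4$, and $\tau=0$ otherwise; let $\beta=1$ if $x<x_3$ or $x>x_5$, and $\beta=0$ otherwise. For $c\in\{1+\theta,\,1+x,\,0,\,x-\lambda\}$ and $a<z<b$ let $$A_c(z)=\operatorname{Arctan}\left(\sqrt{\frac{b-z}{z-a}}\sqrt{\frac{c-a}{c-b}}\right),\qquad A_c(z)=\frac\pi2\ \text{ if } c=b .$$ Define $\rho$ by $\rho=0$ outside $I$, $\rho=\beta$ on $[\ell,a]$, $\rho=\tau$ on $[b,h]$, and for $a<z<b$ $$\rho(z)=\tau+\frac1\pi\Bigl(\epsilon_1A_{1+\theta}(z)+\epsilon_2A_{1+x}(z)+\epsilon_3A_0(z)+\epsilon_4A_{x-\lambda}(z)\Bigr),$$ where $\epsilon_1=-1$ if $x>x_4$ and $+1$ otherwise; $\epsilon_2=-1$ if $x<x_2$ and $+1$ otherwise; $\epsilon_3=+1$ if $x<x_3$ and $-1$ otherwise; $\epsilon_4=+1$ if $x>x_5$ and $-1$ otherwise. (The four geometric regimes are $(\beta,\tau)=(0,0),(1,1),(1,0),(0,1)$.)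 Let $L_0(t)=t\log t-t$ and, for $r\ge0$, $$S_r[\sigma]=\int_0^{r+1}\bigl(L_0(\mu)+L_0(r+1-\mu)\bigr)\sigma(\mu)\,d\mu-\frac12\int_0^{r+1}\!\!\int_0^{r+1}\log|\mu-\nu|\,\sigma(\mu)\sigma(\nu)\,d\mu\,d\nu,$$ and $S[\sigma]=S_x[\sigma]+S_{\lambda+\theta-x}[\sigma(1+\theta-\cdot)]$, considered on the measurable $\sigma$ with $0\le\sigma\le1$, $\sigma=0$ outside $I$ and $\int\sigma=1$ (pointwise conditions almost everywhere). **Theorem.** For all $\lambda,\theta>0$ and $0\le x\le\lambda+\theta$: 1. $\ell\le a\le b\le h$, and $a<b$ if $0<x<\lambda+\theta$. 2. $\rho$ is the limit density at $x$, and the only one up to null sets; likewise $\rho$ is the minimizer of $S$, unique up to null sets. 3. $\int_I\rho(u)\,du=1$, and for every $\mu\in(a,b)$ the following principal value exists and $$\frac12\log\frac{\mu(\lambda-x+\mu)}{(1+x-\mu)(1+\theta-\mu)}=\mathrm{p.v.}\!\int_I\frac{\rho(u)\,du}{\mu-u}.$$ 4. $0<\rho<1$ on $(a,b)$, while $\rho$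 is frozen outside: $\rho=\beta$ on $[\ell,a]$ and $\rho=\tau$ on $[b,h]$. Moreover (arctic ellipse), in the coordinates (position $x$ of the cut, coordinate $z$ on the cut), which are affinely related to the Euclidean coordinates of the hexagon, the region $E=\{(x,z):0\le x\le\lambda+\theta,\ a(x)\le z\le b(x)\}$ is bounded by a non-degenerate ellipse and inscribed in the hexagon $\{0\le x\le\lambda+\theta,\ \ell(x)\le z\le h(x)\}$: it is contained in it and meets each of its six sides in exactly one point, namely $\bigl(0,\frac{\lambda}{\lambda+\theta}\bigr)$, $(x_2,1+x_2)$, $(x_3,0)$, $(x_4,1+\theta)$, $(x_5,x_5-\lambda)$, $\bigl(\lambda+\theta,\frac{\theta(1+\lambda+\theta)}{\lambda+\theta}\bigr)$. -/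

import Mathlib

open MeasureTheory Filter Topology

noncomputable section

namespace Hexagon

/-! ### Uniformly random families of non-intersecting lattice paths -/

/-- The families of `k` non-intersecting lattice paths that encode the rhombus tilings of the
`k × n × p` hexagon.  The paths start at `(i, -i)`, `0 ≤ i < k`, make `n + p` unit steps, each of
them `(1, 0)` or `(0, 1)`, and end at `(p + i, n - i)`.  `h t i` is the first coordinate of the
`i`-th path after `t` steps (its second coordinate is `t - h t i`), so that two paths can only meet
at equal times. -/
def pathFamilies (k n p : ℕ) : Set (Fin (n + p + 1) → Fin k → ℕ) :=
  {h | (∀ i, h 0 i = i) ∧ (∀ i, h (Fin.last (n + p)) i = p + i) ∧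
    (∀ (t : Fin (n + p)) (i : Fin k),
      h t.succ i = h t.castSucc i ∨ h t.succ i = h t.castSucc i + 1) ∧
    ∀ t, StrictMono (h t)}

/-- The proportion of the `k` points of the family `h` on the cut at distance `m` from the edge of
length `k` whose coordinate, in units of `k`, is at most `t`. -/
def cutFraction {k n p : ℕ} (h : Fin (n + p + 1) → Fin k → ℕ) (m : Fin (n + p + 1)) (t : ℝ) : ℝ :=
  (Set.ncard {i : Fin k | (h m i : ℝ) ≤ t * k} : ℝ) / k

/-- Probability of an event for the uniform distribution on the path families. -/
def pathProb (k n p : ℕ) (E : Set (Fin (n + p + 1) → Fin k → ℕ)) : ℝ :=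
  (Set.ncard (pathFamilies k n p ∩ E) : ℝ) / (Set.ncard (pathFamilies k n p) : ℝ)

/-- `ρ` is the limit density of the lattice path points on the cut at position `x` of the hexagon
`1 × lam × th`: whenever `k → ∞`, `n / k → lam`, `p / k → th`, `m / k → x`, the distribution
function of the (rescaled) points on the cut converges in probability to that of `ρ(u) du`. -/
def IsLimitDensity (lam th x : ℝ) (ρ : ℝ → ℝ) : Prop :=
  Integrable ρ ∧
  ∀ (k n p : ℕ → ℕ) (m : ∀ j, Fin (n j + p j + 1)),
    Tendsto k atTop atTop →
    Tendsto (fun j => (n j : ℝ) / k j) atTop (𝓝 lam) →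
    Tendsto (fun j => (p j : ℝ) / k j) atTop (𝓝 th) →
    Tendsto (fun j => ((m j : ℕ) : ℝ) / k j) atTop (𝓝 x) →
    ∀ t ε : ℝ, 0 < ε →
      Tendsto (fun j => pathProb (k j) (n j) (p j)
        {h | ε < |cutFraction h (m j) t - ∫ u in Set.Iic t, ρ u|}) atTop (𝓝 0)

/-! ### The action functional -/

/-- Lower end of the range `I` of the path points on the cut. -/
def lo (lam x : ℝ) : ℝ := max 0 (x - lam)

/-- Upper end of the range `I` of the path points on the cut. -/
def hi (th x : ℝ) : ℝ := 1 + min x th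

/-- `L₀(t) = t log t - t`. -/
def L₀ (t : ℝ) : ℝ := t * Real.log t - t

/-- Action of a cut hexagon with `k` paths of `ℓ k` steps, in the limit `k → ∞`. -/
def cutAction (ℓ : ℝ) (ρ : ℝ → ℝ) : ℝ :=
  (∫ μ in Set.Icc 0 (ℓ + 1), (L₀ μ + L₀ (ℓ + 1 - μ)) * ρ μ) -
    1 / 2 * ∫ μ in Set.Icc 0 (ℓ + 1), ∫ ν in Set.Icc 0 (ℓ + 1), Real.log |μ - ν| * ρ μ * ρ ν

/-- Action of the full hexagon: the sum of the actions of the two cut hexagons, glued by the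
identification `μ' = 1 + th - μ` of the end points on the cut. -/
def action (lam th x : ℝ) (ρ : ℝ → ℝ) : ℝ :=
  cutAction x ρ + cutAction (lam + th - x) (fun μ => ρ (1 + th - μ))

/-- Densities on `I` with values in `[0, 1]` and total mass one. -/
def IsAdmissible (lam th x : ℝ) (ρ : ℝ → ℝ) : Prop :=
  AEStronglyMeasurable ρ volume ∧ (∀ᵐ u, 0 ≤ ρ u ∧ ρ u ≤ 1) ∧
    (∀ᵐ u, u ∉ Set.Icc (lo lam x) (hi th x) → ρ u = 0) ∧ ∫ u, ρ u = 1

/-- `ρ` minimizes the action among the admissible densities. -/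
def IsActionMinimizer (lam th x : ℝ) (ρ : ℝ → ℝ) : Prop :=
  IsAdmissible lam th x ρ ∧
    ∀ σ, IsAdmissible lam th x σ → action lam th x ρ ≤ action lam th x σ

/-- The principal value of `∫_s f(u) / (μ - u) du` exists and equals `c`. -/
def HasPrincipalValue (s : Set ℝ) (f : ℝ → ℝ) (μ c : ℝ) : Prop :=
  Tendsto (fun ε => ∫ u in s \ Set.Ioo (μ - ε) (μ + ε), f u / (μ - u)) (𝓝[>] 0) (𝓝 c)

/-! ### The explicit density -/

/-- Lower end `a` of the interval on which the density varies. -/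
def endA (lam th x : ℝ) : ℝ :=
  ((√(lam * (lam + th - x)) - √(x * th * (1 + lam + th))) / (lam + th)) ^ 2

/-- Upper end `b` of the interval on which the density varies. -/
def endB (lam th x : ℝ) : ℝ :=
  ((√(lam * (lam + th - x)) + √(x * th * (1 + lam + th))) / (lam + th)) ^ 2

/-! Positions of the cut at which `b = 1 + x`, `a = 0`, `b = 1 + th`, `a = x - lam`, respectively.
-/

def x₂ (lam th : ℝ) : ℝ := th / (1 + lam)
def x₃ (lam th : ℝ) : ℝ := lam / (1 + th)
def x₄ (lam th : ℝ) : ℝ := th * (1 + lam + th) / (1 + th)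
def x₅ (lam th : ℝ) : ℝ := lam * (1 + lam + th) / (1 + lam)

open Classical in
/-- Frozen value of the density on `[b, hi]`. -/
def topValue (lam th x : ℝ) : ℝ := if x < x₂ lam th ∨ x₄ lam th < x then 1 else 0

open Classical in
/-- Frozen value of the density on `[lo, a]`. -/
def bottomValue (lam th x : ℝ) : ℝ := if x < x₃ lam th ∨ x₅ lam th < x then 1 else 0

open Classical in
/-- `Arctan (√((b - z) / (z - a)) * √((c - a) / (c - b)))`, with `Arctan ∞ = π / 2` for `c = b`. -/
def arctanTerm (a b c z : ℝ) : ℝ :=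
  if c = b then Real.pi / 2
  else Real.arctan (√((b - z) / (z - a)) * √((c - a) / (c - b)))

open Classical in
/-- The density on `(a, b)`, a sum of four arctangents.  The signs are those of
`+ (1 + th)`, `+ (1 + x)`, `- (0)`, `- (x - lam)` when the density vanishes at both ends; a frozen
region of density one at an end of `I` reverses the sign of the term of that end. -/
def arctanDensity (lam th x z : ℝ) : ℝ :=
  let a := endA lam th x
  let b := endB lam th x
  topValue lam th x + 1 / Real.pi *
    ((if x₄ lam th < x then -1 else 1) * arctanTerm a b (1 + th) z
      + (if x < x₂ lam th then -1 else 1) * arctanTerm a b (1 + x) z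
      + (if x < x₃ lam th then 1 else -1) * arctanTerm a b 0 z
      + (if x₅ lam th < x then 1 else -1) * arctanTerm a b (x - lam) z)

open Classical in
/-- The density: arctangents on `(a, b)`, frozen on the rest of `I`, zero outside `I`. -/
def hexDensity (lam th x z : ℝ) : ℝ :=
  if z ∈ Set.Ioo (endA lam th x) (endB lam th x) then arctanDensity lam th x z
  else if z ∈ Set.Icc (lo lam x) (endA lam th x) then bottomValue lam th x
  else if z ∈ Set.Icc (endB lam th x) (hi th x) then topValue lam th x
  else 0

/-! ### The hexagon and its inscribed ellipse

The plane has coordinates (position of the cut, coordinate on the cut).  They are affinely related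
to the Euclidean coordinates of the hexagon with angles of 120 degrees, and affine maps preserve
ellipses and tangency. -/

/-- The hexagon `1 × lam × th`. -/
def hexagon (lam th : ℝ) : Set (ℝ × ℝ) :=
  {q | 0 ≤ q.1 ∧ q.1 ≤ lam + th ∧ lo lam q.1 ≤ q.2 ∧ q.2 ≤ hi th q.1}

/-- The region swept by the segments `[a, b]`. -/
def arcticRegion (lam th : ℝ) : Set (ℝ × ℝ) :=
  {q | 0 ≤ q.1 ∧ q.1 ≤ lam + th ∧ endA lam th q.1 ≤ q.2 ∧ q.2 ≤ endB lam th q.1}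

/-- A region bounded by a (non-degenerate) ellipse: the image of the closed unit disc under an
invertible affine map. -/
def IsFilledEllipse (E : Set (ℝ × ℝ)) : Prop :=
  ∃ f : EuclideanSpace ℝ (Fin 2) ≃ᵃ[ℝ] ℝ × ℝ, E = f '' Metric.closedBall 0 1

end Hexagon

end

/-! A configuration y on the cut is hit by (number of path families from the start to y) times
(number from y to the end). Each factor is a constant times a Vandermonde product times binomials,
by induction on the number of steps through `sum_det_vandermonde_shift`. The random cut therefore
has law proportional to `weight`, a squared Vandermonde product times a product over the points: a
discrete log-gas. Spread each point over a lattice cell of length 1/k: the resulting density is at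
most one, and Stirling's formula gives log weight = const - k² W + o(k²), where W = `weightedEnergy`
is the action in another form (`abs_log_weight_sub_le`, `action_eq_weightedEnergy`).

W is strictly convex in a quantitative sense. Since -log is a superposition of tents, which are
autocorrelations of intervals, the energy of a neutral charge controls its distribution function
(`integral_sq_le_energy`, `abs_cdf_pow_le_energy`). A density that satisfies the Euler-Lagrange
conditions with obstacles 0 and 1 (`IsEquilibrium`) is thus the unique minimizer, and a distribution
function off by ε costs a fixed amount of energy. Only exp(O(k log k)) configurations compete with
weight ratios exp(-g k²), hence concentration (`IsEquilibrium.exists_pathProb_le`). It remains to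
show that the explicit density is an equilibrium.

For this put z = m + (r/2)(w + 1/w), with m the midpoint and r the half-length of [a, b], so that
the unit circle covers [a, b]. The singular points 1 + θ, 1 + x, 0, x - λ of the external field V
are the images of κ₁, κ₂, -κ₃, -κ₄. Each arctangent is a partial integral of the Poisson kernel
pushed to the segment by the cosine, and harmonicity of log|1 - wζ| gives its logarithmic potential
on the whole line. The derivative of V - 2U, U the potential of the density, becomes the logarithm
of a product of factors (w - κ)/(1 - wκ) and their analogues. It vanishes on |w| = 1, that is on (a,
b), and keeps a sign on each side; the sign depends on whether some κ exceeds one, which is also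
what freezes the density at one there (`CutBlocks.isEquilibrium`). The algebra behind it is κ₁κ₂ =
κ₃κ₄ = 1/(1 + λ + θ) and (r/2)(κ₁ + κ₂ + κ₃ + κ₄) = 1, the latter being unit mass.

The principal value is the derivative of U, equal to V'/2 on (a, b). For the ellipse, the midpoint
of [a, b] is affine in x and the squared half-length is quadratic with zeros at the two extreme
cuts; the tangencies with the four slanted or horizontal sides are equality cases of the inequality
between arithmetic and geometric means. -/

namespace Hexagon

/-! ### Counting chains of strictly increasing configurations -/

section Counting

variable {k : ℕ}

/-- Chains of `t` steps from `A` to `B` through strictly increasing configurations, each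
coordinate moving by `0` or `1` in each step. -/
def chains (t : ℕ) (A B : Fin k → ℕ) : Set (Fin (t + 1) → Fin k → ℕ) :=
  {h | h 0 = A ∧ h (Fin.last t) = B ∧
    (∀ (s : Fin t) (i : Fin k), h s.succ i = h s.castSucc i ∨ h s.succ i = h s.castSucc i + 1) ∧
    ∀ s, StrictMono (h s)}

theorem pathFamilies_eq_chains (k n p : ℕ) :
    pathFamilies k n p = chains (n + p) (fun i : Fin k => (i : ℕ)) (fun i => p + (i : ℕ)) := by
  ext h
  simp only [pathFamilies, chains, Set.mem_ofPred_eq, funext_iff]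

theorem chains_le {t : ℕ} {A B : Fin k → ℕ} {h : Fin (t + 1) → Fin k → ℕ}
    (hh : h ∈ chains t A B) (s : Fin (t + 1)) (i : Fin k) : h s i ≤ A i + s := by
  obtain ⟨h0, -, hs, -⟩ := hh
  induction s using Fin.induction with
  | zero => simp [h0]
  | succ s ih =>
    have := hs s i
    simp only [Fin.val_castSucc, Fin.val_succ] at *
    omega

theorem chains_le_last {t : ℕ} {A B : Fin k → ℕ} {h : Fin (t + 1) → Fin k → ℕ}
    (hh : h ∈ chains t A B) (s : Fin (t + 1)) (i : Fin k) : h s i ≤ B i := by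
  obtain ⟨-, h0, hs, -⟩ := hh
  induction s using Fin.reverseInduction with
  | last => simp [h0]
  | cast s ih =>
    have := hs s i
    omega

theorem chains_finite (t : ℕ) (A B : Fin k → ℕ) : (chains t A B).Finite :=
  (Set.finite_Iic (fun (s : Fin (t + 1)) (i : Fin k) => A i + (s : ℕ))).subset
    fun _ hh s i => chains_le hh s i

theorem chains_strictMono {t : ℕ} {A B : Fin k → ℕ} (h : (chains t A B).Nonempty) :
    StrictMono A ∧ StrictMono B := by
  obtain ⟨h, h0, h1, -, h3⟩ := h
  exact ⟨h0 ▸ h3 0, h1 ▸ h3 _⟩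

/-- Cutting chains at an intermediate time. -/
theorem ncard_chains_through {M : ℕ} (m t : ℕ) (hM : M = m + t) (A B y : Fin k → ℕ) :
    ({h | h ∈ chains M A B ∧ h ⟨m, by omega⟩ = y} : Set _).ncard =
      (chains m A y).ncard * (chains t y B).ncard := by
  subst hM
  rw [← Set.ncard_prod]
  refine Set.ncard_congr (fun h _ => ((fun i => h ⟨i, by omega⟩), (fun i => h ⟨m + i, by omega⟩)))
    ?_ ?_ ?_
  · rintro h ⟨⟨h0, h1, h2, h3⟩, h4⟩
    refine ⟨⟨h0, h4, fun s i => h2 ⟨s, by omega⟩ i, fun s => h3 _⟩,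
      ⟨h4, h1, fun s i => h2 ⟨m + s, by omega⟩ i, fun s => h3 _⟩⟩
  · rintro h h' ⟨⟨h0, h1, h2, h3⟩, h4⟩ ⟨⟨h0', h1', h2', h3'⟩, h4'⟩ heq
    simp only [Prod.mk.injEq, funext_iff] at heq
    ext s i
    rcases le_total (s : ℕ) m with hs | hs
    · exact heq.1 ⟨s, by omega⟩ i
    · have := heq.2 ⟨s - m, by omega⟩ i
      simpa [Nat.add_sub_cancel' hs] using this
  · rintro ⟨f, g⟩ ⟨⟨f0, f1, f2, f3⟩, ⟨g0, g1, g2, g3⟩⟩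
    dsimp only at f0 f1 f2 f3 g0 g1 g2 g3
    -- The two pieces agree at the junction j = m, where both equal y, so the glued family is given
    -- by `g` from time m on, including m.
    have key : ∀ (j : ℕ) (hj : j < m + t + 1) (hm : m ≤ j), (if h : j ≤ m then f ⟨j, by omega⟩
        else g ⟨j - m, by omega⟩) = g ⟨j - m, by omega⟩ := by
      intro j hj hm
      split_ifs with h
      · obtain rfl : j = m := le_antisymm h hm
        have : (⟨j, by omega⟩ : Fin (j + 1)) = Fin.last j := rfl
        rw [this, f1, ← g0]
        congr 1
        ext; simp
      · rfl
    refine ⟨fun s => if h : (s : ℕ) ≤ m then f ⟨s, by omega⟩ else g ⟨s - m, by omega⟩,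
      ⟨⟨?_, ?_, ?_, ?_⟩, ?_⟩, ?_⟩
    · simpa using f0
    · dsimp only [Fin.val_last]
      rw [key _ (by omega) (by omega), ← g1]
      congr 1
      ext; simp
    · intro s i
      dsimp only [Fin.val_succ, Fin.val_castSucc]
      by_cases hs : (s : ℕ) + 1 ≤ m
      · rw [dif_pos hs, dif_pos (by omega)]
        exact f2 ⟨s, by omega⟩ i
      · rw [key _ (by omega) (by omega), key _ (by omega) (by omega)]
        have := g2 ⟨s - m, by omega⟩ i
        have e : (s : ℕ) + 1 - m = s - m + 1 := by omega
        simp only [e]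
        exact this
    · intro s
      dsimp only
      split_ifs
      · exact f3 _
      · exact g3 _
    · simpa using! f1
    · ext s i
      · simp [Nat.lt_succ_iff.mp s.2]
      · dsimp only
        rw [key _ (by omega) (by omega)]
        simp

theorem ncard_chains_zero (A B : Fin k → ℕ) (hA : StrictMono A) :
    (chains 0 A B).ncard = if A = B then 1 else 0 := by
  split_ifs with h
  · rw [Set.ncard_eq_one]
    refine ⟨fun _ => A, ?_⟩
    ext f
    constructor
    · rintro ⟨h0, -⟩
      ext s i
      rw [Fin.fin_one_eq_zero s, h0]
    · rintro rfl
      exact ⟨rfl, h, fun s => s.elim0, fun _ => hA⟩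
  · have : chains 0 A B = ∅ := by
      ext f
      simp only [Set.mem_empty_iff_false, iff_false]
      rintro ⟨h0, h1, -⟩
      exact h (h0.symm.trans h1)
    simp [this]

open Classical in
theorem ncard_chains_one (A B : Fin k → ℕ) :
    (chains 1 A B).ncard = if StrictMono A ∧ StrictMono B ∧ ∀ i, B i = A i ∨ B i = A i + 1
      then 1 else 0 := by
  split_ifs with h
  · rw [Set.ncard_eq_one]
    refine ⟨![A, B], ?_⟩
    ext f
    constructor
    · rintro ⟨h0, h1, -⟩
      ext s i
      fin_cases s
      · simp [h0]
      · simpa using congrFun h1 i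
    · rintro rfl
      refine ⟨rfl, rfl, fun s i => ?_, fun s => ?_⟩
      · rw [Subsingleton.elim s 0]
        exact h.2.2 i
      · fin_cases s
        exacts [h.1, h.2.1]
  · have : chains 1 A B = ∅ := by
      ext f
      simp only [Set.mem_empty_iff_false, iff_false]
      rintro ⟨h0, h1, h2, h3⟩
      refine h ⟨h0 ▸ h3 _, h1 ▸ h3 _, fun i => ?_⟩
      have := h2 0 i
      rw [← h0, ← h1]
      exact this
    simp [this]

open Classical in
/-- Last step decomposition. -/
theorem ncard_chains_succ (t : ℕ) (A B : Fin k → ℕ) (hB : StrictMono B) :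
    (chains (t + 1) A B).ncard = ∑ s ∈ (Finset.univ.filter fun i => 1 ≤ B i).powerset,
      (chains t A (fun i => B i - if i ∈ s then 1 else 0)).ncard := by
  rw [Set.ncard_eq_toFinset_card _ (chains_finite _ _ _)]
  -- The chains are fibred over the set of indices that move in the last step. Only indices with 1 ≤
  -- B i can have moved, and for them the truncated subtraction is a true one.
  rw [Finset.card_eq_sum_card_fiberwise (t := (Finset.univ.filter fun i => 1 ≤ B i).powerset)
    (f := fun h => Finset.univ.filter fun i => h ⟨t, by omega⟩ i ≠ B i)]
  · refine Finset.sum_congr rfl fun s hs => ?_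
    simp only [Finset.mem_powerset, Finset.subset_iff, Finset.mem_filter, Finset.mem_univ,
      true_and] at hs
    have key := ncard_chains_through (M := t + 1) t 1 rfl A B
      (fun i => B i - if i ∈ s then 1 else 0)
    rw [ncard_chains_one] at key
    by_cases hm : StrictMono (fun i => B i - if i ∈ s then 1 else 0)
    · rw [if_pos, mul_one] at key
      · rw [← key, ← Set.ncard_coe_finset]
        congr 1
        ext h
        simp only [Finset.coe_filter, Set.Finite.mem_toFinset, Set.mem_ofPred_eq]
        refine and_congr_right fun hh => ?_
        obtain ⟨-, h1, h2, -⟩ := hh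
        have h2 := h2 (Fin.last t)
        rw [Fin.succ_last, h1] at h2
        change ∀ i, B i = h ⟨t, _⟩ i ∨ B i = h ⟨t, _⟩ i + 1 at h2
        simp only [Finset.ext_iff, funext_iff, Finset.mem_filter, Finset.mem_univ, true_and]
        refine forall_congr' fun i => ?_
        have := h2 i
        have := @hs i
        by_cases hi : i ∈ s <;> simp [hi] at * <;> omega
      · refine ⟨hm, hB, fun i => ?_⟩
        have := @hs i
        by_cases hi : i ∈ s <;> simp [hi] at *
        omega
    -- If the lowered configuration is not strictly increasing, no chain reaches it and no chain of
    -- the fibre passes through it: both sides vanish.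
    · have e1 : (chains t A (fun i => B i - if i ∈ s then 1 else 0)).ncard = 0 := by
        rw [Set.ncard_eq_zero (chains_finite _ _ _)]
        by_contra hne
        exact hm (chains_strictMono (Set.nonempty_iff_ne_empty.mpr hne)).2
      rw [e1, Finset.card_eq_zero, Finset.filter_eq_empty_iff]
      intro h hh he
      rw [Set.Finite.mem_toFinset] at hh
      obtain ⟨-, h1, h2, h3⟩ := hh
      apply hm
      have h2 := h2 (Fin.last t)
      rw [Fin.succ_last, h1] at h2
      change ∀ i, B i = h ⟨t, _⟩ i ∨ B i = h ⟨t, _⟩ i + 1 at h2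
      convert h3 ⟨t, by omega⟩ using 2 with i
      have := h2 i
      rw [← he]
      simp only [Finset.mem_filter, Finset.mem_univ, true_and]
      split_ifs <;> omega
  · intro h hh
    simp only [Finset.mem_coe, Set.Finite.mem_toFinset] at hh
    simp only [Finset.mem_coe, Finset.mem_powerset, Finset.subset_iff, Finset.mem_filter, Finset.mem_univ,
      true_and]
    intro i hi
    have := chains_le_last hh ⟨t, by omega⟩ i
    omega

open Classical in
/-- First step decomposition. -/
theorem ncard_chains_succ' (t : ℕ) (A B : Fin k → ℕ) (hA : StrictMono A) :
    (chains (t + 1) A B).ncard = ∑ s : Finset (Fin k),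
      (chains t (fun i => A i + if i ∈ s then 1 else 0) B).ncard := by
  rw [Set.ncard_eq_toFinset_card _ (chains_finite _ _ _)]
  rw [Finset.card_eq_sum_card_fiberwise (t := Finset.univ)
    (f := fun h => Finset.univ.filter fun i => h ⟨1, by omega⟩ i ≠ A i)]
  · refine Finset.sum_congr rfl fun s _ => ?_
    have key := ncard_chains_through (M := t + 1) 1 t (Nat.add_comm _ _) A B
      (fun i => A i + if i ∈ s then 1 else 0)
    rw [ncard_chains_one] at key
    by_cases hm : StrictMono (fun i => A i + if i ∈ s then 1 else 0)
    · rw [if_pos, one_mul] at key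
      · rw [← key, ← Set.ncard_coe_finset]
        congr 1
        ext h
        simp only [Finset.coe_filter, Set.Finite.mem_toFinset, Set.mem_ofPred_eq]
        refine and_congr_right fun hh => ?_
        obtain ⟨h1, -, h2, -⟩ := hh
        have h2 := h2 0
        rw [Fin.castSucc_zero, h1] at h2
        change ∀ i, h ⟨1, _⟩ i = A i ∨ h ⟨1, _⟩ i = A i + 1 at h2
        simp only [Finset.ext_iff, funext_iff, Finset.mem_filter, Finset.mem_univ, true_and]
        refine forall_congr' fun i => ?_
        have := h2 i
        by_cases hi : i ∈ s <;> simp [hi] at * <;> omega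
      · refine ⟨hA, hm, fun i => ?_⟩
        by_cases hi : i ∈ s <;> simp [hi]
    · have e1 : (chains t (fun i => A i + if i ∈ s then 1 else 0) B).ncard = 0 := by
        rw [Set.ncard_eq_zero (chains_finite _ _ _)]
        by_contra hne
        exact hm (chains_strictMono (Set.nonempty_iff_ne_empty.mpr hne)).1
      rw [e1, Finset.card_eq_zero, Finset.filter_eq_empty_iff]
      intro h hh he
      rw [Set.Finite.mem_toFinset] at hh
      obtain ⟨h1, -, h2, h3⟩ := hh
      apply hm
      have h2 := h2 0
      rw [Fin.castSucc_zero, h1] at h2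
      change ∀ i, h ⟨1, _⟩ i = A i ∨ h ⟨1, _⟩ i = A i + 1 at h2
      convert h3 ⟨1, by omega⟩ using 2 with i
      have := h2 i
      rw [← he]
      simp only [Finset.mem_filter, Finset.mem_univ, true_and]
      split_ifs <;> omega
  · intro h hh
    simp

end Counting

end Hexagon

namespace Hexagon

/-! ### A summation identity for Vandermonde determinants -/

section Vandermonde

open Polynomial

/-- The polynomial whose values are `(C - δ y) (y + δ) ^ j + (M - C + δ y) y ^ j`. -/
noncomputable def shiftPoly (δ c M : ℝ) (j : ℕ) : ℝ[X] :=
  (C c - C δ * X) * (X + C δ) ^ j + (C (M - c) + C δ * X) * X ^ j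

theorem shiftPoly_coeff_succ (δ c M : ℝ) (j n : ℕ) :
    (shiftPoly δ c M j).coeff (n + 1) = c * (δ ^ (j - (n + 1)) * (j.choose (n + 1) : ℕ))
      - δ * (δ ^ (j - n) * (j.choose n : ℕ))
      + ((M - c) * (if n + 1 = j then 1 else 0) + δ * (if n = j then 1 else 0)) := by
  simp only [shiftPoly, sub_mul, add_mul, mul_assoc, coeff_add, coeff_sub, coeff_C_mul,
    coeff_X_mul, coeff_X_add_C_pow, coeff_X_pow]

/-- The terms -δ X^(j+1) and δ X^(j+1) of the two products cancel, so the degree drops from j + 1 to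
j. -/
theorem shiftPoly_natDegree_le {δ : ℝ} (c M : ℝ) (j : ℕ) :
    (shiftPoly δ c M j).natDegree ≤ j := by
  rw [natDegree_le_iff_coeff_eq_zero]
  intro n hn
  obtain ⟨n, rfl⟩ : ∃ m, n = m + 1 := ⟨n - 1, by omega⟩
  rw [shiftPoly_coeff_succ, Nat.choose_eq_zero_of_lt hn, if_neg (by omega)]
  rcases (Nat.lt_succ_iff.mp hn).eq_or_lt with h | h
  · subst h; simp
  · rw [Nat.choose_eq_zero_of_lt h, if_neg (by omega)]; simp

/-- The coefficient collects c - δ · jδ from the first product and M - c from the second; c cancels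
and δ² = 1. -/
theorem shiftPoly_coeff_self {δ : ℝ} (hδ : δ ^ 2 = 1) (c M : ℝ) (j : ℕ) :
    (shiftPoly δ c M j).coeff j = M - j := by
  cases j with
  | zero => simp [shiftPoly]
  | succ j =>
    rw [shiftPoly_coeff_succ]
    have : δ * δ = 1 := by rw [← sq, hδ]
    simp [Nat.choose_succ_self_right]
    linear_combination ((j : ℝ) + 1) * this

/-- The left side is the multilinear expansion of the determinant whose i-th row is the sum of a
shifted and an unshifted weighted row. Entry (i, j) of the sum is a polynomial of degree at most j
in y i with coefficient M - j at X^j, so the matrix is the Vandermonde matrix times an upper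
triangular one. Thus a weighted 0/1 step maps the Vandermonde product to a multiple of itself. -/
theorem sum_det_vandermonde_shift {k : ℕ} {δ : ℝ} (hδ : δ ^ 2 = 1) (c M : ℝ) (y : Fin k → ℝ) :
    ∑ s : Finset (Fin k), (Matrix.vandermonde fun i => y i + if i ∈ s then δ else 0).det *
      ∏ i, (if i ∈ s then c - δ * y i else M - c + δ * y i) =
    (∏ j : Fin k, (M - j)) * (Matrix.vandermonde y).det := by
  let m : Matrix (Fin k) (Fin k) ℝ := fun i j => (c - δ * y i) * (y i + δ) ^ (j : ℕ)
  let m' : Matrix (Fin k) (Fin k) ℝ := fun i j => (M - c + δ * y i) * y i ^ (j : ℕ)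
  have h1 := (Matrix.detRowAlternating (n := Fin k) (R := ℝ)).toMultilinearMap.map_add_univ m m'
  have h2 : (m + m') = Matrix.vandermonde y *
      Matrix.of (fun (i j : Fin k) => (shiftPoly δ c M j).coeff i) := by
    rw [← Matrix.eval_matrixOfPolynomials_eq_vandermonde_mul_matrixOfPolynomials y
      (fun j => shiftPoly δ c M j) (fun j => shiftPoly_natDegree_le c M j)]
    ext i j
    change m i j + m' i j = _
    simp [m, m', shiftPoly]
  have h3 : (Matrix.of (fun (i j : Fin k) => (shiftPoly δ c M j).coeff i)).det =
      ∏ j : Fin k, (M - j) := by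
    rw [Matrix.det_of_isUpperTriangular]
    · simp [shiftPoly_coeff_self hδ]
    · intro i j hij
      exact coeff_eq_zero_of_natDegree_lt
        ((shiftPoly_natDegree_le c M j).trans_lt (by simpa using hij))
  have h4 : (m + m').det = (∏ j : Fin k, (M - j)) * (Matrix.vandermonde y).det := by
    rw [h2, Matrix.det_mul, h3, mul_comm]
  rw [← h4]
  refine Eq.trans ?_ h1.symm
  refine Finset.sum_congr rfl fun s _ => ?_
  have h5 : s.piecewise m m' = Matrix.of fun i j => (if i ∈ s then c - δ * y i
      else M - c + δ * y i) * Matrix.vandermonde (fun i => y i + if i ∈ s then δ else 0) i j := by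
    ext i j
    by_cases hi : i ∈ s <;> simp [hi, m, m', Matrix.vandermonde_apply]
  change _ = Matrix.det (s.piecewise m m')
  rw [h5, Matrix.det_mul_column, mul_comm]

end Vandermonde

/-! ### Product formula for the number of chains -/

section Formula

variable {k : ℕ}

/-- The Vandermonde product of a configuration. -/
noncomputable def vand (y : Fin k → ℕ) : ℝ := (Matrix.vandermonde fun i => (y i : ℝ)).det

theorem vand_eq_prod (y : Fin k → ℕ) :
    vand y = ∏ i : Fin k, ∏ j ∈ Finset.Ioi i, ((y j : ℝ) - y i) := by
  rw [vand, Matrix.det_vandermonde]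

theorem vand_pos {y : Fin k → ℕ} (hy : StrictMono y) : 0 < vand y := by
  rw [vand_eq_prod]
  refine Finset.prod_pos fun i _ => Finset.prod_pos fun j hj => ?_
  rw [sub_pos, Nat.cast_lt]
  exact hy (Finset.mem_Ioi.mp hj)

theorem vand_eq_zero {y : Fin k → ℕ} (hy : ¬ Function.Injective y) : vand y = 0 := by
  by_contra h
  rw [vand, ← ne_eq, Matrix.det_vandermonde_ne_zero_iff] at h
  exact hy fun i j hij => h (by simp [hij])

theorem eq_val_of_strictMono_of_lt {y : Fin k → ℕ} (hy : StrictMono y) (h : ∀ i, y i < k) :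
    y = fun i : Fin k => (i : ℕ) := by
  have h1 : StrictMono (fun i => (⟨y i, h i⟩ : Fin k)) := fun i j hij => hy hij
  have h2 : (fun i => (⟨y i, h i⟩ : Fin k)) = id :=
    (h1.range_inj strictMono_id).mp (by
      rw [(Finite.injective_iff_surjective.mp h1.injective).range_eq]; simp)
  ext i
  exact congrArg Fin.val (congrFun h2 i)

theorem choose_succ_mul_sub (T q : ℕ) :
    ((T + 1).choose q : ℝ) * ((T : ℝ) + 1 - q) = (T + 1) * T.choose q := by
  rcases Nat.lt_or_ge (T + 1) q with h | h
  · rw [Nat.choose_eq_zero_of_lt h, Nat.choose_eq_zero_of_lt (by omega)]; simp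
  · have := Nat.choose_mul_succ_eq T q
    have h2 : ((T + 1 - q : ℕ) : ℝ) = (T : ℝ) + 1 - q := by push_cast [Nat.cast_sub h]; ring
    rw [← h2]
    exact_mod_cast (by rw [← this, mul_comm])

theorem choose_succ_mul (T q : ℕ) (hq : 1 ≤ q) :
    ((T + 1).choose q : ℝ) * q = (T + 1) * T.choose (q - 1) := by
  obtain ⟨q, rfl⟩ : ∃ m, q = m + 1 := ⟨q - 1, by omega⟩
  have := Nat.add_one_mul_choose_eq T q
  rw [Nat.add_sub_cancel]
  exact_mod_cast this.symm

/-- Moves by 0 or 1 preserve weak monotonicity, so strictness can only fail through a collision,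
which kills the Vandermonde product. Non-intersection is therefore automatic in the sums over all
subsets. -/
theorem strictMono_sub_or_vand_eq_zero {y : Fin k → ℕ} (hy : StrictMono y) (s : Finset (Fin k)) :
    StrictMono (fun i => y i - if i ∈ s then 1 else 0) ∨
      vand (fun i => y i - if i ∈ s then 1 else 0) = 0 := by
  by_cases h : Function.Injective (fun i => y i - if i ∈ s then 1 else 0)
  · left
    refine (Monotone.strictMono_of_injective ?_ h)
    intro i j hij
    rcases hij.eq_or_lt with rfl | hij
    · rfl
    · have := hy hij
      dsimp only
      split_ifs <;> omega
  · exact Or.inr (vand_eq_zero h)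

theorem strictMono_add_or_vand_eq_zero {y : Fin k → ℕ} (hy : StrictMono y) (s : Finset (Fin k)) :
    StrictMono (fun i => y i + if i ∈ s then 1 else 0) ∨
      vand (fun i => y i + if i ∈ s then 1 else 0) = 0 := by
  by_cases h : Function.Injective (fun i => y i + if i ∈ s then 1 else 0)
  · left
    refine (Monotone.strictMono_of_injective ?_ h)
    intro i j hij
    rcases hij.eq_or_lt with rfl | hij
    · rfl
    · have := hy hij
      dsimp only
      split_ifs <;> omega
  · exact Or.inr (vand_eq_zero h)

theorem ncard_chains_eq_zero {t : ℕ} {A B : Fin k → ℕ} (h : ¬ (StrictMono A ∧ StrictMono B)) :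
    (chains t A B).ncard = 0 := by
  rw [Set.ncard_eq_zero (chains_finite _ _ _)]
  by_contra hne
  exact h (chains_strictMono (Set.nonempty_iff_ne_empty.mpr hne))

/-- The number of chains that start from the packed configuration. -/
theorem exists_ncard_chains_packed (hk : 0 < k) (t : ℕ) : ∃ c : ℝ, 0 < c ∧
    ∀ y : Fin k → ℕ, StrictMono y → ((chains t (fun i : Fin k => (i : ℕ)) y).ncard : ℝ) =
      c * (vand y * ∏ i, ((t + k - 1).choose (y i) : ℝ)) := by
  induction t with
  | zero =>
    have h0 : StrictMono (fun i : Fin k => (i : ℕ)) := fun i j h => h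
    have hpos : 0 < vand (fun i : Fin k => (i : ℕ)) *
        ∏ i : Fin k, ((0 + k - 1).choose (i : ℕ) : ℝ) :=
      mul_pos (vand_pos h0) (Finset.prod_pos fun i _ => by
        exact_mod_cast Nat.choose_pos (Nat.le_sub_one_of_lt (by omega)))
    -- For t = 0 the binomials with upper index k - 1 vanish unless every y i is below k, which
    -- leaves the packed configuration alone; the constant normalizes its value to one.
    refine ⟨_, inv_pos.mpr hpos, fun y hy => ?_⟩
    rw [ncard_chains_zero _ _ h0]
    split_ifs with h
    · rw [← h, inv_mul_cancel₀ hpos.ne']; simp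
    · have : ∃ i, k ≤ y i := by
        by_contra! hc
        exact h (eq_val_of_strictMono_of_lt hy hc).symm
      obtain ⟨i, hi⟩ := this
      have h0 : ∏ i, ((0 + k - 1).choose (y i) : ℝ) = 0 :=
        Finset.prod_eq_zero (Finset.mem_univ i)
          (by rw [Nat.choose_eq_zero_of_lt (by omega), Nat.cast_zero])
      rw [h0]
      simp
  | succ t ih =>
    obtain ⟨c, hc, ih⟩ := ih
    set T := t + k - 1 with hT
    have hT' : t + 1 + k - 1 = T + 1 := by omega
    have hTk : (k : ℝ) ≤ T + 1 := by exact_mod_cast (by omega : k ≤ T + 1)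
    have hprod : 0 < ∏ j : Fin k, ((T : ℝ) + 1 - (j : ℕ)) := Finset.prod_pos fun j _ => by
      have : ((j : ℕ) : ℝ) < k := by exact_mod_cast j.2
      linarith
    -- Each step multiplies the constant by the factor ∏ (T + 1 - j) of the summation identity,
    -- divided by the factors T + 1 released by the k binomials.
    refine ⟨c * (∏ j : Fin k, ((T : ℝ) + 1 - (j : ℕ))) / (T + 1) ^ k, by positivity,
      fun y hy => ?_⟩
    -- With c = 0 and M = T + 1 the weights are y i for a coordinate that moved and T + 1 - y i for
    -- one that did not: exactly the factors that turn binomials over T + 1 into binomials over T.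
    have key := sum_det_vandermonde_shift (δ := -1) (by norm_num) 0 ((T : ℝ) + 1)
      (fun i : Fin k => (y i : ℝ))
    rw [ncard_chains_succ t _ y hy, hT']
    have e1 : ∀ s : Finset (Fin k), s ∈ (Finset.univ.filter fun i => 1 ≤ y i).powerset →
        ((chains t (fun i : Fin k => (i : ℕ)) (fun i => y i - if i ∈ s then 1 else 0)).ncard : ℝ)
        = c / (T + 1) ^ k * (∏ i, ((T + 1).choose (y i) : ℝ)) *
        ((Matrix.vandermonde fun i => (y i : ℝ) + if i ∈ s then -1 else 0).det *
          ∏ i, (if i ∈ s then 0 - -1 * (y i : ℝ) else (T : ℝ) + 1 - 0 + -1 * y i)) := by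
      intro s hs
      simp only [Finset.mem_powerset, Finset.subset_iff, Finset.mem_filter, Finset.mem_univ,
        true_and] at hs
      have e2 : (Matrix.vandermonde fun i => (y i : ℝ) + if i ∈ s then -1 else 0).det =
          vand (fun i => y i - if i ∈ s then 1 else 0) := by
        rw [vand]
        congr 2
        ext i
        split_ifs with hi
        · rw [Nat.cast_sub (hs hi)]; simp; ring
        · simp
      have e3 : (∏ i, ((T + 1).choose (y i) : ℝ)) *
          ∏ i, (if i ∈ s then 0 - -1 * (y i : ℝ) else (T : ℝ) + 1 - 0 + -1 * y i) =
          (T + 1) ^ k * ∏ i, (T.choose (y i - if i ∈ s then 1 else 0) : ℝ) := by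
        rw [← Finset.prod_mul_distrib]
        have : ((T : ℝ) + 1) ^ k = ∏ _i : Fin k, ((T : ℝ) + 1) := by simp
        rw [this, ← Finset.prod_mul_distrib]
        refine Finset.prod_congr rfl fun i _ => ?_
        split_ifs with hi
        · rw [← choose_succ_mul T (y i) (hs hi)]; ring
        · rw [Nat.sub_zero, ← choose_succ_mul_sub]; ring
      rw [e2]
      have hT0 : ((T : ℝ) + 1) ^ k ≠ 0 := by positivity
      have e4 : c / (T + 1) ^ k * (∏ i, ((T + 1).choose (y i) : ℝ)) *
        (vand (fun i => y i - if i ∈ s then 1 else 0) *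
          ∏ i, (if i ∈ s then 0 - -1 * (y i : ℝ) else (T : ℝ) + 1 - 0 + -1 * y i)) =
          c * (vand (fun i => y i - if i ∈ s then 1 else 0) *
            ∏ i, (T.choose (y i - if i ∈ s then 1 else 0) : ℝ)) := by
        calc _ = c / (T + 1) ^ k * vand (fun i => y i - if i ∈ s then 1 else 0) *
            ((∏ i, ((T + 1).choose (y i) : ℝ)) *
            ∏ i, (if i ∈ s then 0 - -1 * (y i : ℝ) else (T : ℝ) + 1 - 0 + -1 * y i)) := by ring
          _ = _ := by rw [e3]; field_simp
      rw [e4]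
      rcases strictMono_sub_or_vand_eq_zero hy s with h | h
      · exact ih _ h
      · rw [h, ncard_chains_eq_zero]
        · simp
        · intro h'
          exact (vand_pos h'.2).ne' h
    push_cast
    rw [Finset.sum_congr rfl e1, ← Finset.mul_sum,
      Finset.sum_subset (Finset.subset_univ _), key, vand]
    · ring
    -- A subset containing an index with y i = 0 carries the factor y i = 0, so the sum may run over
    -- all subsets.
    · intro s _ hs
      simp only [Finset.mem_powerset, Finset.subset_iff, Finset.mem_filter, Finset.mem_univ,
        true_and, not_forall] at hs
      obtain ⟨i, hi, hi'⟩ := hs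
      rw [Finset.prod_eq_zero (Finset.mem_univ i), mul_zero]
      have : y i = 0 := by omega
      simp [hi, this]

/-- The number of chains that end in a shifted packed configuration. -/
theorem exists_ncard_chains_to_packed (hk : 0 < k) (p t : ℕ) : ∃ c : ℝ, 0 < c ∧
    ∀ y : Fin k → ℕ, StrictMono y → (∀ i, y i ≤ p + k - 1) →
      ((chains t y (fun i : Fin k => p + (i : ℕ))).ncard : ℝ) =
      c * (vand y * ∏ i, ((t + k - 1).choose (p + k - 1 - y i) : ℝ)) := by
  induction t with
  | zero =>
    have h0 : StrictMono (fun i : Fin k => p + (i : ℕ)) := fun i j h => by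
      simpa using h
    have hpos : 0 < vand (fun i : Fin k => p + (i : ℕ)) *
        ∏ i : Fin k, ((0 + k - 1).choose (p + k - 1 - (p + (i : ℕ))) : ℝ) :=
      mul_pos (vand_pos h0) (Finset.prod_pos fun i _ => by
        exact_mod_cast Nat.choose_pos (by have := i.2; omega))
    refine ⟨_, inv_pos.mpr hpos, fun y hy hyp => ?_⟩
    rw [ncard_chains_zero _ _ hy]
    split_ifs with h
    · rw [h, inv_mul_cancel₀ hpos.ne']; simp
    · have : ∃ i, y i < p := by
        by_contra! hc
        apply h
        have h1 : StrictMono (fun i => y i - p) := fun i j hij => by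
          have := hy hij
          have := hc i
          have := hc j
          dsimp only
          omega
        have := eq_val_of_strictMono_of_lt h1 (fun i => by have := hyp i; omega)
        ext i
        have := congrFun this i
        have := hc i
        omega
      obtain ⟨i, hi⟩ := this
      have h0 : ∏ i, ((0 + k - 1).choose (p + k - 1 - y i) : ℝ) = 0 :=
        Finset.prod_eq_zero (Finset.mem_univ i)
          (by rw [Nat.choose_eq_zero_of_lt (by omega), Nat.cast_zero])
      rw [h0]
      simp
  | succ t ih =>
    obtain ⟨c, hc, ih⟩ := ih
    set T := t + k - 1 with hT
    set P := p + k - 1 with hP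
    have hT' : t + 1 + k - 1 = T + 1 := by omega
    have hTk : (k : ℝ) ≤ T + 1 := by exact_mod_cast (by omega : k ≤ T + 1)
    have hprod : 0 < ∏ j : Fin k, ((T : ℝ) + 1 - (j : ℕ)) := Finset.prod_pos fun j _ => by
      have : ((j : ℕ) : ℝ) < k := by exact_mod_cast j.2
      linarith
    refine ⟨c * (∏ j : Fin k, ((T : ℝ) + 1 - (j : ℕ))) / (T + 1) ^ k, by positivity,
      fun y hy hyP => ?_⟩
    -- Time reversed: a moving coordinate has weight P - y i, a resting one T + 1 - P + y i,
    -- matching the binomials in P - y i.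
    have key := sum_det_vandermonde_shift (δ := 1) (by norm_num) (P : ℝ) ((T : ℝ) + 1)
      (fun i : Fin k => (y i : ℝ))
    rw [ncard_chains_succ' t y _ hy, hT']
    have e1 : ∀ s : Finset (Fin k),
        ((chains t (fun i => y i + if i ∈ s then 1 else 0) (fun i : Fin k => p + (i : ℕ))).ncard : ℝ)
        = c / (T + 1) ^ k * (∏ i, ((T + 1).choose (P - y i) : ℝ)) *
        ((Matrix.vandermonde fun i => (y i : ℝ) + if i ∈ s then 1 else 0).det *
          ∏ i, (if i ∈ s then (P : ℝ) - 1 * (y i : ℝ) else (T : ℝ) + 1 - P + 1 * y i)) := by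
      intro s
      have e2 : (Matrix.vandermonde fun i => (y i : ℝ) + if i ∈ s then 1 else 0).det =
          vand (fun i => y i + if i ∈ s then 1 else 0) := by
        rw [vand]
        congr 2
        ext i
        split_ifs <;> simp
      by_cases hs : ∀ i ∈ s, y i < P
      · have e3 : (∏ i, ((T + 1).choose (P - y i) : ℝ)) *
            ∏ i, (if i ∈ s then (P : ℝ) - 1 * (y i : ℝ) else (T : ℝ) + 1 - P + 1 * y i) =
            (T + 1) ^ k * ∏ i, (T.choose (P - (y i + if i ∈ s then 1 else 0)) : ℝ) := by
          rw [← Finset.prod_mul_distrib]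
          have : ((T : ℝ) + 1) ^ k = ∏ _i : Fin k, ((T : ℝ) + 1) := by simp
          rw [this, ← Finset.prod_mul_distrib]
          refine Finset.prod_congr rfl fun i _ => ?_
          have h1 : ((P - y i : ℕ) : ℝ) = P - y i := by rw [Nat.cast_sub (hyP i)]
          split_ifs with hi
          · have h2 : 1 ≤ P - y i := by have := hs i hi; omega
            rw [← Nat.sub_sub, ← choose_succ_mul T (P - y i) h2, h1]; ring
          · simp only [Nat.add_zero]; rw [← choose_succ_mul_sub, h1]; ring
        rw [e2]
        have hT0 : ((T : ℝ) + 1) ^ k ≠ 0 := by positivity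
        have e4 : c / (T + 1) ^ k * (∏ i, ((T + 1).choose (P - y i) : ℝ)) *
          (vand (fun i => y i + if i ∈ s then 1 else 0) *
            ∏ i, (if i ∈ s then (P : ℝ) - 1 * (y i : ℝ) else (T : ℝ) + 1 - P + 1 * y i)) =
            c * (vand (fun i => y i + if i ∈ s then 1 else 0) *
              ∏ i, (T.choose (P - (y i + if i ∈ s then 1 else 0)) : ℝ)) := by
          calc _ = c / (T + 1) ^ k * vand (fun i => y i + if i ∈ s then 1 else 0) *
              ((∏ i, ((T + 1).choose (P - y i) : ℝ)) *
              ∏ i, (if i ∈ s then (P : ℝ) - 1 * (y i : ℝ) else (T : ℝ) + 1 - P + 1 * y i)) := by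
                ring
            _ = _ := by rw [e3]; field_simp
        rw [e4]
        rcases strictMono_add_or_vand_eq_zero hy s with h | h
        · refine ih _ h fun i => ?_
          have := hyP i
          split_ifs with hi
          · exact hs i hi
          · exact this
        · rw [h, ncard_chains_eq_zero]
          · simp
          · intro h'
            exact (vand_pos h'.1).ne' h
      -- A moving coordinate already at its maximum P would overshoot its end point; its weight P -
      -- y i vanishes accordingly.
      · push Not at hs
        obtain ⟨i, hi, hi'⟩ := hs
        have hi'' : y i = P := le_antisymm (hyP i) hi'
        have e5 : ∏ i, (if i ∈ s then (P : ℝ) - 1 * (y i : ℝ) else (T : ℝ) + 1 - P + 1 * y i) = 0 :=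
          Finset.prod_eq_zero (Finset.mem_univ i) (by simp [hi, hi''])
        rw [e5, mul_zero, mul_zero, Nat.cast_eq_zero, Set.ncard_eq_zero (chains_finite _ _ _)]
        by_contra hne
        obtain ⟨h, hh⟩ := Set.nonempty_iff_ne_empty.mpr hne
        have := chains_le_last hh 0 i
        rw [hh.1] at this
        simp only [hi, if_true] at this
        omega
    push_cast
    rw [Finset.sum_congr rfl fun s _ => e1 s, ← Finset.mul_sum, key, vand]
    ring

/-- The weight of a configuration on the cut at distance `m`, up to a constant. -/
noncomputable def weight (n p m : ℕ) (y : Fin k → ℕ) : ℝ :=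
  vand y ^ 2 * ∏ i, (((m + k - 1).choose (y i) : ℝ) *
    ((n + p - m + k - 1).choose (p + k - 1 - y i) : ℝ))

/-- Number of path families through a given configuration. -/
theorem exists_ncard_pathFamilies (hk : 0 < k) (n p : ℕ) (m : Fin (n + p + 1)) :
    ∃ c : ℝ, 0 < c ∧ ∀ y : Fin k → ℕ, StrictMono y → (∀ i, y i ≤ p + k - 1) →
      (({h | h ∈ pathFamilies k n p ∧ h m = y} : Set _).ncard : ℝ) = c * weight n p m y := by
  obtain ⟨c₁, hc₁, h₁⟩ := exists_ncard_chains_packed hk m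
  obtain ⟨c₂, hc₂, h₂⟩ := exists_ncard_chains_to_packed hk p (n + p - m)
  refine ⟨c₁ * c₂, by positivity, fun y hy hyp => ?_⟩
  rw [pathFamilies_eq_chains]
  have := ncard_chains_through (M := n + p) m (n + p - m) (by omega) (fun i : Fin k => (i : ℕ))
    (fun i => p + (i : ℕ)) y
  simp only [Fin.eta] at this
  rw [this, Nat.cast_mul, h₁ y hy, h₂ y hy hyp, weight, Finset.prod_mul_distrib]
  ring

end Formula

end Hexagon

namespace Hexagon

/-! ### Logarithmic potentials and energies of bounded densities -/

/-- Measurable functions with values in `[-1, 1]` that vanish outside `[-R, R]`. -/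
structure IsBddOn (R : ℝ) (d : ℝ → ℝ) : Prop where
  meas : Measurable d
  bdd : ∀ u, |d u| ≤ 1
  supp : ∀ u, u ∉ Set.Icc (-R) R → d u = 0

/-- The logarithmic potential. -/
noncomputable def pot (f : ℝ → ℝ) (z : ℝ) : ℝ := ∫ u, Real.log (z - u) * f u

/-- The (negative of the) mutual logarithmic energy. -/
noncomputable def logEnergy (f g : ℝ → ℝ) : ℝ := ∫ s, ∫ t, Real.log (s - t) * f s * g t

theorem intervalIntegrable_log_sub (z a b : ℝ) :
    IntervalIntegrable (fun u => Real.log (z - u)) volume a b := by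
  have := (intervalIntegral.intervalIntegrable_log' (a := z - a) (b := z - b)).comp_sub_left z
  simpa using this

theorem intervalIntegrable_log_sub' (z a b : ℝ) :
    IntervalIntegrable (fun u => Real.log (u - z)) volume a b := by
  have := (intervalIntegral.intervalIntegrable_log' (a := a - z) (b := b - z)).comp_sub_right z
  simpa using this

theorem integrableOn_log_sub (z a b : ℝ) :
    IntegrableOn (fun u => Real.log (z - u)) (Set.Icc a b) := by
  rcases le_or_gt a b with h | h
  · exact (intervalIntegrable_iff_integrableOn_Icc_of_le h).mp (intervalIntegrable_log_sub z a b)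
  · simp [Set.Icc_eq_empty_of_lt h]

namespace IsBddOn

variable {R : ℝ} {d f g : ℝ → ℝ}

theorem support_subset (hd : IsBddOn R d) : Function.support d ⊆ Set.Icc (-R) R := by
  intro u hu
  by_contra h
  exact hu (hd.supp u h)

theorem mul_integrable (hd : IsBddOn R d) {φ : ℝ → ℝ}
    (hφ : IntegrableOn φ (Set.Icc (-R) R)) : Integrable fun u => φ u * d u := by
  rw [← integrableOn_iff_integrable_of_support_subset (s := Set.Icc (-R) R)]
  · exact Integrable.mul_bdd (c := 1) hφ hd.meas.aestronglyMeasurable (ae_of_all _ hd.bdd)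
  · exact (Function.support_mul_subset_right _ _).trans hd.support_subset

theorem integrable (hd : IsBddOn R d) : Integrable d := by
  have := hd.mul_integrable (φ := fun _ => 1) (by simp)
  simpa using this

theorem integrable_log (hd : IsBddOn R d) (z : ℝ) :
    Integrable fun u => Real.log (z - u) * d u :=
  hd.mul_integrable (integrableOn_log_sub z _ _)

theorem setIntegral_eq (hd : IsBddOn R d) (φ : ℝ → ℝ) :
    ∫ u in Set.Icc (-R) R, φ u * d u = ∫ u, φ u * d u :=
  setIntegral_eq_integral_of_forall_compl_eq_zero fun u hu => by rw [hd.supp u hu, mul_zero]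

/-- On the square [-R, R]² the difference stays in [-2R, 2R], so the logarithm may be replaced by
its integrable restriction to that interval; the integrand is then a convolution integrand times a
bounded function. -/
theorem integrable_log_prod (hf : IsBddOn R f) (hg : IsBddOn R g) :
    Integrable (fun p : ℝ × ℝ => Real.log (p.1 - p.2) * f p.1 * g p.2)
      (volume.prod volume) := by
  have h1 : Integrable (Set.indicator (Set.Icc (-(2 * R)) (2 * R)) Real.log) := by
    rw [integrable_indicator_iff measurableSet_Icc]
    simpa using integrableOn_log_sub 0 (-(2 * R)) (2 * R)
  have h2 := Integrable.convolution_integrand (ContinuousLinearMap.mul ℝ ℝ) hg.integrable h1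
  have h3 := Integrable.mul_bdd (c := 1) h2 (g := fun p : ℝ × ℝ => f p.1)
    (hf.meas.comp measurable_fst).aestronglyMeasurable (ae_of_all _ fun p => hf.bdd p.1)
  refine h3.congr (ae_of_all _ fun p => ?_)
  simp only [ContinuousLinearMap.mul_apply']
  by_cases h : p.1 ∈ Set.Icc (-R) R
  · by_cases h' : p.2 ∈ Set.Icc (-R) R
    · rw [Set.indicator_of_mem]
      · ring
      · constructor <;> linarith [h.1, h.2, h'.1, h'.2]
    · simp [hg.supp _ h']
  · simp [hf.supp _ h]

theorem integrable_mul_pot (hf : IsBddOn R f) (hg : IsBddOn R g) :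
    Integrable fun s => f s * pot g s := by
  refine (hf.integrable_log_prod hg).integral_prod_left.congr (ae_of_all _ fun s => ?_)
  dsimp only
  rw [pot, ← integral_const_mul]
  congr 1
  ext t; ring

theorem logEnergy_eq (f g : ℝ → ℝ) : logEnergy f g = ∫ s, f s * pot g s := by
  rw [logEnergy]
  congr 1
  ext s
  rw [pot, ← integral_const_mul]
  congr 1
  ext t; ring

theorem logEnergy_comm (hf : IsBddOn R f) (hg : IsBddOn R g) :
    logEnergy f g = logEnergy g f := by
  rw [logEnergy, logEnergy, integral_integral_swap (hf.integrable_log_prod hg)]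
  congr 1
  ext s
  congr 1
  ext t
  rw [← Real.log_neg_eq_log]
  ring_nf

theorem pot_sub (hf : IsBddOn R f) (hg : IsBddOn R g) (z : ℝ) :
    pot (fun u => f u - g u) z = pot f z - pot g z := by
  simp only [pot, mul_sub]
  exact integral_sub (hf.integrable_log z) (hg.integrable_log z)

/-- Tent kernels are positive definite. -/
theorem tent_eq (hd : IsBddOn R d) (r : ℝ) :
    Integrable (fun p : ℝ × ℝ => max (r - |p.1 - p.2|) 0 * (d p.1 * d p.2))
      (volume.prod volume) ∧
    Integrable (fun w => (∫ t in Set.Ioc w (w + r), d t) ^ 2) ∧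
    ∫ p : ℝ × ℝ, max (r - |p.1 - p.2|) 0 * (d p.1 * d p.2) ∂(volume.prod volume) =
      ∫ w, (∫ t in Set.Ioc w (w + r), d t) ^ 2 := by
  -- The tent at s - t is the length of the intersection of [s - r, s) and [t - r, t). Integrating
  -- this triple product first over w gives the tent, first over (s, t) the square of the charge of
  -- a window.
  let F : (ℝ × ℝ) → ℝ → ℝ := fun p w =>
    (Set.indicator (Set.Ico (p.1 - r) p.1) 1 w * Set.indicator (Set.Ico (p.2 - r) p.2) 1 w) *
      (d p.1 * d p.2)
  have hmem : ∀ s w : ℝ, w ∈ Set.Ico (s - r) s ↔ s ∈ Set.Ioc w (w + r) := fun s w => by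
    simp only [Set.mem_Ico, Set.mem_Ioc]; constructor <;> intro h <;> constructor <;> linarith
  have hind : ∀ s w : ℝ, Set.indicator (Set.Ico (s - r) s) (1 : ℝ → ℝ) w =
      Set.indicator {p : ℝ × ℝ | p.1 - r ≤ p.2 ∧ p.2 < p.1} 1 (s, w) := fun s w => by
    simp [Set.indicator, Set.mem_Ico]
  have hS : MeasurableSet {p : ℝ × ℝ | p.1 - r ≤ p.2 ∧ p.2 < p.1} := by
    exact (measurableSet_le (by fun_prop : Measurable fun p : ℝ × ℝ => p.1 - r)
      measurable_snd).inter (measurableSet_lt measurable_snd measurable_fst)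
  have hSm : Measurable (Set.indicator {p : ℝ × ℝ | p.1 - r ≤ p.2 ∧ p.2 < p.1} (1 : ℝ × ℝ → ℝ)) :=
    measurable_one.indicator hS
  have hFm : Measurable (Function.uncurry F) := by
    simp only [F, hind, Function.uncurry_def]
    refine Measurable.mul (Measurable.mul ?_ ?_) (Measurable.mul ?_ ?_)
    · exact hSm.comp (by fun_prop : Measurable fun q : (ℝ × ℝ) × ℝ => (q.1.1, q.2))
    · exact hSm.comp (by fun_prop : Measurable fun q : (ℝ × ℝ) × ℝ => (q.1.2, q.2))
    · exact hd.meas.comp (by fun_prop)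
    · exact hd.meas.comp (by fun_prop)
  have hFint : Integrable (Function.uncurry F) ((volume.prod volume).prod volume) := by
    have hb : ∀ q, ‖Function.uncurry F q‖ ≤ 1 := by
      rintro ⟨p, w⟩
      simp only [Function.uncurry_apply_pair, F, norm_mul, Real.norm_eq_abs]
      have h1 : ∀ s, |Set.indicator (Set.Ico (s - r) s) (1 : ℝ → ℝ) w| ≤ 1 := fun s => by
        unfold Set.indicator; split_ifs <;> simp
      exact mul_le_one₀ (mul_le_one₀ (h1 _) (abs_nonneg _) (h1 _)) (by positivity)
        (mul_le_one₀ (hd.bdd _) (abs_nonneg _) (hd.bdd _))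
    rw [← integrableOn_iff_integrable_of_support_subset
      (s := (Set.Icc (-R) R ×ˢ Set.Icc (-R) R) ×ˢ Set.Icc (-R - r) R)]
    · refine Measure.integrableOn_of_bounded (M := 1) ?_ hFm.aestronglyMeasurable
        (ae_of_all _ hb)
      rw [Measure.prod_prod, Measure.prod_prod]
      simp [ENNReal.mul_eq_top, Real.volume_Icc]
    · rintro ⟨⟨s, t⟩, w⟩ h
      have h2 : d s ≠ 0 := fun h0 => h (by simp [Function.uncurry, F, h0])
      have h3 : d t ≠ 0 := fun h0 => h (by simp [Function.uncurry, F, h0])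
      have h4 : w ∈ Set.Ico (s - r) s := by
        by_contra h0
        exact h (by simp [Function.uncurry, F, Set.indicator_of_notMem h0])
      have h2 := hd.support_subset h2
      have h3 := hd.support_subset h3
      exact ⟨⟨h2, h3⟩, by linarith [h4.1, h2.1], by linarith [h4.2, h2.2]⟩
  have hin : ∀ p : ℝ × ℝ, ∫ w, F p w = max (r - |p.1 - p.2|) 0 * (d p.1 * d p.2) := by
    intro p
    simp only [F]
    rw [integral_mul_const]
    congr 1
    have : ∀ w, Set.indicator (Set.Ico (p.1 - r) p.1) (1 : ℝ → ℝ) w *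
        Set.indicator (Set.Ico (p.2 - r) p.2) 1 w =
        Set.indicator (Set.Ico (max (p.1 - r) (p.2 - r)) (min p.1 p.2)) 1 w := fun w => by
      rw [← Set.Ico_inter_Ico, Set.inter_indicator_one]; rfl
    simp_rw [this]
    rw [integral_indicator_one measurableSet_Ico, measureReal_def, Real.volume_Ico,
      ENNReal.toReal_ofReal']
    congr 1
    rw [max_sub_sub_right, ← max_sub_min_eq_abs']
    ring
  have hout : ∀ w, ∫ p, F p w ∂(volume.prod volume) = (∫ t in Set.Ioc w (w + r), d t) ^ 2 := by
    intro w
    have : ∀ p : ℝ × ℝ, F p w = (Set.Ioc w (w + r)).indicator d p.1 *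
        (Set.Ioc w (w + r)).indicator d p.2 := by
      intro p
      simp only [F, Set.indicator, hmem]
      split_ifs <;> simp
    simp_rw [this]
    rw [integral_prod_mul, integral_indicator measurableSet_Ioc, sq]
  refine ⟨?_, ?_, ?_⟩
  · refine hFint.integral_prod_left.congr (ae_of_all _ fun p => ?_)
    exact hin p
  · refine hFint.integral_prod_right.congr (ae_of_all _ fun w => ?_)
    exact hout w
  · have := integral_integral_swap hFint
    simp_rw [hin, hout] at this
    exact this

end IsBddOn

end Hexagon

/-! ### Coercivity of the logarithmic energy -/

namespace Hexagon

/-- Exhibits -log|u| as a superposition of tents of width r ≤ L with weight 1/r², plus the tent of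
width L divided by L, up to a constant. The integrand vanishes for r < |u| and has the primitive log
r + |u|/r beyond. -/
theorem integral_tent {L u : ℝ} (hu : u ≠ 0) (huL : |u| ≤ L) :
    ∫ r in Set.Ioc 0 L, max (r - |u|) 0 / r ^ 2 = Real.log L - Real.log u - 1 + |u| / L := by
  have hpos : 0 < |u| := abs_pos.mpr hu
  rw [← intervalIntegral.integral_of_le (hpos.le.trans huL),
    ← intervalIntegral.integral_add_adjacent_intervals (b := |u|)]
  · have h1 : ∫ r in (0 : ℝ)..|u|, max (r - |u|) 0 / r ^ 2 = 0 := by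
      rw [intervalIntegral.integral_congr (g := fun _ => 0)]
      · simp
      · intro r hr
        rw [Set.uIcc_of_le hpos.le] at hr
        simp [max_eq_right (sub_nonpos.mpr hr.2)]
    have h2 : ∫ r in |u|..L, max (r - |u|) 0 / r ^ 2 =
        (Real.log L + |u| / L) - (Real.log |u| + |u| / |u|) := by
      refine intervalIntegral.integral_eq_sub_of_hasDerivAt (f := fun r => Real.log r + |u| / r)
        (fun r hr => ?_) ?_
      · rw [Set.uIcc_of_le huL] at hr
        have hr0 : r ≠ 0 := (hpos.trans_le hr.1).ne'
        have : HasDerivAt (fun r => Real.log r + |u| / r) (r⁻¹ + |u| * -(r ^ 2)⁻¹) r :=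
          (Real.hasDerivAt_log hr0).add ((hasDerivAt_inv hr0).const_mul |u|)
        refine this.congr_deriv ?_
        rw [max_eq_left (sub_nonneg.mpr hr.1)]
        field_simp
        ring
      · apply ContinuousOn.intervalIntegrable
        rw [Set.uIcc_of_le huL]
        refine ContinuousOn.div (by fun_prop) (by fun_prop) fun r hr => ?_
        exact pow_ne_zero _ (hpos.trans_le hr.1).ne'
    rw [h1, h2, Real.log_abs, div_self hpos.ne']
    ring
  · refine IntervalIntegrable.congr (f := fun _ => 0) ?_ (by simp)
    intro r hr
    rw [Set.uIoc_of_le hpos.le] at hr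
    simp [max_eq_right (sub_nonpos.mpr hr.2)]
  · apply ContinuousOn.intervalIntegrable
    rw [Set.uIcc_of_le huL]
    refine ContinuousOn.div (by fun_prop) (by fun_prop) fun r hr => ?_
    exact pow_ne_zero _ (hpos.trans_le hr.1).ne'

theorem ae_prod_ne : ∀ᵐ p : ℝ × ℝ ∂(volume.prod volume), p.1 - p.2 ≠ 0 := by
  have hS : MeasurableSet {p : ℝ × ℝ | p.1 = p.2} := measurableSet_eq_fun measurable_fst measurable_snd
  have h0 : (volume.prod volume) {p : ℝ × ℝ | p.1 = p.2} = 0 := by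
    rw [Measure.measure_prod_null hS]
    refine ae_of_all _ fun x => ?_
    have : Prod.mk x ⁻¹' {p : ℝ × ℝ | p.1 = p.2} = {x} := by
      ext y; simp [eq_comm]
    change volume (Prod.mk x ⁻¹' {p : ℝ × ℝ | p.1 = p.2}) = 0
    rw [this]; simp
  rw [ae_iff]
  convert h0 using 2
  ext p
  simp [sub_eq_zero]

namespace IsBddOn

variable {R : ℝ} {d f g : ℝ → ℝ}

/-- Allows the scale r to be integrated last. The weight 1/r² is harmless at 0: a window of length r
carries at most charge r in absolute value, and only windows starting in [-R - r, R] carry any, so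
the tent energy of |d| is at most (2R + r) r². -/
theorem integrable_tent_div (hd : IsBddOn R d) (hR : 0 ≤ R) :
    Integrable (Function.uncurry fun (p : ℝ × ℝ) (r : ℝ) =>
      max (r - |p.1 - p.2|) 0 / r ^ 2 * (d p.1 * d p.2))
      ((volume.prod volume).prod (volume.restrict (Set.Ioc 0 (2 * R)))) := by
  have hm : Measurable (Function.uncurry fun (p : ℝ × ℝ) (r : ℝ) =>
      max (r - |p.1 - p.2|) 0 / r ^ 2 * (d p.1 * d p.2)) := by
    have := hd.meas
    simp only [Function.uncurry_def]
    fun_prop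
  have hd' : IsBddOn R (fun u => |d u|) :=
    ⟨hd.meas.norm, fun u => by simpa using hd.bdd u, fun u hu => by simp [hd.supp u hu]⟩
  rw [integrable_prod_iff' hm.aestronglyMeasurable]
  constructor
  · filter_upwards [ae_restrict_mem measurableSet_Ioc] with r hr
    refine ((hd.tent_eq r).1.const_mul (1 / r ^ 2)).congr (ae_of_all _ fun p => ?_)
    simp only [Function.uncurry_apply_pair]
    ring
  · have hcst : IntegrableOn (fun _ : ℝ => (2 * R + 2 * R)) (Set.Ioc 0 (2 * R)) :=
      integrableOn_const measure_Ioc_lt_top.ne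
    refine Integrable.mono' hcst ?_ ?_
    · exact (hm.norm.stronglyMeasurable.integral_prod_left').aestronglyMeasurable
    · filter_upwards [ae_restrict_mem measurableSet_Ioc] with r hr
      have hr0 : 0 < r := hr.1
      have e1 : ∀ p : ℝ × ℝ, ‖Function.uncurry (fun (p : ℝ × ℝ) (r : ℝ) =>
          max (r - |p.1 - p.2|) 0 / r ^ 2 * (d p.1 * d p.2)) (p, r)‖ =
          1 / r ^ 2 * (max (r - |p.1 - p.2|) 0 * (|d p.1| * |d p.2|)) := fun p => by
        simp only [Function.uncurry_apply_pair, norm_mul, norm_div, Real.norm_eq_abs]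
        rw [abs_of_nonneg (le_max_right _ (0 : ℝ)), abs_of_nonneg (sq_nonneg r)]
        ring
      simp_rw [e1]
      rw [integral_const_mul, (hd'.tent_eq r).2.2, Real.norm_eq_abs, abs_of_nonneg
        (mul_nonneg (by positivity) (integral_nonneg fun w => sq_nonneg _))]
      have hb : ∀ w, (∫ t in Set.Ioc w (w + r), |d t|) ^ 2 ≤
          Set.indicator (Set.Icc (-R - r) R) (fun _ => r ^ 2) w := by
        intro w
        by_cases hw : w ∈ Set.Icc (-R - r) R
        · rw [Set.indicator_of_mem hw]
          have h1 : |(∫ t in Set.Ioc w (w + r), |d t|)| ≤ 1 * volume.real (Set.Ioc w (w + r)) :=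
            norm_setIntegral_le_of_norm_le_const (f := fun t => |d t|) (C := 1)
              measure_Ioc_lt_top (fun t _ => by simpa using hd.bdd t)
          rw [Real.volume_real_Ioc_of_le (by linarith)] at h1
          rw [← sq_abs]
          exact pow_le_pow_left₀ (abs_nonneg _) (by linarith) 2
        · rw [Set.indicator_of_notMem hw, setIntegral_eq_zero_of_forall_eq_zero]
          · simp
          · intro t ht
            rw [hd.supp t, abs_zero]
            intro ht'
            exact hw ⟨by linarith [ht.2, ht'.1], by linarith [ht.1, ht'.2]⟩
      have h2 : ∫ w, (∫ t in Set.Ioc w (w + r), |d t|) ^ 2 ≤ (2 * R + r) * r ^ 2 := by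
        refine (integral_mono (hd'.tent_eq r).2.1 ?_ hb).trans ?_
        · exact (integrable_indicator_iff measurableSet_Icc).mpr (by simp)
        · rw [integral_indicator measurableSet_Icc, setIntegral_const,
            Real.volume_real_Icc_of_le (by linarith)]
          simp only [smul_eq_mul]
          apply le_of_eq; ring
      calc 1 / r ^ 2 * ∫ w, (∫ t in Set.Ioc w (w + r), |d t|) ^ 2
          ≤ 1 / r ^ 2 * ((2 * R + r) * r ^ 2) := by gcongr
        _ = 2 * R + r := by field_simp
        _ ≤ 2 * R + 2 * R := by linarith [hr.2]

/-- The logarithmic energy of a neutral charge dominates the `L²` norm of its distribution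
function. -/
theorem integral_sq_le_energy (hd : IsBddOn R d) (hR : 0 < R) (h0 : ∫ u, d u = 0) :
    1 / (2 * R) * ∫ w in Set.Icc (-R) R, (∫ t in Set.Iic w, d t) ^ 2 ≤ -logEnergy d d := by
  have hlog := hd.integrable_log_prod hd
  have htent := hd.tent_eq (2 * R)
  have hint := hd.integrable_tent_div hR.le
  have hdd : Integrable (fun p : ℝ × ℝ => d p.1 * d p.2) (volume.prod volume) :=
    hd.integrable.mul_prod hd.integrable
  -- Positivity holds scale by scale, each tent energy being the integral of a square.
  have e1 : 0 ≤ ∫ p : ℝ × ℝ, (∫ r in Set.Ioc 0 (2 * R),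
      max (r - |p.1 - p.2|) 0 / r ^ 2 * (d p.1 * d p.2)) ∂(volume.prod volume) := by
    rw [integral_integral_swap hint]
    refine setIntegral_nonneg measurableSet_Ioc fun r hr => ?_
    have : ∀ p : ℝ × ℝ, max (r - |p.1 - p.2|) 0 / r ^ 2 * (d p.1 * d p.2) =
      1 / r ^ 2 * (max (r - |p.1 - p.2|) 0 * (d p.1 * d p.2)) := fun p => by ring
    simp_rw [this]
    rw [integral_const_mul, (hd.tent_eq r).2.2]
    exact mul_nonneg (by positivity) (integral_nonneg fun w => sq_nonneg _)
  have e2 : ∫ p : ℝ × ℝ, (∫ r in Set.Ioc 0 (2 * R),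
      max (r - |p.1 - p.2|) 0 / r ^ 2 * (d p.1 * d p.2)) ∂(volume.prod volume) =
      ∫ p : ℝ × ℝ, (Real.log (2 * R) * (d p.1 * d p.2)
        - Real.log (p.1 - p.2) * d p.1 * d p.2 -
        1 / (2 * R) * (max (2 * R - |p.1 - p.2|) 0 * (d p.1 * d p.2))) ∂(volume.prod volume) := by
    refine integral_congr_ae ?_
    filter_upwards [ae_prod_ne] with p hp
    rw [integral_mul_const]
    by_cases h1 : p.1 ∈ Set.Icc (-R) R
    · by_cases h2 : p.2 ∈ Set.Icc (-R) R
      · have hle : |p.1 - p.2| ≤ 2 * R := by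
          rw [abs_le]; constructor <;> linarith [h1.1, h1.2, h2.1, h2.2]
        rw [integral_tent hp hle, max_eq_left (by linarith)]
        field_simp
        ring
      · simp [hd.supp _ h2]
    · simp [hd.supp _ h1]
  have hA : Integrable (fun p : ℝ × ℝ => Real.log (2 * R) * (d p.1 * d p.2)
        - Real.log (p.1 - p.2) * d p.1 * d p.2) (volume.prod volume) := (hdd.const_mul _).sub hlog
  -- Neutrality removes the constant log (2R). What remains is the energy minus 1/(2R) times the
  -- tent energy at scale 2R.
  rw [e2, integral_sub hA (htent.1.const_mul _),
    integral_sub (hdd.const_mul _) hlog, integral_const_mul, integral_prod_mul, h0,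
    integral_const_mul, htent.2.2, integral_prod _ hlog] at e1
  -- For w in [-R, R] a window of length 2R starting at w reaches past the support, so by neutrality
  -- its charge is minus the distribution function at w.
  have e3 : ∫ w in Set.Icc (-R) R, (∫ t in Set.Iic w, d t) ^ 2 ≤
      ∫ w, (∫ t in Set.Ioc w (w + 2 * R), d t) ^ 2 := by
    calc _ = ∫ w in Set.Icc (-R) R, (∫ t in Set.Ioc w (w + 2 * R), d t) ^ 2 := by
          refine setIntegral_congr_fun measurableSet_Icc fun w hw => ?_
          have h1 : ∫ t in Set.Ioc w (w + 2 * R), d t = ∫ t in Set.Ioi w, d t := by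
            refine (setIntegral_eq_of_subset_of_forall_sdiff_eq_zero measurableSet_Ioi
              Set.Ioc_subset_Ioi_self ?_).symm
            rintro t ⟨ht, ht'⟩
            refine hd.supp t fun h => ht' ⟨ht, by linarith [h.2, hw.1]⟩
          have h2 := intervalIntegral.integral_Iic_add_Ioi (b := w) hd.integrable.integrableOn
            hd.integrable.integrableOn
          rw [h0] at h2
          rw [h1, eq_neg_of_add_eq_zero_left h2, neg_sq]
      _ ≤ _ := setIntegral_le_integral htent.2.1 (ae_of_all _ fun w => sq_nonneg _)
  have e4 : 1 / (2 * R) * ∫ w in Set.Icc (-R) R, (∫ t in Set.Iic w, d t) ^ 2 ≤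
      1 / (2 * R) * ∫ w, (∫ t in Set.Ioc w (w + 2 * R), d t) ^ 2 := by gcongr
  rw [logEnergy]
  linarith

theorem abs_cdf_sub_le (hd : IsBddOn R d) {v w : ℝ} (h : v ≤ w) :
    |(∫ t in Set.Iic w, d t) - ∫ t in Set.Iic v, d t| ≤ w - v := by
  rw [intervalIntegral.integral_Iic_sub_Iic hd.integrable.integrableOn
    hd.integrable.integrableOn]
  have := intervalIntegral.norm_integral_le_of_norm_le_const (a := v) (b := w) (f := d) (C := 1)
    fun x _ => hd.bdd x
  rw [abs_of_nonneg (sub_nonneg.mpr h)] at this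
  simpa using this

theorem continuous_cdf (hd : IsBddOn R d) : Continuous fun w => ∫ t in Set.Iic w, d t := by
  refine (LipschitzWith.of_dist_le_mul (K := 1) fun v w => ?_).continuous
  rw [Real.dist_eq, Real.dist_eq, NNReal.coe_one, one_mul]
  rcases le_total v w with h | h
  · rw [abs_sub_comm, abs_sub_comm v, abs_of_nonneg (sub_nonneg.mpr h)]
    exact hd.abs_cdf_sub_le h
  · rw [abs_of_nonneg (sub_nonneg.mpr h)]
    exact hd.abs_cdf_sub_le h

theorem cdf_eq_zero (hd : IsBddOn R d) (h0 : ∫ u, d u = 0) {w : ℝ} (hw : w ∉ Set.Ioo (-R) R) :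
    ∫ t in Set.Iic w, d t = 0 := by
  rcases lt_or_ge (-R) w with h | h
  · rw [← h0]
    have hRw : R ≤ w := by
      by_contra hc; exact hw ⟨h, not_le.mp hc⟩
    refine setIntegral_eq_integral_of_forall_compl_eq_zero fun t ht => hd.supp t fun h' => ht ?_
    exact h'.2.trans hRw
  · rw [integral_Iic_eq_integral_Iio]
    refine setIntegral_eq_zero_of_forall_eq_zero fun t ht => hd.supp t fun h' => ?_
    exact absurd h'.1 (not_le.mpr (lt_of_lt_of_le ht h))

/-- The logarithmic energy of a neutral charge controls its distribution function. -/
theorem abs_cdf_pow_le_energy (hd : IsBddOn R d) (hR : 0 < R) (h0 : ∫ u, d u = 0) (w : ℝ) :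
    |∫ t in Set.Iic w, d t| ^ 3 / (16 * R) ≤ -logEnergy d d := by
  have hmain := hd.integral_sq_le_energy hR h0
  have hnn : 0 ≤ ∫ w in Set.Icc (-R) R, (∫ t in Set.Iic w, d t) ^ 2 :=
    integral_nonneg fun _ => sq_nonneg _
  have hcont : Continuous fun w => (∫ t in Set.Iic w, d t) ^ 2 :=
    hd.continuous_cdf.pow 2
  by_cases hw : w ∈ Set.Ioo (-R) R
  · set η := |∫ t in Set.Iic w, d t| with hη
    have hη0 : 0 ≤ η := abs_nonneg _
    have hηR : η ≤ R - w := by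
      have := hd.abs_cdf_sub_le hw.2.le
      rw [hd.cdf_eq_zero h0 (w := R) (by simp), zero_sub, abs_neg] at this
      exact this
    -- The distribution function is 1-Lipschitz, so it stays above η/2 in absolute value on an
    -- interval of length η/2, which lies in [-R, R] because η ≤ R - w. This contributes (η/2)³, and
    -- 16 = 2 · 2³.
    have h1 : ∀ v ∈ Set.Icc w (w + η / 2), (η / 2) ^ 2 ≤ (∫ t in Set.Iic v, d t) ^ 2 := by
      intro v hv
      have := hd.abs_cdf_sub_le hv.1
      have h2 : η / 2 ≤ |∫ t in Set.Iic v, d t| := by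
        have h3 := abs_sub_abs_le_abs_sub (∫ t in Set.Iic w, d t) (∫ t in Set.Iic v, d t)
        rw [abs_sub_comm] at h3
        linarith [hv.2]
      rw [← sq_abs (∫ t in Set.Iic v, d t)]
      exact pow_le_pow_left₀ (by linarith) h2 2
    have h2 : (η / 2) * (η / 2) ^ 2 ≤ ∫ w in Set.Icc (-R) R, (∫ t in Set.Iic w, d t) ^ 2 := by
      calc (η / 2) * (η / 2) ^ 2 = ∫ v in Set.Icc w (w + η / 2), (η / 2) ^ 2 := by
            rw [setIntegral_const, Real.volume_real_Icc_of_le (by linarith)]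
            simp
        _ ≤ ∫ v in Set.Icc w (w + η / 2), (∫ t in Set.Iic v, d t) ^ 2 :=
            setIntegral_mono_on (integrableOn_const measure_Icc_lt_top.ne)
              (hcont.integrableOn_Icc) measurableSet_Icc h1
        _ ≤ _ := setIntegral_mono_set hcont.integrableOn_Icc (ae_of_all _ fun _ => sq_nonneg _)
            (Set.Icc_subset_Icc hw.1.le (by linarith)).eventuallyLE
    calc η ^ 3 / (16 * R) = 1 / (2 * R) * ((η / 2) * (η / 2) ^ 2) := by field_simp; ring
      _ ≤ 1 / (2 * R) * ∫ w in Set.Icc (-R) R, (∫ t in Set.Iic w, d t) ^ 2 := by gcongr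
      _ ≤ _ := hmain
  · rw [hd.cdf_eq_zero h0 hw]
    simp only [abs_zero, ne_eq, OfNat.ofNat_ne_zero, not_false_eq_true, zero_pow, zero_div]
    exact (mul_nonneg (by positivity) hnn).trans hmain

end IsBddOn

end Hexagon

namespace Hexagon

/-! ### Weak continuity of integrals and potentials -/

/-- Truncating the logarithm at height ε changes it by a nonnegative function of integral 2ε.
Against any density bounded by one the error is at most 2ε, while the truncated logarithm is
Lipschitz. -/
theorem integral_log_max_sub (ε : ℝ) (hε : 0 < ε) :
    Integrable (fun u : ℝ => Real.log (max |u| ε) - Real.log u) ∧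
    ∫ u : ℝ, (Real.log (max |u| ε) - Real.log u) = 2 * ε ∧
    ∀ u : ℝ, u ≠ 0 → 0 ≤ Real.log (max |u| ε) - Real.log u := by
  have h0 : ∀ u : ℝ, u ∉ Set.Icc (-ε) ε → Real.log (max |u| ε) - Real.log u = 0 := by
    intro u hu
    have : ε ≤ |u| := by
      by_contra h
      exact hu ⟨(abs_lt.mp (not_le.mp h)).1.le, (abs_lt.mp (not_le.mp h)).2.le⟩
    rw [max_eq_left this, Real.log_abs, sub_self]
  have h1 : ∀ u ∈ Set.Icc (-ε) ε, Real.log (max |u| ε) - Real.log u = Real.log ε - Real.log u := by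
    intro u hu
    rw [max_eq_right (abs_le.mpr hu)]
  have hi : IntegrableOn (fun u : ℝ => Real.log ε - Real.log u) (Set.Icc (-ε) ε) := by
    refine Integrable.sub (integrableOn_const measure_Icc_lt_top.ne) ?_
    have := integrableOn_log_sub 0 (-ε) ε
    simp only [zero_sub, Real.log_neg_eq_log] at this
    exact this
  refine ⟨?_, ?_, fun u hu => ?_⟩
  · rw [← integrableOn_iff_integrable_of_support_subset (s := Set.Icc (-ε) ε)]
    · exact hi.congr_fun (fun u hu => (h1 u hu).symm) measurableSet_Icc
    · intro u hu
      by_contra h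
      exact hu (h0 u h)
  · rw [← setIntegral_eq_integral_of_forall_compl_eq_zero h0,
      setIntegral_congr_fun measurableSet_Icc h1, integral_Icc_eq_integral_Ioc,
      ← intervalIntegral.integral_of_le (by linarith), intervalIntegral.integral_sub
        (by simp) intervalIntegral.intervalIntegrable_log', integral_log]
    simp
    ring
  · rw [sub_nonneg, ← Real.log_abs u]
    exact Real.log_le_log (abs_pos.mpr hu) (le_max_left _ _)

theorem lipschitz_log_max (z ε : ℝ) (hε : 0 < ε) :
    LipschitzWith (Real.toNNReal (1 / ε)) fun t : ℝ => Real.log (max |z - t| ε) := by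
  refine LipschitzWith.of_dist_le_mul fun s t => ?_
  rw [Real.coe_toNNReal _ (by positivity), Real.dist_eq, Real.dist_eq]
  have key : ∀ a b : ℝ, ε ≤ a → ε ≤ b → Real.log a - Real.log b ≤ 1 / ε * |a - b| := by
    intro a b ha hb
    have hb0 : 0 < b := hε.trans_le hb
    rw [← Real.log_div (hε.trans_le ha).ne' hb0.ne']
    calc Real.log (a / b) ≤ a / b - 1 := Real.log_le_sub_one_of_pos (div_pos (hε.trans_le ha) hb0)
      _ = (a - b) / b := by field_simp
      _ ≤ |a - b| / b := by gcongr; exact le_abs_self _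
      _ ≤ |a - b| / ε := by gcongr
      _ = _ := by ring
  have h1 : |max |z - s| ε - max |z - t| ε| ≤ |s - t| := by
    refine (abs_max_sub_max_le_abs _ _ _).trans ((abs_abs_sub_abs_le _ _).trans (le_of_eq ?_))
    rw [abs_sub_comm s t]; ring_nf
  have h2 := key _ _ (le_max_right |z - s| ε) (le_max_right |z - t| ε)
  have h3 := key _ _ (le_max_right |z - t| ε) (le_max_right |z - s| ε)
  rw [abs_sub_comm (max |z - t| ε)] at h3
  have h4 : 1 / ε * |max |z - s| ε - max |z - t| ε| ≤ 1 / ε * |s - t| := by gcongr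
  rw [abs_le]
  constructor <;> linarith

namespace IsBddOn

variable {R : ℝ} {d f g : ℝ → ℝ}

/-- Integration by parts moves the derivative to φ; neutrality kills the boundary terms, and |φ'| ≤
K almost everywhere. -/
theorem abs_integral_mul_le_of_lipschitzOn (hd : IsBddOn R d) (hR : 0 < R) (h0 : ∫ u, d u = 0)
    {δ : ℝ} (hδ : ∀ w, |∫ t in Set.Iic w, d t| ≤ δ) {φ : ℝ → ℝ} {K : NNReal}
    (hφ : LipschitzOnWith K φ (Set.Icc (-R) R)) : |∫ t, φ t * d t| ≤ K * (2 * R) * δ := by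
  have hle : -R ≤ R := by linarith
  have hu : Set.uIcc (-R) R = Set.Icc (-R) R := Set.uIcc_of_le hle
  have hdi : IntervalIntegrable d volume (-R) R := hd.integrable.intervalIntegrable
  set G : ℝ → ℝ := fun x => ∫ t in (-R)..x, d t with hG
  have hGac : AbsolutelyContinuousOnInterval G (-R) R :=
    hdi.absolutelyContinuousOnInterval_intervalIntegral (by simp)
  have hφac : AbsolutelyContinuousOnInterval φ (-R) R :=
    LipschitzOnWith.absolutelyContinuousOnInterval (by rwa [hu])
  have hGD : ∀ x, G x = ∫ t in Set.Iic x, d t := by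
    intro x
    rw [hG]
    dsimp only
    rw [← intervalIntegral.integral_Iic_sub_Iic hd.integrable.integrableOn
      hd.integrable.integrableOn, hd.cdf_eq_zero h0 (w := -R) (by simp), sub_zero]
  have hparts := hφac.integral_mul_deriv_eq_deriv_mul hGac
  have hderiv : ∫ x in (-R)..R, φ x * deriv G x = ∫ t, φ t * d t := by
    rw [← hd.setIntegral_eq, integral_Icc_eq_integral_Ioc, ← intervalIntegral.integral_of_le hle]
    refine intervalIntegral.integral_congr_ae ?_
    filter_upwards [hdi.ae_hasDerivAt_integral] with x hx hx'
    rw [(hx (Set.uIoc_subset_uIcc hx') (-R) (by simp)).deriv]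
  rw [hderiv, hGD R, hGD (-R), hd.cdf_eq_zero h0 (w := -R) (by simp),
    hd.cdf_eq_zero h0 (w := R) (by simp)] at hparts
  simp only [mul_zero, sub_zero, zero_sub] at hparts
  rw [hparts, abs_neg]
  have hae : ∀ᵐ x, x ∈ Set.uIoc (-R) R → ‖deriv φ x * G x‖ ≤ K * δ := by
    have h1 : ∀ᵐ x : ℝ, x ≠ R := by simp [ae_iff, measure_singleton]
    filter_upwards [h1] with x hx hx'
    rw [Set.uIoc_of_le hle] at hx'
    rw [norm_mul]
    have hnhds : Set.Icc (-R) R ∈ 𝓝 x := Icc_mem_nhds hx'.1 (lt_of_le_of_ne hx'.2 hx)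
    refine mul_le_mul (norm_deriv_le_of_lipschitzOn (𝕜 := ℝ) hnhds hφ) ?_ (norm_nonneg _) K.2
    rw [hGD]
    exact hδ x
  have := intervalIntegral.norm_integral_le_of_norm_le_const_ae (f := fun x => deriv φ x * G x) hae
  rw [Real.norm_eq_abs, abs_of_nonneg (by linarith : 0 ≤ R - -R)] at this
  linarith

theorem abs_pot_sub_le (hd : IsBddOn R d) (z : ℝ) {ε : ℝ} (hε : 0 < ε) :
    |pot d z - ∫ t, Real.log (max |z - t| ε) * d t| ≤ 2 * ε := by
  have hL := integral_log_max_sub ε hε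
  have hi2 : Integrable fun t => Real.log (max |z - t| ε) * d t :=
    hd.mul_integrable (lipschitz_log_max z ε hε).continuous.integrableOn_Icc
  rw [pot, ← integral_sub (hd.integrable_log z) hi2]
  calc |∫ t, (Real.log (z - t) * d t - Real.log (max |z - t| ε) * d t)|
      ≤ ∫ t, (Real.log (max |z - t| ε) - Real.log (z - t)) := by
        rw [← Real.norm_eq_abs]
        refine norm_integral_le_of_norm_le (hL.1.comp_sub_left z) ?_
        have h1 : ∀ᵐ t : ℝ, t ≠ z := by simp [ae_iff, measure_singleton]
        filter_upwards [h1] with t ht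
        have h2 := hL.2.2 (z - t) (sub_ne_zero.mpr ht.symm)
        rw [← sub_mul, norm_mul, norm_sub_rev, Real.norm_eq_abs, Real.norm_eq_abs, abs_of_nonneg h2]
        exact mul_le_of_le_one_right h2 (hd.bdd t)
    _ = 2 * ε := by
        rw [← hL.2.1]
        exact integral_sub_left_eq_self (fun u => Real.log (max |u| ε) - Real.log u) volume z

/-- Truncation at ε costs 2ε, and the truncated logarithm, of Lipschitz constant 1/ε, contributes at
most 2Rδ/ε. The choice ε = √δ balances both. -/
theorem abs_pot_le (hd : IsBddOn R d) (hR : 0 < R) (h0 : ∫ u, d u = 0)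
    {δ : ℝ} (hδ0 : 0 < δ) (hδ : ∀ w, |∫ t in Set.Iic w, d t| ≤ δ) (z : ℝ) :
    |pot d z| ≤ (2 + 2 * R) * √δ := by
  have hs : 0 < √δ := Real.sqrt_pos.mpr hδ0
  have h1 := hd.abs_pot_sub_le z hs
  have h2 := hd.abs_integral_mul_le_of_lipschitzOn hR h0 hδ
    ((lipschitz_log_max z (√δ) hs).lipschitzOnWith (s := Set.Icc (-R) R))
  rw [Real.coe_toNNReal _ (by positivity)] at h2
  have h3 : 1 / √δ * (2 * R) * δ = 2 * R * √δ := by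
    rw [div_mul_eq_mul_div, one_mul, div_mul_eq_mul_div, mul_div_assoc, Real.div_sqrt]
  rw [h3] at h2
  have := abs_sub_abs_le_abs_sub (pot d z) (∫ t, Real.log (max |z - t| (√δ)) * d t)
  linarith

/-- The same truncation with ε = √|z - z'| yields a Hölder modulus of exponent 1/2. -/
theorem continuous_pot (hd : IsBddOn R d) (hR : 0 < R) : Continuous (pot d) := by
  have key : ∀ z z' : ℝ, z ≠ z' → |pot d z - pot d z'| ≤ (4 + 2 * R) * √|z - z'| := by
    intro z z' hz
    have hs : 0 < √|z - z'| := Real.sqrt_pos.mpr (abs_pos.mpr (sub_ne_zero.mpr hz))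
    set ε := √|z - z'| with hε
    have hi : ∀ z, Integrable fun t => Real.log (max |z - t| ε) * d t := fun z =>
      hd.mul_integrable (lipschitz_log_max z ε hs).continuous.integrableOn_Icc
    have h1 := hd.abs_pot_sub_le z hs
    have h2 := hd.abs_pot_sub_le z' hs
    have h3 : |(∫ t, Real.log (max |z - t| ε) * d t) - ∫ t, Real.log (max |z' - t| ε) * d t| ≤
        2 * R * ε := by
      rw [← integral_sub (hi z) (hi z')]
      simp_rw [← sub_mul]
      rw [← hd.setIntegral_eq]
      have := norm_setIntegral_le_of_norm_le_const (μ := volume) (s := Set.Icc (-R) R)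
        (f := fun t => (Real.log (max |z - t| ε) - Real.log (max |z' - t| ε)) * d t) (C := ε)
        measure_Icc_lt_top (fun t _ => by
          rw [norm_mul]
          refine (mul_le_of_le_one_right (norm_nonneg _) (hd.bdd t)).trans ?_
          have h4 := (lipschitz_log_max t ε hs).dist_le_mul z z'
          rw [Real.coe_toNNReal _ (by positivity), Real.dist_eq, Real.dist_eq,
            abs_sub_comm t z, abs_sub_comm t z'] at h4
          refine h4.trans (le_of_eq ?_)
          rw [div_mul_eq_mul_div, one_mul, hε, Real.div_sqrt])
      rw [Real.volume_real_Icc_of_le (by linarith)] at this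
      refine this.trans (le_of_eq ?_)
      ring
    rw [abs_le] at *
    constructor <;> linarith [h1.1, h1.2, h2.1, h2.2, h3.1, h3.2]
  rw [continuous_iff_continuousAt]
  intro z
  rw [ContinuousAt, tendsto_iff_norm_sub_tendsto_zero]
  refine squeeze_zero (fun _ => norm_nonneg _) (g := fun z' => (4 + 2 * R) * √|z' - z|) ?_ ?_
  · intro z'
    rcases eq_or_ne z' z with rfl | h
    · simp
    · exact key z' z h
  · have : Continuous fun z' => (4 + 2 * R) * √|z' - z| := by fun_prop
    have := this.tendsto z
    simpa using this

/-- Weierstrass approximation reduces to a polynomial, which is Lipschitz on the interval. The point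
is that δ is uniform over all neutral charges d. -/
theorem exists_abs_integral_mul_le (hR : 0 < R) {φ : ℝ → ℝ} (hφ : ContinuousOn φ (Set.Icc (-R) R))
    {η : ℝ} (hη : 0 < η) : ∃ δ > 0, ∀ d, IsBddOn R d → ∫ u, d u = 0 →
      (∀ w, |∫ t in Set.Iic w, d t| ≤ δ) → |∫ t, φ t * d t| ≤ η := by
  obtain ⟨p, hp⟩ := exists_polynomial_near_of_continuousOn (-R) R φ hφ (η / (4 * R)) (by positivity)
  have hpc : ContDiffOn ℝ 1 (fun x => p.eval x) (Set.Icc (-R) R) :=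
    (Polynomial.contDiff_aeval p 1).contDiffOn
  obtain ⟨K, hK⟩ := hpc.exists_lipschitzOnWith (by decide) (convex_Icc _ _) isCompact_Icc
  refine ⟨η / (2 * (K * (2 * R) + 1)), by positivity, fun d hd h0 hδ => ?_⟩
  have h1 := hd.abs_integral_mul_le_of_lipschitzOn hR h0 hδ hK
  have hi1 : Integrable fun t => φ t * d t := hd.mul_integrable hφ.integrableOn_Icc
  have hi2 : Integrable fun t => p.eval t * d t :=
    hd.mul_integrable p.continuous.integrableOn_Icc
  have h2 : |(∫ t, φ t * d t) - ∫ t, p.eval t * d t| ≤ η / 2 := by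
    rw [← integral_sub hi1 hi2]
    simp_rw [← sub_mul]
    rw [← hd.setIntegral_eq]
    have := norm_setIntegral_le_of_norm_le_const (μ := volume) (s := Set.Icc (-R) R)
      (f := fun t => (φ t - p.eval t) * d t) (C := η / (4 * R)) measure_Icc_lt_top (fun t ht => by
        rw [norm_mul, norm_sub_rev]
        exact (mul_le_of_le_one_right (norm_nonneg _) (hd.bdd t)).trans (hp t ht).le)
    rw [Real.volume_real_Icc_of_le (by linarith)] at this
    refine this.trans (le_of_eq ?_)
    field_simp; ring
  have h3 : (K : ℝ) * (2 * R) * (η / (2 * (K * (2 * R) + 1))) ≤ η / 2 := by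
    rw [mul_div_assoc', div_le_div_iff₀ (by positivity) (by positivity)]
    nlinarith
  have := abs_sub_abs_le_abs_sub (∫ t, φ t * d t) (∫ t, p.eval t * d t)
  linarith

end IsBddOn

end Hexagon

namespace Hexagon

/-! ### The action functional and its minimizer -/

/-- Probability densities on `s` that are bounded by one. -/
structure IsDensityOn (s : Set ℝ) (σ : ℝ → ℝ) : Prop where
  meas : Measurable σ
  nonneg : ∀ u, 0 ≤ σ u
  le_one : ∀ u, σ u ≤ 1
  supp : ∀ u, u ∉ s → σ u = 0
  mass : ∫ u, σ u = 1

/-- The external potential. -/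
noncomputable def extPot (lam th x z : ℝ) : ℝ :=
  L₀ z + L₀ (x + 1 - z) + (L₀ (1 + th - z) + L₀ (lam - x + z))

/-- The action as a weighted logarithmic energy. -/
noncomputable def weightedEnergy (lam th x : ℝ) (σ : ℝ → ℝ) : ℝ :=
  (∫ u, extPot lam th x u * σ u) - logEnergy σ σ

theorem continuous_L₀ : Continuous L₀ := by
  unfold L₀
  exact Real.continuous_mul_log.sub continuous_id

theorem continuous_extPot (lam th x : ℝ) : Continuous (extPot lam th x) := by
  have := continuous_L₀
  unfold extPot
  fun_prop

namespace IsDensityOn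

variable {s s' : Set ℝ} {σ ρ : ℝ → ℝ} {R : ℝ}

theorem mono (h : IsDensityOn s σ) (hs : s ⊆ s') : IsDensityOn s' σ :=
  ⟨h.meas, h.nonneg, h.le_one, fun u hu => h.supp u fun h' => hu (hs h'), h.mass⟩

theorem isBddOn (h : IsDensityOn (Set.Icc (-R) R) σ) : IsBddOn R σ :=
  ⟨h.meas, fun u => abs_le.mpr ⟨by linarith [h.nonneg u], h.le_one u⟩, h.supp⟩

theorem isBddOn_sub (h : IsDensityOn (Set.Icc (-R) R) σ) (h' : IsDensityOn (Set.Icc (-R) R) ρ) :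
    IsBddOn R (fun u => σ u - ρ u) :=
  ⟨h.meas.sub h'.meas, fun u => abs_le.mpr ⟨by linarith [h.nonneg u, h'.le_one u],
    by linarith [h.le_one u, h'.nonneg u]⟩, fun u hu => by rw [h.supp u hu, h'.supp u hu, sub_zero]⟩

theorem integral_sub_eq_zero (h : IsDensityOn (Set.Icc (-R) R) σ)
    (h' : IsDensityOn (Set.Icc (-R) R) ρ) : ∫ u, (σ u - ρ u) = 0 := by
  rw [integral_sub h.isBddOn.integrable h'.isBddOn.integrable, h.mass, h'.mass, sub_self]

/-- Second order expansion of the energy. -/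
theorem weightedEnergy_sub (h : IsDensityOn (Set.Icc (-R) R) σ)
    (h' : IsDensityOn (Set.Icc (-R) R) ρ) (hR : 0 < R) (lam th x : ℝ) :
    weightedEnergy lam th x σ - weightedEnergy lam th x ρ =
      (∫ u, (extPot lam th x u - 2 * pot ρ u) * (σ u - ρ u)) -
      logEnergy (fun u => σ u - ρ u) (fun u => σ u - ρ u) := by
  have hd := h.isBddOn_sub h'
  have b := h.isBddOn
  have b' := h'.isBddOn
  have hV : Continuous (extPot lam th x) := continuous_extPot lam th x
  have hU := b'.continuous_pot hR
  have i1 := b.mul_integrable hV.integrableOn_Icc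
  have i2 := b'.mul_integrable hV.integrableOn_Icc
  have i3 := b.integrable_mul_pot b
  have i4 := b.integrable_mul_pot b'
  have i5 := b'.integrable_mul_pot b
  have i6 := b'.integrable_mul_pot b'
  have hcomm := IsBddOn.logEnergy_comm b b'
  rw [IsBddOn.logEnergy_eq, IsBddOn.logEnergy_eq] at hcomm
  have e1 : ∫ u, (extPot lam th x u - 2 * pot ρ u) * (σ u - ρ u) =
      (∫ u, extPot lam th x u * σ u) - (∫ u, extPot lam th x u * ρ u) -
        2 * ((∫ u, σ u * pot ρ u) - ∫ u, ρ u * pot ρ u) := by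
    rw [← integral_sub i1 i2, ← integral_sub i4 i6, ← integral_const_mul, ← integral_sub]
    · congr 1; ext u; ring
    · exact i1.sub i2
    · exact (i4.sub i6).const_mul 2
  have e2 : logEnergy (fun u => σ u - ρ u) (fun u => σ u - ρ u) =
      (∫ u, σ u * pot σ u) - (∫ u, σ u * pot ρ u) -
        ((∫ u, ρ u * pot σ u) - ∫ u, ρ u * pot ρ u) := by
    rw [IsBddOn.logEnergy_eq, ← integral_sub i3 i4, ← integral_sub i5 i6, ← integral_sub]
    · congr 1; ext u
      rw [IsBddOn.pot_sub b b']; ring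
    · exact i3.sub i4
    · exact i5.sub i6
  rw [e1, e2, weightedEnergy, weightedEnergy, IsBddOn.logEnergy_eq, IsBddOn.logEnergy_eq]
  linarith

end IsDensityOn

/-- The Euler-Lagrange conditions of the constrained variational problem. -/
structure IsEquilibrium (lam th x : ℝ) (ρ : ℝ → ℝ) (C : ℝ) : Prop extends
    IsDensityOn (Set.Icc (lo lam x) (hi th x)) ρ where
  le_of_lt_one : ∀ᵐ z, z ∈ Set.Icc (lo lam x) (hi th x) → ρ z < 1 →
    C ≤ extPot lam th x z - 2 * pot ρ z
  le_of_pos : ∀ᵐ z, z ∈ Set.Icc (lo lam x) (hi th x) → 0 < ρ z →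
    extPot lam th x z - 2 * pot ρ z ≤ C

/-- A radius of an interval that contains all the relevant densities. -/
noncomputable def bigRadius (lam th : ℝ) : ℝ := lam + th + 3

theorem Icc_lo_hi_subset {lam th x : ℝ} (hlam : 0 < lam) (hth : 0 < th) :
    Set.Icc (lo lam x) (hi th x) ⊆ Set.Icc (-bigRadius lam th) (bigRadius lam th) := by
  refine Set.Icc_subset_Icc ?_ ?_
  · have : 0 ≤ lo lam x := le_max_left _ _
    unfold bigRadius; linarith
  · have : min x th ≤ th := min_le_right _ _
    unfold bigRadius hi; linarith

/-- By Lebesgue differentiation, d is almost everywhere the derivative of its primitive. -/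
theorem ae_eq_zero_of_cdf {R : ℝ} {d : ℝ → ℝ} (hd : IsBddOn R d)
    (h : ∀ w, ∫ t in Set.Iic w, d t = 0) : d =ᵐ[volume] 0 := by
  have hloc : LocallyIntegrable d := hd.integrable.locallyIntegrable
  filter_upwards [LocallyIntegrable.ae_hasDerivAt_integral hloc] with x hx
  have h1 := hx 0
  have h2 : (fun x => ∫ t in (0 : ℝ)..x, d t) = fun _ => 0 := by
    ext y
    rw [← intervalIntegral.integral_Iic_sub_Iic hd.integrable.integrableOn
      hd.integrable.integrableOn, h, h, sub_zero]
  rw [h2] at h1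
  exact h1.unique (hasDerivAt_const x 0)

namespace IsEquilibrium

variable {lam th x C : ℝ} {ρ σ : ℝ → ℝ}

theorem isBddOn (hρ : IsEquilibrium lam th x ρ C) (hlam : 0 < lam) (hth : 0 < th) :
    IsBddOn (bigRadius lam th) ρ :=
  (hρ.toIsDensityOn.mono (Icc_lo_hi_subset hlam hth)).isBddOn

/-- First-order optimality, pointwise: where the effective potential is below C the density is
saturated at 1 and σ - ρ ≤ 0; where it is above C the density is 0 and σ - ρ ≥ 0. -/
theorem integral_nonneg_of_supp (hρ : IsEquilibrium lam th x ρ C)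
    (hσ : IsDensityOn (Set.Icc (lo lam x) (hi th x)) σ) :
    0 ≤ ∫ u, (extPot lam th x u - 2 * pot ρ u - C) * (σ u - ρ u) := by
  refine integral_nonneg_of_ae ?_
  filter_upwards [hρ.le_of_lt_one, hρ.le_of_pos] with u h1 h2
  by_cases hu : u ∈ Set.Icc (lo lam x) (hi th x)
  · have h1 := h1 hu
    have h2 := h2 hu
    rcases lt_trichotomy (extPot lam th x u - 2 * pot ρ u) C with h | h | h
    · have : ρ u = 1 := le_antisymm (hρ.le_one u) (not_lt.mp fun h' => absurd (h1 h') (not_le.mpr h))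
      rw [this]
      exact mul_nonneg_of_nonpos_of_nonpos (by linarith) (by linarith [hσ.le_one u])
    · simp [h]
    · have : ρ u = 0 := le_antisymm (not_lt.mp fun h' => absurd (h2 h') (not_le.mpr h)) (hρ.nonneg u)
      rw [this]
      exact mul_nonneg (by linarith) (by linarith [hσ.nonneg u])
  · rw [hσ.supp u hu, hρ.supp u hu]
    simp

/-- The constant C integrates to zero against the neutral charge σ - ρ. -/
theorem integral_sub_const (hρ : IsEquilibrium lam th x ρ C) (hlam : 0 < lam) (hth : 0 < th)
    (hσ : IsDensityOn (Set.Icc (-bigRadius lam th) (bigRadius lam th)) σ) :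
    ∫ u, (extPot lam th x u - 2 * pot ρ u) * (σ u - ρ u) =
      ∫ u, (extPot lam th x u - 2 * pot ρ u - C) * (σ u - ρ u) := by
  have hR : 0 < bigRadius lam th := by unfold bigRadius; linarith
  have hρ' := hρ.toIsDensityOn.mono (Icc_lo_hi_subset hlam hth)
  have hd := hσ.isBddOn_sub hρ'
  have hE : Continuous fun u => extPot lam th x u - 2 * pot ρ u :=
    (continuous_extPot lam th x).sub ((hρ'.isBddOn.continuous_pot hR).const_mul 2)
  simp_rw [sub_mul _ C]
  rw [integral_sub (hd.mul_integrable hE.integrableOn_Icc) (hd.integrable.const_mul C),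
    integral_const_mul, hσ.integral_sub_eq_zero hρ', mul_zero, sub_zero]

/-- The energy expansion around ρ has a nonnegative linear term and a quadratic term controlling the
distribution function. This gives both uniqueness of the minimizer and the large-deviation gap. -/
theorem weightedEnergy_le (hρ : IsEquilibrium lam th x ρ C) (hlam : 0 < lam) (hth : 0 < th)
    (hσ : IsDensityOn (Set.Icc (lo lam x) (hi th x)) σ) (w : ℝ) :
    |∫ t in Set.Iic w, (σ t - ρ t)| ^ 3 / (16 * bigRadius lam th) ≤
      weightedEnergy lam th x σ - weightedEnergy lam th x ρ := by
  have hR : 0 < bigRadius lam th := by unfold bigRadius; linarith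
  have hρ' := hρ.toIsDensityOn.mono (Icc_lo_hi_subset hlam hth)
  have hσ' := hσ.mono (Icc_lo_hi_subset hlam hth)
  rw [hσ'.weightedEnergy_sub hρ' hR, hρ.integral_sub_const hlam hth hσ']
  have h1 := hρ.integral_nonneg_of_supp hσ
  have h2 := (hσ'.isBddOn_sub hρ').abs_cdf_pow_le_energy hR (hσ'.integral_sub_eq_zero hρ') w
  linarith

end IsEquilibrium

/-! Reduction of the action to the weighted energy. -/

theorem cutAction_congr {ℓ : ℝ} {σ σ' : ℝ → ℝ} (h : σ =ᵐ[volume] σ') :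
    cutAction ℓ σ = cutAction ℓ σ' := by
  unfold cutAction
  congr 1
  · refine setIntegral_congr_ae measurableSet_Icc ?_
    filter_upwards [h] with u hu _
    rw [hu]
  · congr 1
    refine setIntegral_congr_ae measurableSet_Icc ?_
    filter_upwards [h] with u hu _
    refine setIntegral_congr_ae measurableSet_Icc ?_
    filter_upwards [h] with v hv _
    rw [hu, hv]

theorem action_congr {lam th x : ℝ} {σ σ' : ℝ → ℝ} (h : σ =ᵐ[volume] σ') :
    action lam th x σ = action lam th x σ' := by
  unfold action
  rw [cutAction_congr h, cutAction_congr (σ := fun μ => σ (1 + th - μ))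
    (σ' := fun μ => σ' (1 + th - μ))]
  exact (Measure.measurePreserving_sub_left volume (1 + th)).quasiMeasurePreserving.ae_eq_comp h

theorem isAdmissible_congr {lam th x : ℝ} {σ σ' : ℝ → ℝ} (h : σ =ᵐ[volume] σ')
    (hσ : IsAdmissible lam th x σ) : IsAdmissible lam th x σ' := by
  obtain ⟨h1, h2, h3, h4⟩ := hσ
  refine ⟨h1.congr h, ?_, ?_, by rw [← h4, integral_congr_ae h]⟩
  · filter_upwards [h, h2] with u hu hu2
    rwa [← hu]
  · filter_upwards [h, h3] with u hu hu2
    rwa [← hu]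

theorem IsDensityOn.isAdmissible {lam th x : ℝ} {σ : ℝ → ℝ}
    (h : IsDensityOn (Set.Icc (lo lam x) (hi th x)) σ) : IsAdmissible lam th x σ :=
  ⟨h.meas.aestronglyMeasurable, ae_of_all _ fun u => ⟨h.nonneg u, h.le_one u⟩,
    ae_of_all _ h.supp, h.mass⟩

/-- A measurable representative is clipped to [0, 1] and cut off outside I, so that the almost
everywhere constraints hold everywhere. -/
theorem IsAdmissible.exists_isDensityOn {lam th x : ℝ} {σ : ℝ → ℝ} (h : IsAdmissible lam th x σ) :
    ∃ σ', IsDensityOn (Set.Icc (lo lam x) (hi th x)) σ' ∧ σ =ᵐ[volume] σ' := by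
  obtain ⟨h1, h2, h3, h4⟩ := h
  let σ' : ℝ → ℝ := (Set.Icc (lo lam x) (hi th x)).indicator fun u => max 0 (min 1 (h1.mk σ u))
  have hm : Measurable (h1.mk σ) := h1.stronglyMeasurable_mk.measurable
  have hae : σ =ᵐ[volume] σ' := by
    filter_upwards [h1.ae_eq_mk, h2, h3] with u e1 e2 e3
    by_cases hu : u ∈ Set.Icc (lo lam x) (hi th x)
    · simp only [σ', Set.indicator_of_mem hu, ← e1, min_eq_right e2.2, max_eq_right e2.1]
    · simp only [σ', Set.indicator_of_notMem hu, e3 hu]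
  refine ⟨σ', ⟨?_, ?_, ?_, ?_, ?_⟩, hae⟩
  · exact Measurable.indicator (by fun_prop) measurableSet_Icc
  · exact fun u => Set.indicator_nonneg (fun _ _ => le_max_left _ _) u
  · intro u
    refine Set.indicator_le' (f := fun u => max 0 (min 1 (h1.mk σ u))) (g := fun _ => (1 : ℝ)) ?_ ?_ u
    · exact fun _ _ => max_le zero_le_one (min_le_left _ _)
    · exact fun _ _ => zero_le_one
  · exact fun u hu => Set.indicator_of_notMem hu _
  · rw [← integral_congr_ae hae, h4]

theorem cutAction_eq {ℓ : ℝ} {σ : ℝ → ℝ} (h : ∀ u, u ∉ Set.Icc 0 (ℓ + 1) → σ u = 0) :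
    cutAction ℓ σ = (∫ u, (L₀ u + L₀ (ℓ + 1 - u)) * σ u) - 1 / 2 * logEnergy σ σ := by
  unfold cutAction logEnergy
  congr 1
  · exact setIntegral_eq_integral_of_forall_compl_eq_zero fun u hu => by rw [h u hu, mul_zero]
  · congr 1
    have h1 : ∀ u, ∫ v in Set.Icc 0 (ℓ + 1), Real.log |u - v| * σ u * σ v =
        ∫ v, Real.log (u - v) * σ u * σ v := fun u => by
      simp_rw [Real.log_abs]
      exact setIntegral_eq_integral_of_forall_compl_eq_zero fun v hv => by rw [h v hv, mul_zero]
    simp_rw [h1]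
    exact setIntegral_eq_integral_of_forall_compl_eq_zero fun u hu => by simp [h u hu]

/-- The logarithmic energy is invariant under the reflection u ↦ 1 + θ - u, so the two halves 1/2
add up to one full energy; the reflected external term supplies the other two summands of `extPot`.
-/
theorem action_eq_weightedEnergy {lam th x : ℝ} (hlam : 0 < lam) (hth : 0 < th) {σ : ℝ → ℝ}
    (h : IsDensityOn (Set.Icc (lo lam x) (hi th x)) σ) :
    action lam th x σ = weightedEnergy lam th x σ := by
  have hb := (h.mono (Icc_lo_hi_subset hlam hth)).isBddOn
  have h1 : ∀ u, u ∉ Set.Icc 0 (x + 1) → σ u = 0 := fun u hu => h.supp u fun hu' => hu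
    ⟨(le_max_left _ _).trans hu'.1, hu'.2.trans (by
      have : min x th ≤ x := min_le_left _ _
      unfold hi; linarith)⟩
  have h2 : ∀ u, u ∉ Set.Icc 0 (lam + th - x + 1) → σ (1 + th - u) = 0 := fun u hu =>
    h.supp _ fun hu' => hu ⟨by
      have h3 : min x th ≤ th := min_le_right _ _
      have h4 := hu'.2
      unfold hi at h4
      linarith, by
      have h3 : x - lam ≤ lo lam x := le_max_right _ _
      have h4 := hu'.1
      linarith⟩
  have hc := continuous_L₀
  unfold action weightedEnergy
  rw [cutAction_eq h1, cutAction_eq h2]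
  have e1 : ∫ u, (L₀ u + L₀ (lam + th - x + 1 - u)) * σ (1 + th - u) =
      ∫ u, (L₀ (1 + th - u) + L₀ (lam - x + u)) * σ u := by
    rw [← integral_sub_left_eq_self (fun u => (L₀ (1 + th - u) + L₀ (lam - x + u)) * σ u) volume
      (1 + th)]
    congr 1; ext u
    congr 3 <;> ring
  have e2 : logEnergy (fun μ => σ (1 + th - μ)) (fun μ => σ (1 + th - μ)) = logEnergy σ σ := by
    unfold logEnergy
    rw [← integral_sub_left_eq_self (fun s => ∫ t, Real.log (s - t) * σ s * σ t) volume (1 + th)]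
    congr 1; ext s
    rw [← integral_sub_left_eq_self (fun t => Real.log (1 + th - s - t) * σ (1 + th - s) * σ t)
      volume (1 + th)]
    congr 1; ext t
    rw [← Real.log_neg_eq_log]
    congr 3; ring
  have e3 : ∫ u, extPot lam th x u * σ u = (∫ u, (L₀ u + L₀ (x + 1 - u)) * σ u) +
      ∫ u, (L₀ (1 + th - u) + L₀ (lam - x + u)) * σ u := by
    rw [← integral_add]
    · congr 1; ext u; unfold extPot; ring
    · exact hb.mul_integrable (Continuous.integrableOn_Icc (by fun_prop))
    · exact hb.mul_integrable (Continuous.integrableOn_Icc (by fun_prop))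
  rw [e1, e2, e3]
  ring

theorem IsEquilibrium.isActionMinimizer_iff {lam th x C : ℝ} {ρ : ℝ → ℝ}
    (hρ : IsEquilibrium lam th x ρ C) (hlam : 0 < lam) (hth : 0 < th) (σ : ℝ → ℝ) :
    IsActionMinimizer lam th x σ ↔ σ =ᵐ[volume] ρ := by
  have hR : 0 < bigRadius lam th := by unfold bigRadius; linarith
  have hmin : IsActionMinimizer lam th x ρ := by
    refine ⟨hρ.toIsDensityOn.isAdmissible, fun σ hσ => ?_⟩
    obtain ⟨σ', hσ', hae⟩ := hσ.exists_isDensityOn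
    rw [action_congr hae, action_eq_weightedEnergy hlam hth hσ',
      action_eq_weightedEnergy hlam hth hρ.toIsDensityOn, ← sub_nonneg]
    exact le_trans (by positivity) (hρ.weightedEnergy_le hlam hth hσ' 0)
  constructor
  · rintro ⟨hσ, hσ2⟩
    obtain ⟨σ', hσ', hae⟩ := hσ.exists_isDensityOn
    have h1 := hσ2 ρ hmin.1
    rw [action_congr hae, action_eq_weightedEnergy hlam hth hσ',
      action_eq_weightedEnergy hlam hth hρ.toIsDensityOn, ← sub_nonpos] at h1
    have hd := (hσ'.mono (Icc_lo_hi_subset hlam hth)).isBddOn_sub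
      (hρ.toIsDensityOn.mono (Icc_lo_hi_subset hlam hth))
    have h2 : ∀ w, ∫ t in Set.Iic w, (σ' t - ρ t) = 0 := fun w => by
      have h3 := (hρ.weightedEnergy_le hlam hth hσ' w).trans h1
      have h4 : |∫ t in Set.Iic w, (σ' t - ρ t)| ^ 3 ≤ 0 := by
        by_contra h5
        have : 0 < |∫ t in Set.Iic w, (σ' t - ρ t)| ^ 3 / (16 * bigRadius lam th) :=
          div_pos (not_le.mp h5) (by positivity)
        linarith
      have h5 := le_antisymm h4 (by positivity)
      exact abs_eq_zero.mp (pow_eq_zero_iff (by norm_num) |>.mp h5)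
    have h3 := ae_eq_zero_of_cdf hd h2
    refine hae.trans ?_
    filter_upwards [h3] with u hu
    exact sub_eq_zero.mp hu
  · intro h
    refine ⟨isAdmissible_congr h.symm hmin.1, fun τ hτ => ?_⟩
    rw [action_congr h]
    exact hmin.2 τ hτ

end Hexagon

namespace Hexagon

/-! ### From lattice configurations to densities -/

/-- The cell of the lattice point `a` in the lattice of mesh `1 / k`. -/
def cell (k a : ℕ) : Set ℝ := Set.Ico ((a : ℝ) / k) (((a : ℝ) + 1) / k)

theorem measurableSet_cell (k a : ℕ) : MeasurableSet (cell k a) := measurableSet_Ico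

theorem volume_real_cell {k : ℕ} (hk : 0 < k) (a : ℕ) : volume.real (cell k a) = 1 / k := by
  have : (0 : ℝ) < k := by exact_mod_cast hk
  rw [cell, Real.volume_real_Ico_of_le (by gcongr; linarith)]
  ring

theorem volume_cell_ne_top (k a : ℕ) : volume (cell k a) ≠ ⊤ := measure_Ico_lt_top.ne

theorem mem_cell_iff {k : ℕ} (hk : 0 < k) (a : ℕ) (s : ℝ) :
    s ∈ cell k a ↔ (a : ℝ) ≤ s * k ∧ s * k < a + 1 := by
  have : (0 : ℝ) < k := by exact_mod_cast hk
  rw [cell, Set.mem_Ico, div_le_iff₀ this, lt_div_iff₀ this]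

theorem cell_unique {k : ℕ} (hk : 0 < k) {a b : ℕ} {s : ℝ} (ha : s ∈ cell k a)
    (hb : s ∈ cell k b) : a = b := by
  rw [mem_cell_iff hk] at ha hb
  have h1 : a < b + 1 := by exact_mod_cast ha.1.trans_lt hb.2
  have h2 : b < a + 1 := by exact_mod_cast hb.1.trans_lt ha.2
  omega

theorem isBddOn_indicator_cell {k : ℕ} {R : ℝ} {a : ℕ} (hR : 0 ≤ R) (ha : ((a : ℝ) + 1) / k ≤ R) :
    IsBddOn R ((cell k a).indicator 1) := by
  refine ⟨measurable_one.indicator (measurableSet_cell k a), fun u => ?_, fun u hu => ?_⟩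
  · unfold Set.indicator; split_ifs <;> simp
  · refine Set.indicator_of_notMem (fun hu' => hu ⟨?_, hu'.2.le.trans ha⟩) _
    have : (0 : ℝ) ≤ (a : ℝ) / k := by positivity
    linarith [hu'.1]

theorem pot_indicator_cell (k a : ℕ) (s : ℝ) :
    pot ((cell k a).indicator 1) s = ∫ t in cell k a, Real.log (s - t) := by
  rw [pot, ← integral_indicator (measurableSet_cell k a)]
  congr 1; ext t
  unfold Set.indicator; split_ifs <;> simp

theorem abs_mean_cell_sub_le {k : ℕ} (hk : 0 < k) {a : ℕ} {g : ℝ → ℝ} {c e : ℝ}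
    (hg : IntegrableOn g (cell k a)) (h : ∀ t ∈ cell k a, |g t - c| ≤ e) :
    |k * (∫ t in cell k a, g t) - c| ≤ e := by
  have hk' : (0 : ℝ) < k := by exact_mod_cast hk
  have h1 := norm_setIntegral_le_of_norm_le_const (μ := volume) (s := cell k a)
    (f := fun t => g t - c) (C := e) measure_Ico_lt_top h
  rw [volume_real_cell hk, integral_sub hg (integrableOn_const (volume_cell_ne_top k a)),
    setIntegral_const, volume_real_cell hk, Real.norm_eq_abs] at h1
  have h2 : k * (∫ t in cell k a, g t) - c = k * ((∫ t in cell k a, g t) - (1 / (k : ℝ)) • c) := by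
    rw [smul_eq_mul, mul_sub]; field_simp
  rw [h2, abs_mul, abs_of_pos hk']
  calc (k : ℝ) * |(∫ t in cell k a, g t) - (1 / (k : ℝ)) • c| ≤ k * (e * (1 / k)) := by gcongr
    _ = e := by field_simp

theorem integrableOn_log_cell (k a : ℕ) (s : ℝ) :
    IntegrableOn (fun t => Real.log (s - t)) (cell k a) :=
  (integrableOn_log_sub s _ _).mono_set Set.Ico_subset_Icc_self

/-- Error bound for the interaction of two cells at distance `a`. -/
noncomputable def cellErr (k a : ℕ) : ℝ := if a ≤ 1 then 5 * (1 + Real.log k) else 2 / a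

/-- Moving both points within their unit cells changes the difference by at most 1, which is at most
half of |A - B|. The relative change is then at most 2/|A - B|. -/
theorem abs_log_sub_log_le_of_far {A B s t : ℝ} (hAB : 2 ≤ |A - B|) (hs : A ≤ s ∧ s < A + 1)
    (ht : B ≤ t ∧ t < B + 1) : |Real.log (s - t) - Real.log (A - B)| ≤ 2 / |A - B| := by
  have hst : |(s - t) - (A - B)| ≤ 1 := by rw [abs_le]; constructor <;> linarith [hs.1, hs.2, ht.1, ht.2]
  have h1 : |A - B| - 1 ≤ |s - t| := by
    have := abs_sub_abs_le_abs_sub (A - B) (s - t)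
    rw [abs_sub_comm (A - B) (s - t)] at this; linarith
  have h2 : |s - t| ≤ |A - B| + 1 := by
    have := abs_sub_abs_le_abs_sub (s - t) (A - B)
    linarith
  rw [← Real.log_abs (s - t), ← Real.log_abs (A - B)]
  set q := |A - B|
  set r := |s - t|
  have hr : 0 < r := by linarith
  have hq : 0 < q := by linarith
  rw [abs_le, ← Real.log_div hr.ne' hq.ne']
  constructor
  · have h3 := Real.one_sub_inv_le_log_of_pos (div_pos hr hq)
    refine le_trans ?_ h3
    rw [inv_div, neg_le_sub_iff_le_add, div_le_iff₀ hr, add_mul, one_mul, div_mul_eq_mul_div,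
      ← sub_le_iff_le_add', le_div_iff₀ hq]
    nlinarith
  · have h3 := Real.log_le_sub_one_of_pos (div_pos hr hq)
    refine h3.trans ?_
    rw [div_sub_one hq.ne']
    gcongr
    linarith

/-- For k ≥ 2 all differences have modulus at most 1, so the logarithm has constant sign and the
cell may be enlarged to the symmetric interval of radius 2/k around s. -/
theorem setIntegral_abs_log_le {k : ℕ} (hk : 2 ≤ k) (b : ℕ) (s : ℝ)
    (h : ∀ t ∈ cell k b, |s - t| ≤ 2 / k) :
    |∫ t in cell k b, Real.log (s - t)| ≤ 4 / k * (1 + Real.log k) := by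
  have hk' : (2 : ℝ) ≤ k := by exact_mod_cast hk
  have hk1 : (2 : ℝ) / k ≤ 1 := by rw [div_le_one (by linarith)]; exact hk'
  have hk0 : (0 : ℝ) ≤ 2 / k := by positivity
  have hi : IntegrableOn (fun t => Real.log (s - t)) (Set.Icc (s - 2 / k) (s + 2 / k)) :=
    integrableOn_log_sub s _ _
  have hsub : cell k b ⊆ Set.Icc (s - 2 / k) (s + 2 / k) := fun t ht => by
    have := abs_le.mp (h t ht)
    constructor <;> linarith [this.1, this.2]
  have hneg : ∀ t ∈ Set.Icc (s - 2 / k) (s + 2 / k), 0 ≤ -Real.log (s - t) := by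
    intro t ht
    rw [← Real.log_abs]
    have : |s - t| ≤ 1 := by rw [abs_le]; constructor <;> linarith [ht.1, ht.2]
    linarith [Real.log_nonpos (abs_nonneg _) this]
  rw [← abs_neg, ← integral_neg, abs_of_nonneg
    (setIntegral_nonneg (measurableSet_cell k b) fun t ht => hneg t (hsub ht))]
  calc ∫ t in cell k b, -Real.log (s - t)
      ≤ ∫ t in Set.Icc (s - 2 / k) (s + 2 / k), -Real.log (s - t) :=
        setIntegral_mono_set hi.neg (by
          filter_upwards [ae_restrict_mem measurableSet_Icc] with t ht using hneg t ht)
          hsub.eventuallyLE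
    _ = 4 / k * (1 - Real.log (2 / k)) := by
        rw [integral_Icc_eq_integral_Ioc, ← intervalIntegral.integral_of_le (by linarith),
          intervalIntegral.integral_neg,
          intervalIntegral.integral_comp_sub_left (fun u => Real.log u) s, integral_log]
        rw [sub_sub_cancel, sub_add_cancel_left, Real.log_neg_eq_log]
        ring
    _ ≤ 4 / k * (1 + Real.log k) := by
        rw [Real.log_div (by norm_num) (by linarith)]
        have := Real.log_nonneg (by norm_num : (1 : ℝ) ≤ 2)
        gcongr
        linarith

/-- For equal or adjacent cells both quantities are of order log k and are bounded separately (4 + 1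
= 5). For distant cells the logarithm barely varies, and the double mean is compared with its value
at the corners. -/
theorem abs_cell_interaction_le {k : ℕ} (hk : 2 ≤ k) (a b : ℕ) :
    |(k : ℝ) ^ 2 * (∫ s in cell k a, pot ((cell k b).indicator 1) s) -
      Real.log (((a : ℝ) - b) / k)| ≤ cellErr k (a - b + (b - a)) := by
  have hk0 : 0 < k := by omega
  have hk' : (2 : ℝ) ≤ k := by exact_mod_cast hk
  have hlogk : 0 ≤ Real.log k := Real.log_nonneg (by linarith)
  have hcont : Continuous (pot ((cell k b).indicator 1)) :=
    (isBddOn_indicator_cell (R := ((b : ℝ) + 1) / k) (by positivity) le_rfl).continuous_pot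
      (by positivity)
  have hI : IntegrableOn (fun s => k * pot ((cell k b).indicator 1) s) (cell k a) :=
    ((hcont.const_mul _).integrableOn_Icc (a := (a : ℝ) / k) (b := ((a : ℝ) + 1) / k)).mono_set
      Set.Ico_subset_Icc_self
  have hsq : (k : ℝ) ^ 2 * (∫ s in cell k a, pot ((cell k b).indicator 1) s) =
      k * ∫ s in cell k a, k * pot ((cell k b).indicator 1) s := by
    rw [integral_const_mul]; ring
  rw [hsq, cellErr]
  have hdist : ((a - b + (b - a) : ℕ) : ℝ) = |(a : ℝ) - b| := by
    rcases le_total a b with h | h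
    · rw [Nat.sub_eq_zero_of_le h, zero_add, Nat.cast_sub h, abs_sub_comm, abs_of_nonneg]
      exact sub_nonneg.mpr (by exact_mod_cast h)
    · rw [Nat.sub_eq_zero_of_le h, add_zero, Nat.cast_sub h, abs_of_nonneg]
      exact sub_nonneg.mpr (by exact_mod_cast h)
  split_ifs with hab
  · have h1 : |k * (∫ s in cell k a, k * pot ((cell k b).indicator 1) s) - 0| ≤
        4 * (1 + Real.log k) := by
      refine abs_mean_cell_sub_le hk0 hI fun s hs => ?_
      rw [sub_zero, pot_indicator_cell, abs_mul, abs_of_pos (by linarith)]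
      have h2 := setIntegral_abs_log_le hk b s fun t ht => by
        have h3 : |(a : ℝ) - b| ≤ 1 := by rw [← hdist]; exact_mod_cast hab
        rw [mem_cell_iff hk0] at hs ht
        rw [le_div_iff₀ (by linarith), ← abs_of_pos (by linarith : (0 : ℝ) < k), ← abs_mul,
          sub_mul]
        rw [abs_le] at h3 ⊢
        constructor <;> linarith [h3.1, h3.2, hs.1, hs.2, ht.1, ht.2]
      calc (k : ℝ) * |∫ t in cell k b, Real.log (s - t)| ≤ k * (4 / k * (1 + Real.log k)) := by
            gcongr
        _ = 4 * (1 + Real.log k) := by field_simp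
    have h4 : |Real.log (((a : ℝ) - b) / k)| ≤ Real.log k := by
      -- On the diagonal the discrete term is `Real.log 0 = 0`, so self-interactions cost nothing on
      -- the discrete side.
      rcases eq_or_ne a b with rfl | hne
      · simpa using hlogk
      · have h5 : |(a : ℝ) - b| = 1 := by
          rw [← hdist]
          have : a - b + (b - a) = 1 := by omega
          exact_mod_cast this
        rw [← Real.log_abs, abs_div, h5, abs_of_pos (by linarith : (0 : ℝ) < k), one_div,
          Real.log_inv, abs_neg, abs_of_nonneg hlogk]
    rw [sub_zero] at h1
    have := abs_sub (k * (∫ s in cell k a, k * pot ((cell k b).indicator 1) s))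
      (Real.log (((a : ℝ) - b) / k))
    linarith
  · refine abs_mean_cell_sub_le hk0 hI fun s hs => ?_
    rw [pot_indicator_cell]
    refine abs_mean_cell_sub_le hk0 (integrableOn_log_cell k b s) fun t ht => ?_
    rw [hdist]
    have h2 : 2 ≤ |(a : ℝ) - b| := by
      rw [← hdist]
      exact_mod_cast (by omega : 2 ≤ a - b + (b - a))
    rw [mem_cell_iff hk0] at hs ht
    have hab0 : (a : ℝ) - b ≠ 0 := fun h => by rw [h, abs_zero] at h2; linarith
    have h3 := abs_log_sub_log_le_of_far h2 hs ht
    have hne : s * k - t * k ≠ 0 := by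
      intro h0
      have h4 : |(a : ℝ) - b| < 2 := by
        rw [abs_lt]; constructor <;> linarith [hs.1, hs.2, ht.1, ht.2]
      linarith
    rw [← sub_mul] at h3 hne
    have hst : s - t ≠ 0 := left_ne_zero_of_mul hne
    rw [Real.log_mul hst (by linarith)] at h3
    rw [Real.log_div hab0 (by linarith)]
    convert h3 using 2
    ring

end Hexagon

/-! ### Discrete energies versus energies of densities -/

namespace Hexagon

theorem add_sub_le_of_strictMono {k : ℕ} {y : Fin k → ℕ} (hy : StrictMono y) {i j : Fin k}
    (hij : i ≤ j) : y i + ((j : ℕ) - i) ≤ y j := by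
  have key : ∀ d : ℕ, ∀ j : Fin k, (j : ℕ) = i + d → y i + d ≤ y j := by
    intro d
    induction d with
    | zero =>
      intro j hj
      have : j = i := Fin.ext (by simpa using hj)
      simp [this]
    | succ d ih =>
      intro j hj
      have h1 := ih ⟨i + d, by omega⟩ rfl
      have h2 : y ⟨i + d, by omega⟩ < y j := hy (by rw [Fin.lt_def]; simp; omega)
      omega
  exact key _ j (by have : (i : ℕ) ≤ j := hij; omega)

/-- Strictly increasing integers are at least as far apart as their indices, so the packed
configuration is the worst case for `cellErr`. -/
theorem natDist_le_of_strictMono {k : ℕ} {y : Fin k → ℕ} (hy : StrictMono y) (i j : Fin k) :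
    (i : ℕ) - j + (j - i) ≤ y i - y j + (y j - y i) := by
  rcases le_total i j with h | h
  · have := add_sub_le_of_strictMono hy h
    have h' : (i : ℕ) ≤ j := h
    omega
  · have := add_sub_le_of_strictMono hy h
    have h' : (j : ℕ) ≤ i := h
    omega

theorem cellErr_nonneg {k : ℕ} (hk : 1 ≤ k) (a : ℕ) : 0 ≤ cellErr k a := by
  have := Real.log_nonneg (by exact_mod_cast hk : (1 : ℝ) ≤ k)
  unfold cellErr
  split_ifs <;> positivity

theorem cellErr_anti {k : ℕ} (hk : 1 ≤ k) {a b : ℕ} (h : a ≤ b) : cellErr k b ≤ cellErr k a := by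
  have := Real.log_nonneg (by exact_mod_cast hk : (1 : ℝ) ≤ k)
  unfold cellErr
  split_ifs with h1 h2 h2
  · rfl
  · omega
  · have h3 : (2 : ℝ) ≤ b := by exact_mod_cast (by omega : 2 ≤ b)
    have h4 : 2 / (b : ℝ) ≤ 1 := by rw [div_le_one (by linarith)]; exact h3
    linarith
  · have h3 : (2 : ℝ) ≤ a := by exact_mod_cast (by omega : 2 ≤ a)
    gcongr

/-- The two distances 0 and 1 account for 10 (1 + log k), and the tail is twice a harmonic sum. -/
theorem sum_cellErr_range_le {k : ℕ} (hk : 1 ≤ k) :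
    ∑ a ∈ Finset.range k, cellErr k a ≤ 12 * (1 + Real.log k) := by
  have hlog := Real.log_nonneg (by exact_mod_cast hk : (1 : ℝ) ≤ k)
  have h1 : ∀ a ∈ Finset.range k, cellErr k a ≤
      (if a ≤ 1 then 5 * (1 + Real.log k) else 0) + 2 * (a : ℝ)⁻¹ := by
    intro a _
    unfold cellErr
    split_ifs
    · have : (0 : ℝ) ≤ (a : ℝ)⁻¹ := by positivity
      linarith
    · rw [zero_add, div_eq_mul_inv]
  have h2 : ∑ a ∈ Finset.range k, (if a ≤ 1 then 5 * (1 + Real.log k) else 0) ≤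
      10 * (1 + Real.log k) := by
    rw [← Finset.sum_filter, Finset.sum_const, nsmul_eq_mul]
    have h3 : ((Finset.range k).filter fun a => a ≤ 1) ⊆ Finset.range 2 := by
      intro a ha
      simp only [Finset.mem_filter, Finset.mem_range] at *
      omega
    have h4 := Finset.card_le_card h3
    rw [Finset.card_range] at h4
    have h5 : ((((Finset.range k).filter fun a => a ≤ 1).card : ℕ) : ℝ) ≤ 2 := by exact_mod_cast h4
    nlinarith
  have h3 : ∑ a ∈ Finset.range k, ((a : ℝ))⁻¹ ≤ 1 + Real.log k := by
    have h4 := harmonic_le_one_add_log k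
    rw [harmonic] at h4
    push_cast at h4
    refine le_trans ?_ h4
    calc ∑ a ∈ Finset.range k, ((a : ℝ))⁻¹ ≤ ∑ a ∈ Finset.range (k + 1), ((a : ℝ))⁻¹ :=
          Finset.sum_le_sum_of_subset_of_nonneg (Finset.range_mono (by omega))
            fun _ _ _ => by positivity
      _ = _ := by rw [Finset.sum_range_succ']; simp
  refine (Finset.sum_le_sum h1).trans ?_
  rw [Finset.sum_add_distrib, ← Finset.mul_sum]
  linarith

/-- Each distance from i is realized at most twice, once on either side. -/
theorem sum_natDist_le {k : ℕ} (f : ℕ → ℝ) (hf : ∀ a, 0 ≤ f a) (i : Fin k) :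
    ∑ j : Fin k, f ((i : ℕ) - j + (j - i)) ≤ 2 * ∑ a ∈ Finset.range k, f a := by
  have key : ∀ s : Finset (Fin k), Set.InjOn (fun j : Fin k => (i : ℕ) - j + (j - i)) s →
      ∑ j ∈ s, f ((i : ℕ) - j + (j - i)) ≤ ∑ a ∈ Finset.range k, f a := by
    intro s hs
    rw [← Finset.sum_image (f := f) hs]
    refine Finset.sum_le_sum_of_subset_of_nonneg ?_ fun _ _ _ => hf _
    intro a ha
    rw [Finset.mem_image] at ha
    obtain ⟨j, -, rfl⟩ := ha
    rw [Finset.mem_range]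
    omega
  rw [← Finset.sum_filter_add_sum_filter_not Finset.univ (fun j => j ≤ i), two_mul]
  refine add_le_add (key _ ?_) (key _ ?_)
  · intro a ha b hb hab
    simp only [Finset.coe_filter, Finset.mem_univ, true_and, Set.mem_ofPred_eq, Fin.le_def] at *
    ext; omega
  · intro a ha b hb hab
    simp only [Finset.coe_filter, Finset.mem_univ, true_and, Set.mem_ofPred_eq, Fin.le_def] at *
    ext; omega

/-- An error of order log k per point, hence k log k in total, is negligible against the scale k² of
the energy. -/
theorem sum_cellErr_le {k : ℕ} (hk : 1 ≤ k) {y : Fin k → ℕ} (hy : StrictMono y) (i : Fin k) :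
    ∑ j : Fin k, cellErr k (y i - y j + (y j - y i)) ≤ 24 * (1 + Real.log k) := by
  calc ∑ j : Fin k, cellErr k (y i - y j + (y j - y i))
      ≤ ∑ j : Fin k, cellErr k ((i : ℕ) - j + (j - i)) :=
        Finset.sum_le_sum fun j _ => cellErr_anti hk (natDist_le_of_strictMono hy i j)
    _ ≤ 2 * ∑ a ∈ Finset.range k, cellErr k a := sum_natDist_le _ (cellErr_nonneg hk) i
    _ ≤ 24 * (1 + Real.log k) := by linarith [sum_cellErr_range_le hk]

/-- The density of a configuration: each point is spread out over its cell. -/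
noncomputable def cellDensity {k : ℕ} (y : Fin k → ℕ) (s : ℝ) : ℝ :=
  ∑ i, (cell k (y i)).indicator 1 s

section CellDensity

variable {k : ℕ} {y : Fin k → ℕ}

theorem integral_mul_cellDensity {φ : ℝ → ℝ} (hφ : ∀ i, IntegrableOn φ (cell k (y i))) :
    ∫ s, φ s * cellDensity y s = ∑ i, ∫ s in cell k (y i), φ s := by
  have h1 : ∀ i s, φ s * (cell k (y i)).indicator 1 s = (cell k (y i)).indicator φ s := by
    intro i s; unfold Set.indicator; split_ifs <;> simp
  simp_rw [cellDensity, Finset.mul_sum, h1]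
  rw [integral_finsetSum _ fun i _ => (integrable_indicator_iff (measurableSet_cell _ _)).mpr (hφ i)]
  exact Finset.sum_congr rfl fun i _ => integral_indicator (measurableSet_cell _ _)

/-- Distinct lattice points have disjoint cells of length 1/k. This exclusion is the source of the
constraint that densities are at most one. -/
theorem isDensityOn_cellDensity (hk : 0 < k) (hy : StrictMono y) {A B : ℝ}
    (h : ∀ i, A * k ≤ y i ∧ (y i : ℝ) + 1 ≤ B * k) : IsDensityOn (Set.Icc A B) (cellDensity y) := by
  have hk' : (0 : ℝ) < k := by exact_mod_cast hk
  refine ⟨?_, ?_, ?_, ?_, ?_⟩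
  · exact Finset.measurable_sum _ fun i _ => measurable_one.indicator (measurableSet_cell _ _)
  · exact fun s => Finset.sum_nonneg fun i _ => Set.indicator_nonneg (fun _ _ => zero_le_one) _
  · intro s
    by_cases hs : ∃ i, s ∈ cell k (y i)
    · obtain ⟨i, hi⟩ := hs
      rw [cellDensity, Finset.sum_eq_single i]
      · rw [Set.indicator_of_mem hi]; rfl
      · intro j _ hj
        refine Set.indicator_of_notMem (fun hj' => hj ?_) _
        exact hy.injective (cell_unique hk hj' hi)
      · simp
    · push Not at hs
      rw [cellDensity, Finset.sum_eq_zero fun i _ => Set.indicator_of_notMem (hs i) _]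
      exact zero_le_one
  · intro s hs
    refine Finset.sum_eq_zero fun i _ => Set.indicator_of_notMem (fun hi => hs ?_) _
    rw [mem_cell_iff hk] at hi
    have := h i
    constructor
    · exact le_of_mul_le_mul_right (by linarith) hk'
    · exact le_of_mul_le_mul_right (by linarith) hk'
  · have := integral_mul_cellDensity (y := y) (φ := fun _ => 1) fun i =>
      integrableOn_const (volume_cell_ne_top _ _)
    simp only [one_mul, setIntegral_const, volume_real_cell hk] at this
    rw [this]
    simp [hk'.ne']

theorem pot_cellDensity (s : ℝ) :
    pot (cellDensity y) s = ∑ j, pot ((cell k (y j)).indicator 1) s := by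
  rw [pot, integral_mul_cellDensity fun i => integrableOn_log_cell _ _ _]
  exact Finset.sum_congr rfl fun i _ => (pot_indicator_cell _ _ _).symm

/-- The logarithmic energy of a configuration is that of its density. -/
theorem abs_logEnergy_cellDensity_sub_le (hk : 2 ≤ k) (hy : StrictMono y) :
    |(k : ℝ) ^ 2 * logEnergy (cellDensity y) (cellDensity y) -
      ∑ i, ∑ j, Real.log (((y i : ℝ) - y j) / k)| ≤ k * (24 * (1 + Real.log k)) := by
  have hk0 : (0 : ℝ) < k := by exact_mod_cast (by omega : 0 < k)
  have hc : ∀ j, Continuous (pot ((cell k (y j)).indicator 1)) := fun j =>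
    (isBddOn_indicator_cell (R := ((y j : ℝ) + 1) / k) (by positivity) le_rfl).continuous_pot
      (by positivity)
  have hi : ∀ i j, IntegrableOn (pot ((cell k (y j)).indicator 1)) (cell k (y i)) := fun i j =>
    ((hc j).integrableOn_Icc).mono_set Set.Ico_subset_Icc_self
  have h1 : logEnergy (cellDensity y) (cellDensity y) =
      ∑ i, ∑ j, ∫ s in cell k (y i), pot ((cell k (y j)).indicator 1) s := by
    rw [IsBddOn.logEnergy_eq]
    simp_rw [mul_comm (cellDensity y _), pot_cellDensity]
    rw [integral_mul_cellDensity]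
    · exact Finset.sum_congr rfl fun i _ => integral_finsetSum _ fun j _ => hi i j
    · exact fun i => integrable_finsetSum _ fun j _ => hi i j
  rw [h1, Finset.mul_sum, ← Finset.sum_sub_distrib]
  calc |∑ i, ((k : ℝ) ^ 2 * ∑ j, (∫ s in cell k (y i), pot ((cell k (y j)).indicator 1) s) -
        ∑ j, Real.log (((y i : ℝ) - y j) / k))|
      ≤ ∑ i : Fin k, 24 * (1 + Real.log k) := by
        refine (Finset.abs_sum_le_sum_abs _ _).trans (Finset.sum_le_sum fun i _ => ?_)
        rw [Finset.mul_sum, ← Finset.sum_sub_distrib]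
        refine (Finset.abs_sum_le_sum_abs _ _).trans ?_
        refine le_trans (Finset.sum_le_sum fun j _ => abs_cell_interaction_le hk (y i) (y j)) ?_
        exact sum_cellErr_le (by omega) hy i
    _ = _ := by simp

/-- The counting distribution function of a configuration is that of its density. -/
theorem abs_count_sub_cdf_le (hk : 0 < k) (hy : StrictMono y) (t : ℝ) :
    |(Set.ncard {i : Fin k | (y i : ℝ) ≤ t * k} : ℝ) / k - ∫ s in Set.Iic t, cellDensity y s| ≤
      1 / k := by
  classical
  have hk' : (0 : ℝ) < k := by exact_mod_cast hk
  have hv : ∀ i, ∫ s in Set.Iic t, (cell k (y i)).indicator (1 : ℝ → ℝ) s =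
      volume.real (cell k (y i) ∩ Set.Iic t) := fun i => by
    rw [integral_indicator_one (measurableSet_cell _ _), measureReal_restrict_apply
      (measurableSet_cell _ _)]
  have h1 : ∫ s in Set.Iic t, cellDensity y s = ∑ i, volume.real (cell k (y i) ∩ Set.Iic t) := by
    unfold cellDensity
    rw [integral_finsetSum]
    · exact Finset.sum_congr rfl fun i _ => hv i
    · intro i _
      exact ((integrable_indicator_iff (measurableSet_cell _ _)).mpr
        (integrableOn_const (volume_cell_ne_top _ _))).integrableOn
  have h2 : (Set.ncard {i : Fin k | (y i : ℝ) ≤ t * k} : ℝ) / k =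
      ∑ i, if (y i : ℝ) ≤ t * k then 1 / (k : ℝ) else 0 := by
    rw [← Finset.sum_filter, Finset.sum_const, nsmul_eq_mul, ← Set.ncard_coe_finset]
    simp [div_eq_mul_inv]
  have h3 : ∀ i, volume.real (cell k (y i) ∩ Set.Iic t) ≤ 1 / k := fun i => by
    rw [← volume_real_cell hk (y i)]
    exact measureReal_mono Set.inter_subset_left (volume_cell_ne_top _ _)
  have h4 : ∀ i, 0 ≤ (if (y i : ℝ) ≤ t * k then 1 / (k : ℝ) else 0) -
      volume.real (cell k (y i) ∩ Set.Iic t) := fun i => by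
    split_ifs with h
    · linarith [h3 i]
    · have : cell k (y i) ∩ Set.Iic t = ∅ := by
        ext s
        simp only [Set.mem_inter_iff, Set.mem_Iic, Set.mem_empty_iff_false, iff_false, not_and]
        intro hs hst
        rw [mem_cell_iff hk] at hs
        have : s * k ≤ t * k := by gcongr
        linarith [hs.1]
      simp [this]
  -- Only the point whose cell contains t is counted differently by the two distribution functions.
  have h5 : ∀ i, ((if (y i : ℝ) ≤ t * k then 1 / (k : ℝ) else 0) -
      volume.real (cell k (y i) ∩ Set.Iic t)) ≤
      if (y i : ℝ) ≤ t * k ∧ t * k < y i + 1 then 1 / (k : ℝ) else 0 := fun i => by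
    by_cases h : (y i : ℝ) ≤ t * k
    · by_cases h' : t * k < y i + 1
      · simp only [h, h', and_self, if_true]
        linarith [measureReal_nonneg (μ := volume) (s := cell k (y i) ∩ Set.Iic t)]
      · simp only [h, h', and_false, if_true, if_false]
        have : cell k (y i) ∩ Set.Iic t = cell k (y i) := by
          rw [Set.inter_eq_left]
          intro s hs
          rw [mem_cell_iff hk] at hs
          exact le_of_mul_le_mul_right (by linarith) hk'
        rw [this, volume_real_cell hk, sub_self]
    · simp only [h, false_and, if_false]
      linarith [measureReal_nonneg (μ := volume) (s := cell k (y i) ∩ Set.Iic t)]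
  rw [h1, h2, ← Finset.sum_sub_distrib, abs_of_nonneg (Finset.sum_nonneg fun i _ => h4 i)]
  refine (Finset.sum_le_sum fun i _ => h5 i).trans ?_
  rw [← Finset.sum_filter, Finset.sum_const, nsmul_eq_mul]
  have h6 : (Finset.univ.filter fun i => (y i : ℝ) ≤ t * k ∧ t * k < y i + 1).card ≤ 1 := by
    rw [Finset.card_le_one]
    intro i hi j hj
    simp only [Finset.mem_filter, Finset.mem_univ, true_and] at hi hj
    have e1 : y i < y j + 1 := by exact_mod_cast hi.1.trans_lt hj.2
    have e2 : y j < y i + 1 := by exact_mod_cast hj.1.trans_lt hi.2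
    exact hy.injective (by omega)
  have h7 : (((Finset.univ.filter fun i => (y i : ℝ) ≤ t * k ∧ t * k < y i + 1).card : ℕ) : ℝ) ≤ 1 := by
    exact_mod_cast h6
  exact mul_le_of_le_one_left (by positivity) h7

end CellDensity

end Hexagon

namespace Hexagon

/-! ### Asymptotics of the weights -/

/-- Stirling's formula to logarithmic precision. The induction compares increments by means of (j+1)
(log (j+2) - log (j+1)) ≤ 1 ≤ (j+2) (log (j+2) - log (j+1)); it is run at j + 1 to keep the
arguments positive. -/
theorem abs_log_factorial_sub_le (j : ℕ) :
    |Real.log (j.factorial : ℝ) - L₀ j| ≤ 1 + Real.log (j + 1) := by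
  have key : ∀ j : ℕ, L₀ ((j : ℝ) + 1) ≤ Real.log ((j + 1).factorial : ℝ) ∧
      Real.log ((j + 1).factorial : ℝ) ≤ L₀ ((j : ℝ) + 1) + 1 + Real.log (j + 1) := by
    intro j
    induction j with
    | zero => simp [L₀]
    | succ j ih =>
      have hj : (0 : ℝ) < (j : ℝ) + 1 := by positivity
      have hj2 : (0 : ℝ) < (j : ℝ) + 2 := by positivity
      have e : ((j + 1 + 1).factorial : ℝ) = ((j : ℝ) + 2) * ((j + 1).factorial : ℝ) := by
        rw [Nat.factorial_succ]; push_cast; ring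
      have hl1 := Real.one_sub_inv_le_log_of_pos (div_pos hj2 hj)
      have hl2 := Real.log_le_sub_one_of_pos (div_pos hj2 hj)
      rw [Real.log_div hj2.ne' hj.ne', inv_div] at hl1
      rw [Real.log_div hj2.ne' hj.ne'] at hl2
      have h1 : 1 ≤ ((j : ℝ) + 2) * (Real.log (j + 2) - Real.log (j + 1)) := by
        have : ((j : ℝ) + 2) * (1 - (j + 1) / (j + 2)) = 1 := by field_simp; ring
        calc 1 = _ := this.symm
          _ ≤ _ := mul_le_mul_of_nonneg_left hl1 hj2.le
      have h2 : ((j : ℝ) + 1) * (Real.log (j + 2) - Real.log (j + 1)) ≤ 1 := by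
        have : ((j : ℝ) + 1) * ((j + 2) / (j + 1) - 1) = 1 := by field_simp; ring
        calc _ ≤ ((j : ℝ) + 1) * ((j + 2) / (j + 1) - 1) := mul_le_mul_of_nonneg_left hl2 hj.le
          _ = 1 := this
      rw [e, Real.log_mul hj2.ne' (by positivity)]
      push_cast
      rw [show (j : ℝ) + 1 + 1 = j + 2 by ring]
      unfold L₀ at *
      constructor <;> nlinarith [ih.1, ih.2]
  cases j with
  | zero => simp [L₀]
  | succ j =>
    have h := key j
    have h2 : Real.log ((j : ℝ) + 1) ≤ Real.log ((j : ℝ) + 1 + 1) :=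
      Real.log_le_log (by positivity) (by linarith)
    push_cast
    rw [abs_of_nonneg (by linarith [h.1])]
    linarith [h.2]

theorem L₀_scale {k : ℝ} (hk : 0 < k) {a : ℝ} (ha : 0 ≤ a) :
    L₀ a = k * L₀ (a / k) + a * Real.log k := by
  rcases ha.eq_or_lt with rfl | ha
  · simp [L₀]
  · unfold L₀
    rw [Real.log_div ha.ne' hk.ne']
    field_simp
    ring

theorem log_choose {T q : ℕ} (h : q ≤ T) : Real.log (T.choose q : ℝ) =
    Real.log (T.factorial : ℝ) - (Real.log (q.factorial : ℝ) + Real.log ((T - q).factorial : ℝ)) := by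
  rw [← Nat.choose_mul_factorial_mul_factorial h]
  have : (T.choose q : ℝ) ≠ 0 := by exact_mod_cast (Nat.choose_pos h).ne'
  push_cast
  rw [Real.log_mul (by positivity) (by positivity), Real.log_mul (by positivity) (by positivity)]
  ring

section

variable {k : ℕ} {y : Fin k → ℕ}

/-- The configurations of positive weight on the cut at distance `m`. -/
structure IsConfig (n p m : ℕ) (y : Fin k → ℕ) : Prop where
  mono : StrictMono y
  lt_left : ∀ i, y i + 1 ≤ m + k
  lt_right : ∀ i, y i + 1 ≤ p + k
  le_add : ∀ i, m ≤ n + y i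

/-- The square turns the product over i < j into a sum over ordered pairs. The diagonal may be
included because `Real.log 0 = 0`. -/
theorem log_vand_sq (hy : StrictMono y) :
    Real.log (vand y ^ 2) = ∑ i, ∑ j, Real.log ((y i : ℝ) - y j) := by
  have hne : ∀ i, ∀ j ∈ Finset.Ioi i, (y j : ℝ) - y i ≠ 0 := fun i j hj => by
    rw [sub_ne_zero]
    exact_mod_cast (hy (Finset.mem_Ioi.mp hj)).ne'
  rw [Real.log_pow, vand_eq_prod, Real.log_prod fun i _ => Finset.prod_ne_zero_iff.mpr (hne i)]
  have h1 : ∑ i, Real.log (∏ j ∈ Finset.Ioi i, ((y j : ℝ) - y i)) =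
      ∑ i, ∑ j ∈ Finset.Ioi i, Real.log ((y j : ℝ) - y i) :=
    Finset.sum_congr rfl fun i _ => Real.log_prod (hne i)
  have h2 := Finset.sum_sum_Ioi_add_eq_sum_sum_off_diag
    (fun i j : Fin k => Real.log ((y i : ℝ) - y j))
  have h3 : ∀ i : Fin k, ∑ j ∈ Finset.Ioi i, (Real.log ((y j : ℝ) - y i) +
      Real.log ((y i : ℝ) - y j)) = 2 * ∑ j ∈ Finset.Ioi i, Real.log ((y j : ℝ) - y i) := by
    intro i
    rw [Finset.mul_sum]
    refine Finset.sum_congr rfl fun j _ => ?_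
    rw [← Real.log_neg_eq_log ((y i : ℝ) - y j), neg_sub]
    ring
  have h4 : ∀ i : Fin k, ∑ j ∈ ({i}ᶜ : Finset (Fin k)), Real.log ((y j : ℝ) - y i) =
      ∑ j, Real.log ((y i : ℝ) - y j) := by
    intro i
    rw [← Finset.sum_compl_add_sum ({i} : Finset (Fin k))]
    simp only [Finset.sum_singleton, sub_self, Real.log_zero, add_zero]
    refine Finset.sum_congr rfl fun j _ => ?_
    rw [← Real.log_neg_eq_log, neg_sub]
  rw [h1]
  simp_rw [h3, h4] at h2
  rw [← h2, Finset.mul_sum]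
  simp

theorem sum_log_div (hy : StrictMono y) (hk : 0 < k) :
    ∑ i, ∑ j, Real.log (((y i : ℝ) - y j) / k) =
      (∑ i, ∑ j, Real.log ((y i : ℝ) - y j)) -
        ∑ i : Fin k, ∑ j : Fin k, if i = j then 0 else Real.log k := by
  have hk' : (k : ℝ) ≠ 0 := by exact_mod_cast hk.ne'
  simp_rw [← Finset.sum_sub_distrib]
  refine Finset.sum_congr rfl fun i _ => Finset.sum_congr rfl fun j _ => ?_
  split_ifs with h
  · simp [h]
  · refine Real.log_div ?_ hk'
    rw [sub_ne_zero]
    exact fun h' => h (hy.injective (by exact_mod_cast h'))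

/-- Only the four lower factorials depend on the configuration; the upper ones go into the
normalizing constant. -/
theorem IsConfig.log_weight {n p m : ℕ} (hm : m ≤ n + p) (hy : IsConfig n p m y) :
    0 < weight n p m y ∧ Real.log (weight n p m y) = (∑ i, ∑ j, Real.log ((y i : ℝ) - y j)) +
      ∑ i, ((Real.log ((m + k - 1).factorial : ℝ) + Real.log ((n + p - m + k - 1).factorial : ℝ)) -
        (Real.log ((y i).factorial : ℝ) + Real.log ((m + k - 1 - y i).factorial : ℝ) +
        (Real.log ((p + k - 1 - y i).factorial : ℝ) + Real.log ((n + y i - m).factorial : ℝ)))) := by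
  have h1 : ∀ i, y i ≤ m + k - 1 := fun i => by have := hy.lt_left i; omega
  have h2 : ∀ i, p + k - 1 - y i ≤ n + p - m + k - 1 := fun i => by
    have := hy.le_add i; have := hy.lt_right i; omega
  have hpos : ∀ i, 0 < (((m + k - 1).choose (y i) : ℝ) *
    ((n + p - m + k - 1).choose (p + k - 1 - y i) : ℝ)) := fun i =>
    mul_pos (by exact_mod_cast Nat.choose_pos (h1 i)) (by exact_mod_cast Nat.choose_pos (h2 i))
  have hv := vand_pos hy.mono
  refine ⟨mul_pos (by positivity) (Finset.prod_pos fun i _ => hpos i), ?_⟩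
  rw [weight, Real.log_mul (by positivity) (Finset.prod_ne_zero_iff.mpr fun i _ => (hpos i).ne'),
    log_vand_sq hy.mono, Real.log_prod fun i _ => (hpos i).ne']
  congr 1
  refine Finset.sum_congr rfl fun i _ => ?_
  rw [Real.log_mul (left_ne_zero_of_mul (hpos i).ne') (right_ne_zero_of_mul (hpos i).ne'),
    log_choose (h1 i), log_choose (h2 i)]
  have : n + p - m + k - 1 - (p + k - 1 - y i) = n + y i - m := by
    have := hy.le_add i; have := hy.lt_right i; have := hy.lt_left i; omega
  rw [this]
  ring

/-- Each of the four arguments of `L₀` moves by at most δ, so `hmod`, a modulus of continuity of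
`L₀`, is applied four times. Continuity rather than smoothness is needed, since the arguments may
reach 0, where log is singular. -/
theorem abs_extPot_sub_le {lam th x δ η R N P M Y e s : ℝ}
    (hpar : |N - lam| + |P - th| + |M - x| + e ≤ δ) (hδ : δ ≤ 1) (hlam : 0 < lam) (hth : 0 < th)
    (hR : lam + th + |x| + 5 ≤ R)
    (hmod : ∀ u v : ℝ, |u| ≤ R → |v| ≤ R → |u - v| ≤ δ → |L₀ u - L₀ v| ≤ η)
    (hY : 0 ≤ Y) (he : 0 ≤ e) (h1 : Y + e ≤ M + 1)
    (hs1 : Y ≤ s) (hs2 : s ≤ Y + e) :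
    |extPot lam th x s - (L₀ Y + L₀ (M + 1 - e - Y) + (L₀ (P + 1 - e - Y) + L₀ (N + Y - M)))| ≤
      4 * η := by
  have a1 := abs_nonneg (N - lam)
  have a2 := abs_nonneg (P - th)
  have a3 := abs_nonneg (M - x)
  have a4 := neg_abs_le x
  have a5 := le_abs_self x
  have b1 := neg_abs_le (N - lam)
  have b2 := neg_abs_le (P - th)
  have b3 := neg_abs_le (M - x)
  have c1 := le_abs_self (N - lam)
  have c2 := le_abs_self (P - th)
  have c3 := le_abs_self (M - x)
  have m1 := hmod s Y (abs_le.mpr ⟨by linarith, by linarith⟩)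
    (abs_le.mpr ⟨by linarith, by linarith⟩) (abs_le.mpr ⟨by linarith, by linarith⟩)
  have m2 := hmod (x + 1 - s) (M + 1 - e - Y) (abs_le.mpr ⟨by linarith, by linarith⟩)
    (abs_le.mpr ⟨by linarith, by linarith⟩) (abs_le.mpr ⟨by linarith, by linarith⟩)
  have m3 := hmod (1 + th - s) (P + 1 - e - Y) (abs_le.mpr ⟨by linarith, by linarith⟩)
    (abs_le.mpr ⟨by linarith, by linarith⟩) (abs_le.mpr ⟨by linarith, by linarith⟩)
  have m4 := hmod (lam - x + s) (N + Y - M) (abs_le.mpr ⟨by linarith, by linarith⟩)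
    (abs_le.mpr ⟨by linarith, by linarith⟩) (abs_le.mpr ⟨by linarith, by linarith⟩)
  unfold extPot
  rw [abs_le] at m1 m2 m3 m4 ⊢
  constructor <;> linarith [m1.1, m1.2, m2.1, m2.2, m3.1, m3.2, m4.1, m4.2]

/-- Stirling's formula for the four factorials at one point, rescaled by k. Their arguments add up
to n + p + 2k - 2 whatever y i is, so the terms in log k form a constant. -/
theorem IsConfig.abs_point_sub_le {n p m : ℕ} (hk : 2 ≤ k) {lam th x δ η R : ℝ}
    (hpar : |(n : ℝ) / k - lam| + |(p : ℝ) / k - th| + |(m : ℝ) / k - x| + 1 / k ≤ δ) (hδ : δ ≤ 1)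
    (hlam : 0 < lam) (hth : 0 < th) (hR : lam + th + |x| + 5 ≤ R)
    (hmod : ∀ u v : ℝ, |u| ≤ R → |v| ≤ R → |u - v| ≤ δ → |L₀ u - L₀ v| ≤ η)
    (hy : IsConfig n p m y) (i : Fin k) :
    |(Real.log ((y i).factorial : ℝ) + Real.log ((m + k - 1 - y i).factorial : ℝ) +
        (Real.log ((p + k - 1 - y i).factorial : ℝ) + Real.log ((n + y i - m).factorial : ℝ))) -
        ((n : ℝ) + p + 2 * k - 2) * Real.log k -
        (k : ℝ) ^ 2 * ∫ s in cell k (y i), extPot lam th x s| ≤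
        4 * (1 + Real.log (n + p + 2 * k)) + 4 * η * k := by
  have hk0 : (0 : ℝ) < k := by exact_mod_cast (by omega : 0 < k)
  have cV := continuous_extPot lam th x
  have b1 := hy.lt_left i
  have b2 := hy.lt_right i
  have b3 := hy.le_add i
  have c1 : ((m + k - 1 - y i : ℕ) : ℝ) = m + k - 1 - y i := by
    rw [Nat.cast_sub (by omega), Nat.cast_sub (by omega)]; push_cast; ring
  have c2 : ((p + k - 1 - y i : ℕ) : ℝ) = p + k - 1 - y i := by
    rw [Nat.cast_sub (by omega), Nat.cast_sub (by omega)]; push_cast; ring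
  have c3 : ((n + y i - m : ℕ) : ℝ) = n + y i - m := by
    rw [Nat.cast_sub (by omega)]; push_cast; ring
  have d1 : (y i : ℝ) + 1 ≤ m + k := by exact_mod_cast b1
  have d2 : (y i : ℝ) + 1 ≤ p + k := by exact_mod_cast b2
  have d3 : (m : ℝ) ≤ n + y i := by exact_mod_cast b3
  have d4 : (0 : ℝ) ≤ y i := by positivity
  have hf : ∀ a : ℕ, (a : ℝ) + 1 ≤ n + p + 2 * k →
      |Real.log (a.factorial : ℝ) - (k * L₀ (a / k) + a * Real.log k)| ≤
        1 + Real.log (n + p + 2 * k) := by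
    intro a ha
    rw [← L₀_scale hk0 (Nat.cast_nonneg a)]
    refine (abs_log_factorial_sub_le a).trans ?_
    have := Real.log_le_log (by positivity) ha
    linarith
  have k2 : (2 : ℝ) ≤ k := by exact_mod_cast hk
  have f1 := hf (y i) (by have : (0 : ℝ) ≤ n := by positivity
                          linarith)
  have f2 := hf (m + k - 1 - y i) (by rw [c1]; linarith)
  have f3 := hf (p + k - 1 - y i) (by rw [c2]; have : (0 : ℝ) ≤ n := by positivity
                                      linarith)
  have f4 := hf (n + y i - m) (by rw [c3]; linarith)
  rw [c1] at f2
  rw [c2] at f3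
  rw [c3] at f4
  have hint : IntegrableOn (extPot lam th x) (cell k (y i)) :=
    (cV.integrableOn_Icc).mono_set Set.Ico_subset_Icc_self
  have hdiv : ∀ a : ℝ, (a + k - 1 - y i) / k = a / k + 1 - 1 / k - y i / k := fun a => by
    field_simp
  have hdiv' : ((n : ℝ) + y i - m) / k = n / k + y i / k - m / k := by field_simp
  have hle : (y i : ℝ) / k + 1 / k ≤ (m : ℝ) / k + 1 := by
    have := (div_le_div_iff_of_pos_right hk0).mpr d1
    rwa [add_div, add_div, div_self hk0.ne'] at this
  have f5 := abs_mean_cell_sub_le (k := k) (by omega) (a := y i) (g := extPot lam th x)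
    (c := L₀ ((y i : ℝ) / k) + L₀ (((m : ℝ) + k - 1 - y i) / k) +
      (L₀ (((p : ℝ) + k - 1 - y i) / k) + L₀ (((n : ℝ) + y i - m) / k))) (e := 4 * η) hint
    fun s hs => by
      rw [cell, Set.mem_Ico, add_div] at hs
      rw [hdiv, hdiv, hdiv']
      exact abs_extPot_sub_le hpar hδ hlam hth hR hmod (by positivity) (by positivity)
        hle hs.1 hs.2.le
  have g1 : (k : ℝ) ^ 2 * ∫ s in cell k (y i), extPot lam th x s =
    k * (k * ∫ s in cell k (y i), extPot lam th x s) := by ring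
  rw [g1]
  rw [abs_le] at f1 f2 f3 f4 f5 ⊢
  have g2 := mul_le_mul_of_nonneg_left f5.1 hk0.le
  have g3 := mul_le_mul_of_nonneg_left f5.2 hk0.le
  constructor <;> linarith [f1.1, f1.2, f2.1, f2.2, f3.1, f3.2, f4.1, f4.2]

/-- The constant c is common to all configurations; only differences of energies matter when two
weights are compared. -/
theorem abs_log_weight_sub_le {n p m : ℕ} (hk : 2 ≤ k) (hm : m ≤ n + p) {lam th x δ η R : ℝ}
    (hpar : |(n : ℝ) / k - lam| + |(p : ℝ) / k - th| + |(m : ℝ) / k - x| + 1 / k ≤ δ) (hδ : δ ≤ 1)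
    (hlam : 0 < lam) (hth : 0 < th) (hR : lam + th + |x| + 5 ≤ R)
    (hmod : ∀ u v : ℝ, |u| ≤ R → |v| ≤ R → |u - v| ≤ δ → |L₀ u - L₀ v| ≤ η) :
    ∃ c : ℝ, ∀ y : Fin k → ℕ, IsConfig n p m y →
      |Real.log (weight n p m y) - (c - k ^ 2 * weightedEnergy lam th x (cellDensity y))| ≤
        k * (24 * (1 + Real.log k)) + k * (4 * (1 + Real.log (n + p + 2 * k))) + 4 * η * k ^ 2 := by
  have hk0 : (0 : ℝ) < k := by exact_mod_cast (by omega : 0 < k)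
  refine ⟨(∑ i : Fin k, ∑ j : Fin k, if i = j then 0 else Real.log k) +
    ∑ i : Fin k, ((Real.log ((m + k - 1).factorial : ℝ) +
      Real.log ((n + p - m + k - 1).factorial : ℝ)) -
      ((n : ℝ) + p + 2 * k - 2) * Real.log k), fun y hy => ?_⟩
  have e0 := (hy.log_weight hm).2
  have e1 := sum_log_div hy.mono (by omega)
  have e2 := abs_logEnergy_cellDensity_sub_le hk hy.mono
  have cV := continuous_extPot lam th x
  have e3 : ∫ s, extPot lam th x s * cellDensity y s =
      ∑ i, ∫ s in cell k (y i), extPot lam th x s :=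
    integral_mul_cellDensity fun i => (cV.integrableOn_Icc).mono_set Set.Ico_subset_Icc_self
  have e4 := hy.abs_point_sub_le hk hpar hδ hlam hth hR hmod
  have e5 : |∑ i, ((Real.log ((y i).factorial : ℝ) + Real.log ((m + k - 1 - y i).factorial : ℝ) +
        (Real.log ((p + k - 1 - y i).factorial : ℝ) + Real.log ((n + y i - m).factorial : ℝ))) -
        ((n : ℝ) + p + 2 * k - 2) * Real.log k -
        (k : ℝ) ^ 2 * ∫ s in cell k (y i), extPot lam th x s)| ≤
        k * (4 * (1 + Real.log (n + p + 2 * k)) + 4 * η * k) := by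
    refine (Finset.abs_sum_le_sum_abs _ _).trans ((Finset.sum_le_sum fun i _ => e4 i).trans ?_)
    simp [mul_add]
  rw [weightedEnergy, e3, e0]
  rw [Finset.sum_sub_distrib, Finset.sum_sub_distrib, ← Finset.mul_sum _ _ ((k : ℝ) ^ 2)] at e5
  rw [Finset.sum_sub_distrib, Finset.sum_sub_distrib]
  rw [abs_le] at e2 e5 ⊢
  constructor <;> linarith [e2.1, e2.2, e5.1, e5.2]

end

end Hexagon

namespace Hexagon

/-! ### Stability of the variational problem -/

/-- The configurations of a finite hexagon live on an interval that may exceed I by e on either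
side, where the Euler-Lagrange conditions say nothing. As a density is at most one, the excess costs
at most a bound of the effective potential times 2e. -/
theorem IsEquilibrium.exists_energy_ge {lam th x C : ℝ} {ρ : ℝ → ℝ}
    (hρ : IsEquilibrium lam th x ρ C) (hlam : 0 < lam) (hth : 0 < th) :
    ∃ B, 0 < B ∧ ∀ e, 0 ≤ e → e ≤ 1 → ∀ σ,
      IsDensityOn (Set.Icc (lo lam x - e) (hi th x + e)) σ → ∀ w,
      |∫ t in Set.Iic w, (σ t - ρ t)| ^ 3 / (16 * bigRadius lam th) - 2 * B * e ≤
        weightedEnergy lam th x σ - weightedEnergy lam th x ρ := by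
  have hR : 0 < bigRadius lam th := by unfold bigRadius; linarith
  have hρ' := hρ.toIsDensityOn.mono (Icc_lo_hi_subset hlam hth)
  have hE : Continuous fun u => extPot lam th x u - 2 * pot ρ u - C :=
    ((continuous_extPot lam th x).sub ((hρ'.isBddOn.continuous_pot hR).const_mul 2)).sub
      continuous_const
  obtain ⟨B, hB⟩ := (isCompact_Icc (a := -bigRadius lam th)
    (b := bigRadius lam th)).exists_bound_of_continuousOn hE.continuousOn
  refine ⟨|B| + 1, by positivity, fun e he he1 σ hσ w => ?_⟩
  have hsub : Set.Icc (lo lam x - e) (hi th x + e) ⊆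
      Set.Icc (-bigRadius lam th) (bigRadius lam th) := by
    refine Set.Icc_subset_Icc ?_ ?_
    · have : 0 ≤ lo lam x := le_max_left _ _
      unfold bigRadius; linarith
    · have : min x th ≤ th := min_le_right _ _
      unfold bigRadius hi; linarith
  have hσ' := hσ.mono hsub
  rw [hσ'.weightedEnergy_sub hρ' hR, hρ.integral_sub_const hlam hth hσ']
  have h2 := (hσ'.isBddOn_sub hρ').abs_cdf_pow_le_energy hR (hσ'.integral_sub_eq_zero hρ') w
  have hi1 : Integrable ((Set.Icc (lo lam x - e) (lo lam x)).indicator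
      fun _ => -(|B| + 1)) := (integrable_indicator_iff measurableSet_Icc).mpr (by simp)
  have hi2 : Integrable ((Set.Icc (hi th x) (hi th x + e)).indicator
      fun _ => -(|B| + 1)) := (integrable_indicator_iff measurableSet_Icc).mpr (by simp)
  have h1 : ∫ u, ((Set.Icc (lo lam x - e) (lo lam x)).indicator (fun _ => -(|B| + 1)) u +
      (Set.Icc (hi th x) (hi th x + e)).indicator (fun _ => -(|B| + 1)) u) ≤
      ∫ u, (extPot lam th x u - 2 * pot ρ u - C) * (σ u - ρ u) := by
    refine integral_mono_ae (hi1.add hi2)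
      ((hσ'.isBddOn_sub hρ').mul_integrable hE.integrableOn_Icc) ?_
    filter_upwards [hρ.le_of_lt_one, hρ.le_of_pos] with u h1 h2
    have hneg : ∀ s : Set ℝ, s.indicator (fun _ => -(|B| + 1)) u ≤ 0 := fun s =>
      Set.indicator_nonpos (fun _ _ => by linarith [abs_nonneg B]) u
    by_cases hu : u ∈ Set.Icc (lo lam x) (hi th x)
    · have h1 := h1 hu
      have h2 := h2 hu
      refine (add_nonpos (hneg _) (hneg _)).trans ?_
      rcases lt_trichotomy (extPot lam th x u - 2 * pot ρ u) C with h | h | h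
      · have : ρ u = 1 :=
          le_antisymm (hρ.le_one u) (not_lt.mp fun h' => absurd (h1 h') (not_le.mpr h))
        rw [this]
        exact mul_nonneg_of_nonpos_of_nonpos (by linarith) (by linarith [hσ.le_one u])
      · simp [h]
      · have : ρ u = 0 :=
          le_antisymm (not_lt.mp fun h' => absurd (h2 h') (not_le.mpr h)) (hρ.nonneg u)
        rw [this]
        exact mul_nonneg (by linarith) (by linarith [hσ.nonneg u])
    · by_cases hu' : u ∈ Set.Icc (lo lam x - e) (hi th x + e)
      · have hb := abs_le.mp ((hB u (hsub hu')).trans (le_abs_self B))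
        have hs : -(|B| + 1) ≤ (extPot lam th x u - 2 * pot ρ u - C) * (σ u - ρ u) := by
          rw [hρ.supp u hu, sub_zero]
          have h3 := mul_le_mul_of_nonneg_right hb.1 (hσ.nonneg u)
          have h4 := mul_le_mul_of_nonneg_left (hσ.le_one u) (abs_nonneg B)
          linarith
        refine le_trans ?_ hs
        rw [Set.mem_Icc, not_and_or, not_le, not_le] at hu
        rcases hu with hu | hu
        · rw [Set.indicator_of_mem (Set.mem_Icc.mpr ⟨hu'.1, hu.le⟩)]
          linarith [hneg (Set.Icc (hi th x) (hi th x + e))]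
        · rw [Set.indicator_of_mem (s := Set.Icc (hi th x) (hi th x + e))
            (Set.mem_Icc.mpr ⟨hu.le, hu'.2⟩)]
          linarith [hneg (Set.Icc (lo lam x - e) (lo lam x))]
      · rw [hσ.supp u hu', hρ.supp u hu]
        simpa using add_nonpos (hneg _) (hneg _)
  rw [integral_add hi1 hi2, integral_indicator measurableSet_Icc,
    integral_indicator measurableSet_Icc, setIntegral_const, setIntegral_const] at h1
  rw [Real.volume_real_Icc_of_le (by linarith), Real.volume_real_Icc_of_le (by linarith)] at h1
  simp only [smul_eq_mul] at h1
  linarith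

/-- In the expansion around ρ the linear term is small by weak continuity, and the quadratic term
because the potential of the difference is uniformly small. Here ρ need not be an equilibrium. -/
theorem IsDensityOn.exists_energy_le {R : ℝ} {ρ : ℝ → ℝ} (hR : 0 < R)
    (hρ : IsDensityOn (Set.Icc (-R) R) ρ) (lam th x : ℝ) {η : ℝ} (hη : 0 < η) :
    ∃ δ > 0, ∀ σ, IsDensityOn (Set.Icc (-R) R) σ →
      (∀ w, |∫ t in Set.Iic w, (σ t - ρ t)| ≤ δ) →
      weightedEnergy lam th x σ - weightedEnergy lam th x ρ ≤ η := by
  have hE : Continuous fun u => extPot lam th x u - 2 * pot ρ u :=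
    (continuous_extPot lam th x).sub ((hρ.isBddOn.continuous_pot hR).const_mul 2)
  obtain ⟨δ₁, hδ₁, h₁⟩ := IsBddOn.exists_abs_integral_mul_le hR
    (hE.continuousOn (s := Set.Icc (-R) R)) (half_pos hη)
  set K : ℝ := (2 + 2 * R) * (2 * R) with hK
  have hK0 : 0 < K := by positivity
  refine ⟨min δ₁ ((η / (2 * K)) ^ 2), by positivity, fun σ hσ hw => ?_⟩
  have hd := hσ.isBddOn_sub hρ
  have h0 := hσ.integral_sub_eq_zero hρ
  rw [hσ.weightedEnergy_sub hρ hR]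
  have a1 := h₁ _ hd h0 fun w => (hw w).trans (min_le_left _ _)
  have a2 := hd.abs_pot_le hR h0 (δ := (η / (2 * K)) ^ 2) (by positivity)
    fun w => (hw w).trans (min_le_right _ _)
  rw [Real.sqrt_sq (by positivity)] at a2
  have a3 : |logEnergy (fun u => σ u - ρ u) (fun u => σ u - ρ u)| ≤ η / 2 := by
    have h3 : ∀ u, (σ u - ρ u) * pot (fun u => σ u - ρ u) u =
        pot (fun u => σ u - ρ u) u * (σ u - ρ u) := fun u => mul_comm _ _
    simp_rw [IsBddOn.logEnergy_eq, h3]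
    rw [← hd.setIntegral_eq]
    have h4 := norm_setIntegral_le_of_norm_le_const (μ := volume) (s := Set.Icc (-R) R)
      (C := (2 + 2 * R) * (η / (2 * K)))
      (f := fun u => pot (fun u => σ u - ρ u) u * (σ u - ρ u)) (by simp) fun u _ => by
        rw [norm_mul, ← mul_one ((2 + 2 * R) * (η / (2 * K)))]
        exact mul_le_mul (a2 u) (hd.bdd u) (norm_nonneg _) (by positivity)
    rw [Real.volume_real_Icc_of_le (by linarith), Real.norm_eq_abs] at h4
    refine h4.trans (le_of_eq ?_)
    have : (2 + 2 * R) * (η / (2 * K)) * (R - -R) = K * (η / (2 * K)) := by rw [hK]; ring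
    rw [this]
    field_simp
  have := neg_abs_le (logEnergy (fun u => σ u - ρ u) (fun u => σ u - ρ u))
  have := le_abs_self (∫ t, (extPot lam th x t - 2 * pot ρ t) * (σ t - ρ t))
  linarith

end Hexagon

namespace Hexagon

/-! ### The number of path families through a configuration -/

section

variable {k n p : ℕ}

theorem isConfig_of_mem_pathFamilies {h : Fin (n + p + 1) → Fin k → ℕ}
    (hh : h ∈ pathFamilies k n p) (m : Fin (n + p + 1)) : IsConfig n p m (h m) := by
  rw [pathFamilies_eq_chains] at hh
  refine ⟨hh.2.2.2 m, fun i => ?_, fun i => ?_, fun i => ?_⟩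
  · have := chains_le hh m i
    omega
  · have := chains_le_last hh m i
    omega
  · have key : ∀ s : Fin (n + p + 1), (s : ℕ) ≤ n + h s i := by
      intro s
      induction s using Fin.reverseInduction with
      | last =>
        have := congrFun hh.2.1 i
        simp only [Fin.val_last, this]
        omega
      | cast s ih =>
        have := hh.2.2.1 s i
        simp only [Fin.val_castSucc, Fin.val_succ] at *
        omega
    exact key m

theorem pathFamilies_finite : (pathFamilies k n p).Finite := by
  rw [pathFamilies_eq_chains]; exact chains_finite _ _ _

theorem ncard_pathFamilies_pos_of_isConfig (hk : 0 < k) {m : Fin (n + p + 1)} {y : Fin k → ℕ}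
    (hy : IsConfig n p m y) : 0 < (pathFamilies k n p).ncard := by
  obtain ⟨c, hc, h⟩ := exists_ncard_pathFamilies hk n p m
  have h1 := h y hy.mono fun i => by have := hy.lt_right i; omega
  have h2 : (0 : ℝ) < c * weight n p m y := mul_pos hc (hy.log_weight (by omega)).1
  rw [← h1] at h2
  exact (by exact_mod_cast h2 : 0 < _).trans_le
    (Set.ncard_le_ncard (Set.sep_subset _ _) pathFamilies_finite)

theorem pathProb_nonneg (E : Set (Fin (n + p + 1) → Fin k → ℕ)) : 0 ≤ pathProb k n p E := by
  unfold pathProb; positivity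

/-- Comparison with the weight of one configuration. -/
theorem pathProb_le (hk : 0 < k) {m : Fin (n + p + 1)} {y₀ : Fin k → ℕ} (hy₀ : IsConfig n p m y₀)
    {E : Set (Fin (n + p + 1) → Fin k → ℕ)} {Q : ℝ} (hQ : 0 ≤ Q)
    (hE : ∀ h ∈ pathFamilies k n p, h ∈ E → weight n p m (h m) ≤ Q * weight n p m y₀) :
    pathProb k n p E ≤ ((m : ℝ) + k) ^ k * Q := by
  classical
  obtain ⟨c, hc, hcard⟩ := exists_ncard_pathFamilies hk n p m
  have hfin : (pathFamilies k n p ∩ E).Finite := pathFamilies_finite.subset Set.inter_subset_left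
  have hw : 0 < weight n p m y₀ := (hy₀.log_weight (by omega)).1
  have htot : c * weight n p m y₀ ≤ (pathFamilies k n p).ncard := by
    rw [← hcard y₀ hy₀.mono fun i => by have := hy₀.lt_right i; omega]
    exact_mod_cast Set.ncard_le_ncard (Set.sep_subset _ _) pathFamilies_finite
  have hpos : (0 : ℝ) < (pathFamilies k n p).ncard := lt_of_lt_of_le (by positivity) htot
  rw [pathProb, div_le_iff₀ hpos]
  set S := hfin.toFinset with hS
  have hmemS : ∀ h, h ∈ S ↔ h ∈ pathFamilies k n p ∧ h ∈ E := fun h => by simp [hS]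
  -- Union bound: the configurations at time m lie in a box with (m + k)^k elements.
  have hsub : S.image (fun h => h m) ⊆
      Fintype.piFinset fun _ : Fin k => Finset.range ((m : ℕ) + k) := by
    intro y hy
    obtain ⟨h, hh, rfl⟩ := Finset.mem_image.mp hy
    rw [Fintype.mem_piFinset]
    intro i
    have := (isConfig_of_mem_pathFamilies ((hmemS h).mp hh).1 m).lt_left i
    rw [Finset.mem_range]; omega
  have hcardS : ((S.image fun h => h m).card : ℝ) ≤ ((m : ℝ) + k) ^ k := by
    have := Finset.card_le_card hsub
    rw [Fintype.card_piFinset] at this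
    simp only [Finset.card_range, Finset.prod_const, Finset.card_univ, Fintype.card_fin] at this
    exact_mod_cast this
  -- The families through one reference configuration bound the total number from below, so each bad
  -- fibre is at most Q times the total.
  have hfib : ∀ y ∈ S.image (fun h => h m),
      ((S.filter fun h => h m = y).card : ℝ) ≤ Q * (pathFamilies k n p).ncard := by
    intro y hy
    obtain ⟨h, hh, rfl⟩ := Finset.mem_image.mp hy
    obtain ⟨h1, h2⟩ := (hmemS h).mp hh
    have hcf := isConfig_of_mem_pathFamilies h1 m
    have e1 : ((S.filter fun g => g m = h m).card : ℝ) ≤ c * weight n p m (h m) := by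
      rw [← hcard (h m) hcf.mono fun i => by have := hcf.lt_right i; omega,
        ← Set.ncard_coe_finset]
      refine Nat.cast_le.mpr (Set.ncard_le_ncard (fun g hg => ?_)
        (pathFamilies_finite.subset fun _ h => h.1))
      have := Finset.mem_filter.mp (Finset.mem_coe.mp hg)
      exact ⟨((hmemS g).mp this.1).1, this.2⟩
    calc _ ≤ c * weight n p m (h m) := e1
      _ ≤ c * (Q * weight n p m y₀) := mul_le_mul_of_nonneg_left (hE h h1 h2) hc.le
      _ = Q * (c * weight n p m y₀) := by ring
      _ ≤ _ := mul_le_mul_of_nonneg_left htot hQ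
  have e2 : ((pathFamilies k n p ∩ E).ncard : ℝ) =
      ∑ y ∈ S.image (fun h => h m), ((S.filter fun h => h m = y).card : ℝ) := by
    rw [Set.ncard_eq_toFinset_card _ hfin, Finset.card_eq_sum_card_image (fun h => h m)]
    push_cast
    rfl
  rw [e2]
  calc _ ≤ ∑ y ∈ S.image (fun h => h m), Q * ((pathFamilies k n p).ncard : ℝ) :=
        Finset.sum_le_sum hfib
    _ = (S.image fun h => h m).card * (Q * ((pathFamilies k n p).ncard : ℝ)) := by simp
    _ ≤ ((m : ℝ) + k) ^ k * (Q * ((pathFamilies k n p).ncard : ℝ)) :=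
        mul_le_mul_of_nonneg_right hcardS (by positivity)
    _ = _ := by ring

theorem ncard_fin_le {a : ℝ} (ha : 0 ≤ a) (k : ℕ) :
    (Set.ncard {i : Fin k | ((i : ℕ) : ℝ) ≤ a} : ℝ) ≤ a + 1 := by
  have h1 : Set.ncard {i : Fin k | ((i : ℕ) : ℝ) ≤ a} ≤
      Set.ncard (Finset.range (⌊a⌋₊ + 1) : Set ℕ) := by
    refine Set.ncard_le_ncard_of_injOn (fun i : Fin k => (i : ℕ)) (fun i hi => ?_)
      (Fin.val_injective.injOn) (Finset.finite_toSet _)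
    have : (i : ℕ) ≤ ⌊a⌋₊ := Nat.le_floor hi
    simp only [Finset.coe_range, Set.mem_Iio]
    omega
  rw [Set.ncard_coe_finset, Finset.card_range] at h1
  calc (Set.ncard {i : Fin k | ((i : ℕ) : ℝ) ≤ a} : ℝ) ≤ ((⌊a⌋₊ + 1 : ℕ) : ℝ) := by exact_mod_cast h1
    _ ≤ a + 1 := by push_cast; linarith [Nat.floor_le ha]

theorem le_ncard_fin {a : ℝ} {k : ℕ} (ha : a ≤ k) :
    a ≤ (Set.ncard {i : Fin k | ((i : ℕ) : ℝ) < a} : ℝ) := by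
  have hc : ⌈a⌉₊ ≤ k := Nat.ceil_le.mpr ha
  have h1 : Set.ncard (Set.range (Fin.castLE hc)) ≤ Set.ncard {i : Fin k | ((i : ℕ) : ℝ) < a} := by
    refine Set.ncard_le_ncard ?_ (Set.toFinite _)
    rintro _ ⟨i, rfl⟩
    exact Nat.lt_ceil.mp i.2
  rw [← Set.image_univ, Set.ncard_image_of_injective _ (Fin.castLE_injective hc),
    Set.ncard_univ, Nat.card_eq_fintype_card, Fintype.card_fin] at h1
  exact (Nat.le_ceil a).trans (by exact_mod_cast h1)

namespace IsDensityOn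

variable {l r : ℝ} {ρ : ℝ → ℝ}

theorem integrable (h : IsDensityOn (Set.Icc l r) ρ) : Integrable ρ :=
  (h.mono (s' := Set.Icc (-(|l| + |r|)) (|l| + |r|)) (Set.Icc_subset_Icc
    (by linarith [neg_abs_le l, abs_nonneg r]) (by linarith [le_abs_self r, abs_nonneg l]))).isBddOn.integrable

theorem cdf_mono (h : IsDensityOn (Set.Icc l r) ρ) {v w : ℝ} (hvw : v ≤ w) :
    ∫ t in Set.Iic v, ρ t ≤ ∫ t in Set.Iic w, ρ t :=
  setIntegral_mono_set h.integrable.integrableOn (ae_of_all _ h.nonneg)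
    (Set.Iic_subset_Iic.mpr hvw).eventuallyLE

theorem cdf_sub_le (h : IsDensityOn (Set.Icc l r) ρ) {v w : ℝ} (hvw : v ≤ w) :
    (∫ t in Set.Iic w, ρ t) - ∫ t in Set.Iic v, ρ t ≤ w - v :=
  (le_abs_self _).trans ((h.mono (s' := Set.Icc (-(|l| + |r|)) (|l| + |r|)) (Set.Icc_subset_Icc
    (by linarith [neg_abs_le l, abs_nonneg r])
    (by linarith [le_abs_self r, abs_nonneg l]))).isBddOn.abs_cdf_sub_le hvw)

theorem cdf_nonneg (h : IsDensityOn (Set.Icc l r) ρ) (w : ℝ) : 0 ≤ ∫ t in Set.Iic w, ρ t :=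
  integral_nonneg h.nonneg

theorem cdf_le_one (h : IsDensityOn (Set.Icc l r) ρ) (w : ℝ) : ∫ t in Set.Iic w, ρ t ≤ 1 := by
  rw [← h.mass]
  exact setIntegral_le_integral h.integrable (ae_of_all _ h.nonneg)

theorem cdf_left (h : IsDensityOn (Set.Icc l r) ρ) : ∫ t in Set.Iic l, ρ t = 0 := by
  rw [integral_Iic_eq_integral_Iio]
  exact setIntegral_eq_zero_of_forall_eq_zero fun t ht =>
    h.supp t fun h' => not_lt.mpr h'.1 ht

theorem cdf_right (h : IsDensityOn (Set.Icc l r) ρ) : ∫ t in Set.Iic r, ρ t = 1 := by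
  rw [← h.mass]
  exact setIntegral_eq_integral_of_forall_compl_eq_zero fun t ht =>
    h.supp t fun h' => ht h'.2

theorem le_of_mass (h : IsDensityOn (Set.Icc l r) ρ) : l ≤ r := by
  by_contra hc
  have := h.cdf_mono (not_le.mp hc).le
  rw [h.cdf_left, h.cdf_right] at this
  linarith

theorem continuous_cdf (h : IsDensityOn (Set.Icc l r) ρ) :
    Continuous fun w => ∫ t in Set.Iic w, ρ t :=
  (h.mono (s' := Set.Icc (-(|l| + |r|)) (|l| + |r|)) (Set.Icc_subset_Icc
    (by linarith [neg_abs_le l, abs_nonneg r])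
    (by linarith [le_abs_self r, abs_nonneg l]))).isBddOn.continuous_cdf

end IsDensityOn

/-- Rounding of the quantiles of a density to a configuration. -/
theorem exists_isConfig_near (hk : 0 < k) {m : ℕ} (hm : m ≤ n + p) {l r e : ℝ} (hl : 0 ≤ l)
    (he : 0 ≤ e) (h1 : ((m - n : ℕ) : ℝ) / k ≤ l + e) (h2 : r ≤ ((min m p : ℕ) : ℝ) / k + 1 + e)
    {ρ : ℝ → ℝ} (hρ : IsDensityOn (Set.Icc l r) ρ) :
    ∃ y : Fin k → ℕ, IsConfig n p m y ∧
      ∀ w, |∫ t in Set.Iic w, (cellDensity y t - ρ t)| ≤ e + 3 / k := by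
  have hk' : (0 : ℝ) < k := by exact_mod_cast hk
  set F : ℝ → ℝ := fun w => ∫ t in Set.Iic w, ρ t with hF
  have hFl : F l = 0 := hρ.cdf_left
  have hFr : F r = 1 := hρ.cdf_right
  -- Quantiles: u i is a point with a proportion i/k of the mass to its left.
  have hu : ∀ i : Fin k, ∃ u ∈ Set.Icc l r, F u = (i : ℕ) / k := by
    intro i
    have := intermediate_value_Icc hρ.le_of_mass hρ.continuous_cdf.continuousOn (f := F)
    refine this ?_
    rw [hFl, hFr]
    refine ⟨by positivity, (div_le_one hk').mpr ?_⟩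
    exact_mod_cast i.2.le
  choose u huI huF using hu
  have hlow : ∀ i : Fin k, ((i : ℕ) : ℝ) ≤ k * u i - k * l := fun i => by
    have := hρ.cdf_sub_le (huI i).1
    change F (u i) - F l ≤ _ at this
    rw [huF, hFl, sub_zero, div_le_iff₀ hk'] at this
    linarith
  have hupp : ∀ i : Fin k, k * u i + k ≤ k * r + (i : ℕ) := fun i => by
    have := hρ.cdf_sub_le (huI i).2
    change F r - F (u i) ≤ _ at this
    rw [huF, hFr, sub_le_iff_le_add, ← mul_le_mul_iff_right₀ hk'] at this
    have e1 : (k : ℝ) * (r - u i + (i : ℕ) / k) = k * r - k * u i + (i : ℕ) := by field_simp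
    linarith
  -- Since the density is at most one, a mass 1/k needs length at least 1/k. The rescaled quantiles
  -- are thus one apart and their integer parts are strictly increasing.
  have hgap : ∀ i j : Fin k, i < j → k * u i + 1 ≤ k * u j := fun i j hij => by
    have h3 : ((i : ℕ) : ℝ) + 1 ≤ (j : ℕ) := by exact_mod_cast hij
    have h4 : u i ≤ u j := by
      by_contra hc
      have := hρ.cdf_mono (not_le.mp hc).le
      change F (u j) ≤ F (u i) at this
      rw [huF, huF, div_le_div_iff_of_pos_right hk'] at this
      linarith
    have := hρ.cdf_sub_le h4
    change F (u j) - F (u i) ≤ _ at this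
    rw [huF, huF, ← sub_div, div_le_iff₀ hk'] at this
    linarith
  have hu0 : ∀ i, 0 ≤ k * u i := fun i => mul_nonneg hk'.le (hl.trans (huI i).1)
  have hq : ∀ i j : Fin k, i < j → ⌊k * u i⌋₊ < ⌊k * u j⌋₊ := fun i j hij => by
    rw [Nat.lt_iff_add_one_le, ← Nat.floor_add_one (hu0 i)]
    exact Nat.floor_mono (hgap i j hij)
  -- The integer parts are clamped between the lowest and the highest allowed configuration. The
  -- bounds `hlow` and `hupp` show that clamping moves no point by more than e in rescaled units,
  -- beyond rounding.
  set y : Fin k → ℕ := fun i => max ((m - n) + i) (min ⌊k * u i⌋₊ (min m p + i)) with hy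
  have hmono : StrictMono y := fun i j hij => by
    have h3 := hq i j hij
    have h4 : (i : ℕ) < j := hij
    simp only [hy]
    omega
  have hyU : ∀ i, (y i : ℝ) ≤ k * u i + k * e := fun i => by
    simp only [hy]
    rw [Nat.cast_max, max_le_iff]
    constructor
    · rw [div_le_iff₀ hk'] at h1
      push_cast
      linarith [hlow i]
    · rw [Nat.cast_min]
      exact (min_le_left _ _).trans ((Nat.floor_le (hu0 i)).trans (by linarith [mul_nonneg hk'.le he]))
  have hyL : ∀ i, k * u i - k * e - 1 ≤ (y i : ℝ) := fun i => by
    simp only [hy]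
    rw [Nat.cast_max]
    refine le_trans ?_ (le_max_right _ _)
    rw [Nat.cast_min, le_min_iff]
    constructor
    · have := Nat.lt_floor_add_one (k * u i)
      linarith [mul_nonneg hk'.le he]
    · have h3 := mul_le_mul_of_nonneg_left h2 hk'.le
      have e1 : (k : ℝ) * (((min m p : ℕ) : ℝ) / k + 1 + e) = (min m p : ℕ) + k + k * e := by
        field_simp
      rw [e1] at h3
      rw [Nat.cast_add]
      linarith [hupp i]
  have hcf : IsConfig n p m y := by
    refine ⟨hmono, fun i => ?_, fun i => ?_, fun i => ?_⟩ <;>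
    · have := i.2
      simp only [hy]
      omega
  refine ⟨y, hcf, fun w => ?_⟩
  have hden : IsDensityOn (Set.Icc 0 ((p : ℝ) / k + 1)) (cellDensity y) := by
    refine isDensityOn_cellDensity hk hmono fun i => ⟨by simp, ?_⟩
    have e1 : ((p : ℝ) / k + 1) * k = p + k := by field_simp
    rw [e1]
    exact_mod_cast hcf.lt_right i
  rw [integral_sub hden.integrable.integrableOn hρ.integrable.integrableOn]
  have hcount := abs_count_sub_cdf_le hk hmono w
  have c1 : (Set.ncard {i : Fin k | (y i : ℝ) ≤ w * k} : ℝ) / k ≤ F w + e + 2 / k := by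
    have hb : (0 : ℝ) ≤ k * (F w + e) + 1 := by
      have := hρ.cdf_nonneg w
      positivity
    have h3 : (Set.ncard {i : Fin k | (y i : ℝ) ≤ w * k} : ℝ) ≤ k * (F w + e) + 1 + 1 := by
      refine le_trans ?_ (ncard_fin_le hb k)
      refine Nat.cast_le.mpr (Set.ncard_le_ncard (fun i hi => ?_) (Set.toFinite _))
      have hi' : (y i : ℝ) ≤ w * k := hi
      have h4 : u i ≤ w + (e + 1 / k) := by
        rw [← mul_le_mul_iff_right₀ hk']
        have e1 : (k : ℝ) * (w + (e + 1 / k)) = w * k + k * e + 1 := by field_simp; ring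
        linarith [hyL i]
      have h5 := hρ.cdf_mono h4
      have h6 := hρ.cdf_sub_le (v := w) (w := w + (e + 1 / k)) (by
        have : (0 : ℝ) ≤ 1 / k := by positivity
        linarith)
      change F (u i) ≤ F (w + (e + 1 / k)) at h5
      change F (w + (e + 1 / k)) - F w ≤ _ at h6
      rw [huF] at h5
      have h7 : ((i : ℕ) : ℝ) / k ≤ F w + e + 1 / k := by linarith
      rw [div_le_iff₀ hk'] at h7
      have e1 : (F w + e + 1 / k) * k = k * (F w + e) + 1 := by field_simp
      rw [e1] at h7
      exact h7
    rw [div_le_iff₀ hk']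
    have e1 : (F w + e + 2 / k) * k = k * (F w + e) + 2 := by field_simp
    linarith
  have c2 : F w - e ≤ (Set.ncard {i : Fin k | (y i : ℝ) ≤ w * k} : ℝ) / k := by
    rw [le_div_iff₀ hk']
    refine (le_ncard_fin (k := k) ?_).trans (Nat.cast_le.mpr
      (Set.ncard_le_ncard (fun i hi => ?_) (Set.toFinite _)))
    · have h3 : F w ≤ 1 := hρ.cdf_le_one w
      have := mul_le_mul_of_nonneg_right (by linarith : F w - e ≤ 1) hk'.le
      linarith
    · have hi' : ((i : ℕ) : ℝ) < (F w - e) * k := hi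
      rw [← div_lt_iff₀ hk', ← huF] at hi'
      have h6 := hρ.cdf_sub_le (v := w - e) (w := w) (by linarith)
      change F w - F (w - e) ≤ _ at h6
      have h7 : u i ≤ w - e := by
        by_contra hc
        have : F (w - e) ≤ F (u i) := hρ.cdf_mono (not_le.mp hc).le
        linarith
      have := mul_le_mul_of_nonneg_left h7 hk'.le
      change (y i : ℝ) ≤ w * k
      linarith [hyU i]
  have e3 : (3 : ℝ) / k = 2 / k + 1 / k := by ring
  have h0 : (0 : ℝ) ≤ 2 / k := by positivity
  rw [abs_le] at hcount ⊢
  constructor <;> linarith [hcount.1, hcount.2]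

end

end Hexagon

namespace Hexagon

/-! ### Concentration of the cut distribution -/

theorem isDensityOn_of_isConfig {k n p m : ℕ} (hk : 0 < k) {y : Fin k → ℕ} (hy : IsConfig n p m y)
    {lam th x e : ℝ} (hpar : |(n : ℝ) / k - lam| + |(p : ℝ) / k - th| + |(m : ℝ) / k - x| ≤ e) :
    IsDensityOn (Set.Icc (lo lam x - e) (hi th x + e)) (cellDensity y) := by
  have hk0 : (0 : ℝ) < k := by exact_mod_cast hk
  have a1 := abs_nonneg ((n : ℝ) / k - lam)
  have a2 := abs_nonneg ((p : ℝ) / k - th)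
  have a3 := abs_nonneg ((m : ℝ) / k - x)
  have b1 := neg_abs_le ((n : ℝ) / k - lam)
  have b2 := neg_abs_le ((p : ℝ) / k - th)
  have b3 := neg_abs_le ((m : ℝ) / k - x)
  have c1 := le_abs_self ((n : ℝ) / k - lam)
  have c2 := le_abs_self ((p : ℝ) / k - th)
  have c3 := le_abs_self ((m : ℝ) / k - x)
  refine isDensityOn_cellDensity hk hy.mono fun i => ⟨?_, ?_⟩
  · rw [← le_div_iff₀ hk0, sub_le_iff_le_add]
    have d1 : (m : ℝ) / k ≤ n / k + y i / k := by
      rw [← add_div]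
      exact (div_le_div_iff_of_pos_right hk0).mpr (by exact_mod_cast hy.le_add i)
    have d2 : (0 : ℝ) ≤ y i / k := by positivity
    exact max_le (by linarith) (by linarith)
  · rw [← div_le_iff₀ hk0, ← sub_le_iff_le_add]
    have d1 : ((y i : ℝ) + 1) / k ≤ m / k + 1 := by
      rw [div_add_one hk0.ne']
      exact (div_le_div_iff_of_pos_right hk0).mpr (by exact_mod_cast hy.lt_left i)
    have d2 : ((y i : ℝ) + 1) / k ≤ p / k + 1 := by
      rw [div_add_one hk0.ne']
      exact (div_le_div_iff_of_pos_right hk0).mpr (by exact_mod_cast hy.lt_right i)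
    rw [hi, ← sub_le_iff_le_add']
    exact le_min (by linarith) (by linarith)

theorem Icc_enlarged_subset {lam th x e : ℝ} (hlam : 0 < lam) (hth : 0 < th) (he : e ≤ 1) :
    Set.Icc (lo lam x - e) (hi th x + e) ⊆ Set.Icc (-bigRadius lam th) (bigRadius lam th) := by
  refine Set.Icc_subset_Icc ?_ ?_
  · have : 0 ≤ lo lam x := le_max_left _ _
    unfold bigRadius; linarith
  · have : min x th ≤ th := min_le_right _ _
    unfold bigRadius hi; linarith

theorem exists_modulus_L₀ (R : ℝ) {η : ℝ} (hη : 0 < η) :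
    ∃ δ > 0, ∀ u v : ℝ, |u| ≤ R → |v| ≤ R → |u - v| ≤ δ → |L₀ u - L₀ v| ≤ η := by
  have h := (isCompact_Icc (a := -R) (b := R)).uniformContinuousOn_of_continuous
    (continuous_L₀.continuousOn)
  obtain ⟨δ, hδ, h⟩ := Metric.uniformContinuousOn_iff.mp h η hη
  refine ⟨δ / 2, by positivity, fun u v hu hv huv => ?_⟩
  have := h u (abs_le.mp hu) v (abs_le.mp hv) (by rw [Real.dist_eq]; linarith)
  exact this.le

/-- Every bad configuration has an energy larger by a fixed amount than that of the rounded
quantiles of ρ; a comparison of weights and the union bound conclude. -/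
theorem IsEquilibrium.exists_pathProb_le {lam th x C : ℝ} {ρ : ℝ → ℝ}
    (hρ : IsEquilibrium lam th x ρ C) (hlam : 0 < lam) (hth : 0 < th) {ε : ℝ} (hε : 0 < ε) :
    ∃ δ > 0, ∃ g > 0, ∀ k n p : ℕ, 2 ≤ k → ∀ m : Fin (n + p + 1),
      |(n : ℝ) / k - lam| + |(p : ℝ) / k - th| + |((m : ℕ) : ℝ) / k - x| + 1 / k ≤ δ → ∀ t,
      pathProb k n p {h | ε < |cutFraction h m t - ∫ u in Set.Iic t, ρ u|} ≤
        Real.exp (57 * k * (1 + Real.log ((lam + th + 4) * k)) - g * k ^ 2) := by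
  have hR : 0 < bigRadius lam th := by unfold bigRadius; linarith
  set g₀ : ℝ := (ε / 2) ^ 3 / (16 * bigRadius lam th) with hg₀
  have hg₀0 : 0 < g₀ := by positivity
  obtain ⟨δ₁, hδ₁, hmod⟩ := exists_modulus_L₀ (lam + th + |x| + 5) (η := g₀ / 64) (by positivity)
  obtain ⟨B, hB, hlow⟩ := hρ.exists_energy_ge hlam hth
  have hρ' := hρ.toIsDensityOn.mono (Icc_lo_hi_subset hlam hth)
  obtain ⟨δ₂, hδ₂, hupp⟩ := hρ'.exists_energy_le hR lam th x (η := g₀ / 4) (by positivity)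
  -- The gap g₀ loses g₀/4 for the enlarged support and g₀/4 for the reference configuration,
  -- leaving g₀/2. Twice the Stirling error takes another g₀/8, hence 3g₀/8. The terms of order k
  -- log k are 2 · 28 from that error and 1 from the number of configurations, hence 57. The bound
  -- δ₂/4 absorbs e + 3/k ≤ 4e.
  refine ⟨min (min δ₁ (δ₂ / 4)) (min (min 1 (ε / 4)) (g₀ / (8 * B))), by positivity,
    3 * g₀ / 8, by positivity, fun k n p hk m hpar t => ?_⟩
  set e : ℝ := |(n : ℝ) / k - lam| + |(p : ℝ) / k - th| + |((m : ℕ) : ℝ) / k - x| + 1 / k with he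
  simp only [le_min_iff] at hpar
  obtain ⟨⟨q1, q2⟩, ⟨q3, q4⟩, q5⟩ := hpar
  have hk0 : (0 : ℝ) < k := by exact_mod_cast (by omega : 0 < k)
  have hk1 : (0 : ℝ) < 1 / k := by positivity
  have hmnp : (m : ℕ) ≤ n + p := by omega
  have a1 := abs_nonneg ((n : ℝ) / k - lam)
  have a2 := abs_nonneg ((p : ℝ) / k - th)
  have a3 := abs_nonneg (((m : ℕ) : ℝ) / k - x)
  have b1 := neg_abs_le ((n : ℝ) / k - lam)
  have b2 := neg_abs_le ((p : ℝ) / k - th)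
  have b3 := neg_abs_le (((m : ℕ) : ℝ) / k - x)
  have c1 := le_abs_self ((n : ℝ) / k - lam)
  have c2 := le_abs_self ((p : ℝ) / k - th)
  have c3 := le_abs_self (((m : ℕ) : ℝ) / k - x)
  have he0 : 0 ≤ e := by linarith
  have hpar' : |(n : ℝ) / k - lam| + |(p : ℝ) / k - th| + |((m : ℕ) : ℝ) / k - x| ≤ e := by linarith
  -- the reference configuration
  have hl : ((m - n : ℕ) : ℝ) / k ≤ lo lam x + e := by
    rcases le_total (m : ℕ) n with h | h
    · rw [Nat.sub_eq_zero_of_le h, Nat.cast_zero, zero_div]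
      have : 0 ≤ lo lam x := le_max_left _ _
      linarith
    · rw [Nat.cast_sub h, sub_div]
      have : x - lam ≤ lo lam x := le_max_right _ _
      linarith
  have hr : hi th x ≤ ((min (m : ℕ) p : ℕ) : ℝ) / k + 1 + e := by
    have h1 : min x th ≤ x := min_le_left _ _
    have h2 : min x th ≤ th := min_le_right _ _
    rcases le_total (m : ℕ) p with h | h
    · rw [min_eq_left h, hi]; linarith
    · rw [min_eq_right h, hi]; linarith
  obtain ⟨y₀, hy₀, hcdf⟩ := exists_isConfig_near (by omega) hmnp (le_max_left _ _) he0 hl hr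
    hρ.toIsDensityOn
  have hW₀ : weightedEnergy lam th x (cellDensity y₀) - weightedEnergy lam th x ρ ≤ g₀ / 4 := by
    refine hupp _ ((isDensityOn_of_isConfig (by omega) hy₀ hpar').mono
      (Icc_enlarged_subset hlam hth q3)) fun w => (hcdf w).trans ?_
    have : (3 : ℝ) / k = 3 * (1 / k) := by ring
    linarith
  obtain ⟨c, hc⟩ := abs_log_weight_sub_le hk hmnp he.ge q3 hlam hth le_rfl
    fun u v hu hv huv => hmod u v hu hv (huv.trans q1)
  -- logarithms
  have hk2 : (2 : ℝ) ≤ k := by exact_mod_cast hk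
  have hnk : (n : ℝ) ≤ (lam + 1) * k := by rw [← div_le_iff₀ hk0]; linarith
  have hpk : (p : ℝ) ≤ (th + 1) * k := by rw [← div_le_iff₀ hk0]; linarith
  have hn0 : (0 : ℝ) ≤ n := by positivity
  have hp0 : (0 : ℝ) ≤ p := by positivity
  have hmr : ((m : ℕ) : ℝ) ≤ n + p := by exact_mod_cast hmnp
  set T : ℝ := Real.log ((lam + th + 4) * k) with hT
  have hMk : (n : ℝ) + p + 2 * k ≤ (lam + th + 4) * k := by linarith
  have hlk : Real.log k ≤ T := Real.log_le_log hk0 (by linarith)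
  have hlT : Real.log (n + p + 2 * k) ≤ T := Real.log_le_log (by positivity) hMk
  set D : ℝ := k * (24 * (1 + Real.log k)) + k * (4 * (1 + Real.log (n + p + 2 * k))) +
    4 * (g₀ / 64) * k ^ 2 with hD
  have hDle : D ≤ 28 * k * (1 + T) + g₀ / 16 * k ^ 2 := by
    have h1 := mul_le_mul_of_nonneg_left hlk hk0.le
    have h2 := mul_le_mul_of_nonneg_left hlT hk0.le
    rw [hD]
    linarith
  have hpow : (((m : ℕ) : ℝ) + k) ^ k ≤ Real.exp (k * T) := by
    have hmk : ((m : ℕ) : ℝ) + k ≤ (lam + th + 4) * k := by linarith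
    rw [mul_comm, ← Real.rpow_natCast, hT, ← Real.rpow_def_of_pos (by positivity)]
    exact Real.rpow_le_rpow (by positivity) hmk (by positivity)
  have hmain := pathProb_le (m := m) (by omega) hy₀
    (E := {h | ε < |cutFraction h m t - ∫ u in Set.Iic t, ρ u|})
    (Q := Real.exp (2 * D - k ^ 2 * (g₀ / 2))) (Real.exp_pos _).le fun h hh hbad => ?_
  · refine hmain.trans ((mul_le_mul_of_nonneg_right hpow (Real.exp_pos _).le).trans ?_)
    rw [← Real.exp_add, Real.exp_le_exp]
    have : 0 ≤ (k : ℝ) := hk0.le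
    linarith
  · have hy := isConfig_of_mem_pathFamilies hh m
    have hcfrac := abs_count_sub_cdf_le (by omega) hy.mono t
    have hbad' : ε < |cutFraction h m t - ∫ u in Set.Iic t, ρ u| := hbad
    have hden := isDensityOn_of_isConfig (by omega) hy hpar'
    have hW := hlow e he0 q3 _ hden t
    rw [integral_sub hden.integrable.integrableOn
      (hρ.isBddOn hlam hth).integrable.integrableOn] at hW
    have hgap : ε / 2 ≤ |(∫ u in Set.Iic t, cellDensity (h m) u) - ∫ u in Set.Iic t, ρ u| := by
      have h3 := abs_sub_le (cutFraction h m t) (∫ u in Set.Iic t, cellDensity (h m) u)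
        (∫ u in Set.Iic t, ρ u)
      unfold cutFraction at h3 hbad'
      linarith
    have hcube : g₀ ≤ |(∫ u in Set.Iic t, cellDensity (h m) u) - ∫ u in Set.Iic t, ρ u| ^ 3 /
        (16 * bigRadius lam th) := by
      rw [hg₀]
      gcongr
    have hBe : 2 * B * e ≤ g₀ / 4 := by
      rw [le_div_iff₀ (by positivity)] at q5
      linarith
    have w1 := hy.log_weight hmnp
    have w0 := hy₀.log_weight hmnp
    have l1 := abs_le.mp (hc _ hy)
    have l0 := abs_le.mp (hc _ hy₀)
    rw [← Real.exp_log w1.1, ← Real.exp_log w0.1, ← Real.exp_add, Real.exp_le_exp]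
    have hk22 : (0 : ℝ) ≤ (k : ℝ) ^ 2 := by positivity
    have hWW : g₀ / 2 ≤ weightedEnergy lam th x (cellDensity (h m)) -
        weightedEnergy lam th x (cellDensity y₀) := by linarith
    have := mul_le_mul_of_nonneg_left hWW hk22
    linarith [l1.2, l0.1]

/-- Entropy k log k loses against energy k². The constant c makes 57 c M = g/2 in the bound log (M
k) ≤ c M k - 1 - log c. -/
theorem tendsto_exp_entropy {M g : ℝ} (hM : 0 < M) (hg : 0 < g) :
    Tendsto (fun k : ℕ => Real.exp (57 * k * (1 + Real.log (M * k)) - g * (k : ℝ) ^ 2)) atTop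
      (𝓝 0) := by
  set c : ℝ := g / (114 * M) with hc
  have hc0 : 0 < c := by positivity
  set K : ℝ := 57 * (1 - 1 - Real.log c) with hK
  have hlim : Tendsto (fun k : ℕ => Real.exp (-(k : ℝ))) atTop (𝓝 0) :=
    Real.tendsto_exp_neg_atTop_nhds_zero.comp tendsto_natCast_atTop_atTop
  refine squeeze_zero' (Eventually.of_forall fun _ => (Real.exp_pos _).le) ?_ hlim
  filter_upwards [eventually_ge_atTop (⌈2 * (K + 1) / g⌉₊ + 1)] with k hk
  rw [Real.exp_le_exp]
  have hk0 : (0 : ℝ) < k := by exact_mod_cast (by omega : 0 < k)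
  have hkK : 2 * (K + 1) / g ≤ k :=
    (Nat.le_ceil _).trans (by exact_mod_cast (by omega : ⌈2 * (K + 1) / g⌉₊ ≤ k))
  have hlog : Real.log (M * k) ≤ c * (M * k) - 1 - Real.log c := by
    have h1 := Real.log_le_sub_one_of_pos (x := c * (M * k)) (by positivity)
    rw [Real.log_mul hc0.ne' (by positivity)] at h1
    linarith
  have hcM : c * (M * k) = g * k / 114 := by rw [hc]; field_simp
  rw [div_le_iff₀ hg] at hkK
  have h2 : 57 * (1 + Real.log (M * k)) - g * k ≤ -1 := by
    rw [hcM] at hlog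
    linarith
  have := mul_le_mul_of_nonneg_left h2 hk0.le
  linarith

theorem IsEquilibrium.isLimitDensity {lam th x C : ℝ} {ρ : ℝ → ℝ}
    (hρ : IsEquilibrium lam th x ρ C) (hlam : 0 < lam) (hth : 0 < th) :
    IsLimitDensity lam th x ρ := by
  refine ⟨(hρ.isBddOn hlam hth).integrable, fun k n p m hk hn hp hm t ε hε => ?_⟩
  obtain ⟨δ, hδ, g, hg, hb⟩ := hρ.exists_pathProb_le hlam hth hε
  have hpar : Tendsto (fun j => |(n j : ℝ) / k j - lam| + |(p j : ℝ) / k j - th| +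
      |((m j : ℕ) : ℝ) / k j - x| + 1 / (k j : ℝ)) atTop (𝓝 0) := by
    have h1 := (hn.sub_const lam).abs
    have h2 := (hp.sub_const th).abs
    have h3 := (hm.sub_const x).abs
    have h4 : Tendsto (fun j => 1 / (k j : ℝ)) atTop (𝓝 0) :=
      tendsto_one_div_atTop_nhds_zero_nat.comp hk
    simpa using ((h1.add h2).add h3).add h4
  refine squeeze_zero' (Eventually.of_forall fun _ => pathProb_nonneg _) ?_
    ((tendsto_exp_entropy (M := lam + th + 4) (by linarith) hg).comp hk)
  filter_upwards [hpar.eventually (eventually_le_nhds hδ), hk.eventually_ge_atTop 2] with j h1 h2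
  exact hb _ _ _ h2 _ h1 t

/-! ### Uniqueness of the limit density -/

theorem ae_eq_of_cdf {f g : ℝ → ℝ} (hf : Integrable f) (hg : Integrable g)
    (h : ∀ w, ∫ t in Set.Iic w, f t = ∫ t in Set.Iic w, g t) : f =ᵐ[volume] g := by
  filter_upwards [LocallyIntegrable.ae_hasDerivAt_integral hf.locallyIntegrable,
    LocallyIntegrable.ae_hasDerivAt_integral hg.locallyIntegrable] with x hx hx'
  have h1 := hx 0
  have h2 : (fun x => ∫ t in (0 : ℝ)..x, f t) = fun x => ∫ t in (0 : ℝ)..x, g t := by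
    ext y
    rw [← intervalIntegral.integral_Iic_sub_Iic hf.integrableOn hf.integrableOn, h, h,
      intervalIntegral.integral_Iic_sub_Iic hg.integrableOn hg.integrableOn]
  rw [h2] at h1
  exact h1.unique (hx' 0)

theorem ncard_pathFamilies_pos {k n p : ℕ} (hk : 0 < k) (m : Fin (n + p + 1)) :
    0 < (pathFamilies k n p).ncard := by
  refine ncard_pathFamilies_pos_of_isConfig hk (m := m) (y := fun i => (m - n) + i)
    ⟨fun i j hij => ?_, fun i => ?_, fun i => ?_, fun i => ?_⟩
  · have : (i : ℕ) < j := hij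
    simpa using this
  all_goals
    have := i.2
    have := m.2
    omega

/-- If two limits differed at some w by 3ε, every path family would miss one of them by more than ε,
so the two probabilities would add up to at least one. -/
theorem IsLimitDensity.ae_eq {lam th x : ℝ} (hlam : 0 < lam) (hth : 0 < th)
    (hx : x ∈ Set.Icc 0 (lam + th)) {ρ σ : ℝ → ℝ} (hρ : IsLimitDensity lam th x ρ)
    (hσ : IsLimitDensity lam th x σ) : ρ =ᵐ[volume] σ := by
  refine ae_eq_of_cdf hρ.1 hσ.1 fun w => ?_
  by_contra hne
  set ε : ℝ := |(∫ t in Set.Iic w, ρ t) - ∫ t in Set.Iic w, σ t| / 3 with hε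
  have hε0 : 0 < ε := by
    have := abs_pos.mpr (sub_ne_zero.mpr hne)
    positivity
  -- A sequence of hexagons realizing the prescribed ratios, which exists because x lies in [0, λ +
  -- θ]; the minimum keeps m within the n + p available steps.
  let k : ℕ → ℕ := fun j => j + 1
  let n : ℕ → ℕ := fun j => ⌊lam * (k j : ℝ)⌋₊
  let p : ℕ → ℕ := fun j => ⌊th * (k j : ℝ)⌋₊
  let m : ∀ j, Fin (n j + p j + 1) := fun j =>
    ⟨min ⌊x * (k j : ℝ)⌋₊ (n j + p j), by omega⟩
  have hk : Tendsto k atTop atTop := tendsto_add_atTop_nat 1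
  have hkr : Tendsto (fun j => (k j : ℝ)) atTop atTop := tendsto_natCast_atTop_atTop.comp hk
  have hn : Tendsto (fun j => (n j : ℝ) / k j) atTop (𝓝 lam) :=
    (tendsto_nat_floor_mul_div_atTop hlam.le).comp hkr
  have hp : Tendsto (fun j => (p j : ℝ) / k j) atTop (𝓝 th) :=
    (tendsto_nat_floor_mul_div_atTop hth.le).comp hkr
  have hm : Tendsto (fun j => ((m j : ℕ) : ℝ) / k j) atTop (𝓝 x) := by
    have h1 := ((tendsto_nat_floor_mul_div_atTop hx.1).comp hkr).min (hn.add hp)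
    rw [min_eq_left hx.2] at h1
    refine h1.congr fun j => ?_
    have hk0 : (0 : ℝ) < k j := by positivity
    simp only [m, Function.comp]
    rw [← add_div, min_div_div_right hk0.le]
    push_cast
    rfl
  have h1 := hρ.2 k n p m hk hn hp hm w ε hε0
  have h2 := hσ.2 k n p m hk hn hp hm w ε hε0
  have h3 := h1.add h2
  rw [add_zero] at h3
  refine absurd (ge_of_tendsto' h3 (b := 1) fun j => ?_) (by norm_num)
  have hpos : (0 : ℝ) < (pathFamilies (k j) (n j) (p j)).ncard := by
    exact_mod_cast ncard_pathFamilies_pos (Nat.succ_pos j) (m j)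
  rw [pathProb, pathProb, ← add_div, le_div_iff₀ hpos, one_mul, ← Nat.cast_add, Nat.cast_le]
  refine le_trans (Set.ncard_le_ncard (fun h hh => ?_) ?_) (Set.ncard_union_le _ _)
  · by_contra hc
    simp only [Set.mem_union, Set.mem_inter_iff, hh, true_and, Set.mem_ofPred_eq, not_or,
      not_lt] at hc
    have := abs_sub_le (∫ t in Set.Iic w, ρ t) (cutFraction h (m j) w) (∫ t in Set.Iic w, σ t)
    rw [abs_sub_comm _ (cutFraction h (m j) w)] at this
    linarith [hc.1, hc.2]
  · exact (pathFamilies_finite.inter_of_left _).union (pathFamilies_finite.inter_of_left _)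

theorem IsLimitDensity.congr {lam th x : ℝ} {ρ σ : ℝ → ℝ} (hρ : IsLimitDensity lam th x ρ)
    (h : ρ =ᵐ[volume] σ) : IsLimitDensity lam th x σ := by
  refine ⟨hρ.1.congr h, fun k n p m hk hn hp hm t ε hε => ?_⟩
  rw [← setIntegral_congr_ae₀ (f := ρ) nullMeasurableSet_Iic (h.mono fun _ h _ => h)]
  exact hρ.2 k n p m hk hn hp hm t ε hε

theorem IsEquilibrium.isLimitDensity_iff {lam th x C : ℝ} {ρ : ℝ → ℝ}
    (hρ : IsEquilibrium lam th x ρ C) (hlam : 0 < lam) (hth : 0 < th)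
    (hx : x ∈ Set.Icc 0 (lam + th)) (σ : ℝ → ℝ) : IsLimitDensity lam th x σ ↔ σ =ᵐ[volume] ρ :=
  ⟨fun h => h.ae_eq hlam hth hx (hρ.isLimitDensity hlam hth),
    fun h => (hρ.isLimitDensity hlam hth).congr h.symm⟩

end Hexagon

namespace Hexagon

/-! ### Logarithmic integrals against the Poisson kernel -/

/-- The Poisson kernel of the unit disc at a real point. -/
noncomputable def poissonWeight (κ ψ : ℝ) : ℝ := (1 - κ ^ 2) / (1 + κ ^ 2 - 2 * κ * Real.cos ψ)

section

variable {κ : ℝ}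

theorem poissonWeight_denom_pos (hκ : |κ| < 1) (ψ : ℝ) : 0 < 1 + κ ^ 2 - 2 * κ * Real.cos ψ := by
  have h1 := abs_lt.mp hκ
  have h2 : |κ * Real.cos ψ| ≤ |κ| := by
    rw [abs_mul]
    exact mul_le_of_le_one_right (abs_nonneg _) (Real.abs_cos_le_one ψ)
  have h3 := le_abs_self (κ * Real.cos ψ)
  have h4 : 0 < (1 - |κ|) ^ 2 := by
    have : 0 < 1 - |κ| := by linarith
    positivity
  have h5 := sq_abs κ
  nlinarith

theorem poissonWeight_pos (hκ : |κ| < 1) (ψ : ℝ) : 0 < poissonWeight κ ψ := by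
  refine div_pos ?_ (poissonWeight_denom_pos hκ ψ)
  have := (sq_lt_one_iff_abs_lt_one κ).mpr hκ
  linarith

theorem continuous_poissonWeight (hκ : |κ| < 1) : Continuous (poissonWeight κ) := by
  unfold poissonWeight
  exact continuous_const.div (by fun_prop) fun ψ => (poissonWeight_denom_pos hκ ψ).ne'

theorem poissonWeight_periodic (κ : ℝ) : Function.Periodic (poissonWeight κ) (2 * Real.pi) :=
  fun ψ => by simp [poissonWeight]

theorem poissonKernel_circleMap (κ ψ : ℝ) :
    poissonKernel 0 (κ : ℂ) (circleMap 0 1 ψ) = poissonWeight κ ψ := by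
  have h1 : ‖circleMap 0 1 ψ‖ = 1 := by simp
  have h2 : ‖circleMap 0 1 ψ - (κ : ℂ)‖ ^ 2 = 1 + κ ^ 2 - 2 * κ * Real.cos ψ := by
    rw [← Complex.normSq_eq_norm_sq, Complex.normSq_apply]
    simp only [circleMap, zero_add, Complex.ofReal_one, one_mul, Complex.sub_re, Complex.sub_im,
      Complex.exp_ofReal_mul_I_re, Complex.exp_ofReal_mul_I_im, Complex.ofReal_re,
      Complex.ofReal_im]
    nlinarith [Real.sin_sq_add_cos_sq ψ]
  rw [poissonKernel_def, sub_zero, sub_zero, h1, h2, poissonWeight]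
  simp

theorem integral_poissonWeight_mul (hκ : |κ| < 1) {f : ℂ → ℝ}
    (hf : InnerProductSpace.HarmonicOnNhd f (Metric.closedBall 0 1)) :
    ∫ ψ in (0 : ℝ)..2 * Real.pi, poissonWeight κ ψ * f (circleMap 0 1 ψ) = 2 * Real.pi * f κ := by
  have h := InnerProductSpace.HarmonicOnNhd.circleAverage_poissonKernel_smul hf (w := (κ : ℂ))
    (by simpa using hκ)
  rw [Real.circleAverage_def] at h
  simp only [Pi.smul_apply', poissonKernel_circleMap, smul_eq_mul] at h
  rw [← h]
  field_simp

theorem integral_poissonWeight (hκ : |κ| < 1) :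
    ∫ ψ in (0 : ℝ)..2 * Real.pi, poissonWeight κ ψ = 2 * Real.pi := by
  simpa using integral_poissonWeight_mul hκ (f := fun _ => 1) fun z _ => by simp

theorem integral_poissonWeight_mul_cos (hκ : |κ| < 1) :
    ∫ ψ in (0 : ℝ)..2 * Real.pi, poissonWeight κ ψ * Real.cos ψ = 2 * Real.pi * κ := by
  have := integral_poissonWeight_mul hκ (f := fun z => z.re) fun z _ =>
    (analyticAt_id (𝕜 := ℂ) (z := z)).harmonicAt_re
  simpa [circleMap, Complex.exp_ofReal_mul_I_re] using this

theorem one_sub_mul_ne_zero {w z : ℂ} (hw : ‖w‖ < 1) (hz : ‖z‖ ≤ 1) : 1 - w * z ≠ 0 := by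
  intro h
  have h1 : ‖w * z‖ < 1 := by
    rw [norm_mul]
    exact (mul_le_of_le_one_right (norm_nonneg _) hz).trans_lt hw
  rw [← sub_eq_zero.mp h, norm_one] at h1
  exact lt_irrefl _ h1

theorem integral_poissonWeight_mul_log_of_lt (hκ : |κ| < 1) {w : ℂ} (hw : ‖w‖ < 1) :
    ∫ ψ in (0 : ℝ)..2 * Real.pi, poissonWeight κ ψ * Real.log ‖1 - w * circleMap 0 1 ψ‖ =
      2 * Real.pi * Real.log ‖1 - w * κ‖ :=
  integral_poissonWeight_mul hκ (f := fun z => Real.log ‖1 - w * z‖) fun z hz =>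
    AnalyticAt.harmonicAt_log_norm (by fun_prop) (one_sub_mul_ne_zero hw (by simpa using hz))

theorem intervalIntegrable_log_norm_one_sub (w : ℂ) :
    IntervalIntegrable (fun ψ => Real.log ‖1 - w * circleMap 0 1 ψ‖) volume 0 (2 * Real.pi) :=
  MeromorphicOn.circleIntegrable_log_norm (f := fun z => 1 - w * z) (c := 0) (R := 1)
    (fun z _ => by fun_prop)

theorem ae_one_sub_mul_circleMap_ne_zero (w : ℂ) :
    ∀ᵐ ψ : ℝ, 1 - w * circleMap 0 1 ψ ≠ 0 := by
  have h : Set.Countable (circleMap 0 1 ⁻¹' {w⁻¹}) :=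
    (Set.countable_singleton w⁻¹).preimage_circleMap 0 one_ne_zero
  filter_upwards [h.ae_notMem volume] with ψ hψ h0
  refine hψ ?_
  rw [Set.mem_preimage, Set.mem_singleton_iff]
  exact (eq_inv_of_mul_eq_one_right (sub_eq_zero.mp h0).symm)

/-- A lower bound uniform in t: it provides the integrable majorant of log |1 - t u| when t tends to
1. -/
theorem half_norm_one_sub_le {u : ℂ} (hu : ‖u‖ = 1) {t : ℝ} (ht0 : 0 ≤ t) (ht1 : t ≤ 1) :
    ‖1 - u‖ / 2 ≤ ‖1 - t * u‖ := by
  have h1 : ‖(t : ℂ) * u‖ = t := by rw [norm_mul, hu, Complex.norm_real]; simp [abs_of_nonneg ht0]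
  have h2 : 1 - t ≤ ‖1 - t * u‖ := by
    have := norm_sub_norm_le (1 : ℂ) (t * u)
    rwa [h1, norm_one] at this
  have h3 : ‖1 - u‖ ≤ ‖1 - t * u‖ + (1 - t) := by
    have e : 1 - u = (1 - t * u) + ((t - 1 : ℝ) : ℂ) * u := by push_cast; ring
    rw [e]
    refine (norm_add_le _ _).trans ?_
    rw [norm_mul, hu, Complex.norm_real, mul_one, Real.norm_eq_abs, abs_of_nonpos (by linarith)]
    linarith
  linarith

/-- For |w| < 1 the function log |1 - w z| is harmonic near the closed disc and the Poisson formula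
applies. For |w| = 1, the case needed on the segment itself, w is approached by t w with t < 1 and
dominated convergence is used. -/
theorem integral_poissonWeight_mul_log (hκ : |κ| < 1) {w : ℂ} (hw : ‖w‖ ≤ 1) :
    ∫ ψ in (0 : ℝ)..2 * Real.pi, poissonWeight κ ψ * Real.log ‖1 - w * circleMap 0 1 ψ‖ =
      2 * Real.pi * Real.log ‖1 - w * κ‖ := by
  rcases hw.lt_or_eq with hw | hw
  · exact integral_poissonWeight_mul_log_of_lt hκ hw
  have hw0 : w ≠ 0 := by rintro rfl; simp at hw
  have hκ' : 1 - w * (κ : ℂ) ≠ 0 := by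
    rw [mul_comm]; exact one_sub_mul_ne_zero (by simpa using hκ) hw.le
  have hcont := continuous_poissonWeight hκ
  have hlim : Tendsto (fun t : ℝ => 2 * Real.pi * Real.log ‖1 - (t * w) * (κ : ℂ)‖) (𝓝[<] 1)
      (𝓝 (2 * Real.pi * Real.log ‖1 - w * κ‖)) := by
    have : ContinuousAt (fun t : ℝ => 2 * Real.pi * Real.log ‖1 - (t * w) * (κ : ℂ)‖) 1 := by
      refine ContinuousAt.mul continuousAt_const (ContinuousAt.log (by fun_prop) ?_)
      simpa using hκ'
    have h := this.tendsto
    simp only [Complex.ofReal_one, one_mul] at h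
    exact h.mono_left nhdsWithin_le_nhds
  have hI : ∀ᶠ t : ℝ in 𝓝[<] 1, t ∈ Set.Ioo (0 : ℝ) 1 := Ioo_mem_nhdsLT zero_lt_one
  refine tendsto_nhds_unique (f := fun t : ℝ => ∫ ψ in (0 : ℝ)..2 * Real.pi,
    poissonWeight κ ψ * Real.log ‖1 - (t * w) * circleMap 0 1 ψ‖) (l := 𝓝[<] 1) ?_ ?_
  · refine intervalIntegral.tendsto_integral_filter_of_dominated_convergence
      (fun ψ => poissonWeight κ ψ * (Real.log 2 + |Real.log ‖1 - w * circleMap 0 1 ψ‖|))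
      ?_ ?_ ?_ ?_
    · refine Eventually.of_forall fun t => Measurable.aestronglyMeasurable ?_
      exact hcont.measurable.mul (Real.measurable_log.comp (by fun_prop))
    · filter_upwards [hI] with t ht
      filter_upwards [ae_one_sub_mul_circleMap_ne_zero w] with ψ hψ _
      rw [norm_mul, Real.norm_eq_abs, abs_of_pos (poissonWeight_pos hκ ψ)]
      refine mul_le_mul_of_nonneg_left ?_ (poissonWeight_pos hκ ψ).le
      have hu : ‖w * circleMap 0 1 ψ‖ = 1 := by rw [norm_mul, hw]; simp
      have h1 := half_norm_one_sub_le hu ht.1.le ht.2.le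
      rw [← mul_assoc] at h1
      have h0 : 0 < ‖1 - w * circleMap 0 1 ψ‖ := norm_pos_iff.mpr hψ
      have h2 : ‖1 - t * w * circleMap 0 1 ψ‖ ≤ 2 := by
        refine (norm_sub_le _ _).trans ?_
        rw [mul_assoc, norm_mul, hu, norm_one, Complex.norm_real, Real.norm_eq_abs,
          abs_of_pos ht.1]
        linarith [ht.2]
      have h3 := Real.log_le_log (by positivity) h1
      rw [Real.log_div h0.ne' two_ne_zero] at h3
      have h4 := Real.log_le_log (lt_of_lt_of_le (by positivity) h1) h2
      rw [Real.norm_eq_abs, abs_le]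
      have := neg_abs_le (Real.log ‖1 - w * circleMap 0 1 ψ‖)
      have := abs_nonneg (Real.log ‖1 - w * circleMap 0 1 ψ‖)
      constructor <;> linarith
    · exact (intervalIntegrable_const.add (intervalIntegrable_log_norm_one_sub w).abs).continuousOn_mul
        hcont.continuousOn
    · filter_upwards [ae_one_sub_mul_circleMap_ne_zero w] with ψ hψ _
      have : ContinuousAt (fun t : ℝ => poissonWeight κ ψ *
          Real.log ‖1 - (t * w) * circleMap 0 1 ψ‖) 1 := by
        refine ContinuousAt.mul continuousAt_const (ContinuousAt.log (by fun_prop) ?_)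
        simpa using hψ
      have h := this.tendsto
      simp only [Complex.ofReal_one, one_mul] at h
      exact h.mono_left nhdsWithin_le_nhds
  · refine hlim.congr' ?_
    filter_upwards [hI] with t ht
    refine (integral_poissonWeight_mul_log_of_lt hκ (w := t * w) ?_).symm
    rw [norm_mul, hw, Complex.norm_real, Real.norm_eq_abs, abs_of_pos ht.1, mul_one]
    exact ht.2

/-- With ζ = exp(iψ) one has 2 cos ψ = ζ + 1/ζ, hence 2w (Z - cos ψ) = (1 - wζ)(1 - w/ζ); the second
factor has the modulus of 1 - w̄ζ by conjugation. -/
theorem abs_sub_cos_mul {w : ℂ} (hw0 : w ≠ 0) {Z : ℝ} (hZ : 2 * (Z : ℂ) = w + w⁻¹) (ψ : ℝ) :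
    |Z - Real.cos ψ| * (2 * ‖w‖) =
      ‖1 - w * circleMap 0 1 ψ‖ * ‖1 - (starRingEnd ℂ) w * circleMap 0 1 ψ‖ := by
  have hconj : ‖1 - w * (circleMap 0 1 ψ)⁻¹‖ = ‖1 - (starRingEnd ℂ) w * circleMap 0 1 ψ‖ := by
    rw [← Complex.norm_conj]
    have : (starRingEnd ℂ) (circleMap 0 1 ψ)⁻¹ = circleMap 0 1 ψ := by
      rw [Complex.inv_def, map_mul, Complex.conj_conj, Complex.normSq_eq_norm_sq]
      simp
    simp [this]
  rw [← hconj, ← norm_mul, ← Real.norm_eq_abs, ← Complex.norm_real, ← Complex.norm_ofNat,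
    ← norm_mul, ← norm_mul]
  congr 1
  have hc : circleMap 0 1 ψ ≠ 0 := circleMap_ne_center one_ne_zero
  have hcos : 2 * (Real.cos ψ : ℂ) = circleMap 0 1 ψ + (circleMap 0 1 ψ)⁻¹ := by
    rw [Complex.ofReal_cos, Complex.two_cos]
    simp [circleMap, ← Complex.exp_neg]
  have e1 : ((Z - Real.cos ψ : ℝ) : ℂ) * (2 * w) =
      (2 * (Z : ℂ) - 2 * (Real.cos ψ : ℂ)) * w := by push_cast; ring
  rw [e1, hZ, hcos]
  field_simp
  ring

/-- The logarithmic potential of the Poisson kernel pushed to a segment. -/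
theorem integral_poissonWeight_mul_log_sub_cos (hκ : |κ| < 1) {w : ℂ} (hw0 : w ≠ 0)
    (hw : ‖w‖ ≤ 1) {Z r : ℝ} (hr : 0 < r) (hZ : 2 * (Z : ℂ) = w + w⁻¹) :
    ∫ ψ in (0 : ℝ)..2 * Real.pi, poissonWeight κ ψ * Real.log (r * (Z - Real.cos ψ)) =
      2 * Real.pi * (2 * Real.log ‖1 - w * κ‖ + Real.log r - Real.log 2 - Real.log ‖w‖) := by
  have hcont := continuous_poissonWeight hκ
  have hnw : 0 < ‖w‖ := norm_pos_iff.mpr hw0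
  have e : ∀ᵐ ψ : ℝ, ψ ∈ Set.uIoc 0 (2 * Real.pi) →
      poissonWeight κ ψ * Real.log (r * (Z - Real.cos ψ)) =
      (poissonWeight κ ψ * Real.log ‖1 - w * circleMap 0 1 ψ‖ +
      poissonWeight κ ψ * Real.log ‖1 - (starRingEnd ℂ) w * circleMap 0 1 ψ‖) +
      poissonWeight κ ψ * (Real.log r - Real.log 2 - Real.log ‖w‖) := by
    filter_upwards [ae_one_sub_mul_circleMap_ne_zero w,
      ae_one_sub_mul_circleMap_ne_zero ((starRingEnd ℂ) w)] with ψ h1 h2 _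
    have h1' := norm_ne_zero_iff.mpr h1
    have h2' := norm_ne_zero_iff.mpr h2
    have hid := abs_sub_cos_mul hw0 hZ ψ
    have h0 : |Z - Real.cos ψ| ≠ 0 := fun h => by
      rw [h, zero_mul] at hid
      exact mul_ne_zero h1' h2' hid.symm
    have h3 := congrArg Real.log hid
    rw [Real.log_mul h0 (by positivity), Real.log_mul two_ne_zero hnw.ne',
      Real.log_mul h1' h2', Real.log_abs] at h3
    rw [← mul_add, ← mul_add, Real.log_mul hr.ne' (by simpa using h0)]
    congr 1
    linarith
  have i1 := (intervalIntegrable_log_norm_one_sub w).continuousOn_mul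
    (hcont.continuousOn (s := Set.uIcc 0 (2 * Real.pi)))
  have i2 := (intervalIntegrable_log_norm_one_sub ((starRingEnd ℂ) w)).continuousOn_mul
    (hcont.continuousOn (s := Set.uIcc 0 (2 * Real.pi)))
  have i3 := (hcont.intervalIntegrable (μ := volume) 0 (2 * Real.pi)).mul_const
    (Real.log r - Real.log 2 - Real.log ‖w‖)
  have hk : ‖1 - (starRingEnd ℂ) w * (κ : ℂ)‖ = ‖1 - w * κ‖ := by
    rw [← Complex.norm_conj]; simp
  rw [intervalIntegral.integral_congr_ae e, intervalIntegral.integral_add (i1.add i2) i3,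
    intervalIntegral.integral_add i1 i2, integral_poissonWeight_mul_log hκ hw,
    integral_poissonWeight_mul_log hκ (by simpa using hw), hk,
    intervalIntegral.integral_mul_const, integral_poissonWeight hκ]
  ring

end

end Hexagon

namespace Hexagon

/-! ### Densities with known potential -/

/-- `f` has total mass `M`, and `H` is the derivative of its logarithmic potential. -/
structure HasTransform (f : ℝ → ℝ) (M : ℝ) (H : ℝ → ℝ) : Prop where
  integrable : Integrable f
  integrable_log : ∀ z, Integrable fun u => Real.log (z - u) * f u
  mass : ∫ u, f u = M
  intervalIntegrable : ∀ z₁ z₂, IntervalIntegrable H volume z₁ z₂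
  pot_sub : ∀ z₁ z₂, pot f z₂ - pot f z₁ = ∫ z in z₁..z₂, H z

namespace HasTransform

variable {f g : ℝ → ℝ} {M N : ℝ} {H G : ℝ → ℝ}

theorem add (hf : HasTransform f M H) (hg : HasTransform g N G) :
    HasTransform (fun u => f u + g u) (M + N) (fun z => H z + G z) := by
  refine ⟨hf.integrable.add hg.integrable, fun z => ?_, ?_, fun a b =>
    (hf.intervalIntegrable a b).add (hg.intervalIntegrable a b), fun a b => ?_⟩
  · simp_rw [mul_add]
    exact (hf.integrable_log z).add (hg.integrable_log z)
  · rw [integral_add hf.integrable hg.integrable, hf.mass, hg.mass]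
  · rw [intervalIntegral.integral_add (hf.intervalIntegrable a b) (hg.intervalIntegrable a b),
      ← hf.pot_sub, ← hg.pot_sub]
    have : ∀ z, pot (fun u => f u + g u) z = pot f z + pot g z := fun z => by
      simp_rw [pot, mul_add]
      exact integral_add (hf.integrable_log z) (hg.integrable_log z)
    rw [this, this]
    ring

theorem const_mul (hf : HasTransform f M H) (c : ℝ) :
    HasTransform (fun u => c * f u) (c * M) (fun z => c * H z) := by
  refine ⟨hf.integrable.const_mul c, fun z => ?_, ?_, fun a b =>
    (hf.intervalIntegrable a b).const_mul c, fun a b => ?_⟩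
  · simp_rw [mul_left_comm _ c]
    exact (hf.integrable_log z).const_mul c
  · rw [integral_const_mul, hf.mass]
  · rw [intervalIntegral.integral_const_mul, ← hf.pot_sub]
    have : ∀ z, pot (fun u => c * f u) z = c * pot f z := fun z => by
      simp_rw [pot, mul_left_comm _ c]
      exact integral_const_mul _ _
    rw [this, this]
    ring

theorem sub (hf : HasTransform f M H) (hg : HasTransform g N G) :
    HasTransform (fun u => f u - g u) (M - N) (fun z => H z - G z) := by
  have := hf.add (hg.const_mul (-1))
  simpa [sub_eq_add_neg] using this

theorem congr (hf : HasTransform f M H) (hfg : f =ᵐ[volume] g) (hHG : H =ᵐ[volume] G) :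
    HasTransform g M G := by
  have hl : ∀ z, (fun u => Real.log (z - u) * f u) =ᵐ[volume] fun u => Real.log (z - u) * g u :=
    fun z => hfg.mono fun u hu => by simp only [hu]
  refine ⟨hf.integrable.congr hfg, fun z => (hf.integrable_log z).congr (hl z), ?_,
    fun a b => (hf.intervalIntegrable a b).congr_ae (ae_restrict_of_ae hHG), fun a b => ?_⟩
  · rw [← integral_congr_ae hfg, hf.mass]
  · have : ∀ z, pot g z = pot f z := fun z => (integral_congr_ae (hl z)).symm
    rw [this, this, hf.pot_sub]
    exact intervalIntegral.integral_congr_ae (hHG.mono fun z hz _ => hz)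

end HasTransform

/-- The kernel depends on z - u only, so both sides are the same combination of integrals of log
over intervals. The integrated form stays valid across the singularities. -/
theorem integral_log_sub_sub (l s z₁ z₂ : ℝ) :
    (∫ u in l..s, Real.log (z₂ - u)) - (∫ u in l..s, Real.log (z₁ - u)) =
      ∫ z in z₁..z₂, (Real.log (z - l) - Real.log (z - s)) := by
  have hi : ∀ a b, IntervalIntegrable Real.log volume a b := fun _ _ =>
    intervalIntegral.intervalIntegrable_log'
  rw [intervalIntegral.integral_sub (intervalIntegrable_log_sub' l _ _)
    (intervalIntegrable_log_sub' s _ _), intervalIntegral.integral_comp_sub_left,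
    intervalIntegral.integral_comp_sub_left, intervalIntegral.integral_comp_sub_right,
    intervalIntegral.integral_comp_sub_right,
    intervalIntegral.integral_interval_sub_interval_comm (hi _ _) (hi _ _) (hi _ _),
    intervalIntegral.integral_symm, intervalIntegral.integral_symm (z₂ - l)]
  ring

theorem hasTransform_indicator {p q : ℝ} (h : p ≤ q) :
    HasTransform ((Set.Icc p q).indicator 1) (q - p)
      (fun z => Real.log (z - p) - Real.log (z - q)) := by
  have hm : ∀ z : ℝ, (fun u => Real.log (z - u) * (Set.Icc p q).indicator 1 u) =
      (Set.Icc p q).indicator fun u => Real.log (z - u) := fun z => by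
    ext u; unfold Set.indicator; split_ifs <;> simp
  have hp : ∀ z, pot ((Set.Icc p q).indicator 1) z = ∫ u in p..q, Real.log (z - u) := fun z => by
    rw [pot, hm, integral_indicator measurableSet_Icc, integral_Icc_eq_integral_Ioc,
      intervalIntegral.integral_of_le h]
  refine ⟨?_, fun z => ?_, ?_, fun a b => (intervalIntegrable_log_sub' _ _ _).sub
    (intervalIntegrable_log_sub' _ _ _), fun a b => ?_⟩
  · exact (integrable_indicator_iff measurableSet_Icc).mpr (by simp [Pi.one_def])
  · rw [hm]
    exact (integrable_indicator_iff measurableSet_Icc).mpr (integrableOn_log_sub z p q)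
  · rw [integral_indicator_one measurableSet_Icc, Real.volume_real_Icc_of_le h]
  · rw [hp, hp, integral_log_sub_sub]

/-! ### Superpositions of intervals and their potentials -/

section Mixture

variable {ν : Measure ℝ} {P s : ℝ → ℝ} {l b : ℝ}

/-- A mixture of indicator functions of intervals with a common left end. -/
noncomputable def mixture (ν : Measure ℝ) (P s : ℝ → ℝ) (l u : ℝ) : ℝ :=
  ∫ ψ, P ψ * (Set.Icc l (s ψ)).indicator 1 u ∂ν

theorem integrable_mixture_prod (hP : Integrable P ν) (hs : Measurable s)
    (hb : ∀ ψ, s ψ ≤ b) {φ : ℝ → ℝ} (hφ : IntegrableOn φ (Set.Icc l b)) :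
    Integrable (fun x : ℝ × ℝ => φ x.1 * (P x.2 * (Set.Icc l (s x.2)).indicator 1 x.1))
      (volume.prod ν) := by
  have h1 : Integrable ((Set.Icc l b).indicator φ) :=
    (integrable_indicator_iff measurableSet_Icc).mpr hφ
  have h2 := (h1.mul_prod hP).indicator (s := {x : ℝ × ℝ | l ≤ x.1 ∧ x.1 ≤ s x.2})
    ((measurableSet_le measurable_const measurable_fst).inter
      (measurableSet_le measurable_fst (hs.comp measurable_snd)))
  refine h2.congr (ae_of_all _ fun x => ?_)
  dsimp only
  by_cases hx : l ≤ x.1 ∧ x.1 ≤ s x.2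
  · have hx' : x.1 ∈ Set.Icc l (s x.2) := hx
    have hx'' : x.1 ∈ Set.Icc l b := ⟨hx.1, hx.2.trans (hb _)⟩
    rw [Set.indicator_of_mem (by exact hx), Set.indicator_of_mem hx', Set.indicator_of_mem hx'']
    simp
  · have hx' : x.1 ∉ Set.Icc l (s x.2) := hx
    rw [Set.indicator_of_notMem (by exact hx), Set.indicator_of_notMem hx']
    simp

variable [SFinite ν]

theorem integrable_mul_mixture (hP : Integrable P ν) (hs : Measurable s) (hb : ∀ ψ, s ψ ≤ b)
    {φ : ℝ → ℝ} (hφ : IntegrableOn φ (Set.Icc l b)) :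
    Integrable fun u => φ u * mixture ν P s l u := by
  refine (integrable_mixture_prod hP hs hb hφ).integral_prod_left.congr (ae_of_all _ fun u => ?_)
  dsimp only
  rw [integral_const_mul, mixture]

theorem integral_mul_mixture (hP : Integrable P ν) (hs : Measurable s) (hl : ∀ ψ, l ≤ s ψ)
    (hb : ∀ ψ, s ψ ≤ b) {φ : ℝ → ℝ} (hφ : IntegrableOn φ (Set.Icc l b)) :
    ∫ u, φ u * mixture ν P s l u = ∫ ψ, P ψ * (∫ u in l..s ψ, φ u) ∂ν := by
  have h1 := integral_integral_swap (f := fun u ψ => φ u * (P ψ * (Set.Icc l (s ψ)).indicator 1 u))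
    (integrable_mixture_prod hP hs hb hφ)
  simp_rw [integral_const_mul] at h1
  simp_rw [mixture]
  rw [h1]
  refine integral_congr_ae (ae_of_all _ fun ψ => ?_)
  dsimp only
  rw [intervalIntegral.integral_of_le (hl ψ), ← integral_Icc_eq_integral_Ioc,
    ← integral_indicator measurableSet_Icc, ← integral_const_mul]
  congr 1
  ext u
  unfold Set.indicator
  split_ifs <;> simp [mul_comm]

/-- After translation by s ψ the logarithm is integrated over an interval inside [-K, K], which
bounds its integral uniformly in ψ. -/
theorem integrable_log_sub_prod (hP : Integrable P ν) (hs : Measurable s) (hl : ∀ ψ, l ≤ s ψ)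
    (hb : ∀ ψ, s ψ ≤ b) (z₁ z₂ : ℝ) :
    Integrable (fun x : ℝ × ℝ => P x.2 * Real.log (x.1 - s x.2))
      ((volume.restrict (Set.uIoc z₁ z₂)).prod ν) := by
  have hmeas : AEStronglyMeasurable (fun x : ℝ × ℝ => P x.2 * Real.log (x.1 - s x.2))
      ((volume.restrict (Set.uIoc z₁ z₂)).prod ν) :=
    hP.aestronglyMeasurable.comp_snd.mul (Measurable.aestronglyMeasurable (by fun_prop))
  have hi : ∀ c, IntegrableOn (fun z => Real.log (z - c)) (Set.uIoc z₁ z₂) := fun c =>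
    intervalIntegrable_iff.mp (intervalIntegrable_log_sub' c z₁ z₂)
  rw [integrable_prod_iff' hmeas]
  refine ⟨ae_of_all _ fun ψ => (hi (s ψ)).const_mul (P ψ), ?_⟩
  set K : ℝ := |z₁| + |z₂| + |l| + |b| with hK
  have hlog : IntegrableOn (fun t => |Real.log t|) (Set.Icc (-K) K) := by
    have := (integrableOn_log_sub 0 (-K) K).abs
    simpa [IntegrableOn] using this
  refine Integrable.mono' (hP.abs.mul_const (∫ t in Set.Icc (-K) K, |Real.log t|))
    hmeas.norm.prod_swap.integral_prod_right' (ae_of_all _ fun ψ => ?_)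
  rw [Real.norm_eq_abs, abs_of_nonneg (integral_nonneg fun _ => norm_nonneg _)]
  simp_rw [norm_mul, Real.norm_eq_abs]
  rw [integral_const_mul]
  refine mul_le_mul_of_nonneg_left ?_ (abs_nonneg _)
  have e1 : ∫ z in Set.uIoc z₁ z₂, |Real.log (z - s ψ)| =
      ∫ t in Set.uIoc (z₁ - s ψ) (z₂ - s ψ), |Real.log t| := by
    rw [Set.uIoc, Set.uIoc, ← intervalIntegral.integral_of_le min_le_max,
      ← intervalIntegral.integral_of_le min_le_max,
      intervalIntegral.integral_comp_sub_right (fun t => |Real.log t|), min_sub_sub_right,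
      max_sub_sub_right]
  rw [e1]
  refine setIntegral_mono_set hlog (ae_of_all _ fun _ => abs_nonneg _) (LE.le.eventuallyLE ?_)
  intro t ht
  have h1 := hl ψ
  have h2 := hb ψ
  have := neg_abs_le z₁
  have := neg_abs_le z₂
  have := neg_abs_le l
  have := neg_abs_le b
  have := le_abs_self z₁
  have := le_abs_self z₂
  have := le_abs_self l
  have := le_abs_self b
  rw [Set.mem_uIoc] at ht
  rcases ht with ht | ht <;> constructor <;> linarith [ht.1, ht.2]

/-- By Fubini this averages the case of one interval, whose transform is log (z - l) - log (z - s).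
The transform of a mixture is thus again a logarithmic potential, now of the law of the right end
points. -/
theorem hasTransform_mixture (hP : Integrable P ν) (hs : Measurable s) (hl : ∀ ψ, l ≤ s ψ)
    (hb : ∀ ψ, s ψ ≤ b) :
    HasTransform (mixture ν P s l) (∫ ψ, P ψ * (s ψ - l) ∂ν)
      (fun z => (∫ ψ, P ψ ∂ν) * Real.log (z - l) - ∫ ψ, P ψ * Real.log (z - s ψ) ∂ν) := by
  have h1 : IntegrableOn (fun _ : ℝ => (1 : ℝ)) (Set.Icc l b) := by simp
  have hlog : ∀ z, IntegrableOn (fun u => Real.log (z - u)) (Set.Icc l b) := fun z =>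
    integrableOn_log_sub z l b
  have hprod := fun z₁ z₂ => integrable_log_sub_prod hP hs hl hb z₁ z₂
  have hii : ∀ z₁ z₂, IntervalIntegrable (fun z => ∫ ψ, P ψ * Real.log (z - s ψ) ∂ν)
      volume z₁ z₂ := fun z₁ z₂ => by
    rw [intervalIntegrable_iff]
    exact (hprod z₁ z₂).integral_prod_left
  have hll : ∀ z₁ z₂, IntervalIntegrable (fun z => (∫ ψ, P ψ ∂ν) * Real.log (z - l))
      volume z₁ z₂ := fun z₁ z₂ => (intervalIntegrable_log_sub' l z₁ z₂).const_mul _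
  refine ⟨?_, fun z => integrable_mul_mixture hP hs hb (hlog z), ?_,
    fun z₁ z₂ => (hll z₁ z₂).sub (hii z₁ z₂), fun z₁ z₂ => ?_⟩
  · simpa using integrable_mul_mixture hP hs hb h1
  · simpa using integral_mul_mixture hP hs hl hb h1
  · rw [pot, pot, integral_mul_mixture hP hs hl hb (hlog z₂),
      integral_mul_mixture hP hs hl hb (hlog z₁),
      intervalIntegral.integral_sub (hll z₁ z₂) (hii z₁ z₂),
      intervalIntegral.integral_const_mul,
      intervalIntegral_integral_swap (f := fun z ψ => P ψ * Real.log (z - s ψ)) (hprod z₁ z₂)]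
    have i1 : ∀ z, Integrable (fun ψ => P ψ * ∫ u in l..s ψ, Real.log (z - u)) ν := fun z => by
      refine (integrable_mixture_prod hP hs hb (hlog z)).integral_prod_right.congr
        (ae_of_all _ fun ψ => ?_)
      dsimp only
      rw [intervalIntegral.integral_of_le (hl ψ), ← integral_Icc_eq_integral_Ioc,
        ← integral_indicator measurableSet_Icc, ← integral_const_mul]
      congr 1
      ext u
      unfold Set.indicator
      split_ifs <;> simp [mul_comm]
    have i2 : Integrable (fun ψ => ∫ z in z₁..z₂, P ψ * Real.log (z - s ψ)) ν := by
      have := (hprod z₁ z₂).integral_prod_right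
      simp_rw [intervalIntegral.intervalIntegral_eq_integral_uIoc, smul_eq_mul]
      exact this.const_mul _
    rw [← integral_sub (i1 z₂) (i1 z₁), ← integral_mul_const, ← integral_sub (hP.mul_const _) i2]
    refine integral_congr_ae (ae_of_all _ fun ψ => ?_)
    dsimp only
    rw [← mul_sub, integral_log_sub_sub, intervalIntegral.integral_sub
      (intervalIntegrable_log_sub' _ _ _) (intervalIntegrable_log_sub' _ _ _),
      intervalIntegral.integral_const_mul, mul_sub]

end Mixture

end Hexagon

namespace Hexagon

/-! ### The image of the Poisson kernel on a segment -/

section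

variable {κ : ℝ}

/-- The half-angle primitive of the Poisson kernel; this is where the arctangents of the density
originate. -/
theorem hasDerivAt_arctan_tan_half (hκ : |κ| < 1) {ψ : ℝ} (h1 : -Real.pi < ψ) (h2 : ψ < Real.pi) :
    HasDerivAt (fun ψ => 2 * Real.arctan ((1 + κ) / (1 - κ) * Real.tan (ψ / 2)))
      (poissonWeight κ ψ) ψ := by
  have hκ' := abs_lt.mp hκ
  have hc : 0 < Real.cos (ψ / 2) := Real.cos_pos_of_mem_Ioo ⟨by linarith, by linarith⟩
  have ht : HasDerivAt (fun ψ => Real.tan (ψ / 2)) (1 / Real.cos (ψ / 2) ^ 2 * (1 / 2)) ψ :=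
    HasDerivAt.comp (h₂ := Real.tan) ψ (Real.hasDerivAt_tan hc.ne') ((hasDerivAt_id' ψ).div_const 2)
  have h := ((ht.const_mul ((1 + κ) / (1 - κ))).arctan).const_mul 2
  refine h.congr_deriv ?_
  have e : Real.cos ψ = 2 * Real.cos (ψ / 2) ^ 2 - 1 := by
    rw [← Real.cos_two_mul]; ring_nf
  have hd := poissonWeight_denom_pos hκ ψ
  have hs : Real.sin (ψ / 2) ^ 2 = 1 - Real.cos (ψ / 2) ^ 2 := Real.sin_sq _
  rw [e] at hd
  rw [poissonWeight, e, Real.tan_eq_sin_div_cos]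
  have h1κ : 1 - κ ≠ 0 := by linarith
  have hd2 : 1 + ((1 + κ) / (1 - κ) * (Real.sin (ψ / 2) / Real.cos (ψ / 2))) ^ 2 =
      (1 + κ ^ 2 - 2 * κ * (2 * Real.cos (ψ / 2) ^ 2 - 1)) /
        ((1 - κ) ^ 2 * Real.cos (ψ / 2) ^ 2) := by
    rw [mul_pow, div_pow, div_pow, hs]
    field_simp
    ring
  rw [hd2]
  field_simp
  ring

/-- Over the period (-π, π] the condition on the cosines is |ψ| ≤ φ, and the primitive is odd. -/
theorem integral_poissonWeight_indicator (hκ : |κ| < 1) {φ : ℝ} (h0 : 0 < φ) (h1 : φ < Real.pi) :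
    ∫ ψ in (0 : ℝ)..2 * Real.pi, (if Real.cos φ ≤ Real.cos ψ then poissonWeight κ ψ else 0) =
      4 * Real.arctan ((1 + κ) / (1 - κ) * Real.tan (φ / 2)) := by
  have hper : Function.Periodic (fun ψ => if Real.cos φ ≤ Real.cos ψ then poissonWeight κ ψ else 0)
      (2 * Real.pi) := fun ψ => by simp [poissonWeight_periodic κ ψ]
  have e1 := hper.intervalIntegral_add_eq 0 (-Real.pi)
  rw [zero_add, show -Real.pi + 2 * Real.pi = Real.pi by ring] at e1
  rw [e1]
  have hiff : ∀ ψ ∈ Set.Ioc (-Real.pi) Real.pi,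
      (Real.cos φ ≤ Real.cos ψ ↔ ψ ∈ Set.Icc (-φ) φ) := by
    intro ψ hψ
    rw [← Real.cos_abs ψ, Set.mem_Icc, ← abs_le]
    exact Real.strictAntiOn_cos.le_iff_ge ⟨h0.le, h1.le⟩
      ⟨abs_nonneg ψ, abs_le.mpr ⟨hψ.1.le, hψ.2⟩⟩
  have e2 : ∫ ψ in -Real.pi..Real.pi, (if Real.cos φ ≤ Real.cos ψ then poissonWeight κ ψ else 0) =
      ∫ ψ in -φ..φ, poissonWeight κ ψ := by
    rw [intervalIntegral.integral_of_le (by linarith), intervalIntegral.integral_of_le (by linarith),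
      ← integral_Icc_eq_integral_Ioc (x := -φ)]
    have : Set.Icc (-φ) φ = Set.Ioc (-Real.pi) Real.pi ∩ Set.Icc (-φ) φ :=
      (Set.inter_eq_right.mpr fun ψ (hψ : ψ ∈ Set.Icc (-φ) φ) =>
        Set.mem_Ioc.mpr ⟨by linarith [hψ.1], by linarith [hψ.2]⟩).symm
    rw [this, ← setIntegral_indicator measurableSet_Icc]
    refine setIntegral_congr_fun measurableSet_Ioc fun ψ hψ => ?_
    simp only [Set.indicator, hiff ψ hψ]
    congr
  rw [e2, intervalIntegral.integral_eq_sub_of_hasDerivAt (f := fun ψ =>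
    2 * Real.arctan ((1 + κ) / (1 - κ) * Real.tan (ψ / 2)))]
  · rw [neg_div, Real.tan_neg, mul_neg, Real.arctan_neg]
    ring
  · intro ψ hψ
    rw [Set.uIcc_of_le (by linarith)] at hψ
    exact hasDerivAt_arctan_tan_half hκ (by linarith [hψ.1]) (by linarith [hψ.2])
  · exact (continuous_poissonWeight hκ).intervalIntegrable _ _

/-- The square root in the density is the tangent of half the angle φ with u = m + r cos φ. -/
theorem sqrt_div_eq_tan_half {m r u : ℝ} (hr : 0 < r) (h1 : m - r < u) (h2 : u < m + r) :
    ∃ φ, 0 < φ ∧ φ < Real.pi ∧ u = m + r * Real.cos φ ∧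
      √((m + r - u) / (u - (m - r))) = Real.tan (φ / 2) := by
  have e1 : -1 < (u - m) / r := by rw [lt_div_iff₀ hr]; linarith
  have e2 : (u - m) / r < 1 := by rw [div_lt_iff₀ hr]; linarith
  have hc := Real.cos_arccos e1.le e2.le
  have h0 : 0 < Real.arccos ((u - m) / r) := Real.arccos_pos.mpr e2
  have hpi : Real.arccos ((u - m) / r) < Real.pi := by
    refine lt_of_le_of_ne (Real.arccos_le_pi _) fun h => ?_
    rw [h, Real.cos_pi] at hc
    linarith
  set φ := Real.arccos ((u - m) / r)
  have hu : u = m + r * Real.cos φ := by rw [hc]; field_simp; ring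
  refine ⟨φ, h0, hpi, hu, ?_⟩
  have hcp : 0 < Real.cos (φ / 2) := Real.cos_pos_of_mem_Ioo ⟨by linarith, by linarith⟩
  have ht : 0 < Real.tan (φ / 2) := Real.tan_pos_of_pos_of_lt_pi_div_two (by linarith) (by linarith)
  have e : Real.cos φ = 2 * Real.cos (φ / 2) ^ 2 - 1 := by
    rw [← Real.cos_two_mul]; ring_nf
  have hs : Real.sin (φ / 2) ^ 2 = 1 - Real.cos (φ / 2) ^ 2 := Real.sin_sq _
  have h3 : (m + r - u) / (u - (m - r)) = Real.tan (φ / 2) ^ 2 := by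
    rw [Real.tan_eq_sin_div_cos, div_pow, hs, div_eq_div_iff (by linarith) (by positivity), hu, e]
    ring
  rw [h3, Real.sqrt_sq ht.le]

/-- The mixture of the indicator functions of the intervals from `l` to the points
`m + r * cos ψ`, weighted by half of the normalized Poisson kernel. -/
noncomputable def poissonMix (m r l κ : ℝ) : ℝ → ℝ :=
  mixture (volume.restrict (Set.Ioc 0 (2 * Real.pi)))
    (fun ψ => poissonWeight κ ψ * (4 * Real.pi)⁻¹) (fun ψ => m + r * Real.cos ψ) l

variable {m r l : ℝ}

theorem poissonMix_eq (m r l κ u : ℝ) : poissonMix m r l κ u = (∫ ψ in (0 : ℝ)..2 * Real.pi,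
    (if l ≤ u ∧ u ≤ m + r * Real.cos ψ then poissonWeight κ ψ else 0)) * (4 * Real.pi)⁻¹ := by
  rw [poissonMix, mixture, intervalIntegral.integral_of_le (by positivity), ← integral_mul_const]
  congr 1
  ext ψ
  simp only [Set.indicator, Set.mem_Icc, Pi.one_apply]
  split_ifs <;> ring

theorem poissonMix_of_lt {u : ℝ} (hu : u < l) : poissonMix m r l κ u = 0 := by
  rw [poissonMix_eq]
  simp [not_le.mpr hu]

theorem poissonMix_of_gt (hr : 0 < r) {u : ℝ} (hu : m + r < u) : poissonMix m r l κ u = 0 := by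
  have : ∀ ψ, ¬u ≤ m + r * Real.cos ψ := fun ψ => by
    have := mul_le_mul_of_nonneg_left (Real.cos_le_one ψ) hr.le
    intro h; linarith
  rw [poissonMix_eq]
  simp [this]

theorem poissonMix_of_le (hκ : |κ| < 1) (hr : 0 < r) {u : ℝ} (hl : l ≤ u) (hu : u ≤ m - r) :
    poissonMix m r l κ u = 1 / 2 := by
  have : ∀ ψ, u ≤ m + r * Real.cos ψ := fun ψ => by
    have := mul_le_mul_of_nonneg_left (Real.neg_one_le_cos ψ) hr.le
    linarith
  rw [poissonMix_eq]
  simp only [hl, this, and_self, if_true]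
  rw [integral_poissonWeight hκ]
  field_simp
  norm_num

theorem poissonMix_of_mem (hκ : |κ| < 1) (hr : 0 < r) {u : ℝ} (hl : l ≤ u) (h1 : m - r < u)
    (h2 : u < m + r) : poissonMix m r l κ u =
      Real.arctan ((1 + κ) / (1 - κ) * √((m + r - u) / (u - (m - r)))) / Real.pi := by
  obtain ⟨φ, h0, hpi, hu, ht⟩ := sqrt_div_eq_tan_half hr h1 h2
  have h3 : ∀ ψ, u ≤ m + r * Real.cos ψ ↔ Real.cos φ ≤ Real.cos ψ := fun ψ => by
    rw [hu, add_le_add_iff_left, mul_le_mul_iff_right₀ hr]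
  rw [poissonMix_eq, ht]
  simp only [hl, true_and, h3]
  rw [integral_poissonWeight_indicator hκ h0 hpi]
  field_simp

/-- The formula for H in the variable w covers the segment (|w| = 1) and its outside (w real, |w| <
1) at once, which is what later allows signs to be read off. -/
theorem hasTransform_poissonMix (hκ : |κ| < 1) (hr : 0 < r) (hl : l ≤ m - r) :
    ∃ H, HasTransform (poissonMix m r l κ) (1 / 2 * (m + r * κ - l)) H ∧
      (∀ (w : ℂ) (Z : ℝ), w ≠ 0 → ‖w‖ ≤ 1 → 2 * (Z : ℂ) = w + w⁻¹ →
        H (m + r * Z) = 1 / 2 * Real.log (m + r * Z - l) -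
          1 / 2 * (2 * Real.log ‖1 - w * κ‖ + Real.log r - Real.log 2 - Real.log ‖w‖)) := by
  have hcont := continuous_poissonWeight hκ
  have hP : Integrable (fun ψ => poissonWeight κ ψ * (4 * Real.pi)⁻¹)
      (volume.restrict (Set.Ioc 0 (2 * Real.pi))) :=
    (hcont.mul continuous_const).integrableOn_Ioc
  have h := hasTransform_mixture (s := fun ψ => m + r * Real.cos ψ) (l := l) (b := m + r) hP
    (by fun_prop) (fun ψ => by
      have := mul_le_mul_of_nonneg_left (Real.neg_one_le_cos ψ) hr.le
      linarith) (fun ψ => by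
      have := mul_le_mul_of_nonneg_left (Real.cos_le_one ψ) hr.le
      linarith)
  have e1 : ∫ ψ in Set.Ioc 0 (2 * Real.pi), poissonWeight κ ψ * (4 * Real.pi)⁻¹ = 1 / 2 := by
    rw [integral_mul_const, ← intervalIntegral.integral_of_le (by positivity),
      integral_poissonWeight hκ]
    field_simp
    norm_num
  have e2 : ∫ ψ in Set.Ioc 0 (2 * Real.pi),
      poissonWeight κ ψ * (4 * Real.pi)⁻¹ * (m + r * Real.cos ψ - l) =
      1 / 2 * (m + r * κ - l) := by
    have i1 := (hcont.intervalIntegrable (μ := volume) 0 (2 * Real.pi)).mul_const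
      ((4 * Real.pi)⁻¹ * (m - l))
    have i2 : IntervalIntegrable (fun ψ => poissonWeight κ ψ * Real.cos ψ * ((4 * Real.pi)⁻¹ * r))
        volume 0 (2 * Real.pi) :=
      ((hcont.mul Real.continuous_cos).intervalIntegrable _ _).mul_const _
    rw [← intervalIntegral.integral_of_le (by positivity)]
    calc _ = ∫ ψ in (0 : ℝ)..2 * Real.pi, (poissonWeight κ ψ * ((4 * Real.pi)⁻¹ * (m - l)) +
          poissonWeight κ ψ * Real.cos ψ * ((4 * Real.pi)⁻¹ * r)) := by
          congr 1; ext ψ; ring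
      _ = _ := by
          rw [intervalIntegral.integral_add i1 i2, intervalIntegral.integral_mul_const,
            intervalIntegral.integral_mul_const, integral_poissonWeight hκ,
            integral_poissonWeight_mul_cos hκ]
          field_simp
          ring
  rw [e1, e2] at h
  refine ⟨_, h, fun w Z hw0 hw hZ => ?_⟩
  congr 1
  rw [← intervalIntegral.integral_of_le (by positivity)]
  have e3 := integral_poissonWeight_mul_log_sub_cos hκ hw0 hw hr hZ
  calc _ = ∫ ψ in (0 : ℝ)..2 * Real.pi, poissonWeight κ ψ *
        Real.log (r * (Z - Real.cos ψ)) * (4 * Real.pi)⁻¹ := by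
        congr 1; ext ψ
        rw [show m + r * Z - (m + r * Real.cos ψ) = r * (Z - Real.cos ψ) by ring]
        ring
    _ = _ := by
        rw [intervalIntegral.integral_mul_const, e3]
        field_simp
        ring

end

end Hexagon

namespace Hexagon

/-! ### Building blocks of the density -/

section

variable {m r l κ : ℝ}

/-- The pole is the image of κ under w ↦ m + (r/2)(w + 1/w), so z minus the pole factors as -(r/2)(w
- κ)(1 - wκ)/(wκ). -/
theorem log_sub_pole (hr : 0 < r) (hκ : κ ≠ 0) {w : ℂ} {Z : ℝ} (hw0 : w ≠ 0)
    (hZ : 2 * (Z : ℂ) = w + w⁻¹) (h1 : w - κ ≠ 0) (h2 : 1 - w * κ ≠ 0) (m : ℝ) :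
    Real.log (m + r * Z - (m + r / 2 * (κ + 1 / κ))) =
      Real.log r - Real.log 2 - Real.log ‖w‖ + Real.log ‖w - κ‖ + Real.log ‖1 - w * κ‖ -
        Real.log κ := by
  have hκc : (κ : ℂ) ≠ 0 := by exact_mod_cast hκ
  have e : |m + r * Z - (m + r / 2 * (κ + 1 / κ))| * (2 * ‖w‖ * |κ|) =
      r * (‖w - κ‖ * ‖1 - w * κ‖) := by
    have e1 : ((m + r * Z - (m + r / 2 * (κ + 1 / κ)) : ℝ) : ℂ) * (2 * w * κ) =
        -(r * ((w - κ) * (1 - w * κ))) := by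
      push_cast
      have : (m : ℂ) + r * Z - (m + r / 2 * (κ + 1 / κ)) =
          r / 2 * (2 * (Z : ℂ) - (κ + 1 / κ)) := by ring
      rw [this, hZ]
      field_simp
      ring
    have e2 := congrArg norm e1
    simpa [abs_of_pos hr, -Complex.ofReal_sub, -Complex.ofReal_add] using e2
  have hk : 0 < |κ| := abs_pos.mpr hκ
  have hw : 0 < ‖w‖ := norm_pos_iff.mpr hw0
  have n1 : 0 < ‖w - κ‖ := norm_pos_iff.mpr h1
  have n2 : 0 < ‖1 - w * κ‖ := norm_pos_iff.mpr h2
  have h0 : |m + r * Z - (m + r / 2 * (κ + 1 / κ))| ≠ 0 := fun h => by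
    rw [h, zero_mul] at e
    exact (by positivity : r * (‖w - κ‖ * ‖1 - w * κ‖) ≠ 0) e.symm
  have e3 := congrArg Real.log e
  rw [Real.log_mul h0 (by positivity), Real.log_mul (by positivity) hk.ne',
    Real.log_mul two_ne_zero hw.ne', Real.log_mul hr.ne' (by positivity),
    Real.log_mul n1.ne' n2.ne', Real.log_abs, Real.log_abs] at e3
  linarith

/-- On the unit circle w - κ is w times the conjugate of 1 - wκ. -/
theorem norm_sub_eq_of_norm_eq_one {w : ℂ} (hw : ‖w‖ = 1) (κ : ℝ) : ‖w - κ‖ = ‖1 - w * κ‖ := by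
  have h : w * (starRingEnd ℂ) w = 1 := by
    rw [Complex.mul_conj, Complex.normSq_eq_norm_sq, hw]; simp
  have e : w - κ = w * (starRingEnd ℂ) (1 - w * κ) := by
    rw [map_sub, map_one, map_mul, Complex.conj_ofReal, mul_sub, ← mul_assoc, h]
    ring
  rw [e, norm_mul, hw, one_mul, Complex.norm_conj]

/-- The angle `arctan ((1 + κ) / (1 - κ) * t)`, continued through `κ = 1`. -/
noncomputable def upAngle (κ t : ℝ) : ℝ :=
  if κ < 1 then Real.arctan ((1 + κ) / (1 - κ) * t)
  else if κ = 1 then Real.pi / 2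
  else Real.pi - Real.arctan ((κ + 1) / (κ - 1) * t)

/-- The angle `arctan ((1 - κ) / (1 + κ) * t)`. -/
noncomputable def downAngle (κ t : ℝ) : ℝ := Real.arctan ((1 - κ) / (1 + κ) * t)

/-- A density that changes from `1 / 2` at the left of the segment to the value `0` or `1` at its
right end. -/
structure IsUpBlock (m r l κ : ℝ) (T H : ℝ → ℝ) : Prop where
  hasTransform : HasTransform T (1 / 2 * (m + r * κ - l)) H
  eq_of_lt : ∀ u, u < l → T u = 0
  eq_of_le : ∀ u, l ≤ u → u ≤ m - r → T u = 1 / 2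
  eq_of_mem : ∀ u, m - r < u → u < m + r →
    T u = upAngle κ √((m + r - u) / (u - (m - r))) / Real.pi
  eq_of_gt : ∀ u, m + r < u → u ≤ m + r / 2 * (κ + 1 / κ) → T u = if 1 < κ then 1 else 0
  eq_of_gt' : ∀ u, m + r / 2 * (κ + 1 / κ) < u → T u = 0
  eq_log : ∀ (w : ℂ) (Z : ℝ), w ≠ 0 → ‖w‖ ≤ 1 → 2 * (Z : ℂ) = w + w⁻¹ → w - κ ≠ 0 →
    1 - w * κ ≠ 0 → H (m + r * Z) = 1 / 2 * Real.log (m + r * Z - l) -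
      1 / 2 * (2 * Real.log ‖1 - w * κ‖ + Real.log r - Real.log 2 - Real.log ‖w‖)

theorem two_le_add_inv (hκ : 0 < κ) : 2 ≤ κ + 1 / κ := by
  have : κ + 1 / κ - 2 = (κ - 1) ^ 2 / κ := by field_simp; ring
  have h2 : 0 ≤ (κ - 1) ^ 2 / κ := by positivity
  linarith

theorem indicator_Icc_one {p q u : ℝ} :
    (Set.Icc p q).indicator (1 : ℝ → ℝ) u = if p ≤ u ∧ u ≤ q then 1 else 0 := by
  simp [Set.indicator, Set.mem_Icc]

/-- For κ < 1 the Poisson mixture works. When κ passes through 1 the pole touches the right end and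
the Poisson kernel degenerates. For κ > 1 one takes the interval up to the pole minus the mixture
with parameter 1/κ: the logarithm of the pole, contributed by the interval, turns |1 - w/κ| back
into |1 - wκ|, so the formula for H is the same in all cases. At κ = 1 half the indicator of [l, m +
r] serves. -/
theorem exists_isUpBlock (hr : 0 < r) (hl : l ≤ m - r) (hκ : 0 < κ) :
    ∃ T H, IsUpBlock m r l κ T H := by
  have hc : m + r ≤ m + r / 2 * (κ + 1 / κ) := by
    have := mul_le_mul_of_nonneg_left (two_le_add_inv hκ) (half_pos hr).le
    linarith
  rcases lt_trichotomy κ 1 with h | h | h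
  · have hκ' : |κ| < 1 := abs_lt.mpr ⟨by linarith, h⟩
    obtain ⟨H, hT, hH⟩ := hasTransform_poissonMix hκ' hr hl
    refine ⟨_, H, hT, fun u hu => poissonMix_of_lt hu,
      fun u hu hu' => poissonMix_of_le hκ' hr hu hu', fun u h1 h2 => ?_,
      fun u hu _ => ?_, fun u hu => poissonMix_of_gt hr (by linarith),
      fun w Z h0 h1 h2 _ _ => hH w Z h0 h1 h2⟩
    · rw [poissonMix_of_mem hκ' hr (by linarith) h1 h2, upAngle, if_pos h]
    · rw [poissonMix_of_gt hr hu, if_neg (by linarith)]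
  · subst h
    have hT := (hasTransform_indicator (p := l) (q := m + r) (by linarith)).const_mul (1 / 2)
    refine ⟨_, _, by convert hT using 1; ring, fun u hu => ?_, fun u hu hu' => ?_,
      fun u h1 h2 => ?_, fun u hu _ => ?_, fun u hu => ?_, fun w Z h0 h1 h2 h3 h4 => ?_⟩
    · rw [indicator_Icc_one, if_neg (by intro h; linarith [h.1]), mul_zero]
    · rw [indicator_Icc_one, if_pos ⟨hu, by linarith⟩, mul_one]
    · rw [indicator_Icc_one, if_pos ⟨by linarith, h2.le⟩, upAngle, if_neg (lt_irrefl _), if_pos rfl]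
      field_simp
    · rw [indicator_Icc_one, if_neg (by intro h; linarith [h.2]), if_neg (lt_irrefl _), mul_zero]
    · rw [indicator_Icc_one, if_neg (by intro h; linarith [h.2]), mul_zero]
    · have e := log_sub_pole hr one_ne_zero h0 h2 h3 h4 m
      have e1 : ‖w - (1 : ℝ)‖ = ‖1 - w * (1 : ℝ)‖ := by
        rw [← norm_neg]; congr 1; push_cast; ring
      rw [e1] at e
      rw [show m + r / 2 * (1 + 1 / 1) = m + r by ring, Real.log_one] at e
      rw [e]
      ring
  · have hκ' : |1 / κ| < 1 := by
      rw [abs_of_pos (by positivity), div_lt_one hκ]; exact h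
    obtain ⟨H, hT, hH⟩ := hasTransform_poissonMix hκ' hr hl
    have hT' := (hasTransform_indicator (p := l) (q := m + r / 2 * (κ + 1 / κ))
      (by linarith)).sub hT
    refine ⟨_, _, by convert hT' using 1; ring, fun u hu => ?_, fun u hu hu' => ?_,
      fun u h1 h2 => ?_, fun u hu hu' => ?_, fun u hu => ?_, fun w Z h0 h1 h2 h3 h4 => ?_⟩
    · rw [indicator_Icc_one, if_neg (by intro h; linarith [h.1]), poissonMix_of_lt hu, sub_zero]
    · rw [indicator_Icc_one, if_pos ⟨hu, by linarith⟩, poissonMix_of_le hκ' hr hu hu']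
      norm_num
    · rw [indicator_Icc_one, if_pos ⟨by linarith, by linarith⟩,
        poissonMix_of_mem hκ' hr (by linarith) h1 h2, upAngle, if_neg h.not_gt, if_neg h.ne']
      have : (1 + 1 / κ) / (1 - 1 / κ) = (κ + 1) / (κ - 1) := by
        have : κ - 1 ≠ 0 := by linarith
        field_simp
      rw [this]
      field_simp
    · rw [indicator_Icc_one, if_pos ⟨by linarith, hu'⟩, poissonMix_of_gt hr hu, if_pos h, sub_zero]
    · rw [indicator_Icc_one, if_neg (by intro h; linarith [h.2]), poissonMix_of_gt hr (by linarith),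
        sub_zero]
    · have e := log_sub_pole hr hκ.ne' h0 h2 h3 h4 m
      have e1 : ‖1 - w * ((1 / κ : ℝ) : ℂ)‖ = ‖w - κ‖ / κ := by
        have hκc : (κ : ℂ) ≠ 0 := by exact_mod_cast hκ.ne'
        have : 1 - w * ((1 / κ : ℝ) : ℂ) = -((w - κ) / κ) := by
          push_cast; field_simp; ring
        rw [this, norm_neg, norm_div, Complex.norm_real, Real.norm_eq_abs, abs_of_pos hκ]
      rw [hH w Z h0 h1 h2, e, e1, Real.log_div (norm_ne_zero_iff.mpr h3) hκ.ne']
      ring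

/-- A density that changes from the value `± 1 / 2` at the left of the segment to `0` at its right
end. -/
structure IsDownBlock (m r l κ : ℝ) (T H : ℝ → ℝ) : Prop where
  hasTransform : HasTransform T (1 / 2 * (l - m + r * κ)) H
  eq_of_lt : ∀ u, u < l → T u = 0
  eq_of_le : ∀ u, l ≤ u → m - r / 2 * (κ + 1 / κ) < u → u ≤ m - r →
    T u = if 1 < κ then 1 / 2 else -(1 / 2)
  eq_of_mem : ∀ u, m - r < u → u < m + r →
    T u = -(downAngle κ √((m + r - u) / (u - (m - r))) / Real.pi)
  eq_of_gt : ∀ u, m + r < u → T u = 0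
  eq_log : ∀ (w : ℂ) (Z : ℝ), w ≠ 0 → ‖w‖ ≤ 1 → 2 * (Z : ℂ) = w + w⁻¹ → w + κ ≠ 0 →
    1 + w * κ ≠ 0 → H (m + r * Z) = -(1 / 2 * Real.log (m + r * Z - l)) +
      1 / 2 * (2 * Real.log ‖1 + w * κ‖ + Real.log r - Real.log 2 - Real.log ‖w‖)

/-- The analogue with the parameter -κ, whose pole lies to the left of the segment, and with
reversed sign. For κ > 1 the indicator of [l, pole] is subtracted, which requires the pole not to
lie to the left of l. -/
theorem exists_isDownBlock (hr : 0 < r) (hl : l ≤ m - r) (hκ : 0 < κ)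
    (hlc : 1 < κ → l ≤ m - r / 2 * (κ + 1 / κ)) : ∃ T H, IsDownBlock m r l κ T H := by
  have hc : m - r / 2 * (κ + 1 / κ) ≤ m - r := by
    have := mul_le_mul_of_nonneg_left (two_le_add_inv hκ) (half_pos hr).le
    linarith
  have epole : m - r / 2 * (κ + 1 / κ) = m + r / 2 * (-κ + 1 / -κ) := by
    rw [div_neg]; ring
  rcases lt_trichotomy κ 1 with h | h | h
  · have hκ' : |-κ| < 1 := by rw [abs_neg]; exact abs_lt.mpr ⟨by linarith, h⟩
    obtain ⟨H, hT, hH⟩ := hasTransform_poissonMix hκ' hr hl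
    refine ⟨_, _, by convert hT.const_mul (-1) using 1; ring, fun u hu => ?_,
      fun u hu _ hu' => ?_, fun u h1 h2 => ?_,
      fun u hu => ?_, fun w Z h0 h1 h2 _ _ => ?_⟩
    · rw [poissonMix_of_lt hu, mul_zero]
    · rw [poissonMix_of_le hκ' hr hu hu', if_neg (by linarith)]; ring
    · rw [poissonMix_of_mem hκ' hr (by linarith) h1 h2, downAngle, ← sub_eq_add_neg, sub_neg_eq_add]
      ring
    · rw [poissonMix_of_gt hr hu, mul_zero]
    · rw [hH w Z h0 h1 h2]
      have : 1 - w * ((-κ : ℝ) : ℂ) = 1 + w * κ := by push_cast; ring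
      rw [this]
      ring
  · subst h
    have hT := (hasTransform_indicator hl).const_mul (-(1 / 2))
    refine ⟨_, _, by convert hT using 1; ring, fun u hu => ?_, fun u hu _ hu' => ?_,
      fun u h1 h2 => ?_, fun u hu => ?_, fun w Z h0 h1 h2 h3 h4 => ?_⟩
    · rw [indicator_Icc_one, if_neg (by intro h; linarith [h.1]), mul_zero]
    · rw [indicator_Icc_one, if_pos ⟨hu, hu'⟩, mul_one, if_neg (lt_irrefl _)]
    · rw [indicator_Icc_one, if_neg (by intro h; linarith [h.2]), mul_zero, downAngle]
      simp
    · rw [indicator_Icc_one, if_neg (by intro h; linarith [h.2]), mul_zero]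
    · have e := log_sub_pole hr (neg_ne_zero.mpr one_ne_zero) h0 h2
        (by push_cast; simpa using h3) (by push_cast; simpa using h4) m
      have e1 : ‖w - ((-1 : ℝ) : ℂ)‖ = ‖1 + w * (1 : ℝ)‖ := by
        congr 1; push_cast; ring
      have e2 : ‖1 - w * ((-1 : ℝ) : ℂ)‖ = ‖1 + w * (1 : ℝ)‖ := by
        congr 1; push_cast; ring
      rw [e1, e2, show m + r / 2 * (-1 + 1 / -1) = m - r by norm_num; ring, Real.log_neg_eq_log,
        Real.log_one] at e
      rw [e]
      ring
  · have hκ' : |-(1 / κ)| < 1 := by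
      rw [abs_neg, abs_of_pos (by positivity), div_lt_one hκ]; exact h
    obtain ⟨H, hT, hH⟩ := hasTransform_poissonMix hκ' hr hl
    have hT' := hT.sub (hasTransform_indicator (hlc h))
    refine ⟨_, _, by convert hT' using 1; ring, fun u hu => ?_, fun u hu huc hu' => ?_,
      fun u h1 h2 => ?_, fun u hu => ?_, fun w Z h0 h1 h2 h3 h4 => ?_⟩
    · rw [indicator_Icc_one, if_neg (by intro h; linarith [h.1]), poissonMix_of_lt hu, sub_zero]
    · rw [indicator_Icc_one, if_neg (by intro h; linarith [h.2]), poissonMix_of_le hκ' hr hu hu',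
        if_pos h, sub_zero]
    · rw [indicator_Icc_one, if_neg (by intro h; linarith [h.2]),
        poissonMix_of_mem hκ' hr (by linarith) h1 h2, downAngle, sub_zero]
      have : (1 + -(1 / κ)) / (1 - -(1 / κ)) = -((1 - κ) / (1 + κ)) := by
        have h3 : 1 + κ ≠ 0 := by positivity
        have h4 : 1 - -(1 / κ) = (1 + κ) / κ := by field_simp; ring
        rw [h4]
        field_simp
        ring
      rw [this, neg_mul, Real.arctan_neg, neg_div]
    · rw [indicator_Icc_one, if_neg (by intro h; linarith [h.2]), poissonMix_of_gt hr hu, sub_zero]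
    · have e := log_sub_pole hr (neg_ne_zero.mpr hκ.ne') h0 h2
        (by push_cast; simpa using h3) (by push_cast; simpa using h4) m
      have e1 : ‖1 - w * ((-(1 / κ) : ℝ) : ℂ)‖ = ‖w + κ‖ / κ := by
        have hκc : (κ : ℂ) ≠ 0 := by exact_mod_cast hκ.ne'
        have : 1 - w * ((-(1 / κ) : ℝ) : ℂ) = (w + κ) / κ := by
          push_cast; field_simp; ring
        rw [this, norm_div, Complex.norm_real, Real.norm_eq_abs, abs_of_pos hκ]
      have e2 : w - ((-κ : ℝ) : ℂ) = w + κ := by push_cast; ring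
      have e3 : 1 - w * ((-κ : ℝ) : ℂ) = 1 + w * κ := by push_cast; ring
      rw [e2, e3, ← epole, Real.log_neg_eq_log] at e
      rw [hH w Z h0 h1 h2, e, e1, Real.log_div (norm_ne_zero_iff.mpr h3) hκ.ne']
      ring

end

end Hexagon

namespace Hexagon

/-! ### Sums of four blocks -/

section Angles

variable {κ t : ℝ}

theorem arctan_lt_upAngle (hκ : 0 < κ) (ht : 0 < t) : Real.arctan t < upAngle κ t := by
  have h2 := Real.arctan_lt_pi_div_two t
  unfold upAngle
  split_ifs with h h'
  · refine Real.arctan_strictMono (lt_mul_of_one_lt_left ht ?_)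
    rw [lt_div_iff₀ (by linarith)]; linarith
  · exact h2
  · have := Real.arctan_lt_pi_div_two ((κ + 1) / (κ - 1) * t)
    linarith

theorem downAngle_lt_arctan (hκ : 0 < κ) (ht : 0 < t) : downAngle κ t < Real.arctan t := by
  refine Real.arctan_strictMono (mul_lt_of_lt_one_left ht ?_)
  rw [div_lt_iff₀ (by linarith)]; linarith

/-- At most one of the κ reaches 1. If κ₁ > 1, the bound amounts to (1 + κ₂)/(1 - κ₂) < (κ₁ + 1)/(κ₁
- 1), which is κ₁κ₂ < 1. -/
theorem upAngle_add_lt_pi {κ₁ κ₂ : ℝ} (h₁ : 0 < κ₁) (h₂ : 0 < κ₂) (h : κ₁ * κ₂ < 1) (ht : 0 < t) :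
    upAngle κ₁ t + upAngle κ₂ t < Real.pi := by
  have key : ∀ κ₁ κ₂ : ℝ, 0 < κ₁ → 0 < κ₂ → κ₁ * κ₂ < 1 → 1 < κ₁ →
      upAngle κ₁ t + upAngle κ₂ t < Real.pi := by
    intro κ₁ κ₂ h₁ h₂ h h1
    have h2 : κ₂ < 1 := by nlinarith
    rw [upAngle, if_neg h1.not_gt, if_neg h1.ne', upAngle, if_pos h2]
    have : Real.arctan ((1 + κ₂) / (1 - κ₂) * t) < Real.arctan ((κ₁ + 1) / (κ₁ - 1) * t) := by
      refine Real.arctan_strictMono (mul_lt_mul_of_pos_right ?_ ht)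
      rw [div_lt_div_iff₀ (by linarith) (by linarith)]
      nlinarith
    linarith
  have hlt : ∀ κ, κ < 1 → upAngle κ t < Real.pi / 2 := fun κ hκ => by
    rw [upAngle, if_pos hκ]; exact Real.arctan_lt_pi_div_two _
  have hone : upAngle 1 t = Real.pi / 2 := by simp [upAngle]
  rcases lt_trichotomy κ₁ 1 with c1 | c1 | c1
  · rcases lt_trichotomy κ₂ 1 with c2 | c2 | c2
    · linarith [hlt _ c1, hlt _ c2]
    · rw [c2, hone]; linarith [hlt _ c1]
    · rw [add_comm]; exact key κ₂ κ₁ h₂ h₁ (by linarith) c2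
  · have c2 : κ₂ < 1 := by rw [c1] at h; linarith
    rw [c1, hone]; linarith [hlt _ c2]
  · exact key κ₁ κ₂ h₁ h₂ h c1

/-- Positivity is -(1 - κ₁)/(1 + κ₁) < (1 - κ₂)/(1 + κ₂), again equivalent to κ₁κ₂ < 1. -/
theorem downAngle_add_pos {κ₁ κ₂ : ℝ} (h₁ : 0 < κ₁) (h₂ : 0 < κ₂) (h : κ₁ * κ₂ < 1) (ht : 0 < t) :
    0 < downAngle κ₁ t + downAngle κ₂ t := by
  rw [← neg_lt_iff_pos_add, downAngle, downAngle, ← Real.arctan_neg, ← neg_mul]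
  refine Real.arctan_strictMono (mul_lt_mul_of_pos_right ?_ ht)
  rw [← neg_div, div_lt_div_iff₀ (by linarith) (by linarith)]
  nlinarith

end Angles

theorem exists_inv_add_of_abs_lt {Z : ℝ} (h : |Z| < 1) :
    ∃ w : ℂ, w.im ≠ 0 ∧ ‖w‖ = 1 ∧ 2 * (Z : ℂ) = w + w⁻¹ := by
  have hZ : 0 < 1 - Z ^ 2 := by
    have := (sq_lt_one_iff_abs_lt_one Z).mpr h
    linarith
  have hs := Real.sq_sqrt hZ.le
  have hn : Complex.normSq ⟨Z, √(1 - Z ^ 2)⟩ = 1 := by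
    rw [Complex.normSq_mk]; nlinarith
  refine ⟨⟨Z, √(1 - Z ^ 2)⟩, (Real.sqrt_pos.mpr hZ).ne', ?_, ?_⟩
  · rw [Complex.normSq_eq_norm_sq] at hn
    exact (pow_eq_one_iff_of_nonneg (norm_nonneg _) two_ne_zero).mp hn
  · rw [Complex.inv_def, hn]
    apply Complex.ext <;> simp
    ring

theorem exists_inv_add_of_one_lt {Z : ℝ} (h : 1 < Z) :
    ∃ w : ℝ, 0 < w ∧ w < 1 ∧ 2 * Z = w + w⁻¹ := by
  have hZ : 0 ≤ Z ^ 2 - 1 := by nlinarith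
  have hs := Real.sq_sqrt hZ
  have h0 := Real.sqrt_nonneg (Z ^ 2 - 1)
  have h1 : √(Z ^ 2 - 1) < Z := by nlinarith
  have h2 : Z - 1 < √(Z ^ 2 - 1) := by nlinarith
  refine ⟨Z - √(Z ^ 2 - 1), by linarith, by linarith, ?_⟩
  have h4 : (Z - √(Z ^ 2 - 1))⁻¹ = Z + √(Z ^ 2 - 1) :=
    inv_eq_of_mul_eq_one_right (by nlinarith)
  rw [h4]; ring

/-! ### Sign of the derivative of the effective potential -/

section Sign

variable {w κ₁ κ₂ κ₃ κ₄ : ℝ}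

/-- The derivative of the effective potential outside of the segment. -/
noncomputable def logRatio (w κ₁ κ₂ κ₃ κ₄ : ℝ) : ℝ :=
  Real.log (w + κ₃) + Real.log (w + κ₄) - Real.log (1 + w * κ₃) - Real.log (1 + w * κ₄) -
    Real.log (w - κ₁) - Real.log (w - κ₂) + Real.log (1 - w * κ₁) + Real.log (1 - w * κ₂)

/-- Reflection of the segment exchanges the poles on the right with those on the left, so only one
side needs an estimate. -/
theorem logRatio_neg (w κ₁ κ₂ κ₃ κ₄ : ℝ) :
    logRatio (-w) κ₁ κ₂ κ₃ κ₄ = -logRatio w κ₃ κ₄ κ₁ κ₂ := by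
  unfold logRatio
  rw [← Real.log_neg_eq_log (-w - κ₁), ← Real.log_neg_eq_log (-w - κ₂),
    ← Real.log_neg_eq_log (-w + κ₃), ← Real.log_neg_eq_log (-w + κ₄)]
  ring_nf

/-- Because κ₁κ₂ = κ₃κ₄, the difference of the two products factors completely as (1 - w²)(1 - κ₁κ₂)
w (κ₁ + κ₂ + κ₃ + κ₄). -/
theorem prod_sub_prod_pos (hw0 : 0 < w) (hw1 : w < 1) (h₁ : 0 < κ₁) (h₂ : 0 < κ₂) (h₃ : 0 < κ₃)
    (h₄ : 0 < κ₄) (h : κ₁ * κ₂ = κ₃ * κ₄) (hlt : κ₁ * κ₂ < 1) :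
    (w - κ₁) * (w - κ₂) * ((1 + w * κ₃) * (1 + w * κ₄)) <
      (1 - w * κ₁) * (1 - w * κ₂) * ((w + κ₃) * (w + κ₄)) := by
  have e : (1 - w * κ₁) * (1 - w * κ₂) * ((w + κ₃) * (w + κ₄)) -
      (w - κ₁) * (w - κ₂) * ((1 + w * κ₃) * (1 + w * κ₄)) =
      (1 - w ^ 2) * (1 - κ₁ * κ₂) * (w * (κ₁ + κ₂ + κ₃ + κ₄)) := by
    have e1 : (1 - w * κ₁) * (1 - w * κ₂) = 1 + w ^ 2 * (κ₁ * κ₂) - w * (κ₁ + κ₂) := by ring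
    have e2 : (w - κ₁) * (w - κ₂) = w ^ 2 + κ₁ * κ₂ - w * (κ₁ + κ₂) := by ring
    have e3 : (1 + w * κ₃) * (1 + w * κ₄) = 1 + w ^ 2 * (κ₃ * κ₄) + w * (κ₃ + κ₄) := by ring
    have e4 : (w + κ₃) * (w + κ₄) = w ^ 2 + κ₃ * κ₄ + w * (κ₃ + κ₄) := by ring
    rw [e1, e2, e3, e4, ← h]
    ring
  have h5 : 0 < 1 - w ^ 2 := by nlinarith
  have h6 : 0 < 1 - κ₁ * κ₂ := by linarith
  have : 0 < (1 - w ^ 2) * (1 - κ₁ * κ₂) * (w * (κ₁ + κ₂ + κ₃ + κ₄)) := by positivity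
  linarith

theorem logRatio_eq (hw0 : 0 < w) (h₃ : 0 < κ₃) (h₄ : 0 < κ₄)
    (hp₁ : 0 < (w - κ₁) * (1 - w * κ₁)) (hp₂ : 0 < (w - κ₂) * (1 - w * κ₂)) :
    logRatio w κ₁ κ₂ κ₃ κ₄ =
      Real.log ((1 - w * κ₁) * (1 - w * κ₂) * ((w + κ₃) * (w + κ₄))) -
        Real.log ((w - κ₁) * (w - κ₂) * ((1 + w * κ₃) * (1 + w * κ₄))) := by
  have a1 := left_ne_zero_of_mul hp₁.ne'
  have a2 := left_ne_zero_of_mul hp₂.ne'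
  have a3 := right_ne_zero_of_mul hp₁.ne'
  have a4 := right_ne_zero_of_mul hp₂.ne'
  have b1 : w + κ₃ ≠ 0 := by positivity
  have b2 : w + κ₄ ≠ 0 := by positivity
  have b3 : 1 + w * κ₃ ≠ 0 := by positivity
  have b4 : 1 + w * κ₄ ≠ 0 := by positivity
  rw [Real.log_mul (mul_ne_zero a3 a4) (mul_ne_zero b1 b2), Real.log_mul a3 a4, Real.log_mul b1 b2,
    Real.log_mul (mul_ne_zero a1 a2) (mul_ne_zero b3 b4), Real.log_mul a1 a2, Real.log_mul b3 b4,
    logRatio]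
  ring

theorem logRatio_nonneg (hw0 : 0 < w) (hw1 : w < 1) (h₁ : 0 < κ₁) (h₂ : 0 < κ₂) (h₃ : 0 < κ₃)
    (h₄ : 0 < κ₄) (h : κ₁ * κ₂ = κ₃ * κ₄) (hlt : κ₁ * κ₂ < 1)
    (hp₁ : 0 < (w - κ₁) * (1 - w * κ₁)) (hp₂ : 0 < (w - κ₂) * (1 - w * κ₂)) (c₁ : κ₁ ≤ 1)
    (c₂ : κ₂ ≤ 1) : 0 ≤ logRatio w κ₁ κ₂ κ₃ κ₄ := by
  have a1 : 0 < 1 - w * κ₁ := by nlinarith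
  have a2 : 0 < 1 - w * κ₂ := by nlinarith
  have a3 : 0 < w - κ₁ := pos_of_mul_pos_left hp₁ a1.le
  have a4 : 0 < w - κ₂ := pos_of_mul_pos_left hp₂ a2.le
  rw [logRatio_eq hw0 h₃ h₄ hp₁ hp₂, sub_nonneg]
  exact Real.log_le_log (by positivity) (prod_sub_prod_pos hw0 hw1 h₁ h₂ h₃ h₄ h hlt).le

/-- If some κ exceeds 1, the pole conditions make both products negative. The order of their
absolute values, and so the sign, is reversed. -/
theorem logRatio_nonpos (hw0 : 0 < w) (hw1 : w < 1) (h₁ : 0 < κ₁) (h₂ : 0 < κ₂) (h₃ : 0 < κ₃)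
    (h₄ : 0 < κ₄) (h : κ₁ * κ₂ = κ₃ * κ₄) (hlt : κ₁ * κ₂ < 1)
    (hp₁ : 0 < (w - κ₁) * (1 - w * κ₁)) (hp₂ : 0 < (w - κ₂) * (1 - w * κ₂))
    (c : 1 < κ₁ ∨ 1 < κ₂) : logRatio w κ₁ κ₂ κ₃ κ₄ ≤ 0 := by
  have key : ∀ κ₁ κ₂ : ℝ, 0 < κ₁ → 0 < κ₂ → κ₁ * κ₂ < 1 → 0 < (w - κ₁) * (1 - w * κ₁) →
      0 < (w - κ₂) * (1 - w * κ₂) → 1 < κ₁ → (1 - w * κ₁) * (1 - w * κ₂) < 0 := by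
    intro κ₁ κ₂ h₁ h₂ hlt hp₁ hp₂ c
    have c₂ : κ₂ < 1 := by nlinarith
    have a2 : 0 < 1 - w * κ₂ := by nlinarith
    have a3 : w - κ₁ < 0 := by linarith
    have a1 : 1 - w * κ₁ < 0 := by
      by_contra hc
      exact absurd hp₁ (not_lt.mpr (mul_nonpos_of_nonpos_of_nonneg a3.le (not_lt.mp hc)))
    exact mul_neg_of_neg_of_pos a1 a2
  have hneg : (1 - w * κ₁) * (1 - w * κ₂) < 0 := by
    rcases c with c | c
    · exact key κ₁ κ₂ h₁ h₂ hlt hp₁ hp₂ c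
    · rw [mul_comm]; exact key κ₂ κ₁ h₂ h₁ (by linarith) hp₂ hp₁ c
  have hnum : (1 - w * κ₁) * (1 - w * κ₂) * ((w + κ₃) * (w + κ₄)) < 0 :=
    mul_neg_of_neg_of_pos hneg (by positivity)
  rw [logRatio_eq hw0 h₃ h₄ hp₁ hp₂, sub_nonpos,
    ← Real.log_neg_eq_log ((1 - w * κ₁) * (1 - w * κ₂) * ((w + κ₃) * (w + κ₄))),
    ← Real.log_neg_eq_log ((w - κ₁) * (w - κ₂) * ((1 + w * κ₃) * (1 + w * κ₄)))]
  exact Real.log_le_log (by linarith)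
    (neg_le_neg (prod_sub_prod_pos hw0 hw1 h₁ h₂ h₃ h₄ h hlt).le)

end Sign

section Blocks

variable {m r l κ₁ κ₂ κ₃ κ₄ : ℝ} {T₁ T₂ T₃ T₄ H₁ H₂ H₃ H₄ : ℝ → ℝ}

/-- The derivative of the external potential with poles given by the parameters. -/
noncomputable def poleSum (m r κ₁ κ₂ κ₃ κ₄ z : ℝ) : ℝ :=
  Real.log (z - (m - r / 2 * (κ₃ + 1 / κ₃))) + Real.log (z - (m - r / 2 * (κ₄ + 1 / κ₄))) -
    Real.log (z - (m + r / 2 * (κ₁ + 1 / κ₁))) - Real.log (z - (m + r / 2 * (κ₂ + 1 / κ₂)))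

structure AreBlocks (m r l κ₁ κ₂ κ₃ κ₄ : ℝ) (T₁ T₂ T₃ T₄ H₁ H₂ H₃ H₄ : ℝ → ℝ) : Prop where
  r_pos : 0 < r
  pos₁ : 0 < κ₁
  pos₂ : 0 < κ₂
  pos₃ : 0 < κ₃
  pos₄ : 0 < κ₄
  mul_eq : κ₁ * κ₂ = κ₃ * κ₄
  mul_lt : κ₁ * κ₂ < 1
  block₁ : IsUpBlock m r l κ₁ T₁ H₁
  block₂ : IsUpBlock m r l κ₂ T₂ H₂
  block₃ : IsDownBlock m r l κ₃ T₃ H₃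
  block₄ : IsDownBlock m r l κ₄ T₄ H₄

namespace AreBlocks

/-- The contributions of r, 2, |w| and l cancel between poles and blocks. The terms log κ cancel
because κ₁κ₂ = κ₃κ₄. -/
theorem poleSum_sub (h : AreBlocks m r l κ₁ κ₂ κ₃ κ₄ T₁ T₂ T₃ T₄ H₁ H₂ H₃ H₄) {w : ℂ} {Z : ℝ}
    (hw0 : w ≠ 0) (hw : ‖w‖ ≤ 1) (hZ : 2 * (Z : ℂ) = w + w⁻¹)
    (a₁ : w - κ₁ ≠ 0) (b₁ : 1 - w * κ₁ ≠ 0) (a₂ : w - κ₂ ≠ 0) (b₂ : 1 - w * κ₂ ≠ 0)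
    (a₃ : w + κ₃ ≠ 0) (b₃ : 1 + w * κ₃ ≠ 0) (a₄ : w + κ₄ ≠ 0) (b₄ : 1 + w * κ₄ ≠ 0) :
    poleSum m r κ₁ κ₂ κ₃ κ₄ (m + r * Z) - 2 * (H₁ (m + r * Z) + H₂ (m + r * Z) +
      (H₃ (m + r * Z) + H₄ (m + r * Z))) =
    Real.log ‖w + κ₃‖ + Real.log ‖w + κ₄‖ - Real.log ‖1 + w * κ₃‖ - Real.log ‖1 + w * κ₄‖ -
      Real.log ‖w - κ₁‖ - Real.log ‖w - κ₂‖ + Real.log ‖1 - w * κ₁‖ + Real.log ‖1 - w * κ₂‖ := by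
  have epole : ∀ κ : ℝ, m - r / 2 * (κ + 1 / κ) = m + r / 2 * (-κ + 1 / -κ) := fun κ => by
    rw [div_neg]; ring
  have n1 : ∀ κ : ℝ, w - ((-κ : ℝ) : ℂ) = w + κ := fun κ => by push_cast; ring
  have n2 : ∀ κ : ℝ, 1 - w * ((-κ : ℝ) : ℂ) = 1 + w * κ := fun κ => by push_cast; ring
  have p1 := log_sub_pole h.r_pos h.pos₁.ne' hw0 hZ a₁ b₁ m
  have p2 := log_sub_pole h.r_pos h.pos₂.ne' hw0 hZ a₂ b₂ m
  have p3 := log_sub_pole h.r_pos (neg_ne_zero.mpr h.pos₃.ne') hw0 hZ (by rwa [n1]) (by rwa [n2]) m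
  have p4 := log_sub_pole h.r_pos (neg_ne_zero.mpr h.pos₄.ne') hw0 hZ (by rwa [n1]) (by rwa [n2]) m
  rw [n1, n2, ← epole, Real.log_neg_eq_log] at p3 p4
  have q1 := h.block₁.eq_log w Z hw0 hw hZ a₁ b₁
  have q2 := h.block₂.eq_log w Z hw0 hw hZ a₂ b₂
  have q3 := h.block₃.eq_log w Z hw0 hw hZ a₃ b₃
  have q4 := h.block₄.eq_log w Z hw0 hw hZ a₄ b₄
  have hl := congrArg Real.log h.mul_eq
  rw [Real.log_mul h.pos₁.ne' h.pos₂.ne', Real.log_mul h.pos₃.ne' h.pos₄.ne'] at hl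
  rw [poleSum, p1, p2, p3, p4, q1, q2, q3, q4]
  linarith

/-- On the segment |w| = 1, where |w - κ| = |1 - wκ| and |w + κ| = |1 + wκ|: the logarithms cancel
in pairs. -/
theorem poleSum_sub_eq_zero (h : AreBlocks m r l κ₁ κ₂ κ₃ κ₄ T₁ T₂ T₃ T₄ H₁ H₂ H₃ H₄) {z : ℝ}
    (h1 : m - r < z) (h2 : z < m + r) :
    poleSum m r κ₁ κ₂ κ₃ κ₄ z - 2 * (H₁ z + H₂ z + (H₃ z + H₄ z)) = 0 := by
  have hr := h.r_pos
  obtain ⟨w, hi, hw, hZ⟩ := exists_inv_add_of_abs_lt (Z := (z - m) / r) (by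
    rw [abs_div, abs_of_pos hr, div_lt_one hr, abs_lt]; constructor <;> linarith)
  have hz : z = m + r * ((z - m) / r) := by field_simp; ring
  have hw0 : w ≠ 0 := by rintro rfl; simp at hi
  have n1 : ∀ κ : ℝ, w + κ ≠ 0 := fun κ hc => hi (by simpa using congrArg Complex.im hc)
  have n2 : ∀ κ : ℝ, w - κ ≠ 0 := fun κ hc => hi (by simpa using congrArg Complex.im hc)
  have n3 : ∀ κ : ℝ, 0 < κ → 1 + w * κ ≠ 0 := fun κ hκ hc => hi (by
    have := congrArg Complex.im hc
    simp at this
    exact this.resolve_right hκ.ne')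
  have n4 : ∀ κ : ℝ, 0 < κ → 1 - w * κ ≠ 0 := fun κ hκ hc => hi (by
    have := congrArg Complex.im hc
    simp at this
    exact this.resolve_right hκ.ne')
  have e1 : ∀ κ : ℝ, ‖w + κ‖ = ‖1 + w * κ‖ := fun κ => by
    have := norm_sub_eq_of_norm_eq_one hw (-κ)
    simpa using this
  have e := h.poleSum_sub hw0 hw.le hZ (n2 _) (n4 _ h.pos₁) (n2 _) (n4 _ h.pos₂) (n1 _)
    (n3 _ h.pos₃) (n1 _) (n3 _ h.pos₄)
  rw [← hz, e1, e1, norm_sub_eq_of_norm_eq_one hw, norm_sub_eq_of_norm_eq_one hw] at e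
  rw [e]
  ring

theorem poleSum_sub_eq_logRatio (h : AreBlocks m r l κ₁ κ₂ κ₃ κ₄ T₁ T₂ T₃ T₄ H₁ H₂ H₃ H₄)
    {w z : ℝ} (hw0 : w ≠ 0) (hw : |w| ≤ 1) (hz : z = m + r / 2 * (w + w⁻¹))
    (h₁ : (w - κ₁) * (1 - w * κ₁) ≠ 0) (h₂ : (w - κ₂) * (1 - w * κ₂) ≠ 0)
    (h₃ : (w + κ₃) * (1 + w * κ₃) ≠ 0) (h₄ : (w + κ₄) * (1 + w * κ₄) ≠ 0) :
    poleSum m r κ₁ κ₂ κ₃ κ₄ z - 2 * (H₁ z + H₂ z + (H₃ z + H₄ z)) =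
      logRatio w κ₁ κ₂ κ₃ κ₄ := by
  have hz' : z = m + r * ((w + w⁻¹) / 2) := by rw [hz]; ring
  have c : ∀ u : ℝ, u ≠ 0 → (u : ℂ) ≠ 0 := fun u hu => by exact_mod_cast hu
  have e := h.poleSum_sub (w := w) (Z := (w + w⁻¹) / 2) (c _ hw0) (by simpa using hw)
    (by push_cast; ring)
    (by exact_mod_cast left_ne_zero_of_mul h₁) (by exact_mod_cast right_ne_zero_of_mul h₁)
    (by exact_mod_cast left_ne_zero_of_mul h₂) (by exact_mod_cast right_ne_zero_of_mul h₂)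
    (by exact_mod_cast left_ne_zero_of_mul h₃) (by exact_mod_cast right_ne_zero_of_mul h₃)
    (by exact_mod_cast left_ne_zero_of_mul h₄) (by exact_mod_cast right_ne_zero_of_mul h₄)
  rw [← hz'] at e
  rw [e, logRatio]
  norm_cast
  simp only [Real.norm_eq_abs, Real.log_abs]

/-- The distance from z to the pole is (r/2)(w - κ)(1 - wκ)/(wκ). -/
theorem pole_cond {r m w z κ : ℝ} (hr : 0 < r) (hw : 0 < w) (hκ : 0 < κ)
    (hz : z = m + r / 2 * (w + w⁻¹)) (hlt : z < m + r / 2 * (κ + 1 / κ)) :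
    0 < (w - κ) * (1 - w * κ) := by
  have e : m + r / 2 * (κ + 1 / κ) - z = r / 2 * ((w - κ) * (1 - w * κ)) / (w * κ) := by
    rw [hz]; field_simp; ring
  have h1 : 0 < r / 2 * ((w - κ) * (1 - w * κ)) / (w * κ) := by linarith
  rw [div_pos_iff_of_pos_right (by positivity)] at h1
  exact pos_of_mul_pos_right h1 (by positivity)

theorem right_sign (h : AreBlocks m r l κ₁ κ₂ κ₃ κ₄ T₁ T₂ T₃ T₄ H₁ H₂ H₃ H₄) {z : ℝ}
    (hz : m + r < z) (hz₁ : z < m + r / 2 * (κ₁ + 1 / κ₁)) (hz₂ : z < m + r / 2 * (κ₂ + 1 / κ₂)) :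
    (κ₁ ≤ 1 → κ₂ ≤ 1 →
      0 ≤ poleSum m r κ₁ κ₂ κ₃ κ₄ z - 2 * (H₁ z + H₂ z + (H₃ z + H₄ z))) ∧
    (1 < κ₁ ∨ 1 < κ₂ →
      poleSum m r κ₁ κ₂ κ₃ κ₄ z - 2 * (H₁ z + H₂ z + (H₃ z + H₄ z)) ≤ 0) := by
  have hr := h.r_pos
  have p3 := h.pos₃
  have p4 := h.pos₄
  obtain ⟨w, hw0, hw1, hZ⟩ := exists_inv_add_of_one_lt (Z := (z - m) / r) (by
    rw [lt_div_iff₀ hr]; linarith)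
  have hz' : z = m + r / 2 * (w + w⁻¹) := by rw [← hZ]; field_simp; ring
  have c1 := pole_cond hr hw0 h.pos₁ hz' hz₁
  have c2 := pole_cond hr hw0 h.pos₂ hz' hz₂
  rw [h.poleSum_sub_eq_logRatio hw0.ne' (by rw [abs_of_pos hw0]; exact hw1.le) hz' c1.ne' c2.ne'
    (by positivity) (by positivity)]
  exact ⟨logRatio_nonneg hw0 hw1 h.pos₁ h.pos₂ p3 p4 h.mul_eq h.mul_lt c1 c2,
    logRatio_nonpos hw0 hw1 h.pos₁ h.pos₂ p3 p4 h.mul_eq h.mul_lt c1 c2⟩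

/-- The reflection z ↦ -z, w ↦ -w reduces this to the estimate on the right with the two pairs of
parameters exchanged. -/
theorem left_sign (h : AreBlocks m r l κ₁ κ₂ κ₃ κ₄ T₁ T₂ T₃ T₄ H₁ H₂ H₃ H₄) {z : ℝ}
    (hz : z < m - r) (hz₃ : m - r / 2 * (κ₃ + 1 / κ₃) < z) (hz₄ : m - r / 2 * (κ₄ + 1 / κ₄) < z) :
    (κ₃ ≤ 1 → κ₄ ≤ 1 →
      poleSum m r κ₁ κ₂ κ₃ κ₄ z - 2 * (H₁ z + H₂ z + (H₃ z + H₄ z)) ≤ 0) ∧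
    (1 < κ₃ ∨ 1 < κ₄ →
      0 ≤ poleSum m r κ₁ κ₂ κ₃ κ₄ z - 2 * (H₁ z + H₂ z + (H₃ z + H₄ z))) := by
  have hr := h.r_pos
  have p1 := h.pos₁
  have p2 := h.pos₂
  obtain ⟨w, hw0, hw1, hZ⟩ := exists_inv_add_of_one_lt (Z := (m - z) / r) (by
    rw [lt_div_iff₀ hr]; linarith)
  have hz' : -z = -m + r / 2 * (w + w⁻¹) := by rw [← hZ]; field_simp; ring
  have hz'' : z = m + r / 2 * (-w + (-w)⁻¹) := by rw [inv_neg]; linarith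
  have c3 := pole_cond hr hw0 h.pos₃ hz' (by linarith)
  have c4 := pole_cond hr hw0 h.pos₄ hz' (by linarith)
  have f : ∀ κ : ℝ, (-w + κ) * (1 + -w * κ) = -((w - κ) * (1 - w * κ)) := fun κ => by ring
  have g : ∀ κ : ℝ, (-w - κ) * (1 - -w * κ) = -((w + κ) * (1 + w * κ)) := fun κ => by ring
  have q1 : (-w - κ₁) * (1 - -w * κ₁) ≠ 0 := by rw [g, neg_ne_zero]; positivity
  have q2 : (-w - κ₂) * (1 - -w * κ₂) ≠ 0 := by rw [g, neg_ne_zero]; positivity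
  rw [h.poleSum_sub_eq_logRatio (neg_ne_zero.mpr hw0.ne')
    (by rw [abs_neg, abs_of_pos hw0]; exact hw1.le) hz'' q1 q2
    (by rw [f]; exact neg_ne_zero.mpr c3.ne') (by rw [f]; exact neg_ne_zero.mpr c4.ne'),
    logRatio_neg, neg_nonpos, neg_nonneg]
  have hlt : κ₃ * κ₄ < 1 := h.mul_eq ▸ h.mul_lt
  exact ⟨logRatio_nonneg hw0 hw1 h.pos₃ h.pos₄ p1 p2 h.mul_eq.symm hlt c3 c4,
    logRatio_nonpos hw0 hw1 h.pos₃ h.pos₄ p1 p2 h.mul_eq.symm hlt c3 c4⟩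

end AreBlocks

end Blocks

end Hexagon

namespace Hexagon

/-! ### The end points of the segment -/

/-- Product of the two square roots in the end points. -/
noncomputable def rootProd (lam th x : ℝ) : ℝ :=
  √(lam * (lam + th - x)) * √(x * th * (1 + lam + th))

/-- Midpoint of the segment. -/
noncomputable def mid (lam th x : ℝ) : ℝ :=
  (lam * (lam + th - x) + x * th * (1 + lam + th)) / (lam + th) ^ 2

/-- Half of the length of the segment. -/
noncomputable def rad (lam th x : ℝ) : ℝ := 2 * rootProd lam th x / (lam + th) ^ 2

section

variable {lam th x : ℝ}

theorem rootProd_nonneg (lam th x : ℝ) : 0 ≤ rootProd lam th x := by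
  unfold rootProd; positivity

theorem rootProd_sq (hlam : 0 < lam) (hth : 0 < th) (h0 : 0 ≤ x) (h1 : x ≤ lam + th) :
    rootProd lam th x ^ 2 = lam * (lam + th - x) * (x * th * (1 + lam + th)) := by
  have : 0 ≤ lam + th - x := by linarith
  rw [rootProd, mul_pow, Real.sq_sqrt (by positivity), Real.sq_sqrt (by positivity)]

theorem rootProd_pos (hlam : 0 < lam) (hth : 0 < th) (h0 : 0 < x) (h1 : x < lam + th) :
    0 < rootProd lam th x := by
  have : 0 < lam + th - x := by linarith
  unfold rootProd; positivity

theorem endA_eq (hlam : 0 < lam) (hth : 0 < th) (h0 : 0 ≤ x) (h1 : x ≤ lam + th) :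
    endA lam th x = mid lam th x - rad lam th x := by
  have h : 0 ≤ lam + th - x := by linarith
  have hN : lam + th ≠ 0 := by positivity
  rw [endA, mid, rad, rootProd, div_pow, sub_sq, Real.sq_sqrt (by positivity),
    Real.sq_sqrt (by positivity)]
  field_simp
  ring

theorem endB_eq (hlam : 0 < lam) (hth : 0 < th) (h0 : 0 ≤ x) (h1 : x ≤ lam + th) :
    endB lam th x = mid lam th x + rad lam th x := by
  have h : 0 ≤ lam + th - x := by linarith
  have hN : lam + th ≠ 0 := by positivity
  rw [endB, mid, rad, rootProd, div_pow, add_sq, Real.sq_sqrt (by positivity),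
    Real.sq_sqrt (by positivity)]
  field_simp
  ring

theorem rad_nonneg (lam th x : ℝ) : 0 ≤ rad lam th x := by
  have := rootProd_nonneg lam th x
  unfold rad; positivity

theorem rad_pos (hlam : 0 < lam) (hth : 0 < th) (h0 : 0 < x) (h1 : x < lam + th) :
    0 < rad lam th x := by
  have := rootProd_pos hlam hth h0 h1
  unfold rad; positivity

theorem two_mul_le_add_of_sq_eq {D A B : ℝ} (hA : 0 ≤ A) (hB : 0 ≤ B) (h : D ^ 2 = A * B) :
    2 * D ≤ A + B :=
  le_of_sq_le_sq (by nlinarith [sq_nonneg (A - B)]) (by positivity)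

theorem eq_of_two_mul_eq_add {D A B : ℝ} (h : D ^ 2 = A * B) (h' : 2 * D = A + B) : A = B := by
  have : (A - B) ^ 2 = 0 := by
    have h2 : (2 * D) ^ 2 = (A + B) ^ 2 := by rw [h']
    linear_combination 4 * h - h2
  exact sub_eq_zero.mp (pow_eq_zero_iff two_ne_zero |>.mp this)

theorem two_mul_eq_add_of_eq {D A B : ℝ} (hD : 0 ≤ D) (hA : 0 ≤ A) (h : D ^ 2 = A * B)
    (h' : A = B) : 2 * D = A + B := by
  subst h'
  have : D = A := by
    rw [← Real.sqrt_sq hD, h, ← sq, Real.sqrt_sq hA]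
  rw [this]; ring

/-! Squared `rootProd` as a product in four ways, one for each of the poles `1 + th`, `1 + x`, `0`
and `x - lam`. -/

theorem endB_add_one_add_th (hlam : 0 < lam) (hth : 0 < th) (h0 : 0 ≤ x) (h1 : x ≤ lam + th) :
    (1 + th - endB lam th x) * (lam + th) ^ 2 =
      lam * x + th * (lam + th - x) * (1 + lam + th) - 2 * rootProd lam th x := by
  rw [endB_eq hlam hth h0 h1, mid, rad]
  field_simp
  ring

theorem endB_add_one_add_x (hlam : 0 < lam) (hth : 0 < th) (h0 : 0 ≤ x) (h1 : x ≤ lam + th) :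
    (1 + x - endB lam th x) * (lam + th) ^ 2 =
      th * (lam + th - x) + lam * x * (1 + lam + th) - 2 * rootProd lam th x := by
  rw [endB_eq hlam hth h0 h1, mid, rad]
  field_simp
  ring

theorem endA_mul (hlam : 0 < lam) (hth : 0 < th) (h0 : 0 ≤ x) (h1 : x ≤ lam + th) :
    endA lam th x * (lam + th) ^ 2 =
      lam * (lam + th - x) + th * x * (1 + lam + th) - 2 * rootProd lam th x := by
  rw [endA_eq hlam hth h0 h1, mid, rad]
  field_simp

theorem endA_sub_mul (hlam : 0 < lam) (hth : 0 < th) (h0 : 0 ≤ x) (h1 : x ≤ lam + th) :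
    (endA lam th x - (x - lam)) * (lam + th) ^ 2 =
      th * x + lam * (lam + th - x) * (1 + lam + th) - 2 * rootProd lam th x := by
  rw [endA_eq hlam hth h0 h1, mid, rad]
  field_simp
  ring

theorem rootProd_sq₁ (hlam : 0 < lam) (hth : 0 < th) (h0 : 0 ≤ x) (h1 : x ≤ lam + th) :
    rootProd lam th x ^ 2 = lam * x * (th * (lam + th - x) * (1 + lam + th)) := by
  rw [rootProd_sq hlam hth h0 h1]; ring

theorem rootProd_sq₂ (hlam : 0 < lam) (hth : 0 < th) (h0 : 0 ≤ x) (h1 : x ≤ lam + th) :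
    rootProd lam th x ^ 2 = th * (lam + th - x) * (lam * x * (1 + lam + th)) := by
  rw [rootProd_sq hlam hth h0 h1]; ring

theorem rootProd_sq₃ (hlam : 0 < lam) (hth : 0 < th) (h0 : 0 ≤ x) (h1 : x ≤ lam + th) :
    rootProd lam th x ^ 2 = lam * (lam + th - x) * (th * x * (1 + lam + th)) := by
  rw [rootProd_sq hlam hth h0 h1]; ring

theorem rootProd_sq₄ (hlam : 0 < lam) (hth : 0 < th) (h0 : 0 ≤ x) (h1 : x ≤ lam + th) :
    rootProd lam th x ^ 2 = th * x * (lam * (lam + th - x) * (1 + lam + th)) := by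
  rw [rootProd_sq hlam hth h0 h1]; ring

/-- Up to the factor (λ + θ)², each gap is A + B - 2√(AB), nonnegative by the inequality between
arithmetic and geometric means; A and B depend on the pole. -/
theorem endB_le (hlam : 0 < lam) (hth : 0 < th) (h0 : 0 ≤ x) (h1 : x ≤ lam + th) :
    endB lam th x ≤ 1 + th ∧ endB lam th x ≤ 1 + x := by
  have h : 0 ≤ lam + th - x := by linarith
  have hN : 0 < (lam + th) ^ 2 := by positivity
  have e1 := endB_add_one_add_th hlam hth h0 h1
  have e2 := endB_add_one_add_x hlam hth h0 h1
  have f1 := two_mul_le_add_of_sq_eq (by positivity) (by positivity) (rootProd_sq₁ hlam hth h0 h1)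
  have f2 := two_mul_le_add_of_sq_eq (by positivity) (by positivity) (rootProd_sq₂ hlam hth h0 h1)
  constructor
  · exact sub_nonneg.mp (nonneg_of_mul_nonneg_left (by rw [e1]; linarith) hN)
  · exact sub_nonneg.mp (nonneg_of_mul_nonneg_left (by rw [e2]; linarith) hN)

theorem le_endA (hlam : 0 < lam) (hth : 0 < th) (h0 : 0 ≤ x) (h1 : x ≤ lam + th) :
    0 ≤ endA lam th x ∧ x - lam ≤ endA lam th x := by
  have h : 0 ≤ lam + th - x := by linarith
  have hN : 0 < (lam + th) ^ 2 := by positivity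
  have e2 := endA_sub_mul hlam hth h0 h1
  have f2 := two_mul_le_add_of_sq_eq (by positivity) (by positivity) (rootProd_sq₄ hlam hth h0 h1)
  exact ⟨sq_nonneg _, sub_nonneg.mp (nonneg_of_mul_nonneg_left (by rw [e2]; linarith) hN)⟩

theorem endB_le_hi (hlam : 0 < lam) (hth : 0 < th) (h0 : 0 ≤ x) (h1 : x ≤ lam + th) :
    endB lam th x ≤ hi th x := by
  have h := endB_le hlam hth h0 h1
  rw [hi, ← sub_le_iff_le_add']
  exact le_min (by linarith [h.2]) (by linarith [h.1])

theorem lo_le_endA (hlam : 0 < lam) (hth : 0 < th) (h0 : 0 ≤ x) (h1 : x ≤ lam + th) :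
    lo lam x ≤ endA lam th x :=
  max_le (le_endA hlam hth h0 h1).1 (le_endA hlam hth h0 h1).2

theorem endA_le_endB (hlam : 0 < lam) (hth : 0 < th) (h0 : 0 ≤ x) (h1 : x ≤ lam + th) :
    endA lam th x ≤ endB lam th x := by
  rw [endA_eq hlam hth h0 h1, endB_eq hlam hth h0 h1]
  linarith [rad_nonneg lam th x]

theorem endA_lt_endB (hlam : 0 < lam) (hth : 0 < th) (h0 : 0 < x) (h1 : x < lam + th) :
    endA lam th x < endB lam th x := by
  rw [endA_eq hlam hth h0.le h1.le, endB_eq hlam hth h0.le h1.le]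
  linarith [rad_pos hlam hth h0 h1]

/-- Equality of the means forces A = B, a linear equation in x whose only root is `x₄`. The other
three contacts are obtained in the same way. -/
theorem endB_eq_one_add_th_iff (hlam : 0 < lam) (hth : 0 < th) (h0 : 0 ≤ x) (h1 : x ≤ lam + th) :
    endB lam th x = 1 + th ↔ x = x₄ lam th := by
  have h : 0 ≤ lam + th - x := by linarith
  have e := endB_add_one_add_th hlam hth h0 h1
  have s := rootProd_sq₁ hlam hth h0 h1
  have hx : x = x₄ lam th ↔ lam * x = th * (lam + th - x) * (1 + lam + th) := by
    rw [x₄, eq_div_iff (by positivity)]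
    constructor
    · intro h; linear_combination (lam + th) * h
    · intro h
      have hN : lam + th ≠ 0 := by positivity
      exact mul_left_cancel₀ hN (by linear_combination h)
  rw [hx]
  constructor
  · intro hb
    rw [hb, sub_self, zero_mul] at e
    exact eq_of_two_mul_eq_add s (by linarith)
  · intro hb
    have := two_mul_eq_add_of_eq (rootProd_nonneg _ _ _) (by positivity) s hb
    have hN : (lam + th) ^ 2 ≠ 0 := by positivity
    have h2 := (mul_eq_zero.mp (e.trans (by linarith))).resolve_right hN
    linarith

theorem endB_eq_one_add_x_iff (hlam : 0 < lam) (hth : 0 < th) (h0 : 0 ≤ x) (h1 : x ≤ lam + th) :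
    endB lam th x = 1 + x ↔ x = x₂ lam th := by
  have h : 0 ≤ lam + th - x := by linarith
  have e := endB_add_one_add_x hlam hth h0 h1
  have s := rootProd_sq₂ hlam hth h0 h1
  have hx : x = x₂ lam th ↔ th * (lam + th - x) = lam * x * (1 + lam + th) := by
    rw [x₂, eq_div_iff (by positivity)]
    constructor
    · intro h; linear_combination -(lam + th) * h
    · intro h
      have hN : lam + th ≠ 0 := by positivity
      exact mul_left_cancel₀ hN (by linear_combination -h)
  rw [hx]
  constructor
  · intro hb
    rw [hb, sub_self, zero_mul] at e
    exact eq_of_two_mul_eq_add s (by linarith)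
  · intro hb
    have := two_mul_eq_add_of_eq (rootProd_nonneg _ _ _) (by positivity) s hb
    have hN : (lam + th) ^ 2 ≠ 0 := by positivity
    have h2 := (mul_eq_zero.mp (e.trans (by linarith))).resolve_right hN
    linarith

theorem endA_eq_zero_iff (hlam : 0 < lam) (hth : 0 < th) (h0 : 0 ≤ x) (h1 : x ≤ lam + th) :
    endA lam th x = 0 ↔ x = x₃ lam th := by
  have h : 0 ≤ lam + th - x := by linarith
  have e := endA_mul hlam hth h0 h1
  have s := rootProd_sq₃ hlam hth h0 h1
  have hx : x = x₃ lam th ↔ lam * (lam + th - x) = th * x * (1 + lam + th) := by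
    rw [x₃, eq_div_iff (by positivity)]
    constructor
    · intro h; linear_combination -(lam + th) * h
    · intro h
      have hN : lam + th ≠ 0 := by positivity
      exact mul_left_cancel₀ hN (by linear_combination -h)
  rw [hx]
  constructor
  · intro hb
    rw [hb, zero_mul] at e
    exact eq_of_two_mul_eq_add s (by linarith)
  · intro hb
    have := two_mul_eq_add_of_eq (rootProd_nonneg _ _ _) (by positivity) s hb
    have hN : (lam + th) ^ 2 ≠ 0 := by positivity
    exact (mul_eq_zero.mp (e.trans (by linarith))).resolve_right hN

theorem endA_eq_x_sub_lam_iff (hlam : 0 < lam) (hth : 0 < th) (h0 : 0 ≤ x) (h1 : x ≤ lam + th) :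
    endA lam th x = x - lam ↔ x = x₅ lam th := by
  have h : 0 ≤ lam + th - x := by linarith
  have e := endA_sub_mul hlam hth h0 h1
  have s := rootProd_sq₄ hlam hth h0 h1
  have hx : x = x₅ lam th ↔ th * x = lam * (lam + th - x) * (1 + lam + th) := by
    rw [x₅, eq_div_iff (by positivity)]
    constructor
    · intro h; linear_combination (lam + th) * h
    · intro h
      have hN : lam + th ≠ 0 := by positivity
      exact mul_left_cancel₀ hN (by linear_combination h)
  rw [hx]
  constructor
  · intro hb
    rw [hb, sub_self, zero_mul] at e
    exact eq_of_two_mul_eq_add s (by linarith)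
  · intro hb
    have := two_mul_eq_add_of_eq (rootProd_nonneg _ _ _) (by positivity) s hb
    have hN : (lam + th) ^ 2 ≠ 0 := by positivity
    have h2 := (mul_eq_zero.mp (e.trans (by linarith))).resolve_right hN
    linarith

/-! ### The parameters of the four blocks -/

/-- If rootProd² = AB is the factorization attached to a pole, then κ = A / rootProd = √(A/B), and
the distance from the midpoint to the pole, (A + B)/(λ + θ)², is (r/2)(κ + 1/κ). -/
noncomputable def kappa₁ (lam th x : ℝ) : ℝ := lam * x / rootProd lam th x
noncomputable def kappa₂ (lam th x : ℝ) : ℝ := th * (lam + th - x) / rootProd lam th x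
noncomputable def kappa₃ (lam th x : ℝ) : ℝ := lam * (lam + th - x) / rootProd lam th x
noncomputable def kappa₄ (lam th x : ℝ) : ℝ := th * x / rootProd lam th x

theorem one_lt_div_iff_of_sq_eq {D A B : ℝ} (hD : 0 < D) (hA : 0 < A) (h : D ^ 2 = A * B) :
    1 < A / D ↔ B < A := by
  rw [one_lt_div hD]
  constructor
  · intro h1
    nlinarith
  · intro h1
    nlinarith

theorem half_rad_mul_add {D A B N : ℝ} (hD : 0 < D) (hA : 0 < A) (h : D ^ 2 = A * B)
    (hN : N ≠ 0) : 2 * D / N ^ 2 / 2 * (A / D + 1 / (A / D)) = (A + B) / N ^ 2 := by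
  field_simp
  linear_combination h

variable (hlam : 0 < lam) (hth : 0 < th) (h0 : 0 < x) (h1 : x < lam + th)

include hlam hth h0 h1

theorem kappa_pos : 0 < kappa₁ lam th x ∧ 0 < kappa₂ lam th x ∧ 0 < kappa₃ lam th x ∧
    0 < kappa₄ lam th x := by
  have h : 0 < lam + th - x := by linarith
  have hD := rootProd_pos hlam hth h0 h1
  refine ⟨?_, ?_, ?_, ?_⟩
  · unfold kappa₁; positivity
  · unfold kappa₂; positivity
  · unfold kappa₃; positivity
  · unfold kappa₄; positivity

theorem kappa_mul : kappa₁ lam th x * kappa₂ lam th x = 1 / (1 + lam + th) ∧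
    kappa₃ lam th x * kappa₄ lam th x = 1 / (1 + lam + th) := by
  have h : lam + th - x ≠ 0 := by linarith
  have hD := rootProd_pos hlam hth h0 h1
  have hs := rootProd_sq hlam hth h0.le h1.le
  have hN : 1 + lam + th ≠ 0 := by positivity
  rw [kappa₁, kappa₂, kappa₃, kappa₄, div_mul_div_comm, div_mul_div_comm, ← sq, hs]
  constructor <;> field_simp

theorem mid_add_kappa₁ : mid lam th x + rad lam th x / 2 * (kappa₁ lam th x + 1 / kappa₁ lam th x) =
    1 + th := by
  rw [kappa₁, rad, half_rad_mul_add (rootProd_pos hlam hth h0 h1) (by positivity)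
    (rootProd_sq₁ hlam hth h0.le h1.le) (by positivity), mid]
  field_simp
  ring

theorem mid_add_kappa₂ : mid lam th x + rad lam th x / 2 * (kappa₂ lam th x + 1 / kappa₂ lam th x) =
    1 + x := by
  have h : 0 < lam + th - x := by linarith
  rw [kappa₂, rad, half_rad_mul_add (rootProd_pos hlam hth h0 h1) (by positivity)
    (rootProd_sq₂ hlam hth h0.le h1.le) (by positivity), mid]
  field_simp
  ring

theorem mid_sub_kappa₃ : mid lam th x - rad lam th x / 2 * (kappa₃ lam th x + 1 / kappa₃ lam th x) =
    0 := by
  have h : 0 < lam + th - x := by linarith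
  rw [kappa₃, rad, half_rad_mul_add (rootProd_pos hlam hth h0 h1) (by positivity)
    (rootProd_sq₃ hlam hth h0.le h1.le) (by positivity), mid]
  field_simp
  ring

theorem mid_sub_kappa₄ : mid lam th x - rad lam th x / 2 * (kappa₄ lam th x + 1 / kappa₄ lam th x) =
    x - lam := by
  rw [kappa₄, rad, half_rad_mul_add (rootProd_pos hlam hth h0 h1) (by positivity)
    (rootProd_sq₄ hlam hth h0.le h1.le) (by positivity), mid]
  field_simp
  ring

/-- The blocks have total mass (r/2)(κ₁ + κ₂ + κ₃ + κ₄), so this is the normalization of the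
density. -/
theorem rad_mul_sum_kappa : rad lam th x / 2 * (kappa₁ lam th x + kappa₂ lam th x +
    (kappa₃ lam th x + kappa₄ lam th x)) = 1 := by
  have hD := rootProd_pos hlam hth h0 h1
  rw [kappa₁, kappa₂, kappa₃, kappa₄, rad]
  field_simp
  ring

/-- κ = √(A/B) exceeds 1 exactly when A > B, so κ₁ passes through 1 where b touches 1 + θ. This
matches the analytic regimes of the blocks with the geometric ones. -/
theorem one_lt_kappa₁_iff : 1 < kappa₁ lam th x ↔ x₄ lam th < x := by
  rw [kappa₁, one_lt_div_iff_of_sq_eq (rootProd_pos hlam hth h0 h1) (by positivity)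
    (rootProd_sq₁ hlam hth h0.le h1.le), x₄, div_lt_iff₀ (by positivity)]
  constructor <;> intro h <;> nlinarith

theorem one_lt_kappa₂_iff : 1 < kappa₂ lam th x ↔ x < x₂ lam th := by
  have h : 0 < lam + th - x := by linarith
  rw [kappa₂, one_lt_div_iff_of_sq_eq (rootProd_pos hlam hth h0 h1) (by positivity)
    (rootProd_sq₂ hlam hth h0.le h1.le), x₂, lt_div_iff₀ (by positivity)]
  constructor <;> intro h <;> nlinarith

theorem one_lt_kappa₃_iff : 1 < kappa₃ lam th x ↔ x < x₃ lam th := by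
  have h : 0 < lam + th - x := by linarith
  rw [kappa₃, one_lt_div_iff_of_sq_eq (rootProd_pos hlam hth h0 h1) (by positivity)
    (rootProd_sq₃ hlam hth h0.le h1.le), x₃, lt_div_iff₀ (by positivity)]
  constructor <;> intro h <;> nlinarith

theorem one_lt_kappa₄_iff : 1 < kappa₄ lam th x ↔ x₅ lam th < x := by
  rw [kappa₄, one_lt_div_iff_of_sq_eq (rootProd_pos hlam hth h0 h1) (by positivity)
    (rootProd_sq₄ hlam hth h0.le h1.le), x₅, div_lt_iff₀ (by positivity)]
  constructor <;> intro h <;> nlinarith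

end

end Hexagon

/-! ### From the blocks to the stated formulas -/

namespace Hexagon

section Angles

variable {m r κ z : ℝ}

theorem add_sub_of_pole (hκ : 0 < κ) :
    m + r / 2 * (κ + 1 / κ) - (m - r) = r / 2 * (κ + 1) ^ 2 / κ ∧
      m + r / 2 * (κ + 1 / κ) - (m + r) = r / 2 * (κ - 1) ^ 2 / κ := by
  constructor <;> field_simp <;> ring

/-- With c the pole, (c - a)/(c - b) = ((κ + 1)/(κ - 1))². Its root contains |κ - 1|, which explains
the change of sign and the added π when κ > 1. -/
theorem arctanTerm_up (hr : 0 < r) (hκ : 0 < κ) :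
    upAngle κ √((m + r - z) / (z - (m - r))) =
      (if 1 < κ then Real.pi else 0) +
        (if 1 < κ then -1 else 1) *
          arctanTerm (m - r) (m + r) (m + r / 2 * (κ + 1 / κ)) z := by
  obtain ⟨e1, e2⟩ := add_sub_of_pole (m := m) (r := r) hκ
  have hc : m + r / 2 * (κ + 1 / κ) = m + r ↔ κ = 1 := by
    rw [← sub_eq_zero, e2]
    constructor
    · intro h
      have h1 : (κ - 1) ^ 2 = 0 := by
        rcases div_eq_zero_iff.mp h with h | h
        · exact (mul_eq_zero.mp h).resolve_left (by positivity)
        · exact absurd h hκ.ne'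
      exact sub_eq_zero.mp (pow_eq_zero_iff two_ne_zero |>.mp h1)
    · rintro rfl; simp
  rw [arctanTerm, e1, e2]
  rcases eq_or_ne κ 1 with h | h
  · rw [if_pos (hc.mpr h), h]; simp [upAngle]
  · have hd : r / 2 * (κ + 1) ^ 2 / κ / (r / 2 * (κ - 1) ^ 2 / κ) = ((κ + 1) / (κ - 1)) ^ 2 := by
      have : κ - 1 ≠ 0 := sub_ne_zero.mpr h
      field_simp
    rw [if_neg (mt hc.mp h), hd, Real.sqrt_sq_eq_abs, upAngle]
    rcases lt_or_gt_of_ne h with h | h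
    · rw [if_pos h, if_neg h.not_gt, if_neg h.not_gt, abs_of_neg
        (div_neg_of_pos_of_neg (by linarith) (by linarith)), ← div_neg, neg_sub, add_comm κ 1,
        mul_comm]
      ring
    · rw [if_neg h.not_gt, if_neg h.ne', if_pos h, if_pos h, abs_of_pos
        (div_pos (by linarith) (by linarith)), mul_comm]
      ring

theorem arctanTerm_down (hr : 0 < r) (hκ : 0 < κ) :
    -downAngle κ √((m + r - z) / (z - (m - r))) =
      (if 1 < κ then 1 else -1) *
        arctanTerm (m - r) (m + r) (m - r / 2 * (κ + 1 / κ)) z := by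
  have e1 : m - r / 2 * (κ + 1 / κ) - (m - r) = -(r / 2 * (κ - 1) ^ 2 / κ) := by
    field_simp; ring
  have e2 : m - r / 2 * (κ + 1 / κ) - (m + r) = -(r / 2 * (κ + 1) ^ 2 / κ) := by
    field_simp; ring
  have hc : m - r / 2 * (κ + 1 / κ) ≠ m + r := by
    rw [← sub_ne_zero, e2, neg_ne_zero]; positivity
  have hd : -(r / 2 * (κ - 1) ^ 2 / κ) / -(r / 2 * (κ + 1) ^ 2 / κ) =
      ((κ - 1) / (κ + 1)) ^ 2 := by
    rw [neg_div_neg_eq]; field_simp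
  rw [arctanTerm, e1, e2, if_neg hc, hd, Real.sqrt_sq_eq_abs, downAngle]
  split_ifs with h
  · rw [abs_of_pos (div_pos (by linarith) (by linarith)), ← Real.arctan_neg, one_mul, ← neg_mul,
      ← neg_div, neg_sub, add_comm κ 1, mul_comm]
  · rw [abs_of_nonpos (div_nonpos_of_nonpos_of_nonneg (by linarith) (by linarith)), ← neg_div,
      neg_sub, add_comm κ 1, mul_comm, neg_one_mul]

end Angles

theorem integral_log_sub (c z₁ z₂ : ℝ) :
    ∫ z in z₁..z₂, Real.log (z - c) = L₀ (z₂ - c) - L₀ (z₁ - c) := by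
  rw [intervalIntegral.integral_comp_sub_right (fun z => Real.log z), integral_log, L₀, L₀]
  ring

theorem intervalIntegrable_log_sub_const (c z₁ z₂ : ℝ) :
    IntervalIntegrable (fun z => Real.log (z - c)) volume z₁ z₂ := by
  have := intervalIntegral.intervalIntegrable_log' (a := z₁ - c) (b := z₂ - c)
  simpa using this.comp_sub_right c

theorem L₀_neg (t : ℝ) : L₀ (-t) = -L₀ t := by
  rw [L₀, L₀, Real.log_neg_eq_log]; ring

/-- `Real.log` is even, so `L₀` is odd and is a primitive of log across 0. The four terms can thus
be written with z minus a pole, on whichever side z lies. -/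
theorem extPot_sub (lam th x z₁ z₂ : ℝ) :
    extPot lam th x z₂ - extPot lam th x z₁ =
      ∫ z in z₁..z₂, (Real.log (z - 0) + Real.log (z - (x - lam)) - Real.log (z - (1 + th)) -
        Real.log (z - (1 + x))) := by
  have i := fun c => intervalIntegrable_log_sub_const c z₁ z₂
  rw [intervalIntegral.integral_sub (((i _).add (i _)).sub (i _)) (i _),
    intervalIntegral.integral_sub ((i _).add (i _)) (i _),
    intervalIntegral.integral_add (i _) (i _)]
  simp only [integral_log_sub]
  have e : ∀ z, extPot lam th x z =
      L₀ (z - 0) + L₀ (z - (x - lam)) - L₀ (z - (1 + th)) - L₀ (z - (1 + x)) := fun z => by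
    rw [extPot, show x + 1 - z = -(z - (1 + x)) by ring,
      show 1 + th - z = -(z - (1 + th)) by ring, L₀_neg, L₀_neg,
      show lam - x + z = z - (x - lam) by ring, sub_zero]
    ring
  rw [e, e]; ring

theorem measurable_arctanTerm (a b c : ℝ) : Measurable (arctanTerm a b c) := by
  unfold arctanTerm
  split_ifs
  · exact measurable_const
  · exact Real.continuous_arctan.measurable.comp (by fun_prop)

theorem measurable_hexDensity (lam th x : ℝ) : Measurable (hexDensity lam th x) := by
  unfold hexDensity arctanDensity
  refine Measurable.ite measurableSet_Ioo ?_ (Measurable.ite measurableSet_Icc measurable_const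
    (Measurable.ite measurableSet_Icc measurable_const measurable_const))
  have h := measurable_arctanTerm (endA lam th x) (endB lam th x)
  exact measurable_const.add ((((((h _).const_mul _).add ((h _).const_mul _)).add
    ((h _).const_mul _)).add ((h _).const_mul _)).const_mul _)

section Values

variable {lam th x z : ℝ}

theorem topValue_mem : 0 ≤ topValue lam th x ∧ topValue lam th x ≤ 1 := by
  unfold topValue; split_ifs <;> norm_num

theorem bottomValue_mem : 0 ≤ bottomValue lam th x ∧ bottomValue lam th x ≤ 1 := by
  unfold bottomValue; split_ifs <;> norm_num

theorem frozen_at_start (hlam : 0 < lam) (hth : 0 < th) :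
    topValue lam th 0 = 1 ∧ bottomValue lam th 0 = 1 := by
  rw [topValue, bottomValue, if_pos, if_pos]
  · exact ⟨rfl, rfl⟩
  · left; unfold x₃; positivity
  · left; unfold x₂; positivity

theorem frozen_at_end (hlam : 0 < lam) (hth : 0 < th) :
    topValue lam th (lam + th) = 1 ∧ bottomValue lam th (lam + th) = 1 := by
  rw [topValue, bottomValue, if_pos, if_pos]
  · exact ⟨rfl, rfl⟩
  · right
    rw [x₅, div_lt_iff₀ (by positivity)]; nlinarith
  · right
    rw [x₄, div_lt_iff₀ (by positivity)]; nlinarith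

theorem rad_eq_zero_of_eq (hx : x = 0 ∨ x = lam + th) : rad lam th x = 0 := by
  rcases hx with rfl | rfl <;> simp [rad, rootProd]

theorem endA_eq_endB_of_eq (hlam : 0 < lam) (hth : 0 < th) (hx : x = 0 ∨ x = lam + th) :
    endA lam th x = endB lam th x := by
  have h : 0 ≤ x ∧ x ≤ lam + th := by rcases hx with rfl | rfl <;> constructor <;> linarith
  rw [endA_eq hlam hth h.1 h.2, endB_eq hlam hth h.1 h.2, rad_eq_zero_of_eq hx]
  ring

theorem hexDensity_of_mem_Ioo (hz : z ∈ Set.Ioo (endA lam th x) (endB lam th x)) :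
    hexDensity lam th x z = arctanDensity lam th x z := if_pos hz

theorem hexDensity_of_le (hz : z ∈ Set.Icc (lo lam x) (endA lam th x)) :
    hexDensity lam th x z = bottomValue lam th x := by
  rw [hexDensity, if_neg (fun h => h.1.not_ge hz.2), if_pos hz]

/-- The definition tests [ℓ, a] before [b, h]. The two overlap only if a = b, on the two extreme
cuts, where both frozen values are 1. -/
theorem hexDensity_of_ge (hlam : 0 < lam) (hth : 0 < th) (h0 : 0 ≤ x) (h1 : x ≤ lam + th)
    (hz : z ∈ Set.Icc (endB lam th x) (hi th x)) :
    hexDensity lam th x z = topValue lam th x := by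
  rw [hexDensity, if_neg (fun h => h.2.not_ge hz.1)]
  split_ifs with h
  · have hab : endA lam th x = endB lam th x :=
      le_antisymm (endA_le_endB hlam hth h0 h1) (hz.1.trans h.2)
    have : x = 0 ∨ x = lam + th := by
      by_contra hc
      push Not at hc
      exact (endA_lt_endB hlam hth (lt_of_le_of_ne h0 hc.1.symm) (lt_of_le_of_ne h1 hc.2)).ne hab
    rcases this with rfl | rfl
    · rw [(frozen_at_start hlam hth).1, (frozen_at_start hlam hth).2]
    · rw [(frozen_at_end hlam hth).1, (frozen_at_end hlam hth).2]
  · rfl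

theorem hexDensity_of_not_mem (hlam : 0 < lam) (hth : 0 < th) (h0 : 0 ≤ x) (h1 : x ≤ lam + th)
    (hz : z ∉ Set.Icc (lo lam x) (hi th x)) : hexDensity lam th x z = 0 := by
  have h2 := lo_le_endA hlam hth h0 h1
  have h3 := endB_le_hi hlam hth h0 h1
  have h4 := endA_le_endB hlam hth h0 h1
  rw [hexDensity, if_neg, if_neg, if_neg]
  · exact fun h => hz ⟨(h2.trans h4).trans h.1, h.2⟩
  · exact fun h => hz ⟨h.1, h.2.trans (h4.trans h3)⟩
  · exact fun h => hz ⟨h2.trans h.1.le, h.2.le.trans h3⟩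

theorem mem_cases (lam th x z : ℝ) :
    z ∉ Set.Icc (lo lam x) (hi th x) ∨ z ∈ Set.Icc (lo lam x) (endA lam th x) ∨
      z ∈ Set.Ioo (endA lam th x) (endB lam th x) ∨ z ∈ Set.Icc (endB lam th x) (hi th x) := by
  simp only [Set.mem_Icc, Set.mem_Ioo, not_and_or, not_le]
  rcases lt_or_ge z (lo lam x) with h | h
  · exact .inl (.inl h)
  rcases le_or_gt z (endA lam th x) with h' | h'
  · exact .inr (.inl ⟨h, h'⟩)
  rcases lt_or_ge z (endB lam th x) with h2 | h2
  · exact .inr (.inr (.inl ⟨h', h2⟩))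
  rcases le_or_gt z (hi th x) with h3 | h3
  · exact .inr (.inr (.inr ⟨h2, h3⟩))
  · exact .inl (.inr h3)

end Values

end Hexagon

namespace Hexagon

variable {lam th x z : ℝ} {T₁ T₂ T₃ T₄ H₁ H₂ H₃ H₄ : ℝ → ℝ}

/-! ### The explicit density is the sum of the four blocks -/

/-- The four blocks of the cut at position `x`. -/
abbrev CutBlocks (lam th x : ℝ) (T₁ T₂ T₃ T₄ H₁ H₂ H₃ H₄ : ℝ → ℝ) : Prop :=
  AreBlocks (mid lam th x) (rad lam th x) (lo lam x) (kappa₁ lam th x) (kappa₂ lam th x)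
    (kappa₃ lam th x) (kappa₄ lam th x) T₁ T₂ T₃ T₄ H₁ H₂ H₃ H₄

theorem exists_cutBlocks (hlam : 0 < lam) (hth : 0 < th) (h0 : 0 < x) (h1 : x < lam + th) :
    ∃ T₁ T₂ T₃ T₄ H₁ H₂ H₃ H₄, CutBlocks lam th x T₁ T₂ T₃ T₄ H₁ H₂ H₃ H₄ := by
  have hr := rad_pos hlam hth h0 h1
  obtain ⟨k1, k2, k3, k4⟩ := kappa_pos hlam hth h0 h1
  have hl : lo lam x ≤ mid lam th x - rad lam th x := by
    rw [← endA_eq hlam hth h0.le h1.le]; exact lo_le_endA hlam hth h0.le h1.le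
  have hm := kappa_mul hlam hth h0 h1
  obtain ⟨T₁, H₁, b₁⟩ := exists_isUpBlock hr hl k1
  obtain ⟨T₂, H₂, b₂⟩ := exists_isUpBlock hr hl k2
  obtain ⟨T₃, H₃, b₃⟩ := exists_isDownBlock hr hl k3 (fun h => by
    rw [mid_sub_kappa₃ hlam hth h0 h1]
    rw [one_lt_kappa₃_iff hlam hth h0 h1, x₃, lt_div_iff₀ (by positivity)] at h
    exact max_le le_rfl (by nlinarith))
  obtain ⟨T₄, H₄, b₄⟩ := exists_isDownBlock hr hl k4 (fun h => by
    rw [mid_sub_kappa₄ hlam hth h0 h1]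
    rw [one_lt_kappa₄_iff hlam hth h0 h1, x₅, div_lt_iff₀ (by positivity)] at h
    exact max_le (by nlinarith) le_rfl)
  refine ⟨T₁, T₂, T₃, T₄, H₁, H₂, H₃, H₄, hr, k1, k2, k3, k4, by rw [hm.1, hm.2], ?_,
    b₁, b₂, b₃, b₄⟩
  rw [hm.1, div_lt_one (by positivity)]; linarith

/-- With κκ' < 1 at most one parameter of a pair exceeds 1, so the frozen values, sums of two
indicators, remain 0 or 1. -/
theorem not_one_lt_and {κ κ' : ℝ} (h : κ * κ' < 1) : ¬(1 < κ ∧ 1 < κ') := by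
  rintro ⟨h1, h2⟩; nlinarith

theorem topValue_eq (hlam : 0 < lam) (hth : 0 < th) (h0 : 0 < x) (h1 : x < lam + th) :
    topValue lam th x = (if 1 < kappa₁ lam th x then 1 else 0) +
      (if 1 < kappa₂ lam th x then 1 else 0) := by
  have h := not_one_lt_and (κ := kappa₁ lam th x) (κ' := kappa₂ lam th x) (by
    rw [(kappa_mul hlam hth h0 h1).1, div_lt_one (by positivity)]; linarith)
  rw [one_lt_kappa₁_iff hlam hth h0 h1, one_lt_kappa₂_iff hlam hth h0 h1] at h
  simp only [topValue, one_lt_kappa₁_iff hlam hth h0 h1, one_lt_kappa₂_iff hlam hth h0 h1]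
  split_ifs <;> first | (exfalso; tauto) | norm_num

theorem bottomValue_eq (hlam : 0 < lam) (hth : 0 < th) (h0 : 0 < x) (h1 : x < lam + th) :
    bottomValue lam th x = (if 1 < kappa₃ lam th x then 1 else 0) +
      (if 1 < kappa₄ lam th x then 1 else 0) := by
  have h := not_one_lt_and (κ := kappa₃ lam th x) (κ' := kappa₄ lam th x) (by
    rw [(kappa_mul hlam hth h0 h1).2, div_lt_one (by positivity)]; linarith)
  rw [one_lt_kappa₃_iff hlam hth h0 h1, one_lt_kappa₄_iff hlam hth h0 h1] at h
  simp only [bottomValue, one_lt_kappa₃_iff hlam hth h0 h1, one_lt_kappa₄_iff hlam hth h0 h1]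
  split_ifs <;> first | (exfalso; tauto) | norm_num

theorem CutBlocks.hexDensity_eq (hb : CutBlocks lam th x T₁ T₂ T₃ T₄ H₁ H₂ H₃ H₄)
    (hlam : 0 < lam) (hth : 0 < th) (h0 : 0 < x) (h1 : x < lam + th)
    (hz : z ∈ Set.Ioo (endA lam th x) (endB lam th x)) :
    hexDensity lam th x z = T₁ z + T₂ z + (T₃ z + T₄ z) ∧
      hexDensity lam th x z =
        (upAngle (kappa₁ lam th x) √((endB lam th x - z) / (z - endA lam th x)) +
          upAngle (kappa₂ lam th x) √((endB lam th x - z) / (z - endA lam th x)) -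
          (downAngle (kappa₃ lam th x) √((endB lam th x - z) / (z - endA lam th x)) +
          downAngle (kappa₄ lam th x) √((endB lam th x - z) / (z - endA lam th x)))) / Real.pi := by
  have ea := endA_eq hlam hth h0.le h1.le
  have eb := endB_eq hlam hth h0.le h1.le
  have hz' := hz
  rw [ea, eb] at hz'
  rw [hexDensity_of_mem_Ioo hz, hb.block₁.eq_of_mem z hz'.1 hz'.2,
    hb.block₂.eq_of_mem z hz'.1 hz'.2, hb.block₃.eq_of_mem z hz'.1 hz'.2,
    hb.block₄.eq_of_mem z hz'.1 hz'.2]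
  have key : arctanDensity lam th x z = 1 / Real.pi *
      (upAngle (kappa₁ lam th x) √((mid lam th x + rad lam th x - z) /
          (z - (mid lam th x - rad lam th x))) +
        upAngle (kappa₂ lam th x) √((mid lam th x + rad lam th x - z) /
          (z - (mid lam th x - rad lam th x))) +
        (-downAngle (kappa₃ lam th x) √((mid lam th x + rad lam th x - z) /
          (z - (mid lam th x - rad lam th x))) +
        -downAngle (kappa₄ lam th x) √((mid lam th x + rad lam th x - z) /
          (z - (mid lam th x - rad lam th x))))) := by
    have e3 := arctanTerm_down (m := mid lam th x) (z := z) hb.r_pos hb.pos₃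
    have e4 := arctanTerm_down (m := mid lam th x) (z := z) hb.r_pos hb.pos₄
    have e1 := arctanTerm_up (m := mid lam th x) (z := z) hb.r_pos hb.pos₁
    have e2 := arctanTerm_up (m := mid lam th x) (z := z) hb.r_pos hb.pos₂
    rw [mid_sub_kappa₃ hlam hth h0 h1] at e3
    rw [mid_sub_kappa₄ hlam hth h0 h1] at e4
    rw [mid_add_kappa₁ hlam hth h0 h1] at e1
    rw [mid_add_kappa₂ hlam hth h0 h1] at e2
    rw [e1, e2, e3, e4, arctanDensity, topValue_eq hlam hth h0 h1, ea, eb]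
    simp only [one_lt_kappa₁_iff hlam hth h0 h1, one_lt_kappa₂_iff hlam hth h0 h1,
      one_lt_kappa₃_iff hlam hth h0 h1, one_lt_kappa₄_iff hlam hth h0 h1]
    have hpi := Real.pi_ne_zero
    have q : ∀ (p : Prop) [Decidable p], (if p then Real.pi else 0) =
        Real.pi * (if p then 1 else 0) := fun p _ => by simp
    rw [q, q]
    field_simp
    ring
  rw [key, ea, eb]
  constructor <;> ring

/-- Each up angle exceeds arctan t and each down angle is below it, hence positivity. The up angles
sum to less than π and the down angles to more than 0, hence the upper bound. -/
theorem CutBlocks.hexDensity_mem (hb : CutBlocks lam th x T₁ T₂ T₃ T₄ H₁ H₂ H₃ H₄)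
    (hlam : 0 < lam) (hth : 0 < th) (h0 : 0 < x) (h1 : x < lam + th)
    (hz : z ∈ Set.Ioo (endA lam th x) (endB lam th x)) :
    0 < hexDensity lam th x z ∧ hexDensity lam th x z < 1 := by
  have ht : 0 < √((endB lam th x - z) / (z - endA lam th x)) :=
    Real.sqrt_pos.mpr (div_pos (sub_pos.mpr hz.2) (sub_pos.mpr hz.1))
  rw [(hb.hexDensity_eq hlam hth h0 h1 hz).2]
  have hpi := Real.pi_pos
  constructor
  · refine div_pos ?_ hpi
    linarith [arctan_lt_upAngle hb.pos₁ ht, arctan_lt_upAngle hb.pos₂ ht,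
      downAngle_lt_arctan hb.pos₃ ht, downAngle_lt_arctan hb.pos₄ ht]
  · rw [div_lt_one hpi]
    linarith [upAngle_add_lt_pi hb.pos₁ hb.pos₂ hb.mul_lt ht,
      downAngle_add_pos hb.pos₃ hb.pos₄ (hb.mul_eq ▸ hb.mul_lt) ht]

/-- The up blocks contribute 1/2 each, the down blocks ± 1/2 each, the sign being positive when κ >
1. -/
theorem CutBlocks.sum_eq_of_lt_endA (hb : CutBlocks lam th x T₁ T₂ T₃ T₄ H₁ H₂ H₃ H₄)
    (hlam : 0 < lam) (hth : 0 < th) (h0 : 0 < x) (h1 : x < lam + th)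
    (hz : z ∈ Set.Ioo (lo lam x) (endA lam th x)) :
    T₁ z + T₂ z + (T₃ z + T₄ z) = bottomValue lam th x := by
  have hz' := hz
  rw [endA_eq hlam hth h0.le h1.le] at hz'
  have hp : 0 < z ∧ x - lam < z := max_lt_iff.mp hz.1
  rw [hb.block₁.eq_of_le z hz.1.le hz'.2.le, hb.block₂.eq_of_le z hz.1.le hz'.2.le,
    hb.block₃.eq_of_le z hz.1.le (by rw [mid_sub_kappa₃ hlam hth h0 h1]; exact hp.1) hz'.2.le,
    hb.block₄.eq_of_le z hz.1.le (by rw [mid_sub_kappa₄ hlam hth h0 h1]; exact hp.2) hz'.2.le,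
    bottomValue_eq hlam hth h0 h1]
  split_ifs <;> norm_num

theorem CutBlocks.sum_eq_of_endB_lt (hb : CutBlocks lam th x T₁ T₂ T₃ T₄ H₁ H₂ H₃ H₄)
    (hlam : 0 < lam) (hth : 0 < th) (h0 : 0 < x) (h1 : x < lam + th)
    (hz : z ∈ Set.Ioc (endB lam th x) (hi th x)) :
    T₁ z + T₂ z + (T₃ z + T₄ z) = topValue lam th x := by
  have hz' := hz
  rw [endB_eq hlam hth h0.le h1.le] at hz'
  have hp : z ≤ 1 + x ∧ z ≤ 1 + th := by
    have := hz.2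
    unfold hi at this
    exact ⟨this.trans (by linarith [min_le_left x th]), this.trans (by linarith [min_le_right x th])⟩
  rw [hb.block₁.eq_of_gt z hz'.1 (by rw [mid_add_kappa₁ hlam hth h0 h1]; exact hp.2),
    hb.block₂.eq_of_gt z hz'.1 (by rw [mid_add_kappa₂ hlam hth h0 h1]; exact hp.1),
    hb.block₃.eq_of_gt z hz'.1, hb.block₄.eq_of_gt z hz'.1, topValue_eq hlam hth h0 h1]
  ring

/-- Beyond the nearer pole its block is zero. The block of the farther pole would equal one up to
that pole only if its κ exceeded 1, which forces it to be the nearer pole. -/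
theorem CutBlocks.sum_eq_of_hi_lt (hb : CutBlocks lam th x T₁ T₂ T₃ T₄ H₁ H₂ H₃ H₄)
    (hlam : 0 < lam) (hth : 0 < th) (h0 : 0 < x) (h1 : x < lam + th) (hz : hi th x < z) :
    T₁ z + T₂ z + (T₃ z + T₄ z) = 0 := by
  have hz' : mid lam th x + rad lam th x < z := by
    rw [← endB_eq hlam hth h0.le h1.le]
    exact (endB_le_hi hlam hth h0.le h1.le).trans_lt hz
  have e1 : T₁ z = 0 := by
    rcases le_or_gt z (1 + th) with h | h
    · rw [hb.block₁.eq_of_gt z hz' (by rwa [mid_add_kappa₁ hlam hth h0 h1]), if_neg]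
      rw [one_lt_kappa₁_iff hlam hth h0 h1, x₄, div_lt_iff₀ (by positivity)]
      intro hc
      have : th ≤ x := by nlinarith
      rw [hi, min_eq_right this] at hz
      linarith
    · exact hb.block₁.eq_of_gt' z (by rwa [mid_add_kappa₁ hlam hth h0 h1])
  have e2 : T₂ z = 0 := by
    rcases le_or_gt z (1 + x) with h | h
    · rw [hb.block₂.eq_of_gt z hz' (by rwa [mid_add_kappa₂ hlam hth h0 h1]), if_neg]
      rw [one_lt_kappa₂_iff hlam hth h0 h1, x₂, lt_div_iff₀ (by positivity)]
      intro hc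
      have : x ≤ th := by nlinarith
      rw [hi, min_eq_left this] at hz
      linarith
    · exact hb.block₂.eq_of_gt' z (by rwa [mid_add_kappa₂ hlam hth h0 h1])
  rw [e1, e2, hb.block₃.eq_of_gt z hz', hb.block₄.eq_of_gt z hz']
  ring

theorem CutBlocks.sum_ae_eq (hb : CutBlocks lam th x T₁ T₂ T₃ T₄ H₁ H₂ H₃ H₄)
    (hlam : 0 < lam) (hth : 0 < th) (h0 : 0 < x) (h1 : x < lam + th) :
    (fun z => T₁ z + T₂ z + (T₃ z + T₄ z)) =ᵐ[volume] hexDensity lam th x := by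
  have hne : ∀ c : ℝ, ∀ᵐ z : ℝ, z ≠ c := fun c => Measure.ae_ne volume c
  filter_upwards [hne (lo lam x), hne (endA lam th x), hne (endB lam th x)] with z n1 n2 n3
  rcases mem_cases lam th x z with h | h | h | h
  · rw [hexDensity_of_not_mem hlam hth h0.le h1.le h]
    rcases lt_or_ge z (lo lam x) with h' | h'
    · rw [hb.block₁.eq_of_lt z h', hb.block₂.eq_of_lt z h', hb.block₃.eq_of_lt z h',
        hb.block₄.eq_of_lt z h']
      ring
    · exact hb.sum_eq_of_hi_lt hlam hth h0 h1 (not_le.mp fun h2 => h ⟨h', h2⟩)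
  · rw [hexDensity_of_le h]
    exact hb.sum_eq_of_lt_endA hlam hth h0 h1 ⟨lt_of_le_of_ne h.1 n1.symm, lt_of_le_of_ne h.2 n2⟩
  · exact (hb.hexDensity_eq hlam hth h0 h1 h).1.symm
  · rw [hexDensity_of_ge hlam hth h0.le h1.le h]
    exact hb.sum_eq_of_endB_lt hlam hth h0 h1 ⟨lt_of_le_of_ne h.1 n3.symm, h.2⟩

theorem CutBlocks.hasTransform (hb : CutBlocks lam th x T₁ T₂ T₃ T₄ H₁ H₂ H₃ H₄)
    (hlam : 0 < lam) (hth : 0 < th) (h0 : 0 < x) (h1 : x < lam + th) :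
    HasTransform (hexDensity lam th x) 1 fun z => H₁ z + H₂ z + (H₃ z + H₄ z) := by
  have h := (hb.block₁.hasTransform.add hb.block₂.hasTransform).add
    (hb.block₃.hasTransform.add hb.block₄.hasTransform)
  have e : 1 / 2 * (mid lam th x + rad lam th x * kappa₁ lam th x - lo lam x) +
      1 / 2 * (mid lam th x + rad lam th x * kappa₂ lam th x - lo lam x) +
      (1 / 2 * (lo lam x - mid lam th x + rad lam th x * kappa₃ lam th x) +
      1 / 2 * (lo lam x - mid lam th x + rad lam th x * kappa₄ lam th x)) = 1 := by
    linear_combination rad_mul_sum_kappa hlam hth h0 h1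
  rw [e] at h
  exact h.congr (hb.sum_ae_eq hlam hth h0 h1) (ae_eq_refl _)

/-- The derivative of the effective potential. -/
theorem CutBlocks.extPot_sub_pot_sub (hb : CutBlocks lam th x T₁ T₂ T₃ T₄ H₁ H₂ H₃ H₄)
    (hlam : 0 < lam) (hth : 0 < th) (h0 : 0 < x) (h1 : x < lam + th) (z₁ z₂ : ℝ) :
    extPot lam th x z₂ - 2 * pot (hexDensity lam th x) z₂ -
        (extPot lam th x z₁ - 2 * pot (hexDensity lam th x) z₁) =
      ∫ z in z₁..z₂, (poleSum (mid lam th x) (rad lam th x) (kappa₁ lam th x) (kappa₂ lam th x)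
        (kappa₃ lam th x) (kappa₄ lam th x) z - 2 * (H₁ z + H₂ z + (H₃ z + H₄ z))) := by
  have hT := hb.hasTransform hlam hth h0 h1
  have e := extPot_sub lam th x z₁ z₂
  have i := fun c => intervalIntegrable_log_sub_const c z₁ z₂
  simp only [poleSum, mid_add_kappa₁ hlam hth h0 h1, mid_add_kappa₂ hlam hth h0 h1,
    mid_sub_kappa₃ hlam hth h0 h1, mid_sub_kappa₄ hlam hth h0 h1]
  rw [intervalIntegral.integral_sub ((((i _).add (i _)).sub (i _)).sub (i _))
    ((hT.intervalIntegrable z₁ z₂).const_mul 2), intervalIntegral.integral_const_mul,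
    ← hT.pot_sub, ← e]
  ring

theorem isDensityOn_hexDensity (hlam : 0 < lam) (hth : 0 < th) (h0 : 0 ≤ x) (h1 : x ≤ lam + th)
    (hmem : ∀ z ∈ Set.Ioo (endA lam th x) (endB lam th x),
      0 < hexDensity lam th x z ∧ hexDensity lam th x z < 1)
    (hmass : ∫ z, hexDensity lam th x z = 1) :
    IsDensityOn (Set.Icc (lo lam x) (hi th x)) (hexDensity lam th x) := by
  have h : ∀ z, 0 ≤ hexDensity lam th x z ∧ hexDensity lam th x z ≤ 1 := fun z => by
    rcases mem_cases lam th x z with h | h | h | h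
    · rw [hexDensity_of_not_mem hlam hth h0 h1 h]; norm_num
    · rw [hexDensity_of_le h]; exact bottomValue_mem
    · exact ⟨(hmem z h).1.le, (hmem z h).2.le⟩
    · rw [hexDensity_of_ge hlam hth h0 h1 h]; exact topValue_mem
  exact ⟨measurable_hexDensity lam th x, fun z => (h z).1, fun z => (h z).2,
    fun z hz => hexDensity_of_not_mem hlam hth h0 h1 hz, hmass⟩

/-- The effective potential is constant where the density varies. -/
theorem CutBlocks.extPot_sub_pot_eq (hb : CutBlocks lam th x T₁ T₂ T₃ T₄ H₁ H₂ H₃ H₄)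
    (hlam : 0 < lam) (hth : 0 < th) (h0 : 0 < x) (h1 : x < lam + th)
    (hz : z ∈ Set.Icc (endA lam th x) (endB lam th x)) :
    extPot lam th x z - 2 * pot (hexDensity lam th x) z =
      extPot lam th x (endB lam th x) - 2 * pot (hexDensity lam th x) (endB lam th x) := by
  have ea := endA_eq hlam hth h0.le h1.le
  have eb := endB_eq hlam hth h0.le h1.le
  have e := hb.extPot_sub_pot_sub hlam hth h0 h1 z (endB lam th x)
  rw [intervalIntegral.integral_of_le hz.2, integral_Ioc_eq_integral_Ioo,
    setIntegral_eq_zero_of_forall_eq_zero fun t ht =>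
      hb.poleSum_sub_eq_zero (by rw [← ea]; exact hz.1.trans_lt ht.1) (by rw [← eb]; exact ht.2)]
    at e
  exact (sub_eq_zero.mp e).symm

/-- The effective potential is constant on [a, b]. Moving away from the segment on either side, it
increases if both κ of that side are at most 1, where the frozen density is 0, and decreases if one
exceeds 1, where it is 1: exactly the Euler-Lagrange inequalities. -/
theorem CutBlocks.isEquilibrium (hb : CutBlocks lam th x T₁ T₂ T₃ T₄ H₁ H₂ H₃ H₄)
    (hlam : 0 < lam) (hth : 0 < th) (h0 : 0 < x) (h1 : x < lam + th) :
    IsEquilibrium lam th x (hexDensity lam th x)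
      (extPot lam th x (endB lam th x) - 2 * pot (hexDensity lam th x) (endB lam th x)) := by
  have ea := endA_eq hlam hth h0.le h1.le
  have eb := endB_eq hlam hth h0.le h1.le
  have hab := endA_le_endB hlam hth h0.le h1.le
  have hE := hb.extPot_sub_pot_sub hlam hth h0 h1
  set E := fun z => extPot lam th x z - 2 * pot (hexDensity lam th x) z with hEdef
  set D := fun z => poleSum (mid lam th x) (rad lam th x) (kappa₁ lam th x) (kappa₂ lam th x)
        (kappa₃ lam th x) (kappa₄ lam th x) z - 2 * (H₁ z + H₂ z + (H₃ z + H₄ z)) with hD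
  have hzero : ∀ z ∈ Set.Icc (endA lam th x) (endB lam th x), E z = E (endB lam th x) :=
    fun z hz => hb.extPot_sub_pot_eq hlam hth h0 h1 hz
  have htop : ∀ z ∈ Set.Icc (endB lam th x) (hi th x),
      (hexDensity lam th x z < 1 → E (endB lam th x) ≤ E z) ∧
      (0 < hexDensity lam th x z → E z ≤ E (endB lam th x)) := by
    intro z hz
    have hs : ∀ t ∈ Set.Ioo (endB lam th x) z, _ := fun t ht => by
      have hp : t < 1 + x ∧ t < 1 + th := by
        have := ht.2.trans_le hz.2
        unfold hi at this
        exact ⟨this.trans_le (by linarith [min_le_left x th]),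
          this.trans_le (by linarith [min_le_right x th])⟩
      exact hb.right_sign (z := t) (by rw [← eb]; exact ht.1)
        (by rw [mid_add_kappa₁ hlam hth h0 h1]; exact hp.2)
        (by rw [mid_add_kappa₂ hlam hth h0 h1]; exact hp.1)
    have hv := topValue_eq hlam hth h0 h1
    have e := hE (endB lam th x) z
    rw [intervalIntegral.integral_of_le hz.1, integral_Ioc_eq_integral_Ioo] at e
    rw [hexDensity_of_ge hlam hth h0.le h1.le hz, ← sub_nonneg (b := E (endB lam th x)),
      ← sub_nonpos (b := E (endB lam th x))]
    change E z - E (endB lam th x) = _ at e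
    constructor
    · intro h
      rw [e]
      have : kappa₁ lam th x ≤ 1 ∧ kappa₂ lam th x ≤ 1 := by
        constructor
        all_goals
          by_contra hc
          rw [not_le] at hc
          rw [hv, if_pos hc] at h
          split_ifs at h <;> norm_num at h
      exact setIntegral_nonneg measurableSet_Ioo fun t ht => (hs t ht).1 this.1 this.2
    · intro h
      rw [e]
      have : 1 < kappa₁ lam th x ∨ 1 < kappa₂ lam th x := by
        by_contra hc
        rw [not_or] at hc
        rw [hv, if_neg hc.1, if_neg hc.2] at h
        norm_num at h
      exact setIntegral_nonpos measurableSet_Ioo fun t ht => (hs t ht).2 this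
  have hbot : ∀ z ∈ Set.Icc (lo lam x) (endA lam th x),
      (hexDensity lam th x z < 1 → E (endB lam th x) ≤ E z) ∧
      (0 < hexDensity lam th x z → E z ≤ E (endB lam th x)) := by
    intro z hz
    have hs : ∀ t ∈ Set.Ioo z (endA lam th x), _ := fun t ht => by
      have hp : 0 < t ∧ x - lam < t := max_lt_iff.mp (hz.1.trans_lt ht.1)
      exact hb.left_sign (z := t) (by rw [← ea]; exact ht.2)
        (by rw [mid_sub_kappa₃ hlam hth h0 h1]; exact hp.1)
        (by rw [mid_sub_kappa₄ hlam hth h0 h1]; exact hp.2)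
    have hv := bottomValue_eq hlam hth h0 h1
    have e := hE z (endA lam th x)
    rw [intervalIntegral.integral_of_le hz.2, integral_Ioc_eq_integral_Ioo] at e
    change E (endA lam th x) - E z = _ at e
    rw [hzero _ ⟨le_rfl, hab⟩] at e
    rw [hexDensity_of_le hz, ← sub_nonneg (b := E z), ← sub_nonpos (b := E z)]
    constructor
    · intro h
      rw [e]
      have : kappa₃ lam th x ≤ 1 ∧ kappa₄ lam th x ≤ 1 := by
        constructor
        all_goals
          by_contra hc
          rw [not_le] at hc
          rw [hv, if_pos hc] at h
          split_ifs at h <;> norm_num at h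
      exact setIntegral_nonpos measurableSet_Ioo fun t ht => (hs t ht).1 this.1 this.2
    · intro h
      rw [e]
      have : 1 < kappa₃ lam th x ∨ 1 < kappa₄ lam th x := by
        by_contra hc
        rw [not_or] at hc
        rw [hv, if_neg hc.1, if_neg hc.2] at h
        norm_num at h
      exact setIntegral_nonneg measurableSet_Ioo fun t ht => (hs t ht).2 this
  have hall : ∀ z ∈ Set.Icc (lo lam x) (hi th x),
      (hexDensity lam th x z < 1 → E (endB lam th x) ≤ E z) ∧
      (0 < hexDensity lam th x z → E z ≤ E (endB lam th x)) := by
    intro z hz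
    rcases mem_cases lam th x z with h | h | h | h
    · exact absurd hz h
    · exact hbot z h
    · rw [hzero z ⟨h.1.le, h.2.le⟩]
      exact ⟨fun _ => le_rfl, fun _ => le_rfl⟩
    · exact htop z h
  exact ⟨isDensityOn_hexDensity hlam hth h0.le h1.le
    (fun z hz => hb.hexDensity_mem hlam hth h0 h1 hz) (hb.hasTransform hlam hth h0 h1).mass,
    .of_forall fun z hz => (hall z hz).1, .of_forall fun z hz => (hall z hz).2⟩

/-! ### The two extreme cuts -/

theorem hi_sub_lo_of_eq (hlam : 0 < lam) (hth : 0 < th) (hx : x = 0 ∨ x = lam + th) :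
    hi th x - lo lam x = 1 := by
  rcases hx with rfl | rfl
  · rw [hi, lo, min_eq_left hth.le, max_eq_left (by linarith)]; ring
  · rw [hi, lo, min_eq_right (by linarith), max_eq_right (by linarith)]; ring

theorem hexDensity_of_eq (hlam : 0 < lam) (hth : 0 < th) (hx : x = 0 ∨ x = lam + th) :
    hexDensity lam th x = (Set.Icc (lo lam x) (hi th x)).indicator 1 := by
  have h : 0 ≤ x ∧ x ≤ lam + th := by rcases hx with rfl | rfl <;> constructor <;> linarith
  have hf : topValue lam th x = 1 ∧ bottomValue lam th x = 1 := by
    rcases hx with rfl | rfl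
    · exact frozen_at_start hlam hth
    · exact frozen_at_end hlam hth
  have hab := endA_eq_endB_of_eq hlam hth hx
  have h2 := lo_le_endA hlam hth h.1 h.2
  have h3 := endB_le_hi hlam hth h.1 h.2
  funext z
  rcases mem_cases lam th x z with h' | h' | h' | h'
  · rw [hexDensity_of_not_mem hlam hth h.1 h.2 h', Set.indicator_of_notMem h']
  · rw [hexDensity_of_le h', hf.2, Set.indicator_of_mem (Set.mem_Icc.mpr ⟨h'.1, by linarith [h'.2]⟩),
      Pi.one_apply]
  · rw [hab] at h'
    exact absurd (h'.1.trans h'.2) (lt_irrefl _)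
  · rw [hexDensity_of_ge hlam hth h.1 h.2 h', hf.1, Set.indicator_of_mem
      (Set.mem_Icc.mpr ⟨by linarith [h'.1], h'.2⟩), Pi.one_apply]

/-- Here I has length one, so the density is forced to be its indicator. The condition where ρ < 1
is void, and any upper bound of the effective potential on I serves as C. -/
theorem isEquilibrium_of_eq (hlam : 0 < lam) (hth : 0 < th) (hx : x = 0 ∨ x = lam + th) :
    ∃ C, IsEquilibrium lam th x (hexDensity lam th x) C := by
  have h : 0 ≤ x ∧ x ≤ lam + th := by rcases hx with rfl | rfl <;> constructor <;> linarith
  have hlen := hi_sub_lo_of_eq hlam hth hx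
  have hd : IsDensityOn (Set.Icc (lo lam x) (hi th x)) (hexDensity lam th x) := by
    refine isDensityOn_hexDensity hlam hth h.1 h.2 (fun z hz => ?_) ?_
    · rw [endA_eq_endB_of_eq hlam hth hx] at hz
      exact absurd (hz.1.trans hz.2) (lt_irrefl _)
    · rw [hexDensity_of_eq hlam hth hx, integral_indicator_one measurableSet_Icc,
        Real.volume_real_Icc_of_le (by linarith), hlen]
  have hc : Continuous fun z => extPot lam th x z - 2 * pot (hexDensity lam th x) z :=
    (continuous_extPot lam th x).sub
      (continuous_const.mul ((hd.mono (Icc_lo_hi_subset hlam hth)).isBddOn.continuous_pot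
        (by unfold bigRadius; positivity)))
  obtain ⟨C, hC⟩ := (isCompact_Icc (a := lo lam x) (b := hi th x)).bddAbove_image hc.continuousOn
  refine ⟨C, hd, .of_forall fun z hz hlt => ?_, .of_forall fun z hz _ => hC ⟨z, hz, rfl⟩⟩
  rw [hexDensity_of_eq hlam hth hx, Set.indicator_of_mem hz] at hlt
  exact absurd hlt (lt_irrefl _)

theorem exists_isEquilibrium (hlam : 0 < lam) (hth : 0 < th) (hx : x ∈ Set.Icc 0 (lam + th)) :
    ∃ C, IsEquilibrium lam th x (hexDensity lam th x) C := by
  rcases eq_or_lt_of_le hx.1 with h0 | h0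
  · exact isEquilibrium_of_eq hlam hth (.inl h0.symm)
  rcases eq_or_lt_of_le hx.2 with h1 | h1
  · exact isEquilibrium_of_eq hlam hth (.inr h1)
  obtain ⟨_, _, _, _, _, _, _, _, hb⟩ := exists_cutBlocks hlam hth h0 h1
  exact ⟨_, hb.isEquilibrium hlam hth h0 h1⟩

end Hexagon

namespace Hexagon

/-! ### Principal values -/

/-- The difference of the kernels of a symmetric difference quotient of the logarithm and of a
principal value. -/
noncomputable def pvKernel (s : ℝ) : ℝ :=
  1 / 2 * (Real.log (s + 1) - Real.log (s - 1)) - if 1 ≤ |s| then 1 / s else 0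

theorem pvKernel_neg (s : ℝ) : pvKernel (-s) = -pvKernel s := by
  rw [pvKernel, pvKernel, abs_neg, ← Real.log_neg_eq_log (-s + 1),
    ← Real.log_neg_eq_log (-s - 1), show -(-s + 1) = s - 1 by ring,
    show -(-s - 1) = s + 1 by ring]
  split_ifs
  · rw [div_neg]; ring
  · ring

theorem abs_pvKernel_le_of_two_lt {s : ℝ} (hs : 2 < s) : |pvKernel s| ≤ 4 * (1 + s ^ 2)⁻¹ := by
  have h1 : 0 < s - 1 := by linarith
  have h2 : 0 < s + 1 := by linarith
  have hs0 : 0 < s := by linarith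
  have e : Real.log (s + 1) - Real.log (s - 1) = Real.log ((s + 1) / (s - 1)) :=
    (Real.log_div h2.ne' h1.ne').symm
  have u := Real.log_le_sub_one_of_pos (div_pos h2 h1)
  have l := Real.one_sub_inv_le_log_of_pos (div_pos h2 h1)
  rw [pvKernel, e, if_pos (by rw [abs_of_pos hs0]; linarith), ← div_eq_mul_inv]
  have b : 1 / (s * (s - 1)) ≤ 4 / (1 + s ^ 2) := by
    rw [div_le_div_iff₀ (by positivity) (by positivity)]; nlinarith
  have u' : (s + 1) / (s - 1) - 1 = 2 * (1 / s + 1 / (s * (s - 1))) := by field_simp; ring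
  have l' : 1 - ((s + 1) / (s - 1))⁻¹ = 2 * (1 / s - 1 / (s * (s + 1))) := by
    rw [inv_div]; field_simp; ring
  have b' : 1 / (s * (s + 1)) ≤ 1 / (s * (s - 1)) :=
    one_div_le_one_div_of_le (by positivity) (by nlinarith)
  rw [u'] at u
  rw [l'] at l
  rw [abs_le]
  constructor <;> linarith

/-- Elementary bounds on log ((s + 1)/(s - 1)) show that half of it is 1/s up to O(1/s²), so the
kernel decays integrably. -/
theorem abs_pvKernel_le_of_two_lt_abs {s : ℝ} (hs : 2 < |s|) :
    |pvKernel s| ≤ 4 * (1 + s ^ 2)⁻¹ := by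
  rcases lt_abs.mp hs with h | h
  · exact abs_pvKernel_le_of_two_lt h
  · have := abs_pvKernel_le_of_two_lt h
    rwa [pvKernel_neg, abs_neg, neg_sq] at this

theorem measurable_pvKernel : Measurable pvKernel := by
  unfold pvKernel
  refine Measurable.sub (by fun_prop) (Measurable.ite ?_ (by fun_prop) measurable_const)
  exact measurableSet_le measurable_const (by fun_prop)

theorem integrable_pvKernel : Integrable pvKernel := by
  have hlog : ∀ c : ℝ, IntegrableOn (fun s => Real.log (s - c)) (Set.Icc (-2) 2) := fun c => by
    rw [integrableOn_Icc_iff_integrableOn_Ioc, ← intervalIntegrable_iff_integrableOn_Ioc_of_le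
      (by norm_num)]
    exact intervalIntegrable_log_sub_const c _ _
  have hb : IntegrableOn (fun s => |Real.log (s - (-1))| + |Real.log (s - 1)| + 1)
      (Set.Icc (-2) 2) :=
    (((hlog (-1)).abs).add (hlog 1).abs).add (integrableOn_const (by simp))
  have hdom : Integrable fun s : ℝ => (Set.Icc (-2) 2).indicator
      (fun s => |Real.log (s - (-1))| + |Real.log (s - 1)| + 1) s + 4 * (1 + s ^ 2)⁻¹ :=
    ((integrable_indicator_iff measurableSet_Icc).mpr hb).add
      (integrable_inv_one_add_sq.const_mul 4)
  refine hdom.mono' measurable_pvKernel.aestronglyMeasurable (.of_forall fun s => ?_)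
  rw [Real.norm_eq_abs]
  by_cases hs : s ∈ Set.Icc (-2 : ℝ) 2
  · rw [Set.indicator_of_mem hs]
    have h1 : |pvKernel s| ≤ |Real.log (s - (-1))| + |Real.log (s - 1)| + 1 := by
      have hi : |if 1 ≤ |s| then 1 / s else 0| ≤ 1 := by
        split_ifs with h
        · rw [abs_div, abs_one]
          exact div_le_one_of_le₀ h (abs_nonneg _)
        · simp
      have h3 := abs_sub (1 / 2 * (Real.log (s + 1) - Real.log (s - 1)))
        (if 1 ≤ |s| then 1 / s else 0)
      have h4 := abs_sub (Real.log (s + 1)) (Real.log (s - 1))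
      rw [abs_mul, abs_of_pos (by norm_num : (0 : ℝ) < 1 / 2)] at h3
      rw [pvKernel, sub_neg_eq_add]
      have := abs_nonneg (Real.log (s + 1))
      have := abs_nonneg (Real.log (s - 1))
      linarith
    have : 0 ≤ 4 * (1 + s ^ 2)⁻¹ := by positivity
    linarith
  · rw [Set.indicator_of_notMem hs, zero_add]
    refine abs_pvKernel_le_of_two_lt_abs (not_le.mp fun h => hs ?_)
    exact abs_le.mp h

/-- The kernel is odd. -/
theorem integral_pvKernel : ∫ s, pvKernel s = 0 := by
  have h := integral_neg_eq_self pvKernel volume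
  simp_rw [pvKernel_neg] at h
  rw [integral_neg] at h
  linarith

variable {f : ℝ → ℝ} {R μ c : ℝ}

/-- The rescaled kernel concentrates at μ with total mass zero; |`pvKernel`| dominates because f is
bounded by one. -/
theorem IsBddOn.tendsto_integral_pvKernel (hd : IsBddOn R f) (hc : ContinuousAt f μ) :
    Tendsto (fun ε => ∫ s, pvKernel s * f (μ - ε * s)) (𝓝[>] 0) (𝓝 0) := by
  have h0 : ∫ s, pvKernel s * f μ = 0 := by
    rw [integral_mul_const, integral_pvKernel, zero_mul]
  suffices h : Tendsto (fun ε => ∫ s, pvKernel s * f (μ - ε * s)) (𝓝[>] 0)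
      (𝓝 (∫ s, pvKernel s * f μ)) by rwa [h0] at h
  refine tendsto_integral_filter_of_dominated_convergence (fun s => |pvKernel s|)
    (.of_forall fun ε => ?_) (.of_forall fun ε => .of_forall fun s => ?_)
    integrable_pvKernel.abs (.of_forall fun s => ?_)
  · exact (measurable_pvKernel.mul (hd.meas.comp (by fun_prop))).aestronglyMeasurable
  · rw [norm_mul, Real.norm_eq_abs, Real.norm_eq_abs]
    exact mul_le_of_le_one_right (abs_nonneg _) (hd.bdd _)
  · refine Tendsto.const_mul _ (hc.tendsto.comp ?_)
    have : Tendsto (fun ε : ℝ => μ - ε * s) (𝓝 0) (𝓝 (μ - 0 * s)) :=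
      (by fun_prop : Continuous fun ε : ℝ => μ - ε * s).tendsto 0
    rw [zero_mul, sub_zero] at this
    exact this.mono_left nhdsWithin_le_nhds

theorem tendsto_symm_diff_quotient {F : ℝ → ℝ} (h : HasDerivAt F c μ) :
    Tendsto (fun ε => (2 * ε)⁻¹ * (F (μ + ε) - F (μ - ε))) (𝓝[>] 0) (𝓝 c) := by
  have h1 := hasDerivAt_iff_tendsto_slope_zero.mp h
  have h2 : Tendsto (fun ε : ℝ => -ε) (𝓝[>] 0) (𝓝[≠] 0) := by
    refine tendsto_nhdsWithin_iff.mpr ⟨?_, ?_⟩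
    · have := (continuous_neg (G := ℝ)).tendsto 0
      rw [neg_zero] at this
      exact this.mono_left nhdsWithin_le_nhds
    · filter_upwards [self_mem_nhdsWithin] with ε hε
      exact neg_ne_zero.mpr (ne_of_gt hε)
  have h3 := ((h1.mono_left (nhdsGT_le_nhdsNE 0)).add (h1.comp h2)).const_mul (1 / 2)
  rw [show 1 / 2 * (c + c) = c by ring] at h3
  refine h3.congr' ?_
  filter_upwards [self_mem_nhdsWithin] with ε hε
  have : ε ≠ 0 := ne_of_gt hε
  simp only [Function.comp, smul_eq_mul, ← sub_eq_add_neg]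
  field_simp
  ring

/-- An exact identity: half the difference of the logarithms of μ + ε - u and μ - ε - u, divided by
ε, equals the truncated kernel 1/(μ - u) plus `pvKernel` rescaled to width ε. No regularity of f
enters before the limit. -/
theorem IsBddOn.truncated_integral_eq (hd : IsBddOn R f) {s : Set ℝ} (hs : MeasurableSet s)
    (hf : ∀ u, u ∉ s → f u = 0) (μ : ℝ) {ε : ℝ} (hε : 0 < ε) :
    ∫ u in s \ Set.Ioo (μ - ε) (μ + ε), f u / (μ - u) =
      (2 * ε)⁻¹ * (pot f (μ + ε) - pot f (μ - ε)) - ∫ t, pvKernel t * f (μ - ε * t) := by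
  have e1 : ∫ t, pvKernel t * f (μ - ε * t) = ∫ u, ε⁻¹ * (pvKernel ((μ - u) / ε) * f u) := by
    have h := integral_sub_left_eq_self (fun v => pvKernel (v / ε) * f (μ - v)) volume μ
    simp only [sub_sub_cancel] at h
    rw [integral_const_mul, h]
    have h2 := Measure.integral_comp_div (fun t => pvKernel t * f (μ - ε * t)) ε
    have h3 : ∀ v : ℝ, ε * (v / ε) = v := fun v => mul_div_cancel₀ v hε.ne'
    simp only [h3, smul_eq_mul] at h2
    rw [h2, abs_of_pos hε, inv_mul_cancel_left₀ hε.ne']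
  have iq : Integrable fun u => ε⁻¹ * (pvKernel ((μ - u) / ε) * f u) := by
    refine Integrable.const_mul ?_ _
    have h := (integrable_pvKernel.comp_div hε.ne').comp_sub_left μ
    refine (h.bdd_mul (c := 1) hd.meas.aestronglyMeasurable (.of_forall fun u => ?_)).congr
      (.of_forall fun u => mul_comm _ _)
    rw [Real.norm_eq_abs]; exact hd.bdd u
  have i1 := hd.integrable_log (μ + ε)
  have i2 := hd.integrable_log (μ - ε)
  have i3 : Integrable fun u => (2 * ε)⁻¹ *
      (Real.log (μ + ε - u) * f u - Real.log (μ - ε - u) * f u) := (i1.sub i2).const_mul _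
  rw [e1, pot, pot, ← integral_sub i1 i2, ← integral_const_mul, ← integral_sub i3 iq,
    ← integral_indicator (hs.diff measurableSet_Ioo)]
  refine integral_congr_ae ?_
  filter_upwards [Measure.ae_ne volume (μ + ε), Measure.ae_ne volume (μ - ε)] with u n1 n2
  have m1 : μ + ε - u ≠ 0 := sub_ne_zero.mpr n1.symm
  have m2 : μ - ε - u ≠ 0 := sub_ne_zero.mpr n2.symm
  have habs : 1 ≤ |(μ - u) / ε| ↔ u ∉ Set.Ioo (μ - ε) (μ + ε) := by
    rw [abs_div, abs_of_pos hε, one_le_div hε, Set.mem_Ioo, ← not_lt, abs_lt]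
    refine not_congr ⟨fun h => ⟨by linarith [h.2], by linarith [h.1]⟩,
      fun h => ⟨by linarith [h.2], by linarith [h.1]⟩⟩
  have q : pvKernel ((μ - u) / ε) = 1 / 2 * (Real.log (μ + ε - u) - Real.log (μ - ε - u)) -
      if u ∉ Set.Ioo (μ - ε) (μ + ε) then ε / (μ - u) else 0 := by
    rw [pvKernel, show (μ - u) / ε + 1 = (μ + ε - u) / ε by field_simp; ring,
      show (μ - u) / ε - 1 = (μ - ε - u) / ε by field_simp; ring, Real.log_div m1 hε.ne',
      Real.log_div m2 hε.ne']
    simp only [habs, one_div_div]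
    ring
  rw [q]
  by_cases hu : u ∈ Set.Ioo (μ - ε) (μ + ε)
  · rw [Set.indicator_of_notMem (s := s \ Set.Ioo (μ - ε) (μ + ε)) (fun h => h.2 hu), if_neg (not_not.mpr hu)]
    field_simp
    ring
  · have e2 : (s \ Set.Ioo (μ - ε) (μ + ε)).indicator (fun u => f u / (μ - u)) u =
        f u / (μ - u) := by
      by_cases hus : u ∈ s
      · exact Set.indicator_of_mem (s := s \ Set.Ioo (μ - ε) (μ + ε)) ⟨hus, hu⟩ _
      · rw [hf u hus, zero_div]
        exact Set.indicator_of_notMem (s := s \ Set.Ioo (μ - ε) (μ + ε)) (fun h => hus h.1) _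
    rw [e2, if_pos hu]
    have hne : μ - u ≠ 0 := sub_ne_zero.mpr fun h => hu (by
      subst h; exact ⟨by linarith, by linarith⟩)
    field_simp
    ring

/-- The principal value is the derivative of the logarithmic potential. -/
theorem IsBddOn.hasPrincipalValue (hd : IsBddOn R f) (hc : ContinuousAt f μ)
    (hder : HasDerivAt (pot f) c μ) {s : Set ℝ} (hs : MeasurableSet s)
    (hf : ∀ u, u ∉ s → f u = 0) : HasPrincipalValue s f μ c := by
  have h := (tendsto_symm_diff_quotient hder).sub (hd.tendsto_integral_pvKernel hc)
  rw [sub_zero] at h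
  refine h.congr' ?_
  filter_upwards [self_mem_nhdsWithin] with ε hε
  exact (hd.truncated_integral_eq hs hf μ hε).symm

variable {lam th x z : ℝ}

theorem continuousAt_hexDensity (hz : z ∈ Set.Ioo (endA lam th x) (endB lam th x)) :
    ContinuousAt (hexDensity lam th x) z := by
  have h : ∀ c, ContinuousAt (arctanTerm (endA lam th x) (endB lam th x) c) z := fun c => by
    unfold arctanTerm
    split_ifs
    · exact continuousAt_const
    · have : z - endA lam th x ≠ 0 := (sub_pos.mpr hz.1).ne'
      fun_prop (disch := assumption)
  have h2 : ContinuousAt (arctanDensity lam th x) z := by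
    unfold arctanDensity
    exact continuousAt_const.add (continuousAt_const.mul ((((continuousAt_const.mul (h _)).add
      (continuousAt_const.mul (h _))).add (continuousAt_const.mul (h _))).add
      (continuousAt_const.mul (h _))))
  refine h2.congr ?_
  filter_upwards [isOpen_Ioo.mem_nhds hz] with u hu
  exact (hexDensity_of_mem_Ioo hu).symm

theorem hasDerivAt_L₀ {t : ℝ} (ht : t ≠ 0) : HasDerivAt L₀ (Real.log t) t := by
  have h := (Real.hasDerivAt_mul_log ht).sub (hasDerivAt_id t)
  rw [add_sub_cancel_right] at h
  exact h

theorem hasDerivAt_extPot (h1 : 0 < z) (h2 : 0 < x + 1 - z) (h3 : 0 < 1 + th - z)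
    (h4 : 0 < lam - x + z) : HasDerivAt (extPot lam th x)
      (Real.log (z * (lam - x + z) / ((1 + x - z) * (1 + th - z)))) z := by
  have d1 := hasDerivAt_L₀ h1.ne'
  have d2 := (hasDerivAt_L₀ h2.ne').comp z ((hasDerivAt_id z).const_sub (x + 1))
  have d3 := (hasDerivAt_L₀ h3.ne').comp z ((hasDerivAt_id z).const_sub (1 + th))
  have d4 := (hasDerivAt_L₀ h4.ne').comp z ((hasDerivAt_id z).const_add (lam - x))
  have d := (d1.add d2).add (d3.add d4)
  rw [add_comm 1 x, Real.log_div (by positivity) (by positivity), Real.log_mul h1.ne' h4.ne',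
    Real.log_mul h2.ne' h3.ne']
  have d' : HasDerivAt (extPot lam th x) _ z := d
  exact d'.congr_deriv (by ring)

/-- On (a, b) the potential of the density is half the external potential up to a constant, so its
derivative is explicit. -/
theorem hasPrincipalValue_hexDensity (hlam : 0 < lam) (hth : 0 < th)
    (hx : x ∈ Set.Icc 0 (lam + th)) (hz : z ∈ Set.Ioo (endA lam th x) (endB lam th x)) :
    HasPrincipalValue (Set.Icc (lo lam x) (hi th x)) (hexDensity lam th x) z
      (1 / 2 * Real.log (z * (lam - x + z) / ((1 + x - z) * (1 + th - z)))) := by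
  have hx' : ¬(x = 0 ∨ x = lam + th) := fun h =>
    (hz.1.trans hz.2).ne (endA_eq_endB_of_eq hlam hth h)
  rw [not_or] at hx'
  have h0 : 0 < x := lt_of_le_of_ne hx.1 (Ne.symm hx'.1)
  have h1 : x < lam + th := lt_of_le_of_ne hx.2 hx'.2
  obtain ⟨_, _, _, _, _, _, _, _, hb⟩ := exists_cutBlocks hlam hth h0 h1
  have heq := hb.isEquilibrium hlam hth h0 h1
  have hd := heq.isBddOn hlam hth
  have hA := le_endA hlam hth hx.1 hx.2
  have hB := endB_le hlam hth hx.1 hx.2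
  have dE : HasDerivAt (extPot lam th x) _ z := hasDerivAt_extPot (hA.1.trans_lt hz.1)
    (by linarith [hz.2, hB.2]) (by linarith [hz.2, hB.1]) (by linarith [hz.1, hA.2])
  refine hd.hasPrincipalValue (continuousAt_hexDensity hz) ?_ measurableSet_Icc heq.supp
  refine ((dE.sub_const (extPot lam th x (endB lam th x) -
    2 * pot (hexDensity lam th x) (endB lam th x))).const_mul (1 / 2)).congr_of_eventuallyEq ?_
  filter_upwards [isOpen_Ioo.mem_nhds hz] with u hu
  rw [← hb.extPot_sub_pot_eq hlam hth h0 h1 ⟨hu.1.le, hu.2.le⟩]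
  ring

end Hexagon

namespace Hexagon

/-! ### The inscribed ellipse -/

variable {lam th x : ℝ}

/-- As a function of x the half-length describes a half ellipse over [0, λ + θ], while the midpoint
is affine in x: the region is a sheared ellipse. -/
theorem rad_sq (hlam : 0 < lam) (hth : 0 < th) (h0 : 0 ≤ x) (h1 : x ≤ lam + th) :
    rad lam th x ^ 2 =
      (√(lam * th * (1 + lam + th)) / (lam + th)) ^ 2 *
        (1 - (x / ((lam + th) / 2) - 1) ^ 2) := by
  rw [rad, div_pow, mul_pow, rootProd_sq hlam hth h0 h1, div_pow, Real.sq_sqrt (by positivity)]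
  field_simp
  ring

theorem mem_arcticRegion_iff (hlam : 0 < lam) (hth : 0 < th) (q : ℝ × ℝ) :
    q ∈ arcticRegion lam th ↔ 0 ≤ q.1 ∧ q.1 ≤ lam + th ∧
      (q.2 - mid lam th q.1) ^ 2 ≤ rad lam th q.1 ^ 2 := by
  refine and_congr_right fun h0 => and_congr_right fun h1 => ?_
  rw [endA_eq hlam hth h0 h1, endB_eq hlam hth h0 h1, sq_le_sq, abs_of_nonneg (rad_nonneg lam th _),
    abs_le]
  exact ⟨fun h => ⟨by linarith [h.1], by linarith [h.2]⟩,
    fun h => ⟨by linarith [h.1], by linarith [h.2]⟩⟩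

/-- The invertible lower triangular linear maps of the plane. -/
noncomputable def triangularEquiv (α β γ : ℝ) (hα : α ≠ 0) (hγ : γ ≠ 0) :
    EuclideanSpace ℝ (Fin 2) ≃ₗ[ℝ] ℝ × ℝ where
  toFun v := (α * v 0, β * v 0 + γ * v 1)
  map_add' v w := by ext <;> simp <;> ring
  map_smul' t v := by ext <;> simp <;> ring
  invFun q := !₂[q.1 / α, (q.2 - β * (q.1 / α)) / γ]
  left_inv v := by
    ext i
    fin_cases i
    · simp; field_simp
    · simp; field_simp; ring
  right_inv q := by ext <;> simp <;> field_simp; ring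

theorem isFilledEllipse_arcticRegion (hlam : 0 < lam) (hth : 0 < th) :
    IsFilledEllipse (arcticRegion lam th) := by
  have hN : 0 < (lam + th) / 2 := by positivity
  have hc : 0 < √(lam * th * (1 + lam + th)) / (lam + th) := by positivity
  set c := √(lam * th * (1 + lam + th)) / (lam + th) with hcdef
  set α := (lam + th) / 2 with hα
  -- The centre is (α, mid α) with α = (λ + θ)/2. The shear coefficient mid α - mid 0 follows the
  -- affine midpoint, and c is the half-length on the central cut.
  let f := (triangularEquiv α (mid lam th α - mid lam th 0) c hN.ne' hc.ne').toAffineEquiv.trans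
    (AffineEquiv.constVAdd ℝ (ℝ × ℝ) (α, mid lam th α))
  have hf : ∀ v, f v = (α + α * v 0,
      mid lam th α + ((mid lam th α - mid lam th 0) * v 0 + c * v 1)) := fun v => rfl
  refine ⟨f, Set.ext fun q => ?_⟩
  obtain ⟨v, rfl⟩ := f.surjective q
  have hmid : mid lam th α + (mid lam th α - mid lam th 0) * v 0 = mid lam th (α + α * v 0) := by
    rw [mid, mid, mid]; field_simp; ring
  rw [f.injective.mem_set_image, mem_closedBall_zero_iff, ← sq_le_one_iff₀ (norm_nonneg v),
    EuclideanSpace.norm_sq_eq, Fin.sum_univ_two, mem_arcticRegion_iff hlam hth, hf]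
  simp only [Real.norm_eq_abs, sq_abs]
  have e1 : mid lam th α + ((mid lam th α - mid lam th 0) * v 0 + c * v 1) -
      mid lam th (α + α * v 0) = c * v 1 := by rw [← hmid]; ring
  have e2 : (α + α * v 0) / α - 1 = v 0 := by field_simp; ring
  rw [e1]
  have hlt : lam + th = 2 * α := by rw [hα]; ring
  constructor
  · rintro ⟨h0, h1, h2⟩
    rw [rad_sq hlam hth h0 h1, ← hα, ← hcdef, e2, mul_pow] at h2
    have := le_of_mul_le_mul_left h2 (by positivity)
    linarith
  · intro h
    have hv : |v 0| ≤ 1 := abs_le_one_iff_mul_self_le_one.mpr (by nlinarith [sq_nonneg (v 1)])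
    rw [abs_le] at hv
    have h0 : 0 ≤ α + α * v 0 := by nlinarith
    have h1 : α + α * v 0 ≤ lam + th := by rw [hlt]; nlinarith
    refine ⟨h0, h1, ?_⟩
    rw [rad_sq hlam hth h0 h1, ← hα, ← hcdef, e2, mul_pow]
    exact mul_le_mul_of_nonneg_left (by linarith) (sq_nonneg _)

theorem arcticRegion_subset_hexagon (hlam : 0 < lam) (hth : 0 < th) :
    arcticRegion lam th ⊆ hexagon lam th := fun _ h =>
  ⟨h.1, h.2.1, (lo_le_endA hlam hth h.1 h.2.1).trans h.2.2.1,
    h.2.2.2.trans (endB_le_hi hlam hth h.1 h.2.1)⟩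

theorem mem_segment_graph_iff {x₀ x₁ : ℝ} (h : x₀ ≤ x₁) (k j : ℝ) (q : ℝ × ℝ) :
    q ∈ segment ℝ (x₀, k * x₀ + j) (x₁, k * x₁ + j) ↔
      q.1 ∈ Set.Icc x₀ x₁ ∧ q.2 = k * q.1 + j := by
  rw [← segment_eq_Icc h]
  constructor
  · rintro ⟨a, b, ha, hb, hab, rfl⟩
    refine ⟨⟨a, b, ha, hb, hab, rfl⟩, ?_⟩
    simp only [Prod.smul_mk, Prod.mk_add_mk, smul_eq_mul]
    linear_combination j * hab
  · rintro ⟨⟨a, b, ha, hb, hab, h1⟩, h2⟩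
    refine ⟨a, b, ha, hb, hab, Prod.ext h1 ?_⟩
    rw [h2, ← h1]
    simp only [Prod.smul_mk, Prod.mk_add_mk, smul_eq_mul]
    linear_combination j * hab

theorem arcticRegion_inter_eq {S : Set (ℝ × ℝ)} {x₀ x₁ t : ℝ} {φ : ℝ → ℝ}
    (hS : ∀ q, q ∈ S ↔ q.1 ∈ Set.Icc x₀ x₁ ∧ q.2 = φ q.1) (hsub : 0 ≤ x₀ ∧ x₁ ≤ lam + th)
    (ht : t ∈ Set.Icc x₀ x₁)
    (hφ : ∀ s, 0 ≤ s → s ≤ lam + th →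
      (endA lam th s ≤ φ s ∧ φ s ≤ endB lam th s ↔ s = t)) :
    arcticRegion lam th ∩ S = {(t, φ t)} := by
  ext q
  rw [Set.mem_inter_iff, hS, Set.mem_singleton_iff]
  constructor
  · rintro ⟨⟨h0, h1, h2⟩, _, h3⟩
    rw [h3] at h2
    have := (hφ _ h0 h1).mp h2
    exact Prod.ext this (by rw [h3, this])
  · rintro rfl
    have h0 := hsub.1.trans ht.1
    have h1 := ht.2.trans hsub.2
    exact ⟨⟨h0, h1, (hφ t h0 h1).mpr rfl⟩, ht, rfl⟩

theorem arcticRegion_inter_side₂ (hlam : 0 < lam) (hth : 0 < th) :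
    arcticRegion lam th ∩ segment ℝ (0, 1) (th, 1 + th) = {(x₂ lam th, 1 + x₂ lam th)} := by
  refine arcticRegion_inter_eq (x₀ := 0) (x₁ := th) (φ := fun s => 1 + s) (fun q => ?_)
    ⟨le_rfl, by linarith⟩ ⟨?_, ?_⟩ fun s h0 h1 => ?_
  · have := mem_segment_graph_iff hth.le 1 1 q
    simpa [add_comm] using this
  · unfold x₂; positivity
  · rw [x₂, div_le_iff₀ (by positivity)]; nlinarith
  · rw [← endB_eq_one_add_x_iff hlam hth h0 h1]
    have h2 := (endB_le hlam hth h0 h1).2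
    exact ⟨fun h => le_antisymm h2 h.2,
      fun h => ⟨h ▸ endA_le_endB hlam hth h0 h1, h.ge⟩⟩

theorem arcticRegion_inter_side₃ (hlam : 0 < lam) (hth : 0 < th) :
    arcticRegion lam th ∩ segment ℝ (0, 0) (lam, 0) = {(x₃ lam th, 0)} := by
  refine arcticRegion_inter_eq (x₀ := 0) (x₁ := lam) (φ := fun _ => 0) (fun q => ?_)
    ⟨le_rfl, by linarith⟩ ⟨?_, ?_⟩ fun s h0 h1 => ?_
  · have := mem_segment_graph_iff hlam.le 0 0 q
    simpa using this
  · unfold x₃; positivity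
  · rw [x₃, div_le_iff₀ (by positivity)]; nlinarith
  · rw [← endA_eq_zero_iff hlam hth h0 h1]
    have h2 := (le_endA hlam hth h0 h1).1
    exact ⟨fun h => le_antisymm h.1 h2,
      fun h => ⟨h.le, h ▸ endA_le_endB hlam hth h0 h1⟩⟩

theorem arcticRegion_inter_side₄ (hlam : 0 < lam) (hth : 0 < th) :
    arcticRegion lam th ∩ segment ℝ (th, 1 + th) (lam + th, 1 + th) =
      {(x₄ lam th, 1 + th)} := by
  refine arcticRegion_inter_eq (x₀ := th) (x₁ := lam + th) (φ := fun _ => 1 + th) (fun q => ?_)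
    ⟨hth.le, le_rfl⟩ ⟨?_, ?_⟩ fun s h0 h1 => ?_
  · have := mem_segment_graph_iff (show th ≤ lam + th by linarith) 0 (1 + th) q
    simpa using this
  · rw [x₄, le_div_iff₀ (by positivity)]; nlinarith
  · rw [x₄, div_le_iff₀ (by positivity)]; nlinarith
  · rw [← endB_eq_one_add_th_iff hlam hth h0 h1]
    have h2 := (endB_le hlam hth h0 h1).1
    exact ⟨fun h => le_antisymm h2 h.2,
      fun h => ⟨h ▸ endA_le_endB hlam hth h0 h1, h.ge⟩⟩

theorem arcticRegion_inter_side₅ (hlam : 0 < lam) (hth : 0 < th) :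
    arcticRegion lam th ∩ segment ℝ (lam, 0) (lam + th, th) =
      {(x₅ lam th, x₅ lam th - lam)} := by
  refine arcticRegion_inter_eq (x₀ := lam) (x₁ := lam + th) (φ := fun s => s - lam) (fun q => ?_)
    ⟨hlam.le, le_rfl⟩ ⟨?_, ?_⟩ fun s h0 h1 => ?_
  · have := mem_segment_graph_iff (show lam ≤ lam + th by linarith) 1 (-lam) q
    simpa [← sub_eq_add_neg] using this
  · rw [x₅, le_div_iff₀ (by positivity)]; nlinarith
  · rw [x₅, div_le_iff₀ (by positivity)]; nlinarith
  · rw [← endA_eq_x_sub_lam_iff hlam hth h0 h1]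
    have h2 := (le_endA hlam hth h0 h1).2
    exact ⟨fun h => le_antisymm h.1 h2,
      fun h => ⟨h.le, h ▸ endA_le_endB hlam hth h0 h1⟩⟩

/-- On an extreme cut the half-length is zero, so the fibre reduces to the midpoint. -/
theorem arcticRegion_inter_vertical (hlam : 0 < lam) (hth : 0 < th) (hx : x = 0 ∨ x = lam + th)
    {y₀ y₁ : ℝ} (hy : mid lam th x ∈ Set.Icc y₀ y₁) :
    arcticRegion lam th ∩ segment ℝ (x, y₀) (x, y₁) = {(x, mid lam th x)} := by
  have h : 0 ≤ x ∧ x ≤ lam + th := by rcases hx with rfl | rfl <;> constructor <;> linarith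
  ext q
  rw [← Prod.image_mk_segment_right, segment_eq_Icc (hy.1.trans hy.2), Set.mem_inter_iff,
    mem_arcticRegion_iff hlam hth, Set.mem_singleton_iff]
  constructor
  · rintro ⟨⟨_, _, h2⟩, y, _, rfl⟩
    simp only [rad_eq_zero_of_eq hx] at h2
    have : y - mid lam th x = 0 := by
      refine pow_eq_zero_iff two_ne_zero |>.mp (le_antisymm (h2.trans (by norm_num)) (sq_nonneg _))
    exact Prod.ext rfl (sub_eq_zero.mp this)
  · rintro rfl
    refine ⟨⟨h.1, h.2, ?_⟩, _, hy, rfl⟩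
    simp only [sub_self]
    exact (by norm_num : (0 : ℝ) ^ 2 = 0).trans_le (sq_nonneg _)

theorem arcticRegion_inter_side₁ (hlam : 0 < lam) (hth : 0 < th) :
    arcticRegion lam th ∩ segment ℝ (0, 0) (0, 1) = {(0, lam / (lam + th))} := by
  have e : mid lam th 0 = lam / (lam + th) := by rw [mid]; field_simp; ring
  rw [← e]
  refine arcticRegion_inter_vertical hlam hth (.inl rfl) ?_
  rw [e]
  exact ⟨by positivity, (div_le_one (by positivity)).mpr (by linarith)⟩

theorem arcticRegion_inter_side₆ (hlam : 0 < lam) (hth : 0 < th) :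
    arcticRegion lam th ∩ segment ℝ (lam + th, th) (lam + th, 1 + th) =
      {(lam + th, th * (1 + lam + th) / (lam + th))} := by
  have e : mid lam th (lam + th) = th * (1 + lam + th) / (lam + th) := by
    rw [mid]; field_simp; ring
  rw [← e]
  refine arcticRegion_inter_vertical hlam hth (.inr rfl) ?_
  rw [e]
  constructor
  · rw [le_div_iff₀ (by positivity)]; nlinarith
  · rw [div_le_iff₀ (by positivity)]; nlinarith

end Hexagon

namespace Hexagon

theorem hexDensity_mem {lam th x z : ℝ} (hlam : 0 < lam) (hth : 0 < th)
    (hx : x ∈ Set.Icc 0 (lam + th)) (hz : z ∈ Set.Ioo (endA lam th x) (endB lam th x)) :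
    0 < hexDensity lam th x z ∧ hexDensity lam th x z < 1 := by
  have hx' : ¬(x = 0 ∨ x = lam + th) := fun h =>
    (hz.1.trans hz.2).ne (endA_eq_endB_of_eq hlam hth h)
  rw [not_or] at hx'
  have h0 : 0 < x := lt_of_le_of_ne hx.1 (Ne.symm hx'.1)
  have h1 : x < lam + th := lt_of_le_of_ne hx.2 hx'.2
  obtain ⟨_, _, _, _, _, _, _, _, hb⟩ := exists_cutBlocks hlam hth h0 h1
  exact hb.hexDensity_mem hlam hth h0 h1 hz

end Hexagon

theorem mainTheorem3 (lam th : ℝ) (hlam : 0 < lam) (hth : 0 < th) :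
    -- the density on each cut
    (∀ x ∈ Set.Icc 0 (lam + th),
      -- position of `a` and `b`
      (Hexagon.lo lam x ≤ Hexagon.endA lam th x ∧
        Hexagon.endA lam th x ≤ Hexagon.endB lam th x ∧
        Hexagon.endB lam th x ≤ Hexagon.hi th x ∧
        (0 < x → x < lam + th → Hexagon.endA lam th x < Hexagon.endB lam th x)) ∧
      -- the explicit density is the limit density, and the minimizer of the action
      (∀ ρ : ℝ → ℝ, Hexagon.IsLimitDensity lam th x ρ ↔
        ρ =ᵐ[MeasureTheory.volume] Hexagon.hexDensity lam th x) ∧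
      (∀ ρ : ℝ → ℝ, Hexagon.IsActionMinimizer lam th x ρ ↔
        ρ =ᵐ[MeasureTheory.volume] Hexagon.hexDensity lam th x) ∧
      -- integral equation and total mass
      (∀ μ ∈ Set.Ioo (Hexagon.endA lam th x) (Hexagon.endB lam th x),
        Hexagon.HasPrincipalValue (Set.Icc (Hexagon.lo lam x) (Hexagon.hi th x))
          (Hexagon.hexDensity lam th x) μ
          (1 / 2 * Real.log (μ * (lam - x + μ) / ((1 + x - μ) * (1 + th - μ))))) ∧
      ∫ u in Set.Icc (Hexagon.lo lam x) (Hexagon.hi th x), Hexagon.hexDensity lam th x u = 1 ∧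
      -- strictly between 0 and 1 inside `(a, b)`, frozen outside
      (∀ z ∈ Set.Ioo (Hexagon.endA lam th x) (Hexagon.endB lam th x),
        0 < Hexagon.hexDensity lam th x z ∧ Hexagon.hexDensity lam th x z < 1) ∧
      (∀ z ∈ Set.Icc (Hexagon.lo lam x) (Hexagon.endA lam th x),
        Hexagon.hexDensity lam th x z = Hexagon.bottomValue lam th x) ∧
      (∀ z ∈ Set.Icc (Hexagon.endB lam th x) (Hexagon.hi th x),
        Hexagon.hexDensity lam th x z = Hexagon.topValue lam th x)) ∧
    -- the segments `[a, b]` sweep the ellipse inscribed in the hexagon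
    Hexagon.IsFilledEllipse (Hexagon.arcticRegion lam th) ∧
    Hexagon.arcticRegion lam th ⊆ Hexagon.hexagon lam th ∧
    -- which touches each of the six sides at one point
    Hexagon.arcticRegion lam th ∩ segment ℝ (0, 0) (0, 1) = {(0, lam / (lam + th))} ∧
    Hexagon.arcticRegion lam th ∩ segment ℝ (0, 1) (th, 1 + th) =
      {(Hexagon.x₂ lam th, 1 + Hexagon.x₂ lam th)} ∧
    Hexagon.arcticRegion lam th ∩ segment ℝ (0, 0) (lam, 0) = {(Hexagon.x₃ lam th, 0)} ∧
    Hexagon.arcticRegion lam th ∩ segment ℝ (th, 1 + th) (lam + th, 1 + th) =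
      {(Hexagon.x₄ lam th, 1 + th)} ∧
    Hexagon.arcticRegion lam th ∩ segment ℝ (lam, 0) (lam + th, th) =
      {(Hexagon.x₅ lam th, Hexagon.x₅ lam th - lam)} ∧
    Hexagon.arcticRegion lam th ∩ segment ℝ (lam + th, th) (lam + th, 1 + th) =
      {(lam + th, th * (1 + lam + th) / (lam + th))} := by
  refine ⟨fun x hx => ?_, Hexagon.isFilledEllipse_arcticRegion hlam hth,
    Hexagon.arcticRegion_subset_hexagon hlam hth, Hexagon.arcticRegion_inter_side₁ hlam hth,
    Hexagon.arcticRegion_inter_side₂ hlam hth, Hexagon.arcticRegion_inter_side₃ hlam hth,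
    Hexagon.arcticRegion_inter_side₄ hlam hth, Hexagon.arcticRegion_inter_side₅ hlam hth,
    Hexagon.arcticRegion_inter_side₆ hlam hth⟩
  obtain ⟨C, hC⟩ := Hexagon.exists_isEquilibrium hlam hth hx
  refine ⟨⟨Hexagon.lo_le_endA hlam hth hx.1 hx.2, Hexagon.endA_le_endB hlam hth hx.1 hx.2,
    Hexagon.endB_le_hi hlam hth hx.1 hx.2, Hexagon.endA_lt_endB hlam hth⟩,
    hC.isLimitDensity_iff hlam hth hx, hC.isActionMinimizer_iff hlam hth,
    fun μ hμ => Hexagon.hasPrincipalValue_hexDensity hlam hth hx hμ, ?_,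
    fun z hz => Hexagon.hexDensity_mem hlam hth hx hz, fun z hz => Hexagon.hexDensity_of_le hz,
    fun z hz => Hexagon.hexDensity_of_ge hlam hth hx.1 hx.2 hz⟩
  rw [← hC.mass]
  exact MeasureTheory.setIntegral_eq_integral_of_forall_compl_eq_zero fun u hu => hC.supp u hu
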